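/- Let $k$ be an algebraically closed field of characteristic $p\ge 0$, let $m\ge 1$ be invertible in $k$, let $\xi\in k$ be a primitive $m$-th root of unity, and let $\delta=(\delta_i)_{i\in\mathbb Z/m}\in k^m$ satisfy $\delta_{-i}=\delta_i$ for all $i$. For $n\ge 0$ let $B_n^m=B_n^m(\delta)$ be the cyclotomic Brauer algebra: its basis consists of the Brauer diagrams with $n$ northern and $n$ southern nodes whose strands are oriented and labelled by elements of $\mathbb Z/m$ (reversing the orientation of a strand negates its label); the product $x\cdot y$ is the concatenation of $x$ above $y$, labels on compatibly oriented strands are added, and a closed loop with label $i$ (oriented downwards at its leftmost central node) is replaced by the factor $\delta_i$. Put $\bar\delta_r=\frac1m\sum_{i=0}^{m-1}\xi^{ir}\delta_i$. Let $B(n,x)=B_n^1(x)$ be the Brauer algebra with parameter $x\in k$, and let $WB(r,s,x)\subseteq B(r+s,x)$ be the walled Brauer algebra, spanned by the diagrams in which every arc crosses, and no through strand crosses, a wall placed after the first $r$ nodes. Let $\Lambda(m,n)$ be the set of $m$-tuples of partitions $\lambda=(\lambda^0,\dots,\lambda^{m-1})$ (superscripts read modulo $m$) with $\sum_r|\lambda^r|=n-2l$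 for some $0\le l\le\lfloor n/2\rfloor$. For such $\lambda$ let $\Delta_n(\lambda)=V(m,n,l)\otimes\mathbf S(\lambda)$ be the standard (cell) module of $B_n^m$. Here $V(m,n,l)$ is spanned by the labelled dangles ($l$ disjoint labelled arcs on $n$ nodes, the other nodes being free), $\mathbf S(\lambda)$ is the Specht module of $k((\mathbb Z/m)\wr\Sigma_{n-2l})$ induced from $S(\lambda^0)^{(0)}\otimes\cdots\otimes S(\lambda^{m-1})^{(m-1)}$, where each generator of $\mathbb Z/m$ acts on $S(\lambda^r)^{(r)}$ by $\xi^r$, and a diagram acts by concatenation, the result being $0$ if the number of through strands drops. Let $L_n(\lambda)$ be the head of $\Delta_n(\lambda)$. Let $\Delta_B(\alpha)$ and $\Delta_{WB}(\alpha,\beta)$ be the analogous standard modules of $B(n,x)$, for $|\alpha|=n-2l$, and of $WB(r,s,x)$, for $(|\alpha|,|\beta|)=(r-l,s-l)$, obtained from $S(\alpha)$ and $S(\alpha)\otimes S(\beta)$; for all other partitions these modules are set to be $0$. Let $L_B(\alpha)$ and $L_{WB}(\alpha,\beta)$ be their heads. Write $[M:L]$ for composition multiplicities. Assume that $p=0$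 or $p>n$, and that $\delta\neq 0$ if $n$ is even. Let $\lambda,\mu\in\Lambda(m,n)$ and put $\omega_r=|\lambda^r|$. (i) $\operatorname{Hom}_{B_n^m}(\Delta_n(\lambda),\Delta_n(\mu))$ is isomorphic as a $k$-vector space to $$\operatorname{Hom}_{B(\omega_0,\bar\delta_0)}(\Delta_B(\lambda^0),\Delta_B(\mu^0))\otimes\bigotimes_{0<r<m/2}\operatorname{Hom}_{WB(\omega_r,\omega_{m-r},\bar\delta_r)}(\Delta_{WB}(\lambda^r,\lambda^{m-r}),\Delta_{WB}(\mu^r,\mu^{m-r}))\otimes\operatorname{Hom}_{B(\omega_{m/2},\bar\delta_{m/2})}(\Delta_B(\lambda^{m/2}),\Delta_B(\mu^{m/2})).$$ (ii) $$[\Delta_n(\mu):L_n(\lambda)]=[\Delta_B(\mu^0):L_B(\lambda^0)]\cdot\prod_{0<r<m/2}[\Delta_{WB}(\mu^r,\mu^{m-r}):L_{WB}(\lambda^r,\lambda^{m-r})]\cdot[\Delta_B(\mu^{m/2}):L_B(\lambda^{m/2})],$$ the factors being taken over the same Brauer and walled Brauer algebras as in (i). If $m$ is odd, the last factor in (i)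 and in (ii) is omitted. -/

import Mathlib

set_option linter.unusedSectionVars false
set_option linter.unusedVariables false

namespace CycBrauer

/-- An intermediate stage of a concatenation.  `mate v` is the other end of the strand at the node `v`
(an erased node is its own mate), `lab v` is the label of that strand when it is oriented away
from `v`, and `wt` is the product of the parameters of the closed loops removed so far. -/
structure GlueState (k : Type*) (m : ℕ) (N : Type) where
  mate : N → N
  lab : N → ZMod m
  wt : k

section Glue
variable {k : Type*} [Field k] {m : ℕ} {N : Type} [DecidableEq N] {N' : Type} [DecidableEq N']

/-- Identify the nodes `p` and `q` and erase them: the strands at `p` and `q` are joined and their labels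
(after compatible orientation) are added.  If they are the two ends of one strand, the result is a
closed loop; it is removed at the cost of the factor `δ i`, where `i` is the label of the loop
oriented so as to leave the identified node along the strand at `q`. -/
def glue (δ : ZMod m → k) (p q : N) (s : GlueState k m N) : GlueState k m N where
  mate v := if v = p ∨ v = q then v else if s.mate v = p then s.mate q
    else if s.mate v = q then s.mate p else s.mate v
  lab v := if v = p ∨ v = q then 0 else if s.mate v = p then s.lab v + s.lab q
    else if s.mate v = q then s.lab v + s.lab p else s.lab v
  wt := if s.mate q = p then s.wt * δ (s.lab q) else s.wt

/-- `mate` is an involution and reversing a strand negates its label. -/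
structure GlueState.Good (s : GlueState k m N) : Prop where
  mate_mate : ∀ v, s.mate (s.mate v) = v
  lab_mate : ∀ v, s.lab (s.mate v) = - s.lab v

theorem glue_good (δ : ZMod m → k) {p q : N} {s : GlueState k m N} (h : s.Good) (hpq : p ≠ q)
    (hp : s.mate p ≠ p) (hq : s.mate q ≠ q) : (glue δ p q s).Good := by
  obtain ⟨h1, h2⟩ := h
  constructor
  · intro v
    have a1 := h1 v
    have a2 := h1 p
    have a3 := h1 q
    simp only [glue]
    grind
  · intro v
    have a1 := h1 v
    have a2 := h1 p
    have a3 := h1 q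
    have b1 := h2 v
    have b2 := h2 p
    have b3 := h2 q
    simp only [glue]
    grind

theorem glue_alive (δ : ZMod m → k) {p q v : N} {s : GlueState k m N} (h : s.Good)
    (hpq : p ≠ q) (hv : s.mate v ≠ v) (hvp : v ≠ p) (hvq : v ≠ q) :
    (glue δ p q s).mate v ≠ v := by
  obtain ⟨h1, h2⟩ := h
  have a1 := h1 v
  have a2 := h1 p
  have a3 := h1 q
  simp only [glue]
  grind

theorem glue_erased (δ : ZMod m → k) {p q : N} {s : GlueState k m N} :
    (glue δ p q s).mate p = p ∧ (glue δ p q s).mate q = q := by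
  simp [glue]

theorem glue_erased' (δ : ZMod m → k) {p q v : N} {s : GlueState k m N}
    (hv : s.mate v = v) (hp : s.mate p ≠ p) (hq : s.mate q ≠ q) : (glue δ p q s).mate v = v := by
  simp only [glue]
  grind

theorem glue_comm (δ : ZMod m → k) (hδ : ∀ a, δ (-a) = δ a) {p q p' q' : N}
    {s : GlueState k m N} (h : s.Good)
    (h1 : p ≠ q) (h2 : p ≠ p') (h3 : p ≠ q') (h4 : q ≠ p') (h5 : q ≠ q') (h6 : p' ≠ q')
    (hp : s.mate p ≠ p) (hq : s.mate q ≠ q) (hp' : s.mate p' ≠ p') (hq' : s.mate q' ≠ q') :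
    glue δ p q (glue δ p' q' s) = glue δ p' q' (glue δ p q s) := by
  obtain ⟨g1, g2⟩ := h
  have a1 := g1 p
  have a2 := g1 q
  have a3 := g1 p'
  have a4 := g1 q'
  have b1 := g2 p
  have b2 := g2 q
  have b3 := g2 p'
  have b4 := g2 q'
  have key : ∀ a b : ZMod m, a = -b → δ a = δ b := by
    intro a b hab; rw [hab, hδ]
  simp only [glue, GlueState.mk.injEq]
  refine ⟨?_, ?_, ?_⟩
  · funext v
    have a5 := g1 v
    grind
  · funext v
    have a5 := g1 v
    have b5 := g2 v
    grind
  · have k1 := key (s.lab q + s.lab p') (s.lab q' + s.lab p)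
    have k2 := key (s.lab q + s.lab q') (s.lab q' + s.lab q)
    grind

/-- Glue the listed pairs of nodes, the last pair first and the first pair last. -/
def glueAll (δ : ZMod m → k) (L : List (N × N)) (s : GlueState k m N) : GlueState k m N :=
  L.foldr (fun e t => glue δ e.1 e.2 t) s

def Apart (e f : N × N) : Prop := e.1 ≠ f.1 ∧ e.1 ≠ f.2 ∧ e.2 ≠ f.1 ∧ e.2 ≠ f.2

structure Ready (L : List (N × N)) (s : GlueState k m N) : Prop where
  good : s.Good
  pair : ∀ e ∈ L, e.1 ≠ e.2 ∧ s.mate e.1 ≠ e.1 ∧ s.mate e.2 ≠ e.2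
  apart : L.Pairwise Apart

theorem Ready.tail {e : N × N} {L : List (N × N)} {s : GlueState k m N} (h : Ready (e :: L) s) :
    Ready L s :=
  ⟨h.good, fun f hf => h.pair f (List.mem_cons_of_mem _ hf), (List.pairwise_cons.1 h.apart).2⟩

theorem glueAll_spec (δ : ZMod m → k) (L : List (N × N)) (s : GlueState k m N) (h : Ready L s) :
    (glueAll δ L s).Good ∧
    (∀ v, s.mate v ≠ v → (∀ e ∈ L, v ≠ e.1 ∧ v ≠ e.2) → (glueAll δ L s).mate v ≠ v) ∧
    (∀ e ∈ L, (glueAll δ L s).mate e.1 = e.1 ∧ (glueAll δ L s).mate e.2 = e.2) := by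
  induction L with
  | nil => exact ⟨h.good, fun v hv _ => hv, by simp⟩
  | cons e L ih =>
    obtain ⟨i1, i2, i3⟩ := ih h.tail
    have hap := (List.pairwise_cons.1 h.apart).1
    obtain ⟨he, he1, he2⟩ := h.pair e (by simp)
    have q1 := i2 e.1 he1 (fun f hf => ⟨(hap f hf).1, (hap f hf).2.1⟩)
    have q2 := i2 e.2 he2 (fun f hf => ⟨(hap f hf).2.2.1, (hap f hf).2.2.2⟩)
    refine ⟨glue_good δ i1 he q1 q2, ?_, ?_⟩
    · intro v hv hvL
      have hve := hvL e (by simp)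
      exact glue_alive δ i1 he (i2 v hv (fun f hf => hvL f (by simp [hf]))) hve.1 hve.2
    · intro f hf
      rcases List.mem_cons.1 hf with rfl | hf
      · exact glue_erased δ
      · exact ⟨glue_erased' δ (i3 f hf).1 q1 q2, glue_erased' δ (i3 f hf).2 q1 q2⟩

theorem Apart.symm {e f : N × N} (h : Apart e f) : Apart f e :=
  ⟨h.1.symm, h.2.2.1.symm, h.2.1.symm, h.2.2.2.symm⟩

theorem Ready.perm {L L' : List (N × N)} {s : GlueState k m N} (h : Ready L s) (hp : L.Perm L') :
    Ready L' s :=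
  ⟨h.good, fun e he => h.pair e (hp.mem_iff.2 he),
    (hp.pairwise_iff (fun hxy => Apart.symm hxy)).1 h.apart⟩

theorem glueAll_perm (δ : ZMod m → k) (hδ : ∀ a, δ (-a) = δ a) {L L' : List (N × N)}
    (hp : L.Perm L') (s : GlueState k m N) (h : Ready L s) : glueAll δ L s = glueAll δ L' s := by
  induction hp with
  | nil => rfl
  | cons e hp ih =>
    change glue δ _ _ (glueAll δ _ s) = glue δ _ _ (glueAll δ _ s)
    rw [ih h.tail]
  | swap e f L =>
    obtain ⟨i1, i2, i3⟩ := glueAll_spec δ L s h.tail.tail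
    have hap := (List.pairwise_cons.1 h.apart).1
    have hap' := (List.pairwise_cons.1 h.tail.apart).1
    obtain ⟨he, he1, he2⟩ := h.pair e (by simp)
    obtain ⟨hf, hf1, hf2⟩ := h.pair f (by simp)
    obtain ⟨d1, d2, d3, d4⟩ := hap e (by simp)
    exact glue_comm δ hδ i1 hf d1 d2 d3 d4 he
      (i2 f.1 hf1 fun g hg => ⟨(hap g (by simp [hg])).1, (hap g (by simp [hg])).2.1⟩)
      (i2 f.2 hf2 fun g hg => ⟨(hap g (by simp [hg])).2.2.1, (hap g (by simp [hg])).2.2.2⟩)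
      (i2 e.1 he1 fun g hg => ⟨(hap' g hg).1, (hap' g hg).2.1⟩)
      (i2 e.2 he2 fun g hg => ⟨(hap' g hg).2.2.1, (hap' g hg).2.2.2⟩)
  | trans h1 h2 ih1 ih2 => rw [ih1 h, ih2 (h.perm h1)]

theorem glueAll_append (δ : ZMod m → k) (L L' : List (N × N)) (s : GlueState k m N) :
    glueAll δ (L ++ L') s = glueAll δ L (glueAll δ L' s) := by
  simp [glueAll]

/-- The state `s` is the part of `s'` on the image of `j`, and `s'` has an extra factor `c`. -/
structure Emb (j : N → N') (c : k) (s : GlueState k m N) (s' : GlueState k m N') : Prop where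
  mate : ∀ v, s'.mate (j v) = j (s.mate v)
  lab : ∀ v, s'.lab (j v) = s.lab v
  wt : s'.wt = c * s.wt

theorem Emb.glue {j : N → N'} {c : k} {s : GlueState k m N} {s' : GlueState k m N'}
    (h : Emb j c s s') (hj : Function.Injective j) (δ : ZMod m → k) (p q : N) :
    Emb j c (glue δ p q s) (glue δ (j p) (j q) s') := by
  refine ⟨fun v => ?_, fun v => ?_, ?_⟩
  · simp only [CycBrauer.glue, h.mate, hj.eq_iff]
    split_ifs <;> rfl
  · simp only [CycBrauer.glue, h.mate, h.lab, hj.eq_iff]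
  · simp only [CycBrauer.glue, h.mate, h.lab, hj.eq_iff, h.wt]
    split_ifs <;> ring

theorem Emb.glueAll {j : N → N'} {c : k} {s : GlueState k m N} {s' : GlueState k m N'}
    (h : Emb j c s s') (hj : Function.Injective j) (δ : ZMod m → k) (L : List (N × N)) :
    Emb j c (glueAll δ L s) (glueAll δ (L.map (Prod.map j j)) s') := by
  induction L with
  | nil => exact h
  | cons e L ih => exact ih.glue hj δ e.1 e.2

theorem glueAll_away (δ : ZMod m → k) {j : N → N'} {f : N → N} {g : N → ZMod m}
    (L : List (N' × N')) (s' : GlueState k m N')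
    (hL : ∀ e ∈ L, ∀ v, j v ≠ e.1 ∧ j v ≠ e.2)
    (h1 : ∀ v, s'.mate (j v) = j (f v)) (h2 : ∀ v, s'.lab (j v) = g v) :
    (∀ v, (glueAll δ L s').mate (j v) = j (f v)) ∧ ∀ v, (glueAll δ L s').lab (j v) = g v := by
  induction L with
  | nil => exact ⟨h1, h2⟩
  | cons e L ih =>
    obtain ⟨i1, i2⟩ := ih (fun f hf => hL f (by simp [hf]))
    have he := hL e (by simp)
    change (∀ v, (CycBrauer.glue δ e.1 e.2 (CycBrauer.glueAll δ L s')).mate (j v) = _) ∧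
      ∀ v, (CycBrauer.glue δ e.1 e.2 (CycBrauer.glueAll δ L s')).lab (j v) = _
    simp [CycBrauer.glue, i1, i2, he]

theorem Emb.straighten {φ : N → N'} {c : k} {s : GlueState k m N} {s' : GlueState k m N'}
    (h : Emb φ c s s') (hφ : Function.Injective φ) (δ : ZMod m → k) (v₀ : N) (p t : N')
    (hp : ∀ v, φ v ≠ p) (ht : ∀ v, φ v ≠ t) (hne : s.mate v₀ ≠ v₀) (hpt : p ≠ t)
    (h0 : ∀ v, s.mate (s.mate v) = v)
    (h1 : s'.mate p = t) (h2 : s'.mate t = p) (h3 : s'.lab p = 0) (h4 : s'.lab t = 0) :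
    Emb (Function.update φ v₀ t) c s (CycBrauer.glue δ p (φ v₀) s') ∧
    Emb (Function.update φ v₀ t) c s (CycBrauer.glue δ (φ v₀) p s') := by
  have key : ∀ v, φ v = φ v₀ ↔ v = v₀ := fun v => hφ.eq_iff
  have b1 := h.mate
  have b2 := h.lab
  have b3 := h.wt
  have hpt' := hpt.symm
  have hp' := fun v => (hp v).symm
  have ht' := fun v => (ht v).symm
  have k2 : ∀ v, s.mate v = v₀ ↔ v = s.mate v₀ := fun v =>
    ⟨fun hv => by rw [← hv, h0], fun hv => by rw [hv, h0]⟩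
  have hne' := hne.symm
  refine ⟨⟨fun v => ?_, fun v => ?_, ?_⟩, ⟨fun v => ?_, fun v => ?_, ?_⟩⟩
  all_goals first
    | (by_cases hv : v = v₀
       · subst hv
         simp_all [CycBrauer.glue, Function.update_apply]
       · by_cases hv2 : v = s.mate v₀
         · subst hv2
           simp_all [CycBrauer.glue, Function.update_apply]
         · simp_all [CycBrauer.glue, Function.update_apply])
    | simp_all [CycBrauer.glue]

end Glue

/-- A reduced labelled diagram on the set of nodes `N`: a perfect matching of `N` into strands, each
carrying a label in `ℤ/m`.  `mate v` is the other end of the strand at `v` and `lab v` is its label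
when oriented away from `v`; reversing the orientation negates the label. -/
@[ext]
structure Diagram (m : ℕ) (N : Type) where
  mate : N → N
  lab : N → ZMod m
  mate_mate : ∀ v, mate (mate v) = v
  mate_ne : ∀ v, mate v ≠ v
  lab_mate : ∀ v, lab (mate v) = - lab v

/-- Diagrams with `a` northern nodes (`Sum.inl`) and `b` southern nodes (`Sum.inr`); the
`(m,n)`-diagrams are `Diag m n n`. -/
abbrev Diag (m a b : ℕ) := Diagram m (Fin a ⊕ Fin b)

section Compose
variable {k : Type*} [Field k] {m : ℕ} {a b c d : ℕ}

/-- `x` drawn above `y`, before the southern nodes of `x` are identified with the northern ones of `y`. -/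
def join (k : Type*) [Field k] {m a b c : ℕ} (x : Diag m a b) (y : Diag m b c) :
    GlueState k m ((Fin a ⊕ Fin b) ⊕ (Fin b ⊕ Fin c)) where
  mate := Sum.map x.mate y.mate
  lab := Sum.elim x.lab y.lab
  wt := 1

/-- The pairs (southern node `i` of `x`, northern node `i` of `y`), from left to right. -/
def midPairs (a b c : ℕ) :
    List (((Fin a ⊕ Fin b) ⊕ (Fin b ⊕ Fin c)) × ((Fin a ⊕ Fin b) ⊕ (Fin b ⊕ Fin c))) :=
  (List.finRange b).map fun i => (.inl (.inr i), .inr (.inl i))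

/-- The concatenation of `x` above `y`.  The pairs are glued from right to left, so a closed loop is
removed when its leftmost central node is glued, and its label is read with the orientation that
points downwards there. -/
def concat (δ : ZMod m → k) (x : Diag m a b) (y : Diag m b c) :
    GlueState k m ((Fin a ⊕ Fin b) ⊕ (Fin b ⊕ Fin c)) :=
  glueAll δ (midPairs a b c) (join k x y)

/-- The outer nodes of a concatenation. -/
def outer {a b c : ℕ} : Fin a ⊕ Fin c → (Fin a ⊕ Fin b) ⊕ (Fin b ⊕ Fin c) :=
  Sum.map Sum.inl Sum.inr

/-- Partial inverse of `outer` (with a default value on the central nodes). -/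
def back {a b c : ℕ} (o : Fin a ⊕ Fin c) : (Fin a ⊕ Fin b) ⊕ (Fin b ⊕ Fin c) → Fin a ⊕ Fin c
  | .inl (.inl i) => .inl i
  | .inl (.inr _) => o
  | .inr (.inl _) => o
  | .inr (.inr j) => .inr j

theorem outer_injective : Function.Injective (outer : Fin a ⊕ Fin c → (Fin a ⊕ Fin b) ⊕ _) :=
  Function.Injective.sumMap Sum.inl_injective Sum.inr_injective

theorem join_good (x : Diag m a b) (y : Diag m b c) : (join k x y).Good := by
  constructor
  · rintro (v | v) <;> simp [join, x.mate_mate, y.mate_mate]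
  · rintro (v | v) <;> simp [join, x.lab_mate, y.lab_mate]

theorem join_alive (x : Diag m a b) (y : Diag m b c) : ∀ v, (join k x y).mate v ≠ v := by
  rintro (v | v) <;> simp [join, x.mate_ne, y.mate_ne]

theorem midPairs_ready (x : Diag m a b) (y : Diag m b c) :
    Ready (midPairs a b c) (join k x y) := by
  refine ⟨join_good x y, ?_, ?_⟩
  · intro e he
    refine ⟨?_, join_alive x y _, join_alive x y _⟩
    simp only [midPairs, List.mem_map] at he
    obtain ⟨i, -, rfl⟩ := he
    simp
  · simp only [midPairs, List.pairwise_map]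
    refine (List.nodup_finRange b).imp ?_
    intro i j hij
    simp [Apart, hij]

theorem concat_outer (δ : ZMod m → k) (x : Diag m a b) (y : Diag m b c) (o : Fin a ⊕ Fin c) :
    (concat δ x y).mate (outer o) ≠ outer o ∧
      ∀ o', outer (back o' ((concat δ x y).mate (outer o))) = (concat δ x y).mate (outer o) := by
  obtain ⟨h1, h2, h3⟩ := glueAll_spec δ _ _ (midPairs_ready (k := k) x y)
  have h0 : (concat δ x y).mate (outer o) ≠ outer o := by
    refine h2 _ (join_alive x y _) ?_
    intro e he
    simp only [midPairs, List.mem_map] at he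
    obtain ⟨i, -, rfl⟩ := he
    rcases o with o | o <;> simp [outer]
  refine ⟨h0, ?_⟩
  intro o'
  have h4 : (concat δ x y).mate ((concat δ x y).mate (outer o)) = outer o := h1.mate_mate _
  rcases hw : (concat δ x y).mate (outer o) with (i | i) | (i | i)
  · rfl
  · exfalso
    have h5 : (concat δ x y).mate (.inl (.inr i)) = .inl (.inr i) :=
      (h3 (.inl (.inr i), .inr (.inl i)) (by simp [midPairs])).1
    rw [hw, h5, ← hw] at h4
    exact h0 h4
  · exfalso
    have h5 : (concat δ x y).mate (.inr (.inl i)) = .inr (.inl i) :=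
      (h3 (.inl (.inr i), .inr (.inl i)) (by simp [midPairs])).2
    rw [hw, h5, ← hw] at h4
    exact h0 h4
  · rfl

/-- The reduced diagram of the concatenation of `x` above `y` (it does not depend on `δ`). -/
def comp (δ : ZMod m → k) (x : Diag m a b) (y : Diag m b c) : Diag m a c where
  mate o := back o ((concat δ x y).mate (outer o))
  lab o := (concat δ x y).lab (outer o)
  mate_mate o := by
    apply outer_injective (b := b)
    rw [(concat_outer δ x y _).2, (concat_outer δ x y _).2]
    exact (glueAll_spec δ _ _ (midPairs_ready (k := k) x y)).1.mate_mate _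
  mate_ne o h := by
    apply (concat_outer δ x y o).1
    rw [← (concat_outer δ x y o).2 o, h]
  lab_mate o := by
    rw [(concat_outer δ x y _).2]
    exact (glueAll_spec δ _ _ (midPairs_ready (k := k) x y)).1.lab_mate _

/-- The product of the parameters `δ i` of the closed loops in the concatenation of `x` above `y`. -/
def loopFactor (δ : ZMod m → k) (x : Diag m a b) (y : Diag m b c) : k := (concat δ x y).wt

def Diagram.toState (k : Type*) [Field k] {m : ℕ} {N : Type} (x : Diagram m N) : GlueState k m N :=
  ⟨x.mate, x.lab, 1⟩

theorem comp_emb (δ : ZMod m → k) (x : Diag m a b) (y : Diag m b c) :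
    Emb outer (loopFactor δ x y) ((comp δ x y).toState k) (concat δ x y) :=
  ⟨fun v => ((concat_outer δ x y v).2 v).symm, fun _ => rfl, (mul_one _).symm⟩

theorem comp_unique (δ : ZMod m → k) {x : Diag m a b} {y : Diag m b c} {z : Diag m a c} {w : k}
    {N : Type} [DecidableEq N]
    (f : (Fin a ⊕ Fin b) ⊕ (Fin b ⊕ Fin c) → N) (hf : Function.Injective f) (s : GlueState k m N)
    (u : k) (h : Emb f u (concat δ x y) s)
    (h' : Emb (f ∘ outer) w (z.toState k) s) : comp δ x y = z ∧ u * loopFactor δ x y = w := by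
  have e := comp_emb δ x y
  refine ⟨?_, ?_⟩
  · ext v
    · apply outer_injective (b := b)
      apply hf
      have h1 := e.mate v
      have h2 := h.mate (outer v)
      have h3 := h'.mate v
      simp only [Diagram.toState, Function.comp] at h1 h3
      rw [← h1, ← h2, h3]
    · have h1 := e.lab v
      have h2 := h.lab (outer v)
      have h3 := h'.lab v
      simp only [Diagram.toState, Function.comp] at h1 h3
      rw [← h1, ← h2, h3]
  · have h1 := h.wt
    have h2 := h'.wt
    simp only [Diagram.toState] at h2
    rw [h2, mul_one] at h1
    exact h1.symm

/-- The identity diagram. -/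
def idDiag (m n : ℕ) : Diag m n n where
  mate := Sum.swap
  lab _ := 0
  mate_mate := Sum.swap_swap
  mate_ne v := by rcases v with v | v <;> simp
  lab_mate _ := by simp

theorem id_comp_aux (δ : ZMod m → k) (y : Diag m a b) (L : List (Fin a)) (hL : L.Nodup) :
    ∃ φ : Fin a ⊕ Fin b → (Fin a ⊕ Fin a) ⊕ (Fin a ⊕ Fin b), Function.Injective φ ∧
      (∀ i, φ (.inl i) = if i ∈ L then .inl (.inl i) else .inr (.inl i)) ∧
      (∀ j, φ (.inr j) = .inr (.inr j)) ∧
      Emb φ 1 (y.toState k) (glueAll δ (L.map fun i => (.inl (.inr i), .inr (.inl i)))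
        (join k (idDiag m a) y)) ∧
      ∀ i, i ∉ L → ∀ s, s = glueAll δ (L.map fun i => (.inl (.inr i), .inr (.inl i)))
        (join k (idDiag m a) y) → s.mate (.inl (.inl i)) = .inl (.inr i) ∧
          s.mate (.inl (.inr i)) = .inl (.inl i) ∧ s.lab (.inl (.inl i)) = 0 ∧
          s.lab (.inl (.inr i)) = 0 := by
  induction L with
  | nil =>
    refine ⟨Sum.inr, Sum.inr_injective, by simp, by simp, ⟨fun v => rfl, fun v => rfl, ?_⟩, ?_⟩
    · simp [glueAll, join, Diagram.toState]
    · rintro i - s rfl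
      exact ⟨rfl, rfl, rfl, rfl⟩
  | cons i L ih =>
    obtain ⟨hi, hL'⟩ := List.nodup_cons.1 hL
    obtain ⟨φ, h1, h2, h3, h4, h5⟩ := ih hL'
    set s := glueAll δ (L.map fun i => (.inl (.inr i), .inr (.inl i)))
        (join k (idDiag m a) y) with hs
    obtain ⟨c1, c2, c3, c4⟩ := h5 i hi s rfl
    have hq : φ (.inl i) = .inr (.inl i) := by simp [h2, hi]
    have hnp : ∀ v, φ v ≠ .inl (.inr i) := by
      rintro (v | v)
      · rw [h2]; split_ifs <;> simp
      · simp [h3]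
    have hnt : ∀ v, φ v ≠ .inl (.inl i) := by
      rintro (v | v)
      · rw [h2]; split_ifs with hv
        · simp only [ne_eq, Sum.inl.injEq]; rintro rfl; exact hi hv
        · simp
      · simp [h3]
    refine ⟨Function.update φ (.inl i) (.inl (.inl i)), ?_, ?_, ?_, ?_, ?_⟩
    · intro v w hvw
      by_cases hv : v = .inl i <;> by_cases hw : w = .inl i
      · rw [hv, hw]
      · subst hv; simp [Function.update_of_ne hw] at hvw; exact absurd hvw.symm (hnt w)
      · subst hw; simp [Function.update_of_ne hv] at hvw; exact absurd hvw (hnt v)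
      · rw [Function.update_of_ne hv, Function.update_of_ne hw] at hvw; exact h1 hvw
    · intro v
      by_cases hv : v = i
      · subst hv; simp
      · simp [hv, h2]
    · intro j; simp [h3]
    · have := (h4.straighten h1 δ (.inl i) (.inl (.inr i)) (.inl (.inl i)) hnp hnt
        (y.mate_ne _) (by simp) y.mate_mate c2 c1 c4 c3).1
      rw [hq] at this
      exact this
    · rintro v hv s' rfl
      simp only [List.mem_cons, not_or] at hv
      obtain ⟨d1, d2, d3, d4⟩ := h5 v hv.2 s rfl
      change (glue δ (.inl (.inr i)) (.inr (.inl i)) s).mate _ = _ ∧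
        (glue δ (.inl (.inr i)) (.inr (.inl i)) s).mate _ = _ ∧
        (glue δ (.inl (.inr i)) (.inr (.inl i)) s).lab _ = _ ∧
        (glue δ (.inl (.inr i)) (.inr (.inl i)) s).lab _ = _
      simp [glue, d1, d2, d3, d4, hv.1]

theorem comp_id_aux (δ : ZMod m → k) (x : Diag m a b) (L : List (Fin b)) (hL : L.Nodup) :
    ∃ φ : Fin a ⊕ Fin b → (Fin a ⊕ Fin b) ⊕ (Fin b ⊕ Fin b), Function.Injective φ ∧
      (∀ i, φ (.inr i) = if i ∈ L then .inr (.inr i) else .inl (.inr i)) ∧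
      (∀ j, φ (.inl j) = .inl (.inl j)) ∧
      Emb φ 1 (x.toState k) (glueAll δ (L.map fun i => (.inl (.inr i), .inr (.inl i)))
        (join k x (idDiag m b))) ∧
      ∀ i, i ∉ L → ∀ s, s = glueAll δ (L.map fun i => (.inl (.inr i), .inr (.inl i)))
        (join k x (idDiag m b)) → s.mate (.inr (.inr i)) = .inr (.inl i) ∧
          s.mate (.inr (.inl i)) = .inr (.inr i) ∧ s.lab (.inr (.inr i)) = 0 ∧
          s.lab (.inr (.inl i)) = 0 := by
  induction L with
  | nil =>
    refine ⟨Sum.inl, Sum.inl_injective, by simp, by simp, ⟨fun v => rfl, fun v => rfl, ?_⟩, ?_⟩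
    · simp [glueAll, join, Diagram.toState]
    · rintro i - s rfl
      exact ⟨rfl, rfl, rfl, rfl⟩
  | cons i L ih =>
    obtain ⟨hi, hL'⟩ := List.nodup_cons.1 hL
    obtain ⟨φ, h1, h2, h3, h4, h5⟩ := ih hL'
    set s := glueAll δ (L.map fun i => (.inl (.inr i), .inr (.inl i)))
        (join k x (idDiag m b)) with hs
    obtain ⟨c1, c2, c3, c4⟩ := h5 i hi s rfl
    have hq : φ (.inr i) = .inl (.inr i) := by simp [h2, hi]
    have hnp : ∀ v, φ v ≠ .inr (.inl i) := by
      rintro (v | v)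
      · simp [h3]
      · rw [h2]; split_ifs <;> simp
    have hnt : ∀ v, φ v ≠ .inr (.inr i) := by
      rintro (v | v)
      · simp [h3]
      · rw [h2]; split_ifs with hv
        · simp only [ne_eq, Sum.inr.injEq]; rintro rfl; exact hi hv
        · simp
    refine ⟨Function.update φ (.inr i) (.inr (.inr i)), ?_, ?_, ?_, ?_, ?_⟩
    · intro v w hvw
      by_cases hv : v = .inr i <;> by_cases hw : w = .inr i
      · rw [hv, hw]
      · subst hv; simp [Function.update_of_ne hw] at hvw; exact absurd hvw.symm (hnt w)
      · subst hw; simp [Function.update_of_ne hv] at hvw; exact absurd hvw (hnt v)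
      · rw [Function.update_of_ne hv, Function.update_of_ne hw] at hvw; exact h1 hvw
    · intro v
      by_cases hv : v = i
      · subst hv; simp
      · simp [hv, h2]
    · intro j; simp [h3]
    · have := (h4.straighten h1 δ (.inr i) (.inr (.inl i)) (.inr (.inr i)) hnp hnt
        (x.mate_ne _) (by simp) x.mate_mate c2 c1 c4 c3).2
      rw [hq] at this
      exact this
    · rintro v hv s' rfl
      simp only [List.mem_cons, not_or] at hv
      obtain ⟨d1, d2, d3, d4⟩ := h5 v hv.2 s rfl
      change (glue δ (.inl (.inr i)) (.inr (.inl i)) s).mate _ = _ ∧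
        (glue δ (.inl (.inr i)) (.inr (.inl i)) s).mate _ = _ ∧
        (glue δ (.inl (.inr i)) (.inr (.inl i)) s).lab _ = _ ∧
        (glue δ (.inl (.inr i)) (.inr (.inl i)) s).lab _ = _
      simp [glue, d1, d2, d3, d4, hv.1]

theorem id_comp (δ : ZMod m → k) (y : Diag m a b) :
    comp δ (idDiag m a) y = y ∧ loopFactor δ (idDiag m a) y = 1 := by
  obtain ⟨φ, h1, h2, h3, h4, -⟩ := id_comp_aux δ y (List.finRange a) (List.nodup_finRange a)
  have hφ : φ = outer := by
    funext v
    rcases v with v | v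
    · simp [h2, outer]
    · simp [h3, outer]
  subst hφ
  have := comp_unique δ (x := idDiag m a) (y := y) (z := y) id Function.injective_id
    (concat δ (idDiag m a) y) 1 ⟨fun _ => rfl, fun _ => rfl, (one_mul _).symm⟩ h4
  simpa using this

theorem comp_id (δ : ZMod m → k) (x : Diag m a b) :
    comp δ x (idDiag m b) = x ∧ loopFactor δ x (idDiag m b) = 1 := by
  obtain ⟨φ, h1, h2, h3, h4, -⟩ := comp_id_aux δ x (List.finRange b) (List.nodup_finRange b)
  have hφ : φ = outer := by
    funext v
    rcases v with v | v
    · simp [h3, outer]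
    · simp [h2, outer]
  subst hφ
  have := comp_unique δ (x := x) (y := idDiag m b) (z := x) id Function.injective_id
    (concat δ x (idDiag m b)) 1 ⟨fun _ => rfl, fun _ => rfl, (one_mul _).symm⟩ h4
  simpa using this

theorem Emb.trans {N₁ N₂ N₃ : Type} {f : N₁ → N₂} {g : N₂ → N₃} {u v : k} {s₁ : GlueState k m N₁}
    {s₂ : GlueState k m N₂} {s₃ : GlueState k m N₃} (h : Emb f u s₁ s₂) (h' : Emb g v s₂ s₃) :
    Emb (g ∘ f) (v * u) s₁ s₃ :=
  ⟨fun x => by simp [h'.mate, h.mate], fun x => by simp [h'.lab, h.lab],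
    by rw [h'.wt, h.wt, mul_assoc]⟩

/-- Nodes of a triple concatenation. -/
abbrev Nodes (a b c d : ℕ) : Type := ((Fin a ⊕ Fin b) ⊕ (Fin b ⊕ Fin c)) ⊕ (Fin c ⊕ Fin d)

theorem comp_assoc (δ : ZMod m → k) (hδ : ∀ i, δ (-i) = δ i)
    (x : Diag m a b) (y : Diag m b c) (z : Diag m c d) :
    comp δ (comp δ x y) z = comp δ x (comp δ y z) ∧
      loopFactor δ x y * loopFactor δ (comp δ x y) z =
        loopFactor δ y z * loopFactor δ x (comp δ y z) := by
  let s : GlueState k m (Nodes a b c d) :=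
    ⟨Sum.map (Sum.map x.mate y.mate) z.mate, Sum.elim (Sum.elim x.lab y.lab) z.lab, 1⟩
  let LB : List (Nodes a b c d × Nodes a b c d) := (List.finRange b).map fun i =>
    (.inl (.inl (.inr i)), .inl (.inr (.inl i)))
  let LC : List (Nodes a b c d × Nodes a b c d) := (List.finRange c).map fun i =>
    (.inl (.inr (.inr i)), .inr (.inl i))
  have hready : Ready (LC ++ LB) s := by
    refine ⟨⟨?_, ?_⟩, ?_, ?_⟩
    · rintro ((v | v) | v) <;> simp [s, x.mate_mate, y.mate_mate, z.mate_mate]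
    · rintro ((v | v) | v) <;> simp [s, x.lab_mate, y.lab_mate, z.lab_mate]
    · have halive : ∀ v, s.mate v ≠ v := by
        rintro ((v | v) | v) <;> simp [s, x.mate_ne, y.mate_ne, z.mate_ne]
      intro e he
      refine ⟨?_, halive _, halive _⟩
      simp only [LB, LC, List.mem_append, List.mem_map] at he
      rcases he with ⟨i, -, rfl⟩ | ⟨i, -, rfl⟩ <;> simp
    · rw [List.pairwise_append]
      refine ⟨?_, ?_, ?_⟩
      · simp only [LC, List.pairwise_map]
        exact (List.nodup_finRange c).imp fun hij => by simp [Apart, hij]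
      · simp only [LB, List.pairwise_map]
        exact (List.nodup_finRange b).imp fun hij => by simp [Apart, hij]
      · intro e he f hf
        simp only [LB, LC, List.mem_map] at he hf
        obtain ⟨i, -, rfl⟩ := he
        obtain ⟨j, -, rfl⟩ := hf
        simp [Apart]
  have hcomm : glueAll δ LC (glueAll δ LB s) = glueAll δ LB (glueAll δ LC s) := by
    rw [← glueAll_append, ← glueAll_append]
    exact glueAll_perm δ hδ List.perm_append_comm s hready
  -- first product on the left
  have l1 : Emb Sum.inl 1 (concat δ x y) (glueAll δ LB s) := by
    have h0 : Emb (Sum.inl : _ → Nodes a b c d) 1 (join k x y) s :=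
      ⟨fun v => rfl, fun v => rfl, by simp [join, s]⟩
    have := h0.glueAll Sum.inl_injective δ (midPairs a b c)
    simpa [midPairs, LB, concat, Function.comp_def] using this
  have l2 := glueAll_away δ (j := (Sum.inr : _ → Nodes a b c d)) (f := z.mate) (g := z.lab) LB s
    (by
      intro e he v
      simp only [LB, List.mem_map] at he
      obtain ⟨i, -, rfl⟩ := he
      simp)
    (fun v => rfl) (fun v => rfl)
  let f : (Fin a ⊕ Fin c) ⊕ (Fin c ⊕ Fin d) → Nodes a b c d := Sum.map outer id
  have hf : Function.Injective f := outer_injective.sumMap Function.injective_id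
  have l3 : Emb f (loopFactor δ x y) (join k (comp δ x y) z) (glueAll δ LB s) := by
    have e := (comp_emb δ x y).trans l1
    refine ⟨?_, ?_, ?_⟩
    · rintro (v | v)
      · exact e.mate v
      · exact l2.1 v
    · rintro (v | v)
      · exact e.lab v
      · exact l2.2 v
    · have := e.wt
      simpa [Diagram.toState, join] using this
  have l4 : Emb f (loopFactor δ x y) (concat δ (comp δ x y) z) (glueAll δ LC (glueAll δ LB s)) := by
    have := l3.glueAll hf δ (midPairs a c d)
    simpa [midPairs, LC, concat, Function.comp_def, f, outer] using this
  -- the other bracketing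
  let g₀ : (Fin b ⊕ Fin c) ⊕ (Fin c ⊕ Fin d) → Nodes a b c d := Sum.map Sum.inr id
  have hg₀ : Function.Injective g₀ := Sum.inr_injective.sumMap Function.injective_id
  have r1 : Emb g₀ 1 (concat δ y z) (glueAll δ LC s) := by
    have h0 : Emb g₀ 1 (join k y z) s := by
      refine ⟨?_, ?_, by simp [join, s]⟩
      · rintro (v | v) <;> rfl
      · rintro (v | v) <;> rfl
    have := h0.glueAll hg₀ δ (midPairs b c d)
    simpa [midPairs, LC, concat, Function.comp_def, g₀] using this
  have r2 := glueAll_away δ (j := (Sum.inl ∘ Sum.inl : _ → Nodes a b c d)) (f := x.mate) (g := x.lab) LC s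
    (by
      intro e he v
      simp only [LC, List.mem_map] at he
      obtain ⟨i, -, rfl⟩ := he
      simp)
    (fun v => rfl) (fun v => rfl)
  let g : (Fin a ⊕ Fin b) ⊕ (Fin b ⊕ Fin d) → Nodes a b c d := Sum.elim (Sum.inl ∘ Sum.inl) (g₀ ∘ outer)
  have hg : Function.Injective g := by
    rintro (v | v | v) (w | w | w) <;> simp [g, g₀, outer]
  have r3 : Emb g (loopFactor δ y z) (join k x (comp δ y z)) (glueAll δ LC s) := by
    have e := (comp_emb δ y z).trans r1
    refine ⟨?_, ?_, ?_⟩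
    · rintro (v | v)
      · exact r2.1 v
      · exact e.mate v
    · rintro (v | v)
      · exact r2.2 v
      · exact e.lab v
    · have := e.wt
      simpa [Diagram.toState, join] using this
  have r4 : Emb g (loopFactor δ y z) (concat δ x (comp δ y z)) (glueAll δ LB (glueAll δ LC s)) := by
    have := r3.glueAll hg δ (midPairs a b d)
    simpa [midPairs, LB, concat, Function.comp_def, g, g₀, outer] using this
  rw [← hcomm] at r4
  have r5 := (comp_emb δ x (comp δ y z)).trans r4
  have hfg : g ∘ outer = f ∘ outer := by
    funext v
    rcases v with v | v <;> rfl
  rw [hfg] at r5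
  exact comp_unique δ f hf _ _ l4 r5

end Compose

noncomputable section

/-- Parameters `δ_i`, `i ∈ ℤ/m`, with `δ_{-i} = δ_i`. -/
structure LoopParams (k : Type*) [Field k] (m : ℕ) where
  toFun : ZMod m → k
  symm : ∀ i, toFun (-i) = toFun i

section Algebra
variable {k : Type*} [Field k] {m : ℕ}

/-- The product of diagrams, `(x, y) ↦ loopFactor x y • comp x y`, extended bilinearly. -/
def compLin (δ : ZMod m → k) (a b c : ℕ) :
    (Diag m a b →₀ k) →ₗ[k] (Diag m b c →₀ k) →ₗ[k] (Diag m a c →₀ k) :=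
  Finsupp.linearCombination k fun x => Finsupp.linearCombination k fun y =>
    Finsupp.single (comp δ x y) (loopFactor δ x y)

theorem compLin_single (δ : ZMod m → k) {a b c : ℕ} (x : Diag m a b) (y : Diag m b c) (u v : k) :
    compLin δ a b c (Finsupp.single x u) (Finsupp.single y v) =
      Finsupp.single (comp δ x y) (u * v * loopFactor δ x y) := by
  simp only [compLin, Finsupp.linearCombination_single, LinearMap.smul_apply, Finsupp.smul_single,
    smul_eq_mul, mul_assoc]

theorem compLin_assoc (δ : LoopParams k m) {a b c d : ℕ} (x : Diag m a b →₀ k)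
    (y : Diag m b c →₀ k) (z : Diag m c d →₀ k) :
    compLin δ.toFun a c d (compLin δ.toFun a b c x y) z =
      compLin δ.toFun a b d x (compLin δ.toFun b c d y z) := by
  induction x using Finsupp.induction_linear with
  | zero => simp
  | add x x' h h' => simp [h, h']
  | single x u =>
    induction y using Finsupp.induction_linear with
    | zero => simp
    | add y y' h h' => simp [h, h']
    | single y v =>
      induction z using Finsupp.induction_linear with
      | zero => simp
      | add z z' h h' => simp [h, h']
      | single z w =>
        obtain ⟨h1, h2⟩ := comp_assoc δ.toFun δ.symm x y z
        simp only [compLin_single, h1]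
        congr 1
        linear_combination (u * v * w) * h2

theorem one_compLin (δ : ZMod m → k) {a b : ℕ} (x : Diag m a b →₀ k) :
    compLin δ a a b (Finsupp.single (idDiag m a) 1) x = x := by
  induction x using Finsupp.induction_linear with
  | zero => simp
  | add x x' h h' => simp [h, h']
  | single x u => simp [compLin_single, (id_comp δ x).1, (id_comp δ x).2]

theorem compLin_one (δ : ZMod m → k) {a b : ℕ} (x : Diag m a b →₀ k) :
    compLin δ a b b x (Finsupp.single (idDiag m b) 1) = x := by
  induction x using Finsupp.induction_linear with
  | zero => simp
  | add x x' h h' => simp [h, h']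
  | single x u => simp [compLin_single, (comp_id δ x).1, (comp_id δ x).2]

/-- The cyclotomic Brauer algebra `B_n^m(δ)`, with the `(m,n)`-diagrams as a basis. -/
def CycAlg (_δ : LoopParams k m) (n : ℕ) : Type _ := Diag m n n →₀ k

instance (δ : LoopParams k m) (n : ℕ) : AddCommGroup (CycAlg δ n) :=
  inferInstanceAs (AddCommGroup (Diag m n n →₀ k))

instance (δ : LoopParams k m) (n : ℕ) : Module k (CycAlg δ n) :=
  inferInstanceAs (Module k (Diag m n n →₀ k))

instance (δ : LoopParams k m) (n : ℕ) : Ring (CycAlg δ n) where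
  __ := (inferInstance : AddCommGroup (CycAlg δ n))
  mul x y := compLin δ.toFun n n n x y
  one := (Finsupp.single (idDiag m n) 1 : Diag m n n →₀ k)
  left_distrib x y z := map_add (compLin δ.toFun n n n x) y z
  right_distrib x y z := LinearMap.map_add₂ (compLin δ.toFun n n n) x y z
  zero_mul x := LinearMap.map_zero₂ (compLin δ.toFun n n n) x
  mul_zero x := map_zero (compLin δ.toFun n n n x)
  mul_assoc x y z := compLin_assoc δ x y z
  one_mul x := one_compLin δ.toFun x
  mul_one x := compLin_one δ.toFun x

instance (δ : LoopParams k m) (n : ℕ) : Algebra k (CycAlg δ n) :=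
  Algebra.ofModule (fun r x y => LinearMap.map_smul₂ (compLin δ.toFun n n n) r x y)
    (fun r x y => map_smul (compLin δ.toFun n n n x) r y)

/-- A diagram as an element of the algebra. -/
def CycAlg.of (δ : LoopParams k m) {n : ℕ} (x : Diag m n n) : CycAlg δ n :=
  (Finsupp.single x 1 : Diag m n n →₀ k)

/-- The left `B_n^m(δ)`-module with basis the diagrams with `n` northern and `a` southern nodes, on
which diagrams act by concatenation from above. -/
def DiagSpace (_δ : LoopParams k m) (n a : ℕ) : Type _ := Diag m n a →₀ k

instance (δ : LoopParams k m) (n a : ℕ) : AddCommGroup (DiagSpace δ n a) :=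
  inferInstanceAs (AddCommGroup (Diag m n a →₀ k))

instance (δ : LoopParams k m) (n a : ℕ) : Module k (DiagSpace δ n a) :=
  inferInstanceAs (Module k (Diag m n a →₀ k))

instance (δ : LoopParams k m) (n a : ℕ) : Module (CycAlg δ n) (DiagSpace δ n a) where
  smul X d := compLin δ.toFun n n a X d
  one_smul d := one_compLin δ.toFun d
  mul_smul X Y d := compLin_assoc δ X Y d
  smul_zero X := map_zero (compLin δ.toFun n n a X)
  smul_add X d e := map_add (compLin δ.toFun n n a X) d e
  add_smul X Y d := LinearMap.map_add₂ (compLin δ.toFun n n a) X Y d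
  zero_smul d := LinearMap.map_zero₂ (compLin δ.toFun n n a) d

instance (δ : LoopParams k m) (n a : ℕ) : IsScalarTower k (CycAlg δ n) (DiagSpace δ n a) where
  smul_assoc r X d := LinearMap.map_smul₂ (compLin δ.toFun n n a) r X d

/-- A diagram as an element of `DiagSpace`. -/
def DiagSpace.of (δ : LoopParams k m) {n a : ℕ} (d : Diag m n a) : DiagSpace δ n a :=
  (Finsupp.single d 1 : Diag m n a →₀ k)

/-- Concatenation with elements of `B_a^m(δ)` from below. -/
def DiagSpace.rightMul {δ : LoopParams k m} {n a : ℕ} (v : DiagSpace δ n a) (x : CycAlg δ a) :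
    DiagSpace δ n a :=
  compLin δ.toFun n a a v x

/-- Some strand joins two southern nodes, i.e. fewer than `a` strands are through strands. -/
def HasSouthArc {n a : ℕ} (d : Diag m n a) : Prop := ∃ i j, d.mate (.inr i) = .inr j

/-- The submodule spanned by the diagrams with fewer than `a` through strands. -/
def southArcs (δ : LoopParams k m) (n a : ℕ) : Submodule (CycAlg δ n) (DiagSpace δ n a) :=
  Submodule.span _ {v | ∃ d : Diag m n a, HasSouthArc d ∧ v = DiagSpace.of δ d}

/-- Diagrams with `n` northern nodes and `a` southern nodes modulo those with fewer than `a` through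
strands.  For `a = n - 2l` such a diagram is uniquely an `(m,n,l)`-dangle (its northern half, the
free nodes of which are joined in order to the southern nodes) followed by an element of
`(ℤ/m) ≀ Σ_a`, so this is `V(m,n,l) ⊗ H_a^m`.  It is zero if `n - a` is negative or odd. -/
abbrev ThroughSpace (δ : LoopParams k m) (n a : ℕ) : Type _ := DiagSpace δ n a ⧸ southArcs δ n a

/-- The diagram of a permutation: the southern node `j` is joined to the northern node `g j`. -/
def permDiag (m : ℕ) {n : ℕ} (g : Equiv.Perm (Fin n)) : Diag m n n where
  mate := Sum.elim (fun i => .inr (g.symm i)) (fun j => .inl (g j))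
  lab _ := 0
  mate_mate v := by rcases v with v | v <;> simp
  mate_ne v := by rcases v with v | v <;> simp
  lab_mate _ := by simp

/-- The product of the `t_i^{z i}`: vertical strands, the `i`-th one labelled by `z i` downwards. -/
def labelDiag {n : ℕ} (z : Fin n → ZMod m) : Diag m n n where
  mate := Sum.swap
  lab := Sum.elim z (-z)
  mate_mate := Sum.swap_swap
  mate_ne v := by rcases v with v | v <;> simp
  lab_mate v := by rcases v with v | v <;> simp

/-- The sum of the permutations that preserve the row of each entry. -/
def rowSum (δ : LoopParams k m) {a : ℕ} {R : Type} [DecidableEq R] (row : Fin a → R) :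
    CycAlg δ a :=
  ∑ g : Equiv.Perm (Fin a) with ∀ i, row (g i) = row i, CycAlg.of δ (permDiag m g)

/-- The signed sum of the permutations that preserve the column of each entry. -/
def colSum (δ : LoopParams k m) {a : ℕ} {R : Type} [DecidableEq R] (col : Fin a → R) :
    CycAlg δ a :=
  ∑ g : Equiv.Perm (Fin a) with ∀ i, col (g i) = col i,
    (Equiv.Perm.sign g : ℤ) • CycAlg.of δ (permDiag m g)

end Algebra

section Cells
variable {k : Type*} [Field k] {m : ℕ} [NeZero m]

/-- The idempotent of `k(ℤ/m)^a` belonging to the character in which `t_i` acts by `ξ ^ c i`. -/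
def labelIdem (δ : LoopParams k m) (ξ : k) {a : ℕ} (c : Fin a → ZMod m) : CycAlg δ a :=
  ((m : k) ^ a)⁻¹ • ∑ z : Fin a → ZMod m,
    (∏ i, ξ ^ ((z i).val * (c i).val))⁻¹ • CycAlg.of δ (labelDiag z)

/-- The number of boxes of an `m`-tuple of Young diagrams (partitions), indexed by `ℤ/m`. -/
def size (lam : ZMod m → YoungDiagram) : ℕ := ∑ r, (lam r).card

/-- Membership in `Λ(m,n)`: `lam` is an `m`-partition of `n - 2l` for some `l`. -/
def IsLabel (m n : ℕ) [NeZero m] (lam : ZMod m → YoungDiagram) : Prop := ∃ l, size lam + 2 * l = n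

/-- A fixed filling of the boxes of all components by the numbers `0, …, a - 1`. -/
def tableau (lam : ZMod m → YoungDiagram) : Fin (size lam) ≃ Σ r, (lam r).cells :=
  (Fintype.equivFinOfCardEq (by simp [size, Fintype.card_sigma])).symm

/-- The element `π κ ρ`, where `π` is the idempotent by which every `t_i` with `i` in the component
`r` acts by `ξ ^ r`, and `κ`, `ρ` are the signed column sum and the row sum of the tableau. -/
def spechtGen (δ : LoopParams k m) (ξ : k) (lam : ZMod m → YoungDiagram) : CycAlg δ (size lam) :=
  labelIdem δ ξ (fun i => (tableau lam i).1) *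
    colSum δ (fun i => ((tableau lam i).1, (tableau lam i).2.1.2)) *
    rowSum δ (fun i => ((tableau lam i).1, (tableau lam i).2.1.1))

/-- The Specht module `𝐒(lam)` of `H_a^m = k((ℤ/m) ≀ Σ_a)`, which is spanned by the diagrams without
arcs: the left ideal `H_a^m π κ ρ`.  Here `k Σ_ω κ ρ` is the tensor product of the Specht modules
`S(lam r)` of the symmetric groups, `π` makes `t_i` act on the `r`-th factor by `ξ ^ r`, and since
`H_a^m` is free over the Young subalgebra the left ideal is the module induced from it. -/
def specht (δ : LoopParams k m) (ξ : k) (lam : ZMod m → YoungDiagram) :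
    Submodule k (CycAlg δ (size lam)) :=
  Submodule.span k {x | ∃ u : Diag m (size lam) (size lam), ¬ HasSouthArc u ∧
    x = CycAlg.of δ u * spechtGen δ ξ lam}

/-- The standard (cell) module `Δ_n(lam) = V(m,n,l) ⊗ 𝐒(lam)`, as the submodule of
`V(m,n,l) ⊗ H_a^m` spanned by the `d · x` with `d` a diagram and `x ∈ 𝐒(lam) ⊆ H_a^m`.  A diagram
acts by concatenation, the result being zero if the number of through strands drops. -/
def cell (δ : LoopParams k m) (ξ : k) (n : ℕ) (lam : ZMod m → YoungDiagram) :
    Submodule (CycAlg δ n) (ThroughSpace δ n (size lam)) :=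
  Submodule.span _ {v | ∃ (d : Diag m n (size lam)) (x : CycAlg δ (size lam)),
    x ∈ specht δ ξ lam ∧ v = Submodule.Quotient.mk ((DiagSpace.of δ d).rightMul x)}

end Cells

section Brauer
variable {k : Type*} [Field k]

/-- The single parameter in the case `m = 1`. -/
def constParams (x : k) : LoopParams k 1 := ⟨fun _ => x, fun _ => rfl⟩

/-- The Brauer algebra `B(n, x) = B_n^1(x)`. -/
abbrev BrauerAlg (x : k) (n : ℕ) : Type _ := CycAlg (constParams x) n

/-- The standard module `Δ_{B(n)}(lam)`; it is zero unless `lam` is a partition of some `n - 2l`. -/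
abbrev brauerCell (x : k) (n : ℕ) (lam : YoungDiagram) :
    Submodule (BrauerAlg x n) (ThroughSpace (constParams x) n (size (m := 1) fun _ => lam)) :=
  cell (constParams x) 1 n fun _ => lam

/-- The nodes to the left of the wall, which is placed after the first `r` northern nodes and after
the first `a` southern nodes. -/
def leftOfWall (r s a b : ℕ) : Fin (r + s) ⊕ Fin (a + b) → Prop :=
  Sum.elim (fun i => i.val < r) (fun j => j.val < a)

/-- Walled diagrams: through strands do not cross the wall, and all arcs do. -/
def IsWalled (r s a b : ℕ) (d : Diag 1 (r + s) (a + b)) : Prop :=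
  ∀ v, (leftOfWall r s a b v ↔ leftOfWall r s a b (d.mate v)) ↔ v.isLeft ≠ (d.mate v).isLeft

/-- The walled Brauer algebra `WB(r, s, x)`, the subalgebra of `B(r+s, x)` given by the walled
diagrams (their span is closed under multiplication). -/
def walledAlg (x : k) (r s : ℕ) : Subalgebra k (BrauerAlg x (r + s)) :=
  Algebra.adjoin k {y | ∃ d : Diag 1 (r + s) (r + s), IsWalled r s r s d ∧ y = CycAlg.of _ d}

/-- A filling of the boxes of a bipartition, the first component by the smallest numbers. -/
def biTableau (lam mu : YoungDiagram) : Fin (lam.card + mu.card) ≃ lam.cells ⊕ mu.cells :=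
  finSumFinEquiv.symm.trans (lam.cells.equivFin.symm.sumCongr mu.cells.equivFin.symm)

/-- The element `κ ρ` of the tableau `biTableau`. -/
def walledSpechtGen (x : k) (lam mu : YoungDiagram) : BrauerAlg x (lam.card + mu.card) :=
  colSum _ (fun i => Sum.map (fun c => c.1.2) (fun c => c.1.2) (biTableau lam mu i)) *
  rowSum _ (fun i => Sum.map (fun c => c.1.1) (fun c => c.1.1) (biTableau lam mu i))

/-- The tensor product `S(lam) ⊗ S(mu)` of Specht modules, as the left ideal `k(Σ_a × Σ_b) κ ρ`. -/
def walledSpecht (x : k) (lam mu : YoungDiagram) :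
    Submodule k (BrauerAlg x (lam.card + mu.card)) :=
  Submodule.span k {y | ∃ u : Diag 1 (lam.card + mu.card) (lam.card + mu.card),
    IsWalled lam.card mu.card lam.card mu.card u ∧ ¬ HasSouthArc u ∧ y = CycAlg.of _ u * walledSpechtGen x lam mu}

/-- The standard module `Δ_{WB(r,s)}(lam, mu)`, the inflation of `S(lam) ⊗ S(mu)` along the walled
dangles: the span of the `d · y` with `d` a walled diagram and `y ∈ S(lam) ⊗ S(mu)`.  It is zero
unless `(lam, mu)` is a bipartition of some `(r - l, s - l)`. -/
def walledCell (x : k) (r s : ℕ) (lam mu : YoungDiagram) :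
    Submodule (walledAlg x r s) (ThroughSpace (constParams x) (r + s) (lam.card + mu.card)) :=
  Submodule.span _ {v | ∃ (d : Diag 1 (r + s) (lam.card + mu.card))
    (y : BrauerAlg x (lam.card + mu.card)), IsWalled r s lam.card mu.card d ∧ y ∈ walledSpecht x lam mu ∧
      v = Submodule.Quotient.mk ((DiagSpace.of _ d).rightMul y)}

end Brauer

/-- The head of a module, the quotient by its radical. -/
abbrev head (A M : Type*) [Ring A] [AddCommGroup M] [Module A M] : Type _ :=
  M ⧸ Module.jacobson A M

open Classical in
/-- The composition multiplicity `[M : L]`: the number of factors isomorphic to `L` in a composition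
series of `M`. -/
def multiplicity (A M L : Type*) [Ring A] [AddCommGroup M] [Module A M] [AddCommGroup L]
    [Module A L] : ℕ :=
  if h : ∃ s : CompositionSeries (Submodule A M), s.head = ⊥ ∧ s.last = ⊤ then
    Nat.card {i : Fin h.choose.length // Nonempty
      ((h.choose i.succ ⧸ (h.choose i.castSucc).comap (h.choose i.succ).subtype) ≃ₗ[A] L)}
  else 0

/-- The signed parameter `(1/m) ∑_i ξ^{ir} δ_i`. -/
def deltaBar {k : Type*} [Field k] {m : ℕ} [NeZero m] (δ : LoopParams k m) (ξ : k) (r : ℕ) : k :=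
  (m : k)⁻¹ * ∑ i : ZMod m, ξ ^ (i.val * r) * δ.toFun i

/-- The `r` with `0 < r < m/2`. -/
def middle (m : ℕ) : Finset ℕ := {r ∈ Finset.range m | 0 < r ∧ 2 * r < m}

section Names
variable {k : Type*} [Field k] {m : ℕ} [NeZero m]

/-- `Hom_{B_n^m}(Δ_n(lam), Δ_n(mu))`. -/
abbrev cycHom (δ : LoopParams k m) (ξ : k) (n : ℕ) (lam mu : ZMod m → YoungDiagram) : Type _ :=
  cell δ ξ n lam →ₗ[CycAlg δ n] cell δ ξ n mu

/-- `Hom_{B(n,x)}(Δ_B(lam), Δ_B(mu))`. -/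
abbrev brauerHom (x : k) (n : ℕ) (lam mu : YoungDiagram) : Type _ :=
  brauerCell x n lam →ₗ[BrauerAlg x n] brauerCell x n mu

/-- `Hom_{WB(r,s,x)}(Δ_WB(lam, lam'), Δ_WB(mu, mu'))`. -/
abbrev walledHom (x : k) (r s : ℕ) (lam lam' mu mu' : YoungDiagram) : Type _ :=
  walledCell x r s lam lam' →ₗ[walledAlg x r s] walledCell x r s mu mu'

/-- `[Δ_n(mu) : L_n(lam)]`, where `L_n(lam)` is the head of `Δ_n(lam)`. -/
def cycDecomp (δ : LoopParams k m) (ξ : k) (n : ℕ) (mu lam : ZMod m → YoungDiagram) : ℕ :=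
  multiplicity (CycAlg δ n) (cell δ ξ n mu) (head (CycAlg δ n) (cell δ ξ n lam))

/-- `[Δ_B(mu) : L_B(lam)]` for `B(n,x)`. -/
def brauerDecomp (x : k) (n : ℕ) (mu lam : YoungDiagram) : ℕ :=
  multiplicity (BrauerAlg x n) (brauerCell x n mu) (head (BrauerAlg x n) (brauerCell x n lam))

/-- `[Δ_WB(mu, mu') : L_WB(lam, lam')]` for `WB(r,s,x)`. -/
def walledDecomp (x : k) (r s : ℕ) (mu mu' lam lam' : YoungDiagram) : ℕ :=
  multiplicity (walledAlg x r s) (walledCell x r s mu mu')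
    (head (walledAlg x r s) (walledCell x r s lam lam'))

end Names

end
end CycBrauer

open CycBrauer
open scoped TensorProduct

/-!
The theorem holds because the standard modules of the cyclotomic Brauer algebra become, after cutting with a
suitable idempotent, spaces of *coloured* Brauer diagrams, and strands of different colours do not interact.

**Cutting.** Let `lam` have `a` boxes, and let `x` be the Young symmetrizer of its tableau. The hypotheses on `δ`
provide linear combinations `u`, `w` of diagrams between `n` and `a` nodes with `w u = 1`
(`exists_insert_of_isLabel`), and since `a!` is invertible `x` is a multiple of an idempotent. Up to a scalar
`u x w` is then an idempotent `f` that projects `Δ_n(lam)` onto a line, and `f B f` is spanned by `f` and the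
`u x y x w` with `y` a diagram with southern arcs, which kill the generator `v₀` of `Δ_n(lam)`. For any `M`, the
multiplicity of the head of `Δ_n(lam)` in `M` is therefore the number of composition factors of `f M` on which
the `x y x` vanish (`Cuts.multiplicity_eq`), and a homomorphism from `Δ_n(lam)` to `M` is a vector of `M` that
the annihilator of `v₀` kills (`Cuts.hom_equiv`).

**Fourier transform.** Averaging over the labels with the characters `i ↦ ξ^{ir}` turns a labelled diagram
into an unlabelled one whose northern and southern nodes are coloured by elements of `ℤ/m`, where through strands
join equal colours and arcs join opposite colours (`spread`). In a product, the labels of a closed loop of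
colour `r` are averaged independently of the rest, and so the loop is worth `δ̄_r` (`sum_gl_wt`). For
`M = Δ_n(mu)` the space `f M` becomes `x X x'`, where `X` is spanned by the coloured diagrams without southern
arcs and `x'` is the Young symmetrizer of `mu` (`cellSpace`). Both sides of the theorem are thus invariants of two
coloured tableaux: the number `cellMult` of composition factors of `x X x'` on which the operators `x y` with
southern arcs vanish, and the dimension of the space `arcKernel` of vectors that are killed by all diagrams with
southern arcs (`cycDecomp_eq`, `finrank_cycHom`). The Brauer algebra is the case `m = 1`. The walled Brauer algebra
is obtained with two opposite colours, since a diagram is walled exactly if it respects the colours of the two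
sides of the wall (`isWalled_iff`, `walledDecomp_eq`, `finrank_walledHom`).

**Factorization.** If a set of colours is closed under negation, no strand joins a colour in the set with one
outside, and all the spaces and operators are tensor products. The dimension of `arcKernel` is multiplicative
for this reason (`finrank_arcKernel_sum`), and `cellMult` is because a composition factor of a tensor product on
which all operators vanish comes from such factors on both sides, over any field (`nullLen_tensor`,
`cellMult_sum`). The invariants depend only on which colours are equal or opposite and on the parameters
(`invariants_congr`). Hence the colours `0` and `m/2`, which are their own opposites, contribute the
invariants of Brauer algebras, and the pairs `{r, -r}` with `0 < r < m/2` those of walled Brauer algebras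
(`boxInv_single`, `boxInv_pair`, `boxInv_univ_odd`, `boxInv_univ_even`).
-/

namespace CycBrauer
set_option linter.unusedSectionVars false

/-! ### Counting null steps in chains of stable subspaces -/

section NullChain
open Module
variable {k : Type*} [Field k] {E : Type*} [AddCommGroup E] [Module k E]
  {E' : Type*} [AddCommGroup E'] [Module k E']

/-- `U` is stable under the operators in `S`. -/
def Stab (S : Set (E →ₗ[k] E)) (U : Submodule k E) : Prop := ∀ s ∈ S, ∀ x ∈ U, s x ∈ U

/-- The operators in `S` act by zero on `W / U`. -/
def NullOn (S : Set (E →ₗ[k] E)) (U W : Submodule k E) : Prop := ∀ s ∈ S, ∀ x ∈ W, s x ∈ U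

/-- `NullChain S U W n`: there is a chain of `S`-stable subspaces from `U` to `W` in which the
dimensions of some of the factors on which `S` acts by zero add up to `n`. -/
inductive NullChain (S : Set (E →ₗ[k] E)) : Submodule k E → Submodule k E → ℕ → Prop
  | refl {U} : Stab S U → NullChain S U U 0
  | skip {U W W' n} : NullChain S U W n → W ≤ W' → Stab S W' → NullChain S U W' n
  | null {U W W' n} : NullChain S U W n → W ≤ W' → Stab S W' → NullOn S W W' →
      NullChain S U W' (n + (finrank k W' - finrank k W))

/-- The largest total dimension of null factors in a chain of `S`-stable subspaces from `U` to `W`;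
this is the number of composition factors of `W / U` on which `S` acts by zero. -/
noncomputable def nullLen (S : Set (E →ₗ[k] E)) (U W : Submodule k E) : ℕ :=
  sSup {n | NullChain S U W n}

theorem Stab.inf {S : Set (E →ₗ[k] E)} {U W : Submodule k E} (h : Stab S U) (h' : Stab S W) :
    Stab S (U ⊓ W) := fun s hs x hx => ⟨h s hs x hx.1, h' s hs x hx.2⟩

theorem Stab.sup {S : Set (E →ₗ[k] E)} {U W : Submodule k E} (h : Stab S U) (h' : Stab S W) :
    Stab S (U ⊔ W) := by
  intro s hs x hx
  obtain ⟨a, ha, b, hb, rfl⟩ := Submodule.mem_sup.1 hx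
  rw [map_add]
  exact Submodule.add_mem_sup (h s hs a ha) (h' s hs b hb)

theorem stab_bot (S : Set (E →ₗ[k] E)) : Stab S ⊥ := by
  intro s _ x hx
  rw [(Submodule.mem_bot k).1 hx, map_zero]; exact Submodule.zero_mem _

theorem stab_top (S : Set (E →ₗ[k] E)) : Stab S ⊤ := fun _ _ _ _ => Submodule.mem_top

/-- `t` acts on every `S`-stable subquotient, and by zero on the null ones. -/
structure Dom (S : Set (E →ₗ[k] E)) (t : E →ₗ[k] E) : Prop where
  stab : ∀ U, Stab S U → ∀ x ∈ U, t x ∈ U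
  null : ∀ U W, Stab S U → Stab S W → U ≤ W → NullOn S U W → ∀ x ∈ W, t x ∈ U

theorem Dom.of_mem {S : Set (E →ₗ[k] E)} {t} (h : t ∈ S) : Dom S t :=
  ⟨fun _ hU => hU t h, fun _ _ _ _ _ hn => hn t h⟩

theorem Dom.smul {S : Set (E →ₗ[k] E)} {t} (h : Dom S t) (c : k) : Dom S (c • t) :=
  ⟨fun U hU x hx => U.smul_mem c (h.stab U hU x hx),
    fun U W a b c' d x hx => U.smul_mem c (h.null U W a b c' d x hx)⟩

theorem Dom.comp {S : Set (E →ₗ[k] E)} {t t'} (h : Dom S t) (h' : Dom S t') : Dom S (t ∘ₗ t') :=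
  ⟨fun U hU x hx => h.stab U hU _ (h'.stab U hU x hx),
    fun U W a b c d x hx => h.stab U a _ (h'.null U W a b c d x hx)⟩

namespace NullChain
variable {S : Set (E →ₗ[k] E)} {U W W' : Submodule k E} {n n' : ℕ}

theorem stab_right (h : NullChain S U W n) : Stab S W := by
  cases h <;> assumption

theorem le (h : NullChain S U W n) : U ≤ W := by
  induction h with
  | refl h => exact le_rfl
  | skip _ h _ ih => exact ih.trans h
  | null _ h _ _ ih => exact ih.trans h

theorem trans (h : NullChain S U W n) (h' : NullChain S W W' n') : NullChain S U W' (n + n') := by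
  induction h' with
  | refl _ => exact h
  | skip _ a b ih => exact ih.skip a b
  | null _ a b c ih => rw [← add_assoc]; exact ih.null a b c

theorem bound [FiniteDimensional k E] (h : NullChain S U W n) : n + finrank k U ≤ finrank k W := by
  induction h with
  | refl h => simp
  | skip _ h _ ih => exact ih.trans (Submodule.finrank_mono h)
  | null _ h _ _ ih => have := Submodule.finrank_mono h; omega

/-- A chain up to `Y` induces a chain below the stable subspace `W` and one above it, and the dimensions
add up in each step by the modular law. -/
theorem split [FiniteDimensional k E] {Y : Submodule k E} (hW : Stab S W)
    (h : NullChain S U Y n) :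
    ∃ a b, NullChain S (U ⊓ W) (Y ⊓ W) a ∧ NullChain S (U ⊔ W) (Y ⊔ W) b ∧ n = a + b := by
  induction h with
  | refl h => exact ⟨0, 0, refl (h.inf hW), refl (h.sup hW), rfl⟩
  | skip _ h1 h2 ih =>
    obtain ⟨a, b, ha, hb, e⟩ := ih
    exact ⟨a, b, ha.skip (inf_le_inf_right _ h1) (h2.inf hW), hb.skip (sup_le_sup_right h1 _)
      (h2.sup hW), e⟩
  | @null Y Z n hY h1 h2 h3 ih =>
    obtain ⟨a, b, ha, hb, e⟩ := ih
    refine ⟨_, _, ha.null (inf_le_inf_right _ h1) (h2.inf hW)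
      (fun s hs x hx => ⟨h3 s hs x hx.1, hW s hs x hx.2⟩), hb.null (sup_le_sup_right h1 _)
      (h2.sup hW) ?_, ?_⟩
    · intro s hs x hx
      obtain ⟨y, hy, z, hz, rfl⟩ := Submodule.mem_sup.1 hx
      rw [map_add]
      exact Submodule.add_mem_sup (h3 s hs y hy) (hW s hs z hz)
    · have e1 := Submodule.finrank_sup_add_finrank_inf_eq Y W
      have e2 := Submodule.finrank_sup_add_finrank_inf_eq Z W
      have e3 := Submodule.finrank_mono h1
      have e4 := Submodule.finrank_mono (inf_le_inf_right W h1)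
      have e5 := Submodule.finrank_mono (sup_le_sup_right h1 W)
      omega

/-- Transport of chains inside `[⊥, T]` along an order-preserving map of subspaces that respects
stability, null factors and dimensions of factors. -/
theorem transport {S' : Set (E' →ₗ[k] E')} (F : Submodule k E → Submodule k E') (T : Submodule k E)
    (hmono : ∀ U W, U ≤ W → F U ≤ F W)
    (hstab : ∀ U, U ≤ T → Stab S U → Stab S' (F U))
    (hnull : ∀ U W, W ≤ T → Stab S U → Stab S W → U ≤ W → NullOn S U W → NullOn S' (F U) (F W))
    (hdim : ∀ U W, W ≤ T → U ≤ W →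
      finrank k (F W) - finrank k (F U) = finrank k W - finrank k U)
    (h : NullChain S U W n) (hW : W ≤ T) : NullChain S' (F U) (F W) n := by
  induction h with
  | refl h => exact refl (hstab _ hW h)
  | skip _ h1 h2 ih => exact (ih (h1.trans hW)).skip (hmono _ _ h1) (hstab _ hW h2)
  | @null Y Z n hY h1 h2 h3 ih =>
    rw [← hdim Y Z hW h1]
    exact (ih (h1.trans hW)).null (hmono _ _ h1) (hstab _ hW h2)
      (hnull _ _ hW hY.stab_right h2 h1 h3)

end NullChain

section
variable {S : Set (E →ₗ[k] E)} {U W W' : Submodule k E} {n : ℕ} [FiniteDimensional k E]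

theorem bddAbove_nullChain : BddAbove {n | NullChain S U W n} :=
  ⟨finrank k W, fun _ h => (Nat.le_add_right _ _).trans h.bound⟩

theorem NullChain.le_nullLen (h : NullChain S U W n) : n ≤ nullLen S U W :=
  le_csSup bddAbove_nullChain h

theorem nullChain_nullLen (hU : Stab S U) (hW : Stab S W) (h : U ≤ W) :
    NullChain S U W (nullLen S U W) :=
  Nat.sSup_mem (s := {n | NullChain S U W n}) ⟨0, (NullChain.refl hU).skip h hW⟩
    bddAbove_nullChain

theorem nullLen_add (hU : Stab S U) (hW : Stab S W) (hW' : Stab S W') (h : U ≤ W) (h' : W ≤ W') :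
    nullLen S U W' = nullLen S U W + nullLen S W W' := by
  apply le_antisymm
  · obtain ⟨a, b, ha, hb, e⟩ := (nullChain_nullLen hU hW' (h.trans h')).split hW
    rw [inf_eq_left.2 h, inf_eq_right.2 h'] at ha
    rw [sup_eq_right.2 h, sup_eq_left.2 h'] at hb
    rw [e]
    exact add_le_add ha.le_nullLen hb.le_nullLen
  · exact ((nullChain_nullLen hU hW h).trans (nullChain_nullLen hW hW' h')).le_nullLen

theorem nullLen_of_null (hU : Stab S U) (hW : Stab S W) (h : U ≤ W) (hn : NullOn S U W) :
    nullLen S U W = finrank k W - finrank k U := by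
  apply le_antisymm
  · have := (nullChain_nullLen hU hW h).bound
    omega
  · have := ((NullChain.refl hU).null h hW hn).le_nullLen
    simpa using this

theorem nullLen_self (hU : Stab S U) : nullLen S U U = 0 := by
  have := (nullChain_nullLen hU hU le_rfl).bound
  omega

/-- A simple factor on which `S` does not act by zero contributes nothing. -/
theorem nullLen_of_not_null (hU : Stab S U) (hW : Stab S W) (h : U ≤ W)
    (hs : ∀ Y, Stab S Y → U ≤ Y → Y ≤ W → Y = U ∨ Y = W) (hn : ¬ NullOn S U W) :
    nullLen S U W = 0 := by
  have key : ∀ U' Y n, NullChain S U' Y n → U' = U → Y ≤ W → n = 0 := by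
    intro U' Y n hY
    induction hY with
    | refl _ => intros; rfl
    | skip _ h1 _ ih => intro e h2; exact ih e (h1.trans h2)
    | @null Y Z n hY h1 h2 h3 ih =>
      intro e h4
      subst e
      rw [ih rfl (h1.trans h4)]
      have hUY := hY.le
      rcases hs Y hY.stab_right hUY (h1.trans h4) with rfl | rfl
      · rcases hs Z h2 h1 h4 with rfl | rfl
        · simp
        · exact absurd h3 hn
      · rw [le_antisymm h1 h4]; simp
  exact key _ _ _ (nullChain_nullLen hU hW h) rfl le_rfl

theorem nullLen_anti {S' : Set (E →ₗ[k] E)} (hS : S ⊆ S') (hU : Stab S' U) (hW : Stab S' W)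
    (h : U ≤ W) : nullLen S' U W ≤ nullLen S U W :=
  ((nullChain_nullLen hU hW h).transport id ⊤ (fun _ _ h => h) (fun _ _ h s hs => h s (hS hs))
    (fun _ _ _ _ _ _ h s hs => h s (hS hs)) (fun _ _ _ _ => rfl) le_top).le_nullLen

/-- The number of null factors is unchanged under an injective map that carries one set of operators to
another one generating the same stable subspaces. -/
theorem nullLen_map {E' : Type*} [AddCommGroup E'] [Module k E'] [FiniteDimensional k E']
    {S' : Set (E' →ₗ[k] E')} (φ : E →ₗ[k] E') (hφ : Function.Injective φ)
    (h1 : ∀ s ∈ S', ∃ t, Dom S t ∧ s ∘ₗ φ = φ ∘ₗ t)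
    (h2 : ∀ s ∈ S, ∃ t, Dom S' t ∧ φ ∘ₗ s = t ∘ₗ φ) (hU : Stab S U) (hW : Stab S W) (h : U ≤ W) :
    nullLen S' (U.map φ) (W.map φ) = nullLen S U W := by
  have d : ∀ U : Submodule k E, finrank k (U.map φ) = finrank k U := fun U =>
    (Submodule.equivMapOfInjective φ hφ U).finrank_eq.symm
  have a1 : ∀ U, Stab S U → Stab S' (U.map φ) := by
    rintro U hU s hs _ ⟨x, hx, rfl⟩
    obtain ⟨t, ht, e⟩ := h1 s hs
    exact ⟨t x, ht.stab U hU x hx, (LinearMap.congr_fun e x).symm⟩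
  have a2 : ∀ U W, Stab S U → Stab S W → U ≤ W → NullOn S U W →
      NullOn S' (U.map φ) (W.map φ) := by
    rintro U W hU hW hUW hn s hs _ ⟨x, hx, rfl⟩
    obtain ⟨t, ht, e⟩ := h1 s hs
    exact ⟨t x, ht.null U W hU hW hUW hn x hx, (LinearMap.congr_fun e x).symm⟩
  have b0 : ∀ U : Submodule k E', U ≤ LinearMap.range φ → (U.comap φ).map φ = U := fun U hU =>
    Submodule.map_comap_eq_of_le hU
  apply le_antisymm
  · have hc := nullChain_nullLen (a1 U hU) (a1 W hW) (Submodule.map_mono h)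
    have := hc.transport (S' := S) (fun U => U.comap φ) (LinearMap.range φ)
      (fun _ _ h => Submodule.comap_mono h) ?_ ?_ ?_ (LinearMap.map_le_range)
    · rw [Submodule.comap_map_eq_of_injective hφ, Submodule.comap_map_eq_of_injective hφ] at this
      exact this.le_nullLen
    · intro V hV hs s hss x hx
      obtain ⟨t, ht, e⟩ := h2 s hss
      have := ht.stab V hs (φ x) hx
      rw [show t (φ x) = φ (s x) from (LinearMap.congr_fun e x).symm] at this
      exact this
    · intro V Y hY sV sY hVY hn s hss x hx
      obtain ⟨t, ht, e⟩ := h2 s hss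
      have := ht.null V Y sV sY hVY hn (φ x) hx
      rw [show t (φ x) = φ (s x) from (LinearMap.congr_fun e x).symm] at this
      exact this
    · intro V Y hY hVY
      rw [← d, ← d, b0 _ hY, b0 _ (hVY.trans hY)]
  · refine ((nullChain_nullLen hU hW h).transport (fun U => U.map φ) ⊤
      (fun _ _ h => Submodule.map_mono h) (fun U _ => a1 U) (fun U W _ => a2 U W) ?_
      le_top).le_nullLen
    intro V Y _ _
    simp only [d]

/-- The null factors above the kernel of an equivariant surjection are those of its target. -/
theorem nullLen_ker_top {E' : Type*} [AddCommGroup E'] [Module k E'] [FiniteDimensional k E']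
    {S' : Set (E' →ₗ[k] E')} (φ : E →ₗ[k] E') (hφ : Function.Surjective φ)
    (h1 : ∀ s ∈ S', ∃ t, Dom S t ∧ s ∘ₗ φ = φ ∘ₗ t)
    (h2 : ∀ s ∈ S, ∃ t, Dom S' t ∧ φ ∘ₗ s = t ∘ₗ φ) :
    nullLen S (LinearMap.ker φ) ⊤ = nullLen S' ⊥ ⊤ := by
  have a1 : ∀ U, Stab S' U → Stab S (U.comap φ) := by
    intro U hU s hs x hx
    obtain ⟨t, ht, e⟩ := h2 s hs
    have := ht.stab U hU (φ x) hx
    rw [show t (φ x) = φ (s x) from (LinearMap.congr_fun e x).symm] at this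
    exact this
  have a2 : ∀ U W, Stab S' U → Stab S' W → U ≤ W → NullOn S' U W →
      NullOn S (U.comap φ) (W.comap φ) := by
    intro U W hU hW hUW hn s hs x hx
    obtain ⟨t, ht, e⟩ := h2 s hs
    have := ht.null U W hU hW hUW hn (φ x) hx
    rw [show t (φ x) = φ (s x) from (LinearMap.congr_fun e x).symm] at this
    exact this
  have d : ∀ U : Submodule k E', finrank k (U.comap φ) =
      finrank k U + finrank k (LinearMap.ker φ) := by
    intro U
    have e := LinearMap.finrank_range_add_finrank_ker (φ.domRestrict (U.comap φ))
    have e1 : LinearMap.range (φ.domRestrict (U.comap φ)) = U := by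
      rw [LinearMap.range_domRestrict, Submodule.map_comap_eq_of_surjective hφ]
    have e2 : finrank k (LinearMap.ker (φ.domRestrict (U.comap φ))) =
        finrank k (LinearMap.ker φ) := by
      rw [LinearMap.ker_domRestrict]
      refine (Submodule.comapSubtypeEquivOfLe ?_).finrank_eq
      exact LinearMap.ker_le_comap φ
    rw [e1, e2] at e
    exact e.symm
  have hk : Stab S (LinearMap.ker φ) := a1 ⊥ (stab_bot _)
  apply le_antisymm
  · -- a chain above the kernel is carried down by `map`
    have key : ∀ U W n, NullChain S U W n → LinearMap.ker φ ≤ U →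
        NullChain S' (U.map φ) (W.map φ) n := by
      have dm : ∀ U : Submodule k E, LinearMap.ker φ ≤ U →
          finrank k U = finrank k (U.map φ) + finrank k (LinearMap.ker φ) := by
        intro U hU
        rw [← d, Submodule.comap_map_eq, sup_eq_left.2 hU]
      have st : ∀ U, Stab S U → Stab S' (U.map φ) := by
        rintro U hU s hs _ ⟨x, hx, rfl⟩
        obtain ⟨t, ht, e⟩ := h1 s hs
        exact ⟨t x, ht.stab U hU x hx, (LinearMap.congr_fun e x).symm⟩
      intro U W n h
      induction h with
      | refl h => intro _; exact .refl (st _ h)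
      | skip _ h h' ih => intro hk; exact (ih hk).skip (Submodule.map_mono h) (st _ h')
      | @null W W' n hW h h' hn ih =>
        intro hk
        have e1 := dm W (hk.trans hW.le)
        have e2 := dm W' (hk.trans (hW.le.trans h))
        have : finrank k W' - finrank k W = finrank k (W'.map φ) - finrank k (W.map φ) := by omega
        rw [this]
        refine (ih hk).null (Submodule.map_mono h) (st _ h') ?_
        rintro s hs _ ⟨x, hx, rfl⟩
        obtain ⟨t, ht, e⟩ := h1 s hs
        exact ⟨t x, ht.null W W' hW.stab_right h' h hn x hx, (LinearMap.congr_fun e x).symm⟩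
    have := key _ _ _ (nullChain_nullLen hk (stab_top _) le_top) le_rfl
    rw [Submodule.map_top, LinearMap.range_eq_top.2 hφ,
      show (LinearMap.ker φ).map φ = ⊥ from le_bot_iff.1 (Submodule.map_le_iff_le_comap.2 le_rfl)] at this
    exact this.le_nullLen
  · have := (nullChain_nullLen (stab_bot S') (stab_top S') bot_le).transport (S' := S)
      (fun U => U.comap φ) ⊤ (fun _ _ h => Submodule.comap_mono h) (fun U _ => a1 U)
      (fun U W _ => a2 U W) ?_ le_top
    · exact this.le_nullLen
    · intro U W _ _
      simp only [d]; omega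

end
end NullChain

section NullTensor
universe u₁ u₂
open Module TensorProduct
variable {k : Type*} [Field k]

/-- The operators `s ⊗ 1` and `1 ⊗ t` on a tensor product. -/
def tensorOps {E₁ E₂ : Type*} [AddCommGroup E₁] [Module k E₁] [AddCommGroup E₂] [Module k E₂]
    (S₁ : Set (E₁ →ₗ[k] E₁)) (S₂ : Set (E₂ →ₗ[k] E₂)) :
    Set (E₁ ⊗[k] E₂ →ₗ[k] E₁ ⊗[k] E₂) :=
  (fun s => s.rTensor E₂) '' S₁ ∪ (fun t => t.lTensor E₁) '' S₂

section Sub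
variable {E : Type*} [AddCommGroup E] [Module k E] {S : Set (E →ₗ[k] E)} {U : Submodule k E}

/-- The operators induced on a stable subspace. -/
def subOps (hU : Stab S U) : Set (U →ₗ[k] U) := Set.range fun s : S => s.1.restrict (hU s.1 s.2)

/-- The operators induced on the quotient by a stable subspace. -/
def quotOps (hU : Stab S U) : Set (E ⧸ U →ₗ[k] E ⧸ U) :=
  Set.range fun s : S => U.mapQ U s.1 (hU s.1 s.2)

variable [FiniteDimensional k E]

theorem nullLen_sub (hU : Stab S U) : nullLen (subOps hU) ⊥ ⊤ = nullLen S ⊥ U := by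
  rw [← nullLen_map (S' := S) U.subtype U.injective_subtype _ _ (stab_bot _) (stab_top _) bot_le]
  · simp
  · intro s hs
    exact ⟨_, Dom.of_mem ⟨⟨s, hs⟩, rfl⟩, by ext; rfl⟩
  · rintro _ ⟨⟨s, hs⟩, rfl⟩
    exact ⟨s, Dom.of_mem hs, by ext; rfl⟩

theorem nullLen_quot (hU : Stab S U) : nullLen (quotOps hU) ⊥ ⊤ = nullLen S U ⊤ := by
  rw [← nullLen_ker_top (S := S) U.mkQ U.mkQ_surjective]
  · simp
  · rintro _ ⟨⟨s, hs⟩, rfl⟩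
    exact ⟨s, Dom.of_mem hs, by ext; rfl⟩
  · intro s hs
    exact ⟨_, Dom.of_mem ⟨⟨s, hs⟩, rfl⟩, by ext; rfl⟩

theorem nullLen_sub_add_quot (hU : Stab S U) :
    nullLen S ⊥ ⊤ = nullLen (subOps hU) ⊥ ⊤ + nullLen (quotOps hU) ⊥ ⊤ := by
  rw [nullLen_sub, nullLen_quot]
  exact nullLen_add (stab_bot _) hU (stab_top _) bot_le le_top

end Sub

variable {E₁ : Type u₁} [AddCommGroup E₁] [Module k E₁] [FiniteDimensional k E₁]
  {E₂ : Type u₂} [AddCommGroup E₂] [Module k E₂] [FiniteDimensional k E₂]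

/-- The number of null factors is additive on short exact sequences. -/
theorem nullLen_ses {E' E E'' : Type*} [AddCommGroup E'] [Module k E'] [FiniteDimensional k E']
    [AddCommGroup E] [Module k E] [FiniteDimensional k E]
    [AddCommGroup E''] [Module k E''] [FiniteDimensional k E'']
    {S' : Set (E' →ₗ[k] E')} {S : Set (E →ₗ[k] E)} {S'' : Set (E'' →ₗ[k] E'')}
    (i : E' →ₗ[k] E) (p : E →ₗ[k] E'') (hi : Function.Injective i) (hp : Function.Surjective p)
    (hip : Function.Exact i p)
    (h1 : ∀ s ∈ S, ∃ t, Dom S' t ∧ s ∘ₗ i = i ∘ₗ t)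
    (h2 : ∀ s ∈ S', ∃ t, Dom S t ∧ i ∘ₗ s = t ∘ₗ i)
    (h3 : ∀ s ∈ S'', ∃ t, Dom S t ∧ s ∘ₗ p = p ∘ₗ t)
    (h4 : ∀ s ∈ S, ∃ t, Dom S'' t ∧ p ∘ₗ s = t ∘ₗ p) :
    nullLen S ⊥ ⊤ = nullLen S' ⊥ ⊤ + nullLen S'' ⊥ ⊤ := by
  have hk : Stab S (LinearMap.range i) := by
    rintro s hs _ ⟨x, rfl⟩
    obtain ⟨t, -, e⟩ := h1 s hs
    exact ⟨t x, (LinearMap.congr_fun e x).symm⟩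
  rw [← nullLen_ker_top p hp h3 h4, ← nullLen_map i hi h1 h2 (stab_bot _) (stab_top _) bot_le,
    Submodule.map_bot, Submodule.map_top, LinearMap.exact_iff.1 hip]
  exact nullLen_add (stab_bot _) hk (stab_top _) bot_le le_top

/-- Additivity for the filtration of `E₁ ⊗ E₂` by `U ⊗ E₂`. -/
theorem nullLen_tensor_left (S₁ : Set (E₁ →ₗ[k] E₁)) (S₂ : Set (E₂ →ₗ[k] E₂))
    {U : Submodule k E₁} (hU : Stab S₁ U) :
    nullLen (tensorOps S₁ S₂) ⊥ ⊤ =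
      nullLen (tensorOps (subOps hU) S₂) ⊥ ⊤ + nullLen (tensorOps (quotOps hU) S₂) ⊥ ⊤ := by
  refine nullLen_ses (U.subtype.rTensor E₂) (U.mkQ.rTensor E₂)
    (Module.Flat.rTensor_preserves_injective_linearMap _ U.injective_subtype)
    (LinearMap.rTensor_surjective _ U.mkQ_surjective)
    (rTensor_exact _ (LinearMap.exact_subtype_mkQ U) U.mkQ_surjective) ?_ ?_ ?_ ?_
  · rintro _ (⟨s, hs, rfl⟩ | ⟨s, hs, rfl⟩)
    · exact ⟨_, Dom.of_mem (.inl ⟨_, ⟨⟨s, hs⟩, rfl⟩, rfl⟩), by ext; rfl⟩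
    · exact ⟨_, Dom.of_mem (.inr ⟨s, hs, rfl⟩), by ext; rfl⟩
  · rintro _ (⟨_, ⟨⟨s, hs⟩, rfl⟩, rfl⟩ | ⟨s, hs, rfl⟩)
    · exact ⟨_, Dom.of_mem (.inl ⟨s, hs, rfl⟩), by ext; rfl⟩
    · exact ⟨_, Dom.of_mem (.inr ⟨s, hs, rfl⟩), by ext; rfl⟩
  · rintro _ (⟨_, ⟨⟨s, hs⟩, rfl⟩, rfl⟩ | ⟨s, hs, rfl⟩)
    · exact ⟨_, Dom.of_mem (.inl ⟨s, hs, rfl⟩), by ext; rfl⟩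
    · exact ⟨_, Dom.of_mem (.inr ⟨s, hs, rfl⟩), by ext; rfl⟩
  · rintro _ (⟨s, hs, rfl⟩ | ⟨s, hs, rfl⟩)
    · exact ⟨_, Dom.of_mem (.inl ⟨_, ⟨⟨s, hs⟩, rfl⟩, rfl⟩), by ext; rfl⟩
    · exact ⟨_, Dom.of_mem (.inr ⟨s, hs, rfl⟩), by ext; rfl⟩

theorem nullLen_equiv {E E' : Type*} [AddCommGroup E] [Module k E] [FiniteDimensional k E]
    [AddCommGroup E'] [Module k E'] [FiniteDimensional k E']
    {S : Set (E →ₗ[k] E)} {S' : Set (E' →ₗ[k] E')} (e : E ≃ₗ[k] E')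
    (h1 : ∀ s ∈ S', ∃ t, Dom S t ∧ s ∘ₗ e.toLinearMap = e.toLinearMap ∘ₗ t)
    (h2 : ∀ s ∈ S, ∃ t, Dom S' t ∧ e.toLinearMap ∘ₗ s = t ∘ₗ e.toLinearMap) :
    nullLen S' ⊥ ⊤ = nullLen S ⊥ ⊤ := by
  have := nullLen_map e.toLinearMap e.injective h1 h2 (stab_bot _) (stab_top _) bot_le
  rwa [Submodule.map_bot, Submodule.map_top, LinearEquiv.range] at this

theorem nullLen_tensor_comm (S₁ : Set (E₁ →ₗ[k] E₁)) (S₂ : Set (E₂ →ₗ[k] E₂)) :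
    nullLen (tensorOps S₁ S₂) ⊥ ⊤ = nullLen (tensorOps S₂ S₁) ⊥ ⊤ := by
  refine nullLen_equiv (TensorProduct.comm k E₂ E₁) ?_ ?_
  · rintro _ (⟨s, hs, rfl⟩ | ⟨s, hs, rfl⟩)
    · exact ⟨_, Dom.of_mem (.inr ⟨s, hs, rfl⟩), by ext; rfl⟩
    · exact ⟨_, Dom.of_mem (.inl ⟨s, hs, rfl⟩), by ext; rfl⟩
  · rintro _ (⟨s, hs, rfl⟩ | ⟨s, hs, rfl⟩)
    · exact ⟨_, Dom.of_mem (.inr ⟨s, hs, rfl⟩), by ext; rfl⟩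
    · exact ⟨_, Dom.of_mem (.inl ⟨s, hs, rfl⟩), by ext; rfl⟩

/-- There are no stable subspaces other than `0` and the whole space. -/
def OpSimple {E : Type*} [AddCommGroup E] [Module k E] (S : Set (E →ₗ[k] E)) : Prop :=
  ∀ U, Stab S U → U = ⊥ ∨ U = ⊤

theorem finrank_sub_lt {E : Type*} [AddCommGroup E] [Module k E] [FiniteDimensional k E]
    {U : Submodule k E} (h : U ≠ ⊥) (h' : U ≠ ⊤) :
    finrank k U < finrank k E ∧ finrank k (E ⧸ U) < finrank k E := by
  have h1 := Submodule.finrank_lt h'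
  have h2 := U.finrank_quotient_add_finrank
  have h3 : finrank k U ≠ 0 := fun h3 => h (Submodule.finrank_eq_zero.1 h3)
  omega

theorem nullLen_eq_zero_of_finrank {E : Type*} [AddCommGroup E] [Module k E]
    [FiniteDimensional k E] (S : Set (E →ₗ[k] E)) (h : finrank k E = 0) :
    nullLen S ⊥ ⊤ = 0 := by
  have := (nullChain_nullLen (stab_bot S) (stab_top S) bot_le).bound
  rw [finrank_top] at this
  omega

/-- Tensoring with a multiplicity space keeps the absence of null factors. -/
theorem nullLen_tensor_empty {S₁ : Set (E₁ →ₗ[k] E₁)} (h0 : nullLen S₁ ⊥ ⊤ = 0) :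
    ∀ (d : ℕ) (E₂ : Type u₂) [AddCommGroup E₂] [Module k E₂] [FiniteDimensional k E₂],
      finrank k E₂ = d → nullLen (tensorOps S₁ (∅ : Set (E₂ →ₗ[k] E₂))) ⊥ ⊤ = 0 := by
  intro d
  induction d using Nat.strong_induction_on with
  | _ d ih =>
    intro E₂ _ _ _ hd
    by_cases h : ∃ U : Submodule k E₂, U ≠ ⊥ ∧ U ≠ ⊤
    · obtain ⟨U, hb, ht⟩ := h
      have hU : Stab (∅ : Set (E₂ →ₗ[k] E₂)) U := fun s hs => hs.elim
      obtain ⟨h1, h2⟩ := finrank_sub_lt hb ht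
      have e1 : subOps hU = ∅ := by simp [subOps]
      have e2 : quotOps hU = ∅ := by simp [quotOps]
      rw [nullLen_tensor_comm, nullLen_tensor_left _ _ hU, e1, e2, nullLen_tensor_comm,
        ih _ (hd ▸ h1) U rfl, nullLen_tensor_comm, ih _ (hd ▸ h2) (E₂ ⧸ U) rfl]
    · push Not at h
      by_cases hz : finrank k E₂ = 0
      · apply nullLen_eq_zero_of_finrank
        rw [finrank_tensorProduct, hz, mul_zero]
      · -- `E₂` is a line, so that the tensor product is a copy of `E₁`
        have : Nontrivial E₂ := Module.nontrivial_of_finrank_pos (Nat.pos_of_ne_zero hz)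
        obtain ⟨v, hv⟩ := exists_ne (0 : E₂)
        have hs : Submodule.span k {v} = ⊤ :=
          h _ (by simpa [Submodule.span_singleton_eq_bot] using hv)
        let e : k ≃ₗ[k] E₂ := (LinearEquiv.toSpanNonzeroSingleton k E₂ v hv).trans
          (LinearEquiv.ofTop _ hs)
        rw [← h0]
        refine nullLen_equiv ((TensorProduct.rid k E₁).symm.trans (e.lTensor E₁)) ?_ ?_
        · rintro _ (⟨s, hs, rfl⟩ | ⟨s, hs, rfl⟩)
          · exact ⟨s, Dom.of_mem hs, by ext; simp⟩
          · exact hs.elim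
        · intro s hs
          exact ⟨_, Dom.of_mem (.inl ⟨s, hs, rfl⟩), by ext; simp⟩

theorem nullLen_of_opSimple_null {E : Type*} [AddCommGroup E] [Module k E]
    [FiniteDimensional k E] {S : Set (E →ₗ[k] E)} (hn : NullOn S ⊥ ⊤) :
    nullLen S ⊥ ⊤ = finrank k E := by
  rw [nullLen_of_null (stab_bot _) (stab_top _) bot_le hn, finrank_top, finrank_bot, Nat.sub_zero]

theorem nullLen_tensor_not_null {S₁ : Set (E₁ →ₗ[k] E₁)} (S₂ : Set (E₂ →ₗ[k] E₂))
    (h1 : OpSimple S₁) (n1 : ¬ NullOn S₁ ⊥ ⊤) :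
    nullLen (tensorOps S₁ S₂) ⊥ ⊤ = 0 ∧ nullLen S₁ ⊥ ⊤ = 0 := by
  have h0 : nullLen S₁ ⊥ ⊤ = 0 :=
    nullLen_of_not_null (stab_bot _) (stab_top _) bot_le (fun Y hY _ _ => h1 Y hY) n1
  refine ⟨?_, h0⟩
  have := nullLen_tensor_empty h0 _ E₂ rfl
  refine Nat.le_zero.1 (this ▸ nullLen_anti ?_ (stab_bot _) (stab_top _) bot_le)
  rintro _ (⟨s, hs, rfl⟩ | ⟨s, hs, rfl⟩)
  · exact .inl ⟨s, hs, rfl⟩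
  · exact hs.elim

/-- If neither factor has a proper stable subspace, a tensor factor is null exactly if both factors are. -/
theorem nullLen_tensor_simple {S₁ : Set (E₁ →ₗ[k] E₁)} {S₂ : Set (E₂ →ₗ[k] E₂)}
    (h1 : OpSimple S₁) (h2 : OpSimple S₂) :
    nullLen (tensorOps S₁ S₂) ⊥ ⊤ = nullLen S₁ ⊥ ⊤ * nullLen S₂ ⊥ ⊤ := by
  by_cases n1 : NullOn S₁ ⊥ ⊤
  · by_cases n2 : NullOn S₂ ⊥ ⊤
    · rw [nullLen_of_opSimple_null n1, nullLen_of_opSimple_null n2, nullLen_of_opSimple_null,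
        finrank_tensorProduct]
      have z1 : ∀ s ∈ S₁, s = 0 := fun s hs => LinearMap.ext fun x => by simpa using n1 s hs x trivial
      have z2 : ∀ s ∈ S₂, s = 0 := fun s hs => LinearMap.ext fun x => by simpa using n2 s hs x trivial
      rintro _ (⟨s, hs, rfl⟩ | ⟨s, hs, rfl⟩) x _
      · rw [z1 s hs]; simp
      · rw [z2 s hs]; simp
    · obtain ⟨a, b⟩ := nullLen_tensor_not_null S₁ h2 n2
      rw [nullLen_tensor_comm, a, b, mul_zero]
  · obtain ⟨a, b⟩ := nullLen_tensor_not_null S₂ h1 n1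
    rw [a, b, zero_mul]

/-- Reduction of the first factor to a simple one, by induction on the dimension. -/
theorem nullLen_tensor_aux (S₂ : Set (E₂ →ₗ[k] E₂))
    (P : ∀ (E₁ : Type u₁) [AddCommGroup E₁] [Module k E₁] [FiniteDimensional k E₁]
      (S₁ : Set (E₁ →ₗ[k] E₁)), OpSimple S₁ →
      nullLen (tensorOps S₁ S₂) ⊥ ⊤ = nullLen S₁ ⊥ ⊤ * nullLen S₂ ⊥ ⊤) :
    ∀ (d : ℕ) (E₁ : Type u₁) [AddCommGroup E₁] [Module k E₁] [FiniteDimensional k E₁]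
      (S₁ : Set (E₁ →ₗ[k] E₁)), finrank k E₁ = d →
      nullLen (tensorOps S₁ S₂) ⊥ ⊤ = nullLen S₁ ⊥ ⊤ * nullLen S₂ ⊥ ⊤ := by
  intro d
  induction d using Nat.strong_induction_on with
  | _ d ih =>
    intro E₁ _ _ _ S₁ hd
    by_cases h : OpSimple S₁
    · exact P E₁ S₁ h
    · simp only [OpSimple, not_forall, not_or] at h
      obtain ⟨U, hU, hb, ht⟩ := h
      obtain ⟨h1, h2⟩ := finrank_sub_lt hb ht
      rw [nullLen_tensor_left _ _ hU, nullLen_sub_add_quot hU, ih _ (hd ▸ h1) U _ rfl,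
        ih _ (hd ▸ h2) (E₁ ⧸ U) _ rfl, add_mul]

/-- The number of null factors is multiplicative for tensor products. -/
theorem nullLen_tensor (S₁ : Set (E₁ →ₗ[k] E₁)) (S₂ : Set (E₂ →ₗ[k] E₂)) :
    nullLen (tensorOps S₁ S₂) ⊥ ⊤ = nullLen S₁ ⊥ ⊤ * nullLen S₂ ⊥ ⊤ := by
  refine nullLen_tensor_aux S₂ (fun E₁ _ _ _ S₁ h1 => ?_) _ E₁ S₁ rfl
  rw [nullLen_tensor_comm, mul_comm]
  refine nullLen_tensor_aux S₁ (fun E₂ _ _ _ S₂ h2 => ?_) _ E₂ S₂ rfl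
  rw [nullLen_tensor_comm, mul_comm]
  exact nullLen_tensor_simple h1 h2

end NullTensor

/-! ### Multiplicities and homomorphisms seen through an idempotent -/

section Truncation
open Module
variable {k : Type*} [Field k] {B : Type*} [Ring B] [Algebra k B]
  {Δ : Type*} [AddCommGroup Δ] [Module k Δ] [Module B Δ] [IsScalarTower k B Δ]
  {M : Type*} [AddCommGroup M] [Module k M] [Module B M] [IsScalarTower k B M]

/-- The idempotent `f` is the primitive idempotent of the cyclic module `Δ = B v₀`: it projects `Δ` onto
the line of `v₀`, and `f B f` is the sum of `k f` and the span of a set `I` killing `v₀`. -/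
structure Cuts (f : B) (v₀ : Δ) (I : Set B) : Prop where
  idem : f * f = f
  fix : f • v₀ = v₀
  ne : v₀ ≠ 0
  gen : ∀ v : Δ, ∃ b : B, v = b • v₀
  line : ∀ v : Δ, ∃ a : k, f • v = a • v₀
  corner : ∀ b : B, ∃ a : k, f * b * f - a • f ∈ Submodule.span k I
  kill : ∀ i ∈ I, i • v₀ = 0
  left : ∀ i ∈ I, f * i = i
  right : ∀ i ∈ I, i * f = i

/-- The operators by which the elements of `I` act on a module. -/
def opsOf (k : Type*) [Field k] {B : Type*} [Ring B] [Algebra k B] (M : Type*) [AddCommGroup M]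
    [Module k M] [Module B M] [IsScalarTower k B M] (I : Set B) : Set (M →ₗ[k] M) :=
  (fun i => Algebra.lsmul k k M i) '' I

/-- The subspace `f N` of `M`. -/
def cutSub (k : Type*) [Field k] {B : Type*} [Ring B] [Algebra k B] {M : Type*} [AddCommGroup M]
    [Module k M] [Module B M] [IsScalarTower k B M] (f : B) (N : Submodule B M) :
    Submodule k M := (N.restrictScalars k).map (Algebra.lsmul k k M f)

theorem mem_cutSub {f : B} (hf : f * f = f) {N : Submodule B M} {x : M} :
    x ∈ cutSub k f N ↔ x ∈ N ∧ f • x = x := by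
  constructor
  · rintro ⟨y, hy, rfl⟩
    refine ⟨N.smul_mem f hy, ?_⟩
    change f • f • y = f • y
    rw [smul_smul, hf]
  · rintro ⟨h, h'⟩
    exact ⟨x, h, h'⟩

namespace Cuts
variable {f : B} {v₀ : Δ} {I : Set B}

theorem span_kill (h : Cuts (k := k) f v₀ I) {i : B} (hi : i ∈ Submodule.span k I) :
    i • v₀ = 0 := by
  induction hi using Submodule.span_induction with
  | mem x hx => exact h.kill x hx
  | zero => simp
  | add x y _ _ hx hy => rw [add_smul, hx, hy, add_zero]
  | smul a x _ hx => rw [smul_assoc, hx, smul_zero]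

/-- The radical of `Δ` is its largest submodule without `f`-part. -/
theorem mem_jacobson (h : Cuts (k := k) f v₀ I) (v : Δ) :
    v ∈ jacobson B Δ ↔ ∀ b : B, f • b • v = 0 := by
  have proper : ∀ N : Submodule B Δ, N ≠ ⊤ → ∀ v ∈ N, f • v = 0 := by
    intro N hN v hv
    obtain ⟨a, ha⟩ := h.line v
    by_cases h0 : a = 0
    · rw [ha, h0, zero_smul]
    · exfalso
      apply hN
      rw [eq_top_iff]
      intro w _
      obtain ⟨b, rfl⟩ := h.gen w
      apply N.smul_mem
      have h1 : f • v ∈ N := N.smul_mem f hv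
      rw [ha] at h1
      have h2 := N.smul_of_tower_mem a⁻¹ h1
      rwa [smul_smul, inv_mul_cancel₀ h0, one_smul] at h2
  let R : Submodule B Δ :=
    { carrier := {v | ∀ b : B, f • b • v = 0}
      add_mem' := fun hx hy b => by rw [smul_add, smul_add, hx b, hy b, add_zero]
      zero_mem' := fun b => by simp
      smul_mem' := fun c x hx b => by rw [smul_smul b]; exact hx _ }
  have hR : IsCoatom R := by
    constructor
    · intro e
      have : v₀ ∈ R := e ▸ Submodule.mem_top
      have := this 1
      rw [one_smul, h.fix] at this
      exact h.ne this
    · intro N hN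
      by_contra hne
      exact hN.not_ge fun v hv b => proper N hne _ (N.smul_mem b hv)
  have : jacobson B Δ = R := by
    apply le_antisymm (sInf_le (show R ∈ {m | IsCoatom m} from hR))
    refine le_sInf fun N hN => ?_
    have : N ≤ R := fun v hv b => proper N hN.1 _ (N.smul_mem b hv)
    rcases this.eq_or_lt with e | hlt
    · exact e.ge
    · exact absurd (hN.2 _ hlt) hR.1
  rw [this]
  rfl

/-- The head of `Δ` is simple, and its generator is not zero. -/
theorem head_facts (h : Cuts (k := k) f v₀ I) :
    IsSimpleModule B (head B Δ) ∧
      (Submodule.Quotient.mk v₀ : head B Δ) ≠ 0 := by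
  have hne : (Submodule.Quotient.mk v₀ : head B Δ) ≠ 0 := by
    rw [Ne, Submodule.Quotient.mk_eq_zero, h.mem_jacobson]
    intro e
    have := e 1
    rw [one_smul, h.fix] at this
    exact h.ne this
  refine ⟨isSimpleModule_iff_isCoatom.2 ⟨?_, ?_⟩, hne⟩
  · intro e
    apply hne
    rw [Submodule.Quotient.mk_eq_zero, e]
    trivial
  · intro N hN
    by_contra hne
    refine hN.not_ge fun v hv => ?_
    rw [h.mem_jacobson]
    intro b
    obtain ⟨a, ha⟩ := h.line (b • v)
    by_cases h0 : a = 0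
    · rw [ha, h0, zero_smul]
    · exfalso
      apply hne
      rw [eq_top_iff]
      intro w _
      obtain ⟨b', rfl⟩ := h.gen w
      apply N.smul_mem
      have h1 : f • b • v ∈ N := N.smul_mem f (N.smul_mem b hv)
      rw [ha] at h1
      have h2 := N.smul_of_tower_mem a⁻¹ h1
      rwa [smul_smul, inv_mul_cancel₀ h0, one_smul] at h2

/-- A simple module is the head of `Δ` as soon as its `f`-part has a vector killed by `I`: the two
generators then have the same annihilator. -/
theorem iso_head (h : Cuts (k := k) f v₀ I) {Q : Type*} [AddCommGroup Q] [Module k Q] [Module B Q]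
    [IsScalarTower k B Q] [IsSimpleModule B Q] {q : Q} (hq : q ≠ 0) (hfq : f • q = q)
    (hI : ∀ i ∈ I, i • q = 0) : Nonempty (Q ≃ₗ[B] head B Δ) := by
  obtain ⟨hs, hne⟩ := h.head_facts
  set l : head B Δ := Submodule.Quotient.mk v₀ with hl
  have hfl : f • l = l := by
    rw [hl, ← Submodule.Quotient.mk_smul, h.fix]
  have s1 : Function.Surjective (LinearMap.toSpanSingleton B Q q) :=
    IsSimpleModule.toSpanSingleton_surjective B hq
  have s2 : Function.Surjective (LinearMap.toSpanSingleton B (head B Δ) l) :=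
    IsSimpleModule.toSpanSingleton_surjective B hne
  have hI' : ∀ i ∈ Submodule.span k I, i • q = 0 := by
    intro i hi
    induction hi using Submodule.span_induction with
    | mem x hx => exact hI x hx
    | zero => simp
    | add x y _ _ hx hy => rw [add_smul, hx, hy, add_zero]
    | smul a x _ hx => rw [smul_assoc, hx, smul_zero]
  have hle : LinearMap.ker (LinearMap.toSpanSingleton B Q q) ≤
      LinearMap.ker (LinearMap.toSpanSingleton B (head B Δ) l) := by
    intro b hb
    simp only [LinearMap.mem_ker, LinearMap.toSpanSingleton_apply] at hb ⊢
    by_contra hbl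
    obtain ⟨b', hb'⟩ := IsSimpleModule.toSpanSingleton_surjective B hbl l
    simp only [LinearMap.toSpanSingleton_apply] at hb'
    obtain ⟨a, ha⟩ := h.corner (b' * b)
    obtain ⟨i, hi, e⟩ : ∃ i ∈ Submodule.span k I, f * (b' * b) * f = a • f + i :=
      ⟨_, ha, by abel⟩
    have e1 : (f * (b' * b) * f) • l = l := by
      rw [mul_smul, hfl, mul_smul, mul_smul, hb', hfl]
    have e2 : (f * (b' * b) * f) • q = 0 := by
      rw [mul_smul, hfq, mul_smul, mul_smul, hb, smul_zero, smul_zero]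
    rw [e, add_smul, smul_assoc, hfq, hI' i hi, add_zero] at e2
    have ha0 : a = 0 := (smul_eq_zero.1 e2).resolve_right hq
    have hil : i • l = 0 := by
      rw [hl, ← Submodule.Quotient.mk_smul, h.span_kill hi, Submodule.Quotient.mk_zero]
    rw [e, ha0, zero_smul, zero_add, hil] at e1
    exact hne e1.symm
  have hc : IsCoatom (LinearMap.ker (LinearMap.toSpanSingleton B Q q)) := by
    rw [← isSimpleModule_iff_isCoatom]
    exact IsSimpleModule.congr (LinearMap.quotKerEquivOfSurjective _ s1)
  have heq : LinearMap.ker (LinearMap.toSpanSingleton B Q q) =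
      LinearMap.ker (LinearMap.toSpanSingleton B (head B Δ) l) := by
    refine hle.eq_of_not_lt fun hlt => ?_
    have := hc.2 _ hlt
    have h1 : (1 : B) ∈ LinearMap.ker (LinearMap.toSpanSingleton B (head B Δ) l) := by
      rw [this]; trivial
    simp only [LinearMap.mem_ker, LinearMap.toSpanSingleton_apply, one_smul] at h1
    exact hne h1
  exact ⟨(LinearMap.quotKerEquivOfSurjective _ s1).symm.trans
    ((Submodule.quotEquivOfEq _ _ heq).trans (LinearMap.quotKerEquivOfSurjective _ s2))⟩

theorem cutSub_stab (h : Cuts (k := k) f v₀ I) (N : Submodule B M) :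
    Stab (opsOf k M I) (cutSub k f N) := by
  rintro _ ⟨i, hi, rfl⟩ x hx
  obtain ⟨h1, h2⟩ := (mem_cutSub h.idem).1 hx
  refine (mem_cutSub h.idem).2 ⟨N.smul_mem i h1, ?_⟩
  change f • i • x = i • x
  rw [smul_smul, h.left i hi]

theorem span_mem {Y : Submodule k M} (hY : Stab (opsOf k M I) Y) {i : B}
    (hi : i ∈ Submodule.span k I) {x : M} (hx : x ∈ Y) : i • x ∈ Y := by
  induction hi using Submodule.span_induction with
  | mem i h => exact hY _ ⟨i, h, rfl⟩ x hx
  | zero => rw [zero_smul]; exact Y.zero_mem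
  | add i j _ _ hi hj => rw [add_smul]; exact Y.add_mem hi hj
  | smul a i _ hi => rw [smul_assoc]; exact Y.smul_mem a hi

open Classical in
/-- In a step of a composition series the `f`-part has a null factor exactly if the factor is the head
of `Δ`. -/
theorem nullLen_step [FiniteDimensional k M] (h : Cuts (k := k) f v₀ I) {N N' : Submodule B M}
    (hN : N ⋖ N') :
    nullLen (opsOf k M I) (cutSub k f N) (cutSub k f N') =
      if Nonempty ((N' ⧸ N.comap N'.subtype) ≃ₗ[B] head B Δ) then 1 else 0 := by
  have hQ : IsSimpleModule B (N' ⧸ N.comap N'.subtype) := (covBy_iff_quot_is_simple hN.le).1 hN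
  have sN := h.cutSub_stab (M := M) N
  have sN' := h.cutSub_stab (M := M) N'
  have hle : cutSub k f N ≤ cutSub k f N' := Submodule.map_mono hN.le
  have memN : ∀ x, x ∈ cutSub k f N' → x ∈ N → x ∈ cutSub k f N := fun x hx hx' =>
    (mem_cutSub h.idem).2 ⟨hx', ((mem_cutSub h.idem).1 hx).2⟩
  obtain ⟨hs, hne⟩ := h.head_facts
  -- the vector in the quotient provided by an isomorphism with the head
  have back : Nonempty ((N' ⧸ N.comap N'.subtype) ≃ₗ[B] head B Δ) →
      ∃ y ∈ cutSub k f N', y ∉ N ∧ NullOn (opsOf k M I) (cutSub k f N) (cutSub k f N') := by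
    rintro ⟨e⟩
    obtain ⟨⟨n, hn⟩, hq⟩ := Submodule.Quotient.mk_surjective _
      (e.symm (Submodule.Quotient.mk v₀ : head B Δ))
    have hq0 : e (Submodule.Quotient.mk ⟨n, hn⟩) = (Submodule.Quotient.mk v₀ : head B Δ) := by
      rw [hq, e.apply_symm_apply]
    have inN : ∀ x (hx : x ∈ N'), e (Submodule.Quotient.mk ⟨x, hx⟩) = 0 → x ∈ N := by
      intro x hx h0
      rw [LinearEquiv.map_eq_zero_iff, Submodule.Quotient.mk_eq_zero] at h0
      exact h0
    refine ⟨f • n, ⟨n, hn, rfl⟩, ?_, ?_⟩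
    · intro hfn
      apply hne
      rw [← h.fix, Submodule.Quotient.mk_smul, ← hq0, ← map_smul, ← Submodule.Quotient.mk_smul,
        LinearEquiv.map_eq_zero_iff, Submodule.Quotient.mk_eq_zero]
      exact hfn
    · rintro _ ⟨i, hi, rfl⟩ y hy
      refine memN _ (sN' _ ⟨i, hi, rfl⟩ y hy) ?_
      obtain ⟨hy1, hy2⟩ := (mem_cutSub h.idem).1 hy
      refine inN (i • y) (N'.smul_mem i hy1) ?_
      obtain ⟨w, hw⟩ := Submodule.Quotient.mk_surjective _ (e (Submodule.Quotient.mk ⟨y, hy1⟩))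
      obtain ⟨a, ha⟩ := h.line w
      have e1 : e (Submodule.Quotient.mk ⟨i • y, N'.smul_mem i hy1⟩) =
          i • e (Submodule.Quotient.mk ⟨y, hy1⟩) := by
        rw [← map_smul, ← Submodule.Quotient.mk_smul]; rfl
      rw [e1, ← hw, ← Submodule.Quotient.mk_smul]
      have e2 : i • w = 0 := by
        rw [← h.right i hi, mul_smul, ha, ← algebraMap_smul B a v₀, smul_smul,
          ← Algebra.commutes, mul_smul, h.kill i hi, smul_zero]
      rw [e2, Submodule.Quotient.mk_zero]
  by_cases heq : cutSub k f N = cutSub k f N'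
  · rw [heq, nullLen_self sN', if_neg]
    intro hiso
    obtain ⟨y, hy, hyN, -⟩ := back hiso
    exact hyN ((mem_cutSub h.idem).1 (heq ▸ hy)).1
  obtain ⟨y₀, hy₀, hy₀N⟩ := SetLike.exists_of_lt (lt_of_le_of_ne hle heq)
  -- every vector of the larger cut is obtained from any vector outside the smaller one
  have key : ∀ y ∈ cutSub k f N', y ∉ cutSub k f N → ∀ y' ∈ cutSub k f N', ∃ a : k,
      ∃ i ∈ Submodule.span k I, y' - (a • y + i • y) ∈ cutSub k f N := by
    intro y hy hyN y' hy'
    obtain ⟨hy1, hy2⟩ := (mem_cutSub h.idem).1 hy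
    obtain ⟨hy1', hy2'⟩ := (mem_cutSub h.idem).1 hy'
    have hq : (Submodule.Quotient.mk ⟨y, hy1⟩ : N' ⧸ N.comap N'.subtype) ≠ 0 := by
      rw [Ne, Submodule.Quotient.mk_eq_zero]
      exact fun h' => hyN (memN y hy h')
    obtain ⟨b, hb⟩ := IsSimpleModule.toSpanSingleton_surjective B hq (Submodule.Quotient.mk ⟨y', hy1'⟩)
    rw [LinearMap.toSpanSingleton_apply, ← Submodule.Quotient.mk_smul, eq_comm,
      Submodule.Quotient.eq] at hb
    have hb' : y' - b • y ∈ N := hb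
    obtain ⟨a, ha⟩ := h.corner b
    refine ⟨a, _, ha, ⟨_, hb', ?_⟩⟩
    change f • (y' - b • y) = _
    rw [smul_sub, hy2', sub_smul, smul_assoc, hy2, add_sub_cancel, mul_smul, mul_smul, hy2]
  by_cases hn : NullOn (opsOf k M I) (cutSub k f N) (cutSub k f N')
  · have hnull : ∀ i ∈ Submodule.span k I, i • y₀ ∈ cutSub k f N := by
      intro i hi
      induction hi using Submodule.span_induction with
      | mem i h => exact hn _ ⟨i, h, rfl⟩ _ hy₀
      | zero => rw [zero_smul]; exact Submodule.zero_mem _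
      | add i j _ _ hi hj => rw [add_smul]; exact Submodule.add_mem _ hi hj
      | smul a i _ hi => rw [smul_assoc]; exact Submodule.smul_mem _ a hi
    rw [nullLen_of_null sN sN' hle hn, if_pos]
    · have hsup : cutSub k f N' = cutSub k f N ⊔ Submodule.span k {y₀} := by
        apply le_antisymm
        · intro y' hy'
          obtain ⟨a, i, hi, hm⟩ := key y₀ hy₀ hy₀N y' hy'
          have hin := hnull i hi
          have : y' = (y' - (a • y₀ + i • y₀) + i • y₀) + a • y₀ := by abel
          rw [this]
          exact Submodule.add_mem_sup (Submodule.add_mem _ hm hin)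
            (Submodule.smul_mem _ a (Submodule.mem_span_singleton_self _))
        · exact sup_le hle ((Submodule.span_singleton_le_iff_mem _ _).2 hy₀)
      have h1 : finrank k (cutSub k f N) < finrank k (cutSub k f N') :=
        Submodule.finrank_lt_finrank_of_lt (lt_of_le_of_ne hle heq)
      have h2 := Submodule.finrank_sup_add_finrank_inf_eq (cutSub k f N) (Submodule.span k {y₀})
      have h3 : finrank k (Submodule.span k {y₀}) = 1 :=
        finrank_span_singleton fun e => hy₀N (e ▸ Submodule.zero_mem _)
      rw [← hsup] at h2
      omega
    · obtain ⟨h1, h2⟩ := (mem_cutSub h.idem).1 hy₀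
      refine h.iso_head (q := Submodule.Quotient.mk ⟨y₀, h1⟩) ?_ ?_ ?_
      · rw [Ne, Submodule.Quotient.mk_eq_zero]
        exact fun h' => hy₀N (memN y₀ hy₀ h')
      · rw [← Submodule.Quotient.mk_smul]
        congr 1
        exact Subtype.ext h2
      · intro i hi
        rw [← Submodule.Quotient.mk_smul, Submodule.Quotient.mk_eq_zero]
        exact ((mem_cutSub h.idem).1 (hn _ ⟨i, hi, rfl⟩ _ hy₀)).1
  · rw [nullLen_of_not_null sN sN' hle _ hn, if_neg]
    · exact fun hiso => hn (back hiso).choose_spec.2.2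
    · intro Y hY h1 h2
      by_cases hYN : Y ≤ cutSub k f N
      · exact .inl (le_antisymm hYN h1)
      · right
        obtain ⟨y, hy, hyN⟩ := Set.not_subset.1 hYN
        refine le_antisymm h2 fun y' hy' => ?_
        obtain ⟨a, i, hi, hm⟩ := key y (h2 hy) hyN y' hy'
        have : y' = (y' - (a • y + i • y)) + (a • y + i • y) := by abel
        rw [this]
        exact Y.add_mem (h1 hm) (Y.add_mem (Y.smul_mem a hy) (span_mem hY hi hy))

/-- The multiplicity of the head of `Δ` in `M` is the number of null factors of `f M`. -/
theorem multiplicity_eq [FiniteDimensional k M] (h : Cuts (k := k) f v₀ I) :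
    multiplicity B M (head B Δ) =
      nullLen (opsOf k M I) ⊥ (LinearMap.range (Algebra.lsmul k k M f)) := by
  classical
  have hN : IsNoetherian B M := isNoetherian_of_tower k inferInstance
  have hA : IsArtinian B M := isArtinian_of_tower k inferInstance
  have hex := exists_compositionSeries_of_isNoetherian_isArtinian B M
  rw [multiplicity, dif_pos hex]
  obtain ⟨hb, ht⟩ := hex.choose_spec
  set s := hex.choose
  have mono : ∀ i j : Fin (s.length + 1), i ≤ j → s i ≤ s j := fun i j hij => s.strictMono.monotone hij
  have key : ∀ j (hj : j < s.length + 1), nullLen (opsOf k M I) ⊥ (cutSub k f (s ⟨j, hj⟩)) =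
      ∑ i : Fin s.length, if i.val < j ∧ Nonempty ((s i.succ ⧸ (s i.castSucc).comap
        (s i.succ).subtype) ≃ₗ[B] head B Δ) then 1 else 0 := by
    intro j
    induction j with
    | zero =>
      intro hj
      have : s ⟨0, hj⟩ = ⊥ := hb
      rw [this]
      simp only [Nat.not_lt_zero, false_and, if_false, Finset.sum_const_zero]
      have : cutSub k f (⊥ : Submodule B M) = ⊥ := by simp [cutSub]
      rw [this, nullLen_self (stab_bot _)]
    | succ j ih =>
      intro hj
      have hj' : j < s.length := by omega
      rw [nullLen_add (stab_bot _) (h.cutSub_stab _) (h.cutSub_stab _) bot_le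
        (Submodule.map_mono (mono ⟨j, by omega⟩ ⟨j + 1, hj⟩ (by simp))), ih (by omega)]
      have hstep := h.nullLen_step (s.step ⟨j, hj'⟩)
      have e1 : (⟨j, hj'⟩ : Fin s.length).castSucc = ⟨j, by omega⟩ := rfl
      have e2 : (⟨j, hj'⟩ : Fin s.length).succ = ⟨j + 1, hj⟩ := rfl
      rw [← e1, ← e2, hstep]
      rw [← Finset.add_sum_erase _ _ (Finset.mem_univ (⟨j, hj'⟩ : Fin s.length)),
        ← Finset.add_sum_erase (a := (⟨j, hj'⟩ : Fin s.length)) Finset.univ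
          (fun i : Fin s.length => if i.val < j + 1 ∧ _ then 1 else 0) (Finset.mem_univ _)]
      simp only [lt_irrefl, false_and, if_false, zero_add, Nat.lt_succ_self, true_and]
      rw [add_comm]
      congr 1
      refine Finset.sum_congr rfl fun i hi => ?_
      have : i.val ≠ j := fun e => (Finset.mem_erase.1 hi).1 (Fin.ext e)
      have : i.val < j ↔ i.val < j + 1 := by omega
      simp only [this]
  have hl := key s.length (by omega)
  have e3 : s ⟨s.length, by omega⟩ = ⊤ := ht
  rw [e3] at hl
  have e4 : cutSub k f (⊤ : Submodule B M) = LinearMap.range (Algebra.lsmul k k M f) := by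
    rw [cutSub, Submodule.restrictScalars_top, Submodule.map_top]
  rw [← e4, hl, Nat.card_eq_fintype_card, Fintype.card_subtype, Finset.card_filter]
  refine Finset.sum_congr rfl fun i _ => ?_
  simp [i.2]

/-- The vectors of `M` that a homomorphism from `Δ` can take as the image of `v₀`. -/
def homVecs (k : Type*) [Field k] {B : Type*} [Ring B] [Algebra k B] {Δ : Type*} [AddCommGroup Δ]
    [Module B Δ] (M : Type*) [AddCommGroup M]
    [Module k M] [Module B M] [IsScalarTower k B M] (v₀ : Δ) : Submodule k M where
  carrier := {w | ∀ b : B, b • v₀ = 0 → b • w = 0}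
  add_mem' := fun hx hy b hb => by rw [smul_add, hx b hb, hy b hb, add_zero]
  zero_mem' := fun b _ => smul_zero b
  smul_mem' := fun a x hx b hb => by rw [smul_comm, hx b hb, smul_zero]

/-- A homomorphism from the cyclic module `Δ` is determined by the image of the generator. -/
theorem hom_equiv (h : Cuts (k := k) f v₀ I) :
    Nonempty ((Δ →ₗ[B] M) ≃ₗ[k] homVecs k (B := B) M v₀) := by
  let φ : (Δ →ₗ[B] M) →ₗ[k] homVecs k (B := B) M v₀ :=
    { toFun := fun g => ⟨g v₀, fun b hb => by rw [← map_smul, hb, map_zero]⟩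
      map_add' := fun _ _ => rfl
      map_smul' := fun _ _ => rfl }
  refine ⟨LinearEquiv.ofBijective φ ⟨?_, ?_⟩⟩
  · intro g g' e
    have e' : g v₀ = g' v₀ := congrArg Subtype.val e
    ext v
    obtain ⟨b, rfl⟩ := h.gen v
    rw [map_smul, map_smul, e']
  · rintro ⟨w, hw⟩
    have s : Function.Surjective (LinearMap.toSpanSingleton B Δ v₀) := fun v => by
      obtain ⟨b, rfl⟩ := h.gen v; exact ⟨b, rfl⟩
    have hker : LinearMap.ker (LinearMap.toSpanSingleton B Δ v₀) ≤
        LinearMap.ker (LinearMap.toSpanSingleton B M w) := fun b hb => hw b hb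
    refine ⟨((LinearMap.ker (LinearMap.toSpanSingleton B Δ v₀)).liftQ _ hker).comp
      (LinearMap.quotKerEquivOfSurjective _ s).symm.toLinearMap, Subtype.ext ?_⟩
    change (Submodule.liftQ _ _ hker) ((LinearMap.quotKerEquivOfSurjective _ s).symm v₀) = w
    have : (LinearMap.quotKerEquivOfSurjective _ s).symm v₀ = Submodule.Quotient.mk 1 := by
      rw [LinearEquiv.symm_apply_eq]
      simp
    rw [this]
    simp

end Cuts
end Truncation

/-! ### Tableaux and Young symmetrizers -/

/-- A multitableau with entries in `A`: every entry is placed in a row and a column of one of the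
components, and the places that are taken in a component form a Young diagram. -/
structure Tab (m : ℕ) (A : Type*) where
  comp : A → ZMod m
  row : A → ℕ
  col : A → ℕ
  inj : ∀ a b, comp a = comp b → row a = row b → col a = col b → a = b
  lower : ∀ a i j, i ≤ row a → j ≤ col a → ∃ b, comp b = comp a ∧ row b = i ∧ col b = j

theorem perm_apply_inv {A : Type*} (g : Equiv.Perm A) (a : A) : g (g⁻¹ a) = a := g.apply_symm_apply a

/-- The permutations that preserve the values of `γ`. -/
def colourPerms {A C : Type*} (γ : A → C) : Subgroup (Equiv.Perm A) where
  carrier := {g | ∀ a, γ (g a) = γ a}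
  mul_mem' := fun {g h} hg hh a => by rw [Equiv.Perm.mul_apply, hg, hh]
  one_mem' := fun _ => rfl
  inv_mem' := fun {g} hg a => by
    have := hg (g⁻¹ a)
    rw [perm_apply_inv] at this
    exact this.symm

namespace Tab
variable {m : ℕ} {A : Type*} [Fintype A] [DecidableEq A] (t : Tab m A)

/-- The group of permutations of the entries within the components. -/
abbrev grp : Subgroup (Equiv.Perm A) := colourPerms t.comp

/-- `g` permutes the entries within the rows. -/
def RowPres (g : Equiv.Perm A) : Prop := ∀ a, t.comp (g a) = t.comp a ∧ t.row (g a) = t.row a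

/-- `g` permutes the entries within the columns. -/
def ColPres (g : Equiv.Perm A) : Prop := ∀ a, t.comp (g a) = t.comp a ∧ t.col (g a) = t.col a

open Finset in
/-- If no two entries lie in one row and are moved by `h` into one column, then the row of an entry and
the column of its image under `h` are those of some entry.  Among the `0`-`1`-matrices with the
row and column sums of a Young diagram there is only the diagram: the number of entries that
column `j` has in the rows above `i` is at most its number in the diagram, and the totals agree. -/
theorem exists_place {h : Equiv.Perm A} (hh : h ∈ t.grp)
    (hrc : ∀ a b, t.comp a = t.comp b → t.row a = t.row b → t.col (h a) = t.col (h b) → a = b)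
    (v : A) : ∃ b, t.comp b = t.comp v ∧ t.row b = t.row v ∧ t.col b = t.col (h v) := by
  have hh' : ∀ a, t.comp (h a) = t.comp a := hh
  let above (i : ℕ) : Finset A := univ.filter fun a => t.comp a = t.comp v ∧ t.row a < i
  let a (i j : ℕ) := #((above i).filter fun a => t.col (h a) = j)
  let b (i j : ℕ) := #((above i).filter fun a => t.col a = j)
  have hle : ∀ i j, a i j ≤ b i j := by
    intro i j
    by_cases hex : ∃ c, t.comp c = t.comp v ∧ t.col c = j ∧ i ≤ t.row c
    · obtain ⟨c, hc, rfl, hi⟩ := hex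
      have h1 : a i (t.col c) ≤ i := by
        have := card_le_card_of_injOn (s := (above i).filter fun a => t.col (h a) = t.col c)
          (t := range i) t.row (by
            intro x hx
            simp only [above, coe_filter, mem_filter, mem_univ, true_and, Set.mem_ofPred_eq] at hx
            simpa using hx.1.2)
          (by
            intro x hx y hy hxy
            simp only [above, coe_filter, mem_filter, mem_univ, true_and, Set.mem_ofPred_eq] at hx hy
            exact hrc x y (hx.1.1.trans hy.1.1.symm) hxy (hx.2.trans hy.2.symm))
        simpa using this
      have h2 : i ≤ b i (t.col c) := by
        choose f hf1 hf2 hf3 using fun i' : Fin i =>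
          t.lower c i' (t.col c) (by omega) le_rfl
        have := card_le_card_of_injOn (s := (univ : Finset (Fin i)))
          (t := (above i).filter fun a => t.col a = t.col c) f (by
            intro x _
            simp only [above, coe_filter, mem_filter, mem_univ, true_and, Set.mem_ofPred_eq]
            refine ⟨⟨by rw [hf1, hc], by rw [hf2]; exact x.2⟩, hf3 x⟩)
          (by
            intro x _ y _ hxy
            apply Fin.ext
            rw [← hf2 x, ← hf2 y, hxy])
        simpa using this
      exact h1.trans h2
    · push Not at hex
      refine card_le_card_of_injOn h (fun x hx => ?_) h.injective.injOn
      simp only [above, coe_filter, mem_filter, mem_univ, true_and, Set.mem_ofPred_eq] at hx ⊢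
      have := hex (h x) ((hh' x).trans hx.1.1) hx.2
      exact ⟨⟨(hh' x).trans hx.1.1, this⟩, hx.2⟩
  let J : Finset ℕ := univ.image t.col
  have hJ : ∀ x : A, t.col x ∈ J := fun x => mem_image_of_mem _ (mem_univ _)
  have heq : ∀ i j, a i j = b i j := by
    intro i j
    by_cases hj : j ∈ J
    · have e1 : #(above i) = ∑ j ∈ J, a i j :=
        card_eq_sum_card_fiberwise (fun x _ => hJ (h x))
      have e2 : #(above i) = ∑ j ∈ J, b i j := card_eq_sum_card_fiberwise (fun x _ => hJ x)
      exact (sum_eq_sum_iff_of_le fun j _ => hle i j).1 (e1.symm.trans e2) j hj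
    · have z : b i j = 0 := by
        rw [card_eq_zero, filter_eq_empty_iff]
        rintro x _ rfl
        exact hj (hJ x)
      have := hle i j
      omega
  have add : ∀ (f : A → ℕ) j, #((above (t.row v + 1)).filter fun a => f a = j) =
      #((above (t.row v)).filter fun a => f a = j) +
        #(univ.filter fun a => (t.comp a = t.comp v ∧ t.row a = t.row v) ∧ f a = j) := by
    intro f j
    rw [← card_union_of_disjoint]
    · congr 1
      ext x
      simp only [above, mem_filter, mem_univ, true_and, mem_union]
      constructor
      · rintro ⟨⟨h1, h2⟩, h3⟩
        rcases Nat.lt_succ_iff_lt_or_eq.1 h2 with h2 | h2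
        · exact .inl ⟨⟨h1, h2⟩, h3⟩
        · exact .inr ⟨⟨h1, h2⟩, h3⟩
      · rintro (⟨⟨h1, h2⟩, h3⟩ | ⟨⟨h1, h2⟩, h3⟩)
        · exact ⟨⟨h1, by omega⟩, h3⟩
        · exact ⟨⟨h1, by omega⟩, h3⟩
    · rw [disjoint_left]
      intro x hx hy
      simp only [above, mem_filter, mem_univ, true_and] at hx hy
      omega
  have e1 := add (fun x => t.col (h x)) (t.col (h v))
  have e2 := add t.col (t.col (h v))
  have e3 := heq (t.row v + 1) (t.col (h v))
  have e4 := heq (t.row v) (t.col (h v))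
  simp only [a, b] at e3 e4
  have hpos : 0 < #(univ.filter fun a => (t.comp a = t.comp v ∧ t.row a = t.row v) ∧
      t.col (h a) = t.col (h v)) := card_pos.2 ⟨v, by simp⟩
  have : 0 < #(univ.filter fun a => (t.comp a = t.comp v ∧ t.row a = t.row v) ∧
      t.col a = t.col (h v)) := by omega
  obtain ⟨b, hb⟩ := card_pos.1 this
  simp only [mem_filter, mem_univ, true_and] at hb
  exact ⟨b, hb.1.1, hb.1.2, hb.2⟩

/-- A permutation that moves no two entries of one row into one column is the product of a column
permutation and a row permutation. -/
theorem exists_col_mul_row {h : Equiv.Perm A} (hh : h ∈ t.grp)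
    (hrc : ∀ a b, t.comp a = t.comp b → t.row a = t.row b → t.col (h a) = t.col (h b) → a = b) :
    ∃ c r : Equiv.Perm A, t.ColPres c ∧ t.RowPres r ∧ h = c * r := by
  choose f hf1 hf2 hf3 using t.exists_place hh hrc
  have hinj : Function.Injective f := by
    intro x y hxy
    refine hrc x y ?_ ?_ ?_
    · rw [← hf1 x, ← hf1 y, hxy]
    · rw [← hf2 x, ← hf2 y, hxy]
    · rw [← hf3 x, ← hf3 y, hxy]
  let r : Equiv.Perm A := Equiv.ofBijective f (Finite.injective_iff_bijective.1 hinj)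
  refine ⟨h * r⁻¹, r, fun a => ?_, fun a => ⟨hf1 a, hf2 a⟩, by simp⟩
  obtain ⟨v, rfl⟩ := r.surjective a
  have e : (h * r⁻¹) (r v) = h v := by simp
  rw [e]
  exact ⟨(hh v).trans (hf1 v).symm, (hf3 v).symm⟩

section Alg
variable (k : Type*) [Field k]
open Classical in
/-- The signed sum of the column permutations. -/
noncomputable def kappa : MonoidAlgebra k t.grp :=
  ∑ g : t.grp with t.ColPres g.1, (Equiv.Perm.sign g.1 : ℤ) • MonoidAlgebra.of k t.grp g

open Classical in
/-- The sum of the row permutations. -/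
noncomputable def rho : MonoidAlgebra k t.grp :=
  ∑ g : t.grp with t.RowPres g.1, MonoidAlgebra.of k t.grp g

/-- The Young symmetrizer. -/
noncomputable def symm : MonoidAlgebra k t.grp := t.kappa k * t.rho k

theorem kappa_mul_of {g : t.grp} (hg : t.ColPres g.1) :
    t.kappa k * MonoidAlgebra.of k t.grp g = (Equiv.Perm.sign g.1 : ℤ) • t.kappa k := by
  classical
  rw [kappa, Finset.sum_mul, Finset.smul_sum]
  refine Finset.sum_bij' (fun x _ => x * g) (fun x _ => x * g⁻¹) ?_ ?_ ?_ ?_ ?_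
  · intro x hx
    simp only [Finset.mem_filter, Finset.mem_univ, true_and] at hx ⊢
    intro a
    have h1 := hx (g.1 a)
    have h2 := hg a
    exact ⟨h1.1.trans h2.1, h1.2.trans h2.2⟩
  · intro x hx
    simp only [Finset.mem_filter, Finset.mem_univ, true_and] at hx ⊢
    intro a
    have h1 := hx (g.1⁻¹ a)
    have h2 := hg (g.1⁻¹ a)
    rw [perm_apply_inv] at h2
    exact ⟨h1.1.trans h2.1.symm, h1.2.trans h2.2.symm⟩
  · intro x _; simp
  · intro x _; simp
  · intro x _
    rw [map_mul, smul_mul_assoc, smul_smul]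
    congr 1
    rw [Subgroup.coe_mul, Equiv.Perm.sign_mul, mul_comm, Units.val_mul, mul_assoc,
      Int.units_coe_mul_self, mul_one]

theorem of_mul_rho {g : t.grp} (hg : t.RowPres g.1) :
    MonoidAlgebra.of k t.grp g * t.rho k = t.rho k := by
  classical
  rw [rho, Finset.mul_sum]
  refine Finset.sum_bij' (fun x _ => g * x) (fun x _ => g⁻¹ * x) ?_ ?_ ?_ ?_ ?_
  · intro x hx
    simp only [Finset.mem_filter, Finset.mem_univ, true_and] at hx ⊢
    intro a
    have h1 := hx a
    have h2 := hg (x.1 a)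
    exact ⟨h2.1.trans h1.1, h2.2.trans h1.2⟩
  · intro x hx
    simp only [Finset.mem_filter, Finset.mem_univ, true_and] at hx ⊢
    intro a
    have h1 := hx a
    have h2 := hg (g.1⁻¹ (x.1 a))
    rw [perm_apply_inv] at h2
    exact ⟨h2.1.symm.trans h1.1, h2.2.symm.trans h1.2⟩
  · intro x _; simp
  · intro x _; simp
  · intro x _
    rw [map_mul]

/-- Von Neumann's lemma: `κ h ρ` is a multiple of `κ ρ`. -/
theorem kappa_of_rho (h2 : Nontrivial A → (2 : k) ≠ 0) (h : t.grp) :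
    ∃ ε : k, t.kappa k * MonoidAlgebra.of k t.grp h * t.rho k = ε • t.symm k := by
  by_cases hrc : ∀ a b, t.comp a = t.comp b → t.row a = t.row b →
      t.col (h.1 a) = t.col (h.1 b) → a = b
  · obtain ⟨c, r, hc, hr, e⟩ := t.exists_col_mul_row h.2 hrc
    have e' : h = (⟨c, fun a => (hc a).1⟩ : t.grp) * ⟨r, fun a => (hr a).1⟩ := Subtype.ext e
    refine ⟨((Equiv.Perm.sign c : ℤ) : k), ?_⟩
    rw [e', map_mul, ← mul_assoc, t.kappa_mul_of k hc, mul_assoc, t.of_mul_rho k hr, symm,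
      smul_mul_assoc, Int.cast_smul_eq_zsmul]
  · push Not at hrc
    obtain ⟨a, b, h1, h3, h4, hne⟩ := hrc
    refine ⟨0, ?_⟩
    have hsw : t.RowPres (Equiv.swap a b) := by
      intro x
      by_cases hxa : x = a
      · subst hxa; simp [h1, h3]
      · by_cases hxb : x = b
        · subst hxb; simp [h1, h3]
        · simp [Equiv.swap_apply_of_ne_of_ne hxa hxb]
    have hsw' : t.ColPres (Equiv.swap (h.1 a) (h.1 b)) := by
      have h1' : t.comp (h.1 a) = t.comp (h.1 b) := by rw [h.2 a, h.2 b, h1]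
      intro x
      by_cases hxa : x = h.1 a
      · subst hxa; simp [h1', h4]
      · by_cases hxb : x = h.1 b
        · subst hxb; simp [h1', h4]
        · simp [Equiv.swap_apply_of_ne_of_ne hxa hxb]
    have e : h * (⟨Equiv.swap a b, fun a => (hsw a).1⟩ : t.grp) =
        (⟨Equiv.swap (h.1 a) (h.1 b), fun a => (hsw' a).1⟩ : t.grp) * h := by
      apply Subtype.ext
      change h.1 * Equiv.swap a b = Equiv.swap (h.1 a) (h.1 b) * h.1
      rw [Equiv.swap_apply_apply]
      simp
    have e2 : t.kappa k * MonoidAlgebra.of k t.grp h * t.rho k =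
        -(t.kappa k * MonoidAlgebra.of k t.grp h * t.rho k) := by
      conv_lhs => rw [← t.of_mul_rho k (g := ⟨Equiv.swap a b, fun a => (hsw a).1⟩) hsw,
        ← mul_assoc, mul_assoc (t.kappa k), ← map_mul, e, map_mul, ← mul_assoc,
        t.kappa_mul_of k hsw']
      rw [Equiv.Perm.sign_swap (fun h' => hne (h.1.injective h'))]
      simp
    have e3 : (2 : k) • (t.kappa k * MonoidAlgebra.of k t.grp h * t.rho k) = 0 := by
      rw [two_smul]
      nth_rewrite 1 [e2]
      simp
    rw [zero_smul]
    exact (smul_eq_zero.1 e3).resolve_left (h2 ⟨a, b, hne⟩)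

theorem kappa_mul_mul_rho (h2 : Nontrivial A → (2 : k) ≠ 0) (y : MonoidAlgebra k t.grp) :
    ∃ ε : k, t.kappa k * y * t.rho k = ε • t.symm k := by
  induction y using MonoidAlgebra.induction_on with
  | of g => exact t.kappa_of_rho k h2 g
  | add x y hx hy =>
    obtain ⟨a, ha⟩ := hx
    obtain ⟨b, hb⟩ := hy
    exact ⟨a + b, by rw [mul_add, add_mul, ha, hb, add_smul]⟩
  | smul r x hx =>
    obtain ⟨a, ha⟩ := hx
    exact ⟨r * a, by rw [mul_smul_comm, smul_mul_assoc, ha, smul_smul]⟩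

theorem symm_mul_mul_symm (h2 : Nontrivial A → (2 : k) ≠ 0) (y : MonoidAlgebra k t.grp) :
    ∃ ε : k, t.symm k * y * t.symm k = ε • t.symm k := by
  obtain ⟨ε, h⟩ := t.kappa_mul_mul_rho k h2 (t.rho k * y * t.kappa k)
  refine ⟨ε, ?_⟩
  rw [← h, symm]
  simp only [mul_assoc]

theorem two_ne_zero_of_factorial {k : Type*} [Field k] (hk : ((Fintype.card A).factorial : k) ≠ 0) :
    Nontrivial A → (2 : k) ≠ 0 := by
  intro hA h
  apply hk
  have h1 : 2 ≤ Fintype.card A := Fintype.one_lt_card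
  obtain ⟨c, hc⟩ := Nat.dvd_factorial (by omega : 0 < 2) h1
  rw [hc]
  push_cast
  rw [h, zero_mul]

/-- The Young symmetrizer is not nilpotent: its trace in the regular representation is the order of the
group. -/
theorem symm_sq_ne_zero (hk : ((Fintype.card A).factorial : k) ≠ 0) :
    t.symm k * t.symm k ≠ 0 := by
  classical
  intro hc
  let P : t.grp →* ((t.grp → k) →ₗ[k] (t.grp → k)) :=
    { toFun := fun g => LinearMap.funLeft k k (fun x => g⁻¹ * x)
      map_one' := by ext; simp [LinearMap.funLeft]
      map_mul' := fun g h => by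
        refine LinearMap.ext fun φ => funext fun x => ?_
        simp [LinearMap.funLeft, mul_assoc] }
  have tr : ∀ g, LinearMap.trace k _ (P g) = if g = 1 then (Fintype.card t.grp : k) else 0 := by
    intro g
    rw [LinearMap.trace_eq_matrix_trace k (Pi.basisFun k t.grp), Matrix.trace]
    have : ∀ x, (LinearMap.toMatrix (Pi.basisFun k t.grp) (Pi.basisFun k t.grp) (P g)).diag x =
        if g = 1 then 1 else 0 := by
      intro x
      simp only [Matrix.diag_apply, LinearMap.toMatrix_apply, Pi.basisFun_apply, Pi.basisFun_repr]
      change (Pi.single x (1 : k) : t.grp → k) (g⁻¹ * x) = _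
      rw [Pi.single_apply]
      simp
    simp only [this]
    split_ifs <;> simp
  let Ψ : MonoidAlgebra k t.grp →ₐ[k] ((t.grp → k) →ₗ[k] (t.grp → k)) :=
    MonoidAlgebra.lift k _ _ P
  have hnil : IsNilpotent (Ψ (t.symm k)) := ⟨2, by rw [pow_two, ← map_mul, hc, map_zero]⟩
  have h0 := (LinearMap.isNilpotent_trace_of_isNilpotent hnil).eq_zero
  have hs : t.symm k = ∑ c : t.grp with t.ColPres c.1, ∑ r : t.grp with t.RowPres r.1,
      (Equiv.Perm.sign c.1 : ℤ) • MonoidAlgebra.of k t.grp (c * r) := by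
    rw [symm, kappa, rho, Finset.sum_mul_sum]
    simp only [map_mul, smul_mul_assoc]
  have hΨ : ∀ g, Ψ (MonoidAlgebra.of k t.grp g) = P g := fun g => MonoidAlgebra.lift_of _ _
  have key : LinearMap.trace k _ (Ψ (t.symm k)) = (Fintype.card t.grp : k) := by
    rw [hs]
    simp only [map_sum, map_zsmul, hΨ, tr]
    rw [Finset.sum_eq_single 1, Finset.sum_eq_single 1]
    · simp
    · intro r _ hr; simp [hr]
    · intro h; exact absurd (Finset.mem_filter.2 ⟨Finset.mem_univ _, fun _ => ⟨rfl, rfl⟩⟩) h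
    · intro c hc hc1
      refine Finset.sum_eq_zero fun r hr => ?_
      simp only [Finset.mem_filter, Finset.mem_univ, true_and] at hc hr
      rw [if_neg, smul_zero]
      intro hcr
      apply hc1
      have : r = c⁻¹ := eq_inv_of_mul_eq_one_right hcr
      apply Subtype.ext
      ext a
      have e : r.1 (c.1 a) = a := by rw [this]; simp
      have e1 := hr (c.1 a)
      rw [e] at e1
      exact t.inj _ _ (hc a).1 e1.2.symm (hc a).2
    · intro h; exact absurd (Finset.mem_filter.2 ⟨Finset.mem_univ _, fun _ => ⟨rfl, rfl⟩⟩) h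
  rw [key] at h0
  have hdvd : Fintype.card t.grp ∣ (Fintype.card A).factorial := by
    rw [← Fintype.card_perm, ← Nat.card_eq_fintype_card, ← Nat.card_eq_fintype_card]
    exact Subgroup.card_subgroup_dvd_card t.grp
  obtain ⟨d, hd⟩ := hdvd
  apply hk
  rw [hd]
  push_cast
  rw [h0, zero_mul]

theorem symm_sq (hk : ((Fintype.card A).factorial : k) ≠ 0) :
    ∃ c : k, c ≠ 0 ∧ t.symm k * t.symm k = c • t.symm k := by
  obtain ⟨c, hc⟩ := t.symm_mul_mul_symm k (two_ne_zero_of_factorial hk) 1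
  rw [mul_one] at hc
  refine ⟨c, ?_, hc⟩
  rintro rfl
  exact t.symm_sq_ne_zero k hk (by rw [hc, zero_smul])

end Alg
end Tab

/-! ### Concatenation of diagrams on arbitrary sets of nodes -/

/-- Transport of a diagram along a bijection of the nodes. -/
def Diagram.map {m : ℕ} {N N' : Type} (e : N ≃ N') (d : Diagram m N) : Diagram m N' where
  mate v := e (d.mate (e.symm v))
  lab v := d.lab (e.symm v)
  mate_mate v := by simp [d.mate_mate]
  mate_ne v h := d.mate_ne (e.symm v) (e.injective (by simpa using h))
  lab_mate v := by simp [d.lab_mate]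

theorem Diagram.map_map {m : ℕ} {N N' N'' : Type} (e : N ≃ N') (e' : N' ≃ N'') (d : Diagram m N) :
    (d.map e).map e' = d.map (e.trans e') := by
  ext v <;> rfl

theorem Diagram.map_refl {m : ℕ} {N : Type} (d : Diagram m N) : d.map (Equiv.refl N) = d := rfl

theorem Diagram.map_injective {m : ℕ} {N N' : Type} (e : N ≃ N') :
    Function.Injective (Diagram.map (m := m) e) := by
  intro d d' h
  have : (d.map e).map e.symm = (d'.map e).map e.symm := by rw [h]
  simpa [Diagram.map_map, Diagram.map_refl] using this

/-- A list of all elements of a finite type, without repetitions. -/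
def Enum (B : Type) : Type := {L : List B // L.Nodup ∧ ∀ b, b ∈ L}

/-- An arbitrary enumeration. -/
noncomputable def Enum.univ (B : Type) [Fintype B] : Enum B :=
  ⟨Finset.univ.toList, Finset.nodup_toList _, fun b => by simp⟩

/-- The enumeration in increasing order, which is used in the definition of the product of diagrams. -/
def Enum.fin (n : ℕ) : Enum (Fin n) := ⟨List.finRange n, List.nodup_finRange n, List.mem_finRange⟩

/-- Transport of an enumeration. -/
def Enum.map {B B' : Type} (e : B ≃ B') (L : Enum B) : Enum B' :=
  ⟨L.1.map e, L.2.1.map e.injective, fun b => List.mem_map.2 ⟨e.symm b, L.2.2 _, by simp⟩⟩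

theorem Enum.perm {B : Type} [DecidableEq B] (L L' : Enum B) : L.1.Perm L'.1 := by
  rw [List.perm_ext_iff_of_nodup L.2.1 L'.2.1]
  exact fun b => ⟨fun _ => L'.2.2 b, fun _ => L.2.2 b⟩

/-- The nodes of a concatenation, before the central nodes are identified. -/
abbrev Mid (A B C : Type) : Type := (A ⊕ B) ⊕ (B ⊕ C)

section General
variable {k : Type*} [Field k] {m : ℕ} {A B C A' B' C' : Type}
  [DecidableEq A] [DecidableEq B] [DecidableEq C] [DecidableEq A'] [DecidableEq B'] [DecidableEq C']

/-- `x` drawn above `y`. -/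
def gjoin (k : Type*) [Field k] {m : ℕ} {A B C : Type} (x : Diagram m (A ⊕ B))
    (y : Diagram m (B ⊕ C)) : GlueState k m (Mid A B C) where
  mate := Sum.map x.mate y.mate
  lab := Sum.elim x.lab y.lab
  wt := 1

/-- Glue the central nodes in the list `L`; the parameters may depend on the node. -/
def gl (δ : B → ZMod m → k) (L : List B) (s : GlueState k m (Mid A B C)) :
    GlueState k m (Mid A B C) :=
  L.foldr (fun b t => glue (δ b) (.inl (.inr b)) (.inr (.inl b)) t) s

theorem gl_cons (δ : B → ZMod m → k) (b : B) (L : List B) (s : GlueState k m (Mid A B C)) :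
    gl δ (b :: L) s = glue (δ b) (.inl (.inr b)) (.inr (.inl b)) (gl δ L s) := rfl

theorem gl_append (δ : B → ZMod m → k) (L L' : List B) (s : GlueState k m (Mid A B C)) :
    gl δ (L ++ L') s = gl δ L (gl δ L' s) := by
  simp [gl]

/-- The nodes of the product, as nodes of the concatenation. -/
def gouter : A ⊕ C → Mid A B C := Sum.map Sum.inl Sum.inr

theorem gouter_injective : Function.Injective (gouter : A ⊕ C → Mid A B C) :=
  Sum.inl_injective.sumMap Sum.inr_injective

theorem gouter_ne (b : B) (v : A ⊕ C) :
    (gouter v : Mid A B C) ≠ .inl (.inr b) ∧ (gouter v : Mid A B C) ≠ .inr (.inl b) := by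
  rcases v with v | v <;> simp [gouter]

/-- Partial inverse of `gouter`, with a default value on the central nodes. -/
def gback (o : A ⊕ C) : Mid A B C → A ⊕ C
  | .inl (.inl i) => .inl i
  | .inl (.inr _) => o
  | .inr (.inl _) => o
  | .inr (.inr j) => .inr j

theorem gjoin_good (x : Diagram m (A ⊕ B)) (y : Diagram m (B ⊕ C)) : (gjoin k x y).Good := by
  constructor
  · rintro (v | v) <;> simp [gjoin, x.mate_mate, y.mate_mate]
  · rintro (v | v) <;> simp [gjoin, x.lab_mate, y.lab_mate]

theorem gjoin_alive (x : Diagram m (A ⊕ B)) (y : Diagram m (B ⊕ C)) :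
    ∀ v, (gjoin k x y).mate v ≠ v := by
  rintro (v | v) <;> simp [gjoin, x.mate_ne, y.mate_ne]

/-- The central nodes in `L` can be glued. -/
structure GReady (L : List B) (s : GlueState k m (Mid A B C)) : Prop where
  good : s.Good
  nodup : L.Nodup
  alive : ∀ b ∈ L, s.mate (.inl (.inr b)) ≠ .inl (.inr b) ∧ s.mate (.inr (.inl b)) ≠ .inr (.inl b)

theorem gjoin_ready (x : Diagram m (A ⊕ B)) (y : Diagram m (B ⊕ C)) {L : List B} (h : L.Nodup) :
    GReady L (gjoin k x y) :=
  ⟨gjoin_good x y, h, fun _ _ => ⟨gjoin_alive x y _, gjoin_alive x y _⟩⟩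

theorem GReady.tail {b : B} {L : List B} {s : GlueState k m (Mid A B C)} (h : GReady (b :: L) s) :
    GReady L s :=
  ⟨h.good, (List.nodup_cons.1 h.nodup).2, fun c hc => h.alive c (List.mem_cons_of_mem _ hc)⟩

/-- Glueing the nodes in `L` removes these nodes, represented by fixed points of `mate`, and no others. -/
theorem gl_spec (δ : B → ZMod m → k) (L : List B) (s : GlueState k m (Mid A B C))
    (h : GReady L s) :
    (gl δ L s).Good ∧
    (∀ v, s.mate v ≠ v → (∀ b ∈ L, v ≠ .inl (.inr b) ∧ v ≠ .inr (.inl b)) →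
      (gl δ L s).mate v ≠ v) ∧
    (∀ b ∈ L, (gl δ L s).mate (.inl (.inr b)) = .inl (.inr b) ∧
      (gl δ L s).mate (.inr (.inl b)) = .inr (.inl b)) := by
  induction L with
  | nil => exact ⟨h.good, fun v hv _ => hv, by simp⟩
  | cons b L ih =>
    obtain ⟨i1, i2, i3⟩ := ih h.tail
    have hb := (List.nodup_cons.1 h.nodup).1
    have hal := h.alive b (by simp)
    have hne : ∀ c ∈ L, b ≠ c := by rintro c hc rfl; exact hb hc
    have q1 := i2 (.inl (.inr b)) hal.1 (fun c hc => by simp [hne c hc])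
    have q2 := i2 (.inr (.inl b)) hal.2 (fun c hc => by simp [hne c hc])
    rw [gl_cons]
    refine ⟨glue_good _ i1 (by simp) q1 q2, ?_, ?_⟩
    · intro v hv hvL
      have hve := hvL b (by simp)
      exact glue_alive _ i1 (by simp) (i2 v hv fun c hc => hvL c (by simp [hc])) hve.1 hve.2
    · intro c hc
      rcases List.mem_cons.1 hc with rfl | hc
      · exact glue_erased _
      · exact ⟨glue_erased' _ (i3 c hc).1 q1 q2, glue_erased' _ (i3 c hc).2 q1 q2⟩

/-- After all central nodes have been glued, the strands from outer nodes end in outer nodes. -/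
theorem gl_outer (δ : B → ZMod m → k) (L : Enum B) (x : Diagram m (A ⊕ B)) (y : Diagram m (B ⊕ C))
    (o : A ⊕ C) : (gl δ L.1 (gjoin k x y)).mate (gouter o) ≠ gouter o ∧
      ∀ o', gouter (gback o' ((gl δ L.1 (gjoin k x y)).mate (gouter o))) =
        (gl δ L.1 (gjoin k x y)).mate (gouter o) := by
  obtain ⟨h1, h2, h3⟩ := gl_spec δ L.1 _ (gjoin_ready (k := k) x y L.2.1)
  have h0 := h2 (gouter o) (gjoin_alive x y _) fun b _ => gouter_ne b o
  refine ⟨h0, fun o' => ?_⟩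
  have h4 := h1.mate_mate (gouter o)
  rcases hw : (gl δ L.1 (gjoin k x y)).mate (gouter o) with (i | i) | (i | i)
  · rfl
  · exfalso
    rw [hw, (h3 i (L.2.2 i)).1, ← hw] at h4
    exact h0 h4
  · exfalso
    rw [hw, (h3 i (L.2.2 i)).2, ← hw] at h4
    exact h0 h4
  · rfl

/-- The reduced diagram of the concatenation of `x` above `y`. -/
def gcomp (δ : B → ZMod m → k) (L : Enum B) (x : Diagram m (A ⊕ B)) (y : Diagram m (B ⊕ C)) :
    Diagram m (A ⊕ C) where
  mate o := gback o ((gl δ L.1 (gjoin k x y)).mate (gouter o))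
  lab o := (gl δ L.1 (gjoin k x y)).lab (gouter o)
  mate_mate o := by
    apply gouter_injective (B := B)
    rw [(gl_outer δ L x y _).2, (gl_outer δ L x y _).2]
    exact (gl_spec δ L.1 _ (gjoin_ready (k := k) x y L.2.1)).1.mate_mate _
  mate_ne o h := by
    apply (gl_outer δ L x y o).1
    rw [← (gl_outer δ L x y o).2 o, h]
  lab_mate o := by
    rw [(gl_outer δ L x y _).2]
    exact (gl_spec δ L.1 _ (gjoin_ready (k := k) x y L.2.1)).1.lab_mate _

/-- The product of the parameters of the closed loops. -/
def gwt (δ : B → ZMod m → k) (L : Enum B) (x : Diagram m (A ⊕ B)) (y : Diagram m (B ⊕ C)) : k :=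
  (gl δ L.1 (gjoin k x y)).wt

theorem gcomp_emb (δ : B → ZMod m → k) (L : Enum B) (x : Diagram m (A ⊕ B))
    (y : Diagram m (B ⊕ C)) :
    Emb gouter (gwt δ L x y) ((gcomp δ L x y).toState k) (gl δ L.1 (gjoin k x y)) :=
  ⟨fun v => ((gl_outer δ L x y v).2 v).symm, fun _ => rfl, (mul_one _).symm⟩

/-- A diagram that embeds into the glued state is the concatenation. -/
theorem gcomp_unique {δ : B → ZMod m → k} {L : Enum B} {x : Diagram m (A ⊕ B)}
    {y : Diagram m (B ⊕ C)} {z : Diagram m (A ⊕ C)} {w : k}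
    (h : Emb gouter w (z.toState k) (gl δ L.1 (gjoin k x y))) :
    gcomp δ L x y = z ∧ gwt δ L x y = w := by
  have e := gcomp_emb δ L x y
  refine ⟨?_, ?_⟩
  · ext v
    · apply gouter_injective (B := B)
      have h1 := e.mate v
      have h2 := h.mate v
      simp only [Diagram.toState] at h1 h2
      rw [← h1, ← h2]
    · have h1 := e.lab v
      have h2 := h.lab v
      simp only [Diagram.toState] at h1 h2
      rw [← h1, ← h2]
  · have h2 := h.wt
    simp only [Diagram.toState, mul_one] at h2
    exact h2

/-- The concatenation of `comp` in this notation. -/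
theorem comp_eq_gcomp (δ : ZMod m → k) {a b c : ℕ} (x : Diag m a b) (y : Diag m b c) :
    comp δ x y = gcomp (fun _ => δ) (Enum.fin b) x y ∧
      loopFactor δ x y = gwt (fun _ => δ) (Enum.fin b) x y := by
  have e : concat δ x y = gl (fun _ => δ) (Enum.fin b).1 (gjoin k x y) := by
    simp only [concat, midPairs, glueAll, List.foldr_map]
    rfl
  have h := comp_emb δ x y
  rw [e] at h
  obtain ⟨h1, h2⟩ := gcomp_unique (L := Enum.fin b) h
  exact ⟨h1.symm, h2.symm⟩

/-! ### Invariance under bijections of the nodes -/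

/-- Bijections of the three sets of nodes, on the nodes of a concatenation. -/
def midEquiv (eA : A ≃ A') (eB : B ≃ B') (eC : C ≃ C') : Mid A B C ≃ Mid A' B' C' :=
  (eA.sumCongr eB).sumCongr (eB.sumCongr eC)

theorem gl_map (eA : A ≃ A') (eB : B ≃ B') (eC : C ≃ C') {δ : B → ZMod m → k}
    {δ' : B' → ZMod m → k} (hδ : ∀ b, δ' (eB b) = δ b) (L : List B) {c : k}
    {s : GlueState k m (Mid A B C)} {s' : GlueState k m (Mid A' B' C')}
    (h : Emb (midEquiv eA eB eC) c s s') :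
    Emb (midEquiv eA eB eC) c (gl δ L s) (gl δ' (L.map eB) s') := by
  induction L with
  | nil => exact h
  | cons b L ih =>
    rw [List.map_cons, gl_cons, gl_cons, hδ]
    exact ih.glue (midEquiv eA eB eC).injective (δ b) _ _

theorem gcomp_map (eA : A ≃ A') (eB : B ≃ B') (eC : C ≃ C') {δ : B → ZMod m → k}
    {δ' : B' → ZMod m → k} (hδ : ∀ b, δ' (eB b) = δ b) (L : Enum B) (x : Diagram m (A ⊕ B))
    (y : Diagram m (B ⊕ C)) :
    gcomp δ' (L.map eB) (x.map (eA.sumCongr eB)) (y.map (eB.sumCongr eC)) =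
      (gcomp δ L x y).map (eA.sumCongr eC) ∧
    gwt δ' (L.map eB) (x.map (eA.sumCongr eB)) (y.map (eB.sumCongr eC)) = gwt δ L x y := by
  have h0 : Emb (midEquiv eA eB eC) 1 (gjoin k x y)
      (gjoin k (x.map (eA.sumCongr eB)) (y.map (eB.sumCongr eC))) := by
    refine ⟨?_, ?_, by simp [gjoin]⟩
    · rintro (v | v) <;> simp [gjoin, midEquiv, Diagram.map]
    · rintro (v | v) <;> simp [gjoin, midEquiv, Diagram.map]
  have h1 := (gcomp_emb δ L x y).trans (gl_map eA eB eC hδ L.1 h0)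
  refine gcomp_unique (L := L.map eB) ⟨?_, ?_, ?_⟩
  · intro v
    have e : (gouter v : Mid A' B' C') = midEquiv eA eB eC (gouter ((eA.sumCongr eC).symm v)) := by
      rcases v with v | v <;> simp [gouter, midEquiv]
    have := h1.mate ((eA.sumCongr eC).symm v)
    simp only [Function.comp] at this
    rw [e]
    refine this.trans ?_
    simp only [Diagram.toState, Diagram.map]
    generalize (gcomp δ L x y).mate _ = w
    rcases w with w | w <;> simp [gouter, midEquiv]
  · intro v
    have e : (gouter v : Mid A' B' C') = midEquiv eA eB eC (gouter ((eA.sumCongr eC).symm v)) := by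
      rcases v with v | v <;> simp [gouter, midEquiv]
    have := h1.lab ((eA.sumCongr eC).symm v)
    simp only [Function.comp] at this
    rw [e]
    exact this
  · have := h1.wt
    simpa [Diagram.toState, Enum.map] using this

theorem Enum.map_refl (L : Enum B) : L.map (Equiv.refl B) = L := by
  apply Subtype.ext; simp [Enum.map]

/-- Permuting the outer nodes commutes with concatenation. -/
theorem gcomp_map_outer (eA : A ≃ A') (eC : C ≃ C') (δ : B → ZMod m → k) (L : Enum B)
    (x : Diagram m (A ⊕ B)) (y : Diagram m (B ⊕ C)) :
    gcomp δ L (x.map (eA.sumCongr (Equiv.refl B))) (y.map ((Equiv.refl B).sumCongr eC)) =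
      (gcomp δ L x y).map (eA.sumCongr eC) ∧
    gwt δ L (x.map (eA.sumCongr (Equiv.refl B))) (y.map ((Equiv.refl B).sumCongr eC)) =
      gwt δ L x y := by
  have := gcomp_map eA (Equiv.refl B) eC (δ := δ) (δ' := δ) (fun _ => rfl) L x y
  rwa [Enum.map_refl] at this

/-! ### The identity diagram -/

/-- The identity diagram. -/
def gid (m : ℕ) (A : Type) : Diagram m (A ⊕ A) where
  mate := Sum.swap
  lab _ := 0
  mate_mate := Sum.swap_swap
  mate_ne v := by rcases v with v | v <;> simp
  lab_mate _ := by simp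

/-- Glueing an identity diagram on top of `y` at the nodes in `L` yields `y`, where the northern nodes in
`L` have moved up. -/
theorem gid_comp_aux (δ : A → ZMod m → k) (y : Diagram m (A ⊕ B)) (L : List A) (hL : L.Nodup) :
    ∃ φ : A ⊕ B → Mid A A B, Function.Injective φ ∧
      (∀ i, φ (.inl i) = if i ∈ L then .inl (.inl i) else .inr (.inl i)) ∧
      (∀ j, φ (.inr j) = .inr (.inr j)) ∧
      Emb φ 1 (y.toState k) (gl δ L (gjoin k (gid m A) y)) ∧
      ∀ i, i ∉ L → ∀ s, s = gl δ L (gjoin k (gid m A) y) → s.mate (.inl (.inl i)) = .inl (.inr i) ∧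
          s.mate (.inl (.inr i)) = .inl (.inl i) ∧ s.lab (.inl (.inl i)) = 0 ∧
          s.lab (.inl (.inr i)) = 0 := by
  induction L with
  | nil =>
    refine ⟨Sum.inr, Sum.inr_injective, by simp, by simp, ⟨fun v => rfl, fun v => rfl, ?_⟩, ?_⟩
    · simp [gl, gjoin, Diagram.toState]
    · rintro i - s rfl
      exact ⟨rfl, rfl, rfl, rfl⟩
  | cons i L ih =>
    obtain ⟨hi, hL'⟩ := List.nodup_cons.1 hL
    obtain ⟨φ, h1, h2, h3, h4, h5⟩ := ih hL'
    set s := gl δ L (gjoin k (gid m A) y) with hs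
    obtain ⟨c1, c2, c3, c4⟩ := h5 i hi s rfl
    have hq : φ (.inl i) = .inr (.inl i) := by simp [h2, hi]
    have hnp : ∀ v, φ v ≠ .inl (.inr i) := by
      rintro (v | v)
      · rw [h2]; split_ifs <;> simp
      · simp [h3]
    have hnt : ∀ v, φ v ≠ .inl (.inl i) := by
      rintro (v | v)
      · rw [h2]; split_ifs with hv
        · simp only [ne_eq, Sum.inl.injEq]; rintro rfl; exact hi hv
        · simp
      · simp [h3]
    refine ⟨Function.update φ (.inl i) (.inl (.inl i)), ?_, ?_, ?_, ?_, ?_⟩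
    · intro v w hvw
      by_cases hv : v = .inl i <;> by_cases hw : w = .inl i
      · rw [hv, hw]
      · subst hv; simp [Function.update_of_ne hw] at hvw; exact absurd hvw.symm (hnt w)
      · subst hw; simp [Function.update_of_ne hv] at hvw; exact absurd hvw (hnt v)
      · rw [Function.update_of_ne hv, Function.update_of_ne hw] at hvw; exact h1 hvw
    · intro v
      by_cases hv : v = i
      · subst hv; simp
      · simp [hv, h2]
    · intro j; simp [h3]
    · have := (h4.straighten h1 (δ i) (.inl i) (.inl (.inr i)) (.inl (.inl i)) hnp hnt
        (y.mate_ne _) (by simp) y.mate_mate c2 c1 c4 c3).1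
      rw [hq] at this
      exact this
    · rintro v hv s' rfl
      simp only [List.mem_cons, not_or] at hv
      obtain ⟨d1, d2, d3, d4⟩ := h5 v hv.2 s rfl
      rw [gl_cons, ← hs]
      simp [glue, d1, d2, d3, d4, hv.1]

theorem gid_comp (δ : A → ZMod m → k) (L : Enum A) (y : Diagram m (A ⊕ B)) :
    gcomp δ L (gid m A) y = y ∧ gwt δ L (gid m A) y = 1 := by
  obtain ⟨φ, h1, h2, h3, h4, -⟩ := gid_comp_aux δ y L.1 L.2.1
  have hφ : φ = gouter := by
    funext v
    rcases v with v | v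
    · simp [h2, gouter, L.2.2]
    · simp [h3, gouter]
  subst hφ
  exact gcomp_unique h4

end General

/-! ### Independence of the order in which the central nodes are glued -/

section Order
variable {k : Type*} [Field k] {m : ℕ} {A B C : Type}
  [DecidableEq A] [DecidableEq B] [DecidableEq C] {Γ : Type*} [InvolutiveNeg Γ]

/-- Two glueings commute if no strand joins the nodes of the one with those of the other. -/
theorem glue_comm_of_apart {N : Type} [DecidableEq N] (δ δ' : ZMod m → k) {p q p' q' : N}
    {s : GlueState k m N} (h : s.Good)
    (h2 : p ≠ p') (h3 : p ≠ q') (h4 : q ≠ p') (h5 : q ≠ q') (h6 : p' ≠ q')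
    (e1 : s.mate p ≠ p') (e2 : s.mate p ≠ q') (e3 : s.mate q ≠ p') (e4 : s.mate q ≠ q') :
    glue δ p q (glue δ' p' q' s) = glue δ' p' q' (glue δ p q s) := by
  obtain ⟨g1, g2⟩ := h
  have a1 := g1 p
  have a2 := g1 q
  have a3 := g1 p'
  have a4 := g1 q'
  simp only [glue, GlueState.mk.injEq]
  refine ⟨?_, ?_, ?_⟩
  · funext v
    have a5 := g1 v
    grind
  · funext v
    have a5 := g1 v
    grind
  · grind

/-- The strands of a state join nodes of opposite sign. -/
def Signed {N : Type} (sg : N → Γ) (s : GlueState k m N) : Prop :=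
  ∀ v, s.mate v ≠ v → sg (s.mate v) = - sg v

theorem Signed.glue {N : Type} [DecidableEq N] {sg : N → Γ} {s : GlueState k m N} (h : Signed sg s)
    (hs : s.Good) (δ : ZMod m → k) {p q : N} (hp : s.mate p ≠ p) (hq : s.mate q ≠ q)
    (e : sg p = - sg q) : Signed sg (CycBrauer.glue δ p q s) := by
  intro v hv
  have a1 := hs.mate_mate v
  have a2 := hs.mate_mate p
  have a3 := hs.mate_mate q
  have b1 := h v
  have b2 := h p hp
  have b3 := h q hq
  have b4 : - - sg v = sg v := neg_neg _
  have b5 : - - sg q = sg q := neg_neg _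
  simp only [CycBrauer.glue] at hv ⊢
  grind

theorem Signed.gl {sg : Mid A B C → Γ} {s : GlueState k m (Mid A B C)} (h : Signed sg s)
    (δ : B → ZMod m → k) (e : ∀ b, sg (.inl (.inr b)) = - sg (.inr (.inl b)))
    (L : List B) (hr : GReady L s) : Signed sg (CycBrauer.gl δ L s) := by
  induction L with
  | nil => exact h
  | cons b L ih =>
    obtain ⟨i1, i2, i3⟩ := gl_spec δ L s hr.tail
    have hb := (List.nodup_cons.1 hr.nodup).1
    have hne : ∀ c ∈ L, b ≠ c := by rintro c hc rfl; exact hb hc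
    have hal := hr.alive b (by simp)
    exact (ih hr.tail).glue i1 _ (i2 _ hal.1 fun c hc => by simp [hne c hc])
      (i2 _ hal.2 fun c hc => by simp [hne c hc]) (e b)

/-- The parameter attached to a colour, as a parameter for unlabelled loops. -/
def colourPar (par : Γ → k) (γ : B → Γ) : B → ZMod 1 → k := fun b _ => par (γ b)

/-- For unlabelled diagrams with coloured nodes the order of glueing is irrelevant: the nodes of a closed
loop have equal or opposite colours, and these give the loop the same parameter. -/
theorem gl_perm {par : Γ → k} (hpar : ∀ c, par (-c) = par c) {γ : B → Γ} {sg : Mid A B C → Γ}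
    (e1 : ∀ b, sg (.inl (.inr b)) = - γ b) (e2 : ∀ b, sg (.inr (.inl b)) = γ b)
    {L L' : List B} (hp : L.Perm L') (s : GlueState k 1 (Mid A B C)) (hs : Signed sg s)
    (hr : GReady L s) : gl (colourPar par γ) L s = gl (colourPar par γ) L' s := by
  have e : ∀ b, sg (.inl (.inr b)) = - sg (.inr (.inl b)) := fun b => by rw [e1, e2]
  induction hp with
  | nil => rfl
  | cons b hp ih => rw [gl_cons, gl_cons, ih hr.tail]
  | swap b c L =>
    have hr' := hr.tail.tail
    obtain ⟨i1, i2, i3⟩ := gl_spec (colourPar par γ) L s hr'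
    have hS := hs.gl (colourPar par γ) e L hr'
    have hcb : c ≠ b := by
      rintro rfl; exact (List.nodup_cons.1 hr.nodup).1 (by simp)
    have hc : ∀ d ∈ L, c ≠ d := by
      rintro d hd rfl; exact (List.nodup_cons.1 hr.nodup).1 (by simp [hd])
    have hb : ∀ d ∈ L, b ≠ d := by
      rintro d hd rfl; exact (List.nodup_cons.1 hr.tail.nodup).1 hd
    have ab := hr.alive b (by simp)
    have ac := hr.alive c (by simp)
    have q1 := i2 _ ac.1 fun d hd => by simp [hc d hd]
    have q2 := i2 _ ac.2 fun d hd => by simp [hc d hd]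
    have q3 := i2 _ ab.1 fun d hd => by simp [hb d hd]
    have q4 := i2 _ ab.2 fun d hd => by simp [hb d hd]
    simp only [gl_cons]
    have s1 := hS _ q1
    have s2 := hS _ q2
    by_cases heq : par (γ b) = par (γ c)
    · have : colourPar par γ b = colourPar par γ c := by funext; exact heq
      rw [this]
      exact glue_comm _ (fun _ => rfl) i1 (by simp) (by simp [hcb]) (by simp) (by simp)
        (by simp [hcb]) (by simp) q1 q2 q3 q4
    · -- strands joining the two pairs would force the colours to agree up to sign
      have key : γ b ≠ γ c ∧ γ b ≠ - γ c :=
        ⟨fun h => heq (by rw [h]), fun h => heq (by rw [h, hpar])⟩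
      refine glue_comm_of_apart _ _ i1 (by simp [hcb]) (by simp) (by simp)
        (by simp [hcb]) (by simp) ?_ ?_ ?_ ?_
      · intro h; rw [h, e1, e1, neg_neg] at s1; exact key.2 (neg_eq_iff_eq_neg.1 s1)
      · intro h; rw [h, e1, e2, neg_neg] at s1; exact key.1 s1
      · intro h; rw [h, e1, e2] at s2; exact key.1 (neg_injective s2)
      · intro h; rw [h, e2, e2] at s2; exact key.2 s2
  | trans h1 h2 ih1 ih2 =>
    rw [ih1 hr, ih2 ⟨hr.good, h1.nodup_iff.1 hr.nodup, fun b hb => hr.alive b (h1.mem_iff.2 hb)⟩]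

/-- The sign of an outer node: the colour of a northern node and minus the colour of a southern one. -/
def sign {A B : Type} (γ : A → Γ) (γ' : B → Γ) : A ⊕ B → Γ := Sum.elim γ fun b => - γ' b

/-- The strands of `d` respect the colours: through strands join equal colours, arcs opposite ones. -/
def Compat {m : ℕ} {A B : Type} (γ : A → Γ) (γ' : B → Γ) (d : Diagram m (A ⊕ B)) : Prop :=
  ∀ v, sign γ γ' (d.mate v) = - sign γ γ' v

/-- The signs of all the nodes of a concatenation. -/
def midSign {A B C : Type} (γ : A → Γ) (γ' : B → Γ) (γ'' : C → Γ) : Mid A B C → Γ :=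
  Sum.elim (sign γ γ') (sign γ' γ'')

theorem gjoin_signed {γ : A → Γ} {γ' : B → Γ} {γ'' : C → Γ} {x : Diagram m (A ⊕ B)}
    {y : Diagram m (B ⊕ C)} (hx : Compat γ γ' x) (hy : Compat γ' γ'' y) :
    Signed (midSign γ γ' γ'') (gjoin k x y) := by
  rintro (v | v) _
  · exact hx v
  · exact hy v

theorem gcomp_perm {par : Γ → k} (hpar : ∀ c, par (-c) = par c) {γ : A → Γ} {γ' : B → Γ}
    {γ'' : C → Γ} {x : Diagram 1 (A ⊕ B)} {y : Diagram 1 (B ⊕ C)} (hx : Compat γ γ' x)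
    (hy : Compat γ' γ'' y) (L L' : Enum B) :
    gcomp (colourPar par γ') L x y = gcomp (colourPar par γ') L' x y ∧
      gwt (colourPar par γ') L x y = gwt (colourPar par γ') L' x y := by
  have := gl_perm hpar (γ := γ') (sg := midSign γ γ' γ'') (fun _ => rfl) (fun _ => rfl)
    (L.perm L') (gjoin k x y) (gjoin_signed hx hy) (gjoin_ready x y L.2.1)
  apply gcomp_unique
  rw [this]
  exact gcomp_emb _ L' x y

theorem Compat.gcomp {γ : A → Γ} {γ' : B → Γ}
    {γ'' : C → Γ} {x : Diagram m (A ⊕ B)} {y : Diagram m (B ⊕ C)} (hx : Compat γ γ' x)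
    (hy : Compat γ' γ'' y) (δ : B → ZMod m → k) (L : Enum B) :
    Compat γ γ'' (gcomp δ L x y) := by
  intro v
  have h := (gjoin_signed (k := k) hx hy).gl δ (fun b => rfl) L.1 (gjoin_ready x y L.2.1)
  have e := (gcomp_emb δ L x y).mate v
  have h1 := h (gouter v) (gl_outer δ L x y v).1
  rw [e] at h1
  have key : ∀ w : A ⊕ C, midSign γ γ' γ'' (gouter w) = sign γ γ'' w := by
    rintro (w | w) <;> rfl
  rwa [key, key] at h1

end Order

/-! ### Disjoint unions of diagrams -/

section Tens
variable {k : Type*} [Field k] {m : ℕ} {A₁ B₁ C₁ A₂ B₂ C₂ : Type}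
  [DecidableEq A₁] [DecidableEq B₁] [DecidableEq C₁]
  [DecidableEq A₂] [DecidableEq B₂] [DecidableEq C₂]

/-- The disjoint union of two diagrams. -/
def Diagram.sum {m : ℕ} {N N' : Type} (x : Diagram m N) (y : Diagram m N') :
    Diagram m (N ⊕ N') where
  mate := Sum.map x.mate y.mate
  lab := Sum.elim x.lab y.lab
  mate_mate v := by rcases v with v | v <;> simp [x.mate_mate, y.mate_mate]
  mate_ne v := by rcases v with v | v <;> simp [x.mate_ne, y.mate_ne]
  lab_mate v := by rcases v with v | v <;> simp [x.lab_mate, y.lab_mate]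

/-- The interchange of the two middle summands. -/
def sumSwap (A₁ B₁ A₂ B₂ : Type) : (A₁ ⊕ B₁) ⊕ (A₂ ⊕ B₂) ≃ (A₁ ⊕ A₂) ⊕ (B₁ ⊕ B₂) where
  toFun := Sum.elim (Sum.map .inl .inl) (Sum.map .inr .inr)
  invFun := Sum.elim (Sum.map .inl .inl) (Sum.map .inr .inr)
  left_inv := by rintro ((v | v) | (v | v)) <;> rfl
  right_inv := by rintro ((v | v) | (v | v)) <;> rfl

/-- Two diagrams side by side. -/
def tens (x : Diagram m (A₁ ⊕ B₁)) (y : Diagram m (A₂ ⊕ B₂)) :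
    Diagram m ((A₁ ⊕ A₂) ⊕ (B₁ ⊕ B₂)) :=
  (x.sum y).map (sumSwap A₁ B₁ A₂ B₂)

/-- The part of an enumeration in the first summand. -/
def Enum.left {B₁ B₂ : Type} (L : Enum (B₁ ⊕ B₂)) : Enum B₁ :=
  ⟨L.1.filterMap Sum.getLeft?, by
    refine ⟨L.2.1.filterMap ?_, fun b => List.mem_filterMap.2 ⟨.inl b, L.2.2 _, rfl⟩⟩
    rintro (a | a) (b | b) c hc hc' <;> simp_all⟩

/-- The part of an enumeration in the second summand. -/
def Enum.right {B₁ B₂ : Type} (L : Enum (B₁ ⊕ B₂)) : Enum B₂ :=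
  ⟨L.1.filterMap Sum.getRight?, by
    refine ⟨L.2.1.filterMap ?_, fun b => List.mem_filterMap.2 ⟨.inr b, L.2.2 _, rfl⟩⟩
    rintro (a | a) (b | b) c hc hc' <;> simp_all⟩

/-- The nodes of the concatenation of the diagrams on the left. -/
def midLeft : Mid A₁ B₁ C₁ → Mid (A₁ ⊕ A₂) (B₁ ⊕ B₂) (C₁ ⊕ C₂) :=
  Sum.map (Sum.map .inl .inl) (Sum.map .inl .inl)

/-- The nodes of the concatenation of the diagrams on the right. -/
def midRight : Mid A₂ B₂ C₂ → Mid (A₁ ⊕ A₂) (B₁ ⊕ B₂) (C₁ ⊕ C₂) :=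
  Sum.map (Sum.map .inr .inr) (Sum.map .inr .inr)

theorem midLeft_injective : Function.Injective
    (midLeft : Mid A₁ B₁ C₁ → Mid (A₁ ⊕ A₂) (B₁ ⊕ B₂) (C₁ ⊕ C₂)) :=
  (Sum.inl_injective.sumMap Sum.inl_injective).sumMap (Sum.inl_injective.sumMap Sum.inl_injective)

theorem midRight_injective : Function.Injective
    (midRight : Mid A₂ B₂ C₂ → Mid (A₁ ⊕ A₂) (B₁ ⊕ B₂) (C₁ ⊕ C₂)) :=
  (Sum.inr_injective.sumMap Sum.inr_injective).sumMap (Sum.inr_injective.sumMap Sum.inr_injective)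

theorem midLeft_ne_midRight (v : Mid A₁ B₁ C₁) (w : Mid A₂ B₂ C₂) :
    (midLeft v : Mid (A₁ ⊕ A₂) (B₁ ⊕ B₂) (C₁ ⊕ C₂)) ≠ midRight w := by
  rcases v with (v | v) | (v | v) <;> rcases w with (w | w) | (w | w) <;>
    simp [midLeft, midRight]

/-- A glueing step on the image of `j` does not affect the image of `j'`. -/
theorem Emb.glue_away {N N' N'' : Type} [DecidableEq N] [DecidableEq N'] [DecidableEq N'']
    {j : N → N''} {j' : N' → N''} (hne : ∀ v w, j v ≠ j' w) {c c' : k}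
    {s' : GlueState k m N'} {s'' : GlueState k m N''} (h : Emb j' c s' s'')
    (δ : ZMod m → k) (p q : N) (hw : (CycBrauer.glue δ (j p) (j q) s'').wt = c' * s'.wt) :
    Emb j' c' s' (CycBrauer.glue δ (j p) (j q) s'') := by
  refine ⟨fun v => ?_, fun v => ?_, hw⟩
  · simp [CycBrauer.glue, h.mate, (hne _ _).symm]
  · simp [CycBrauer.glue, h.mate, h.lab, (hne _ _).symm]

theorem gl_tens (δ : B₁ ⊕ B₂ → ZMod m → k) (L : List (B₁ ⊕ B₂))
    {s₁ : GlueState k m (Mid A₁ B₁ C₁)} {s₂ : GlueState k m (Mid A₂ B₂ C₂)}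
    {s : GlueState k m (Mid (A₁ ⊕ A₂) (B₁ ⊕ B₂) (C₁ ⊕ C₂))}
    (h₁ : Emb midLeft s₂.wt s₁ s) (h₂ : Emb midRight s₁.wt s₂ s) :
    Emb midLeft (gl (fun b => δ (.inr b)) (L.filterMap Sum.getRight?) s₂).wt
      (gl (fun b => δ (.inl b)) (L.filterMap Sum.getLeft?) s₁) (gl δ L s) ∧
    Emb midRight (gl (fun b => δ (.inl b)) (L.filterMap Sum.getLeft?) s₁).wt
      (gl (fun b => δ (.inr b)) (L.filterMap Sum.getRight?) s₂) (gl δ L s) := by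
  induction L with
  | nil => exact ⟨h₁, h₂⟩
  | cons b L ih =>
    obtain ⟨i1, i2⟩ := ih
    rcases b with b | b
    · have e := i1.glue midLeft_injective (δ (.inl b)) (.inl (.inr b)) (.inr (.inl b))
      exact ⟨e, i2.glue_away midLeft_ne_midRight (δ (.inl b)) (.inl (.inr b)) (.inr (.inl b))
        (e.wt.trans (mul_comm _ _))⟩
    · have e := i2.glue midRight_injective (δ (.inr b)) (.inl (.inr b)) (.inr (.inl b))
      exact ⟨i1.glue_away (fun v w => (midLeft_ne_midRight w v).symm) (δ (.inr b)) (.inl (.inr b))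
        (.inr (.inl b)) (e.wt.trans (mul_comm _ _)), e⟩

/-- Concatenation of diagrams side by side. -/
theorem gcomp_tens (δ : B₁ ⊕ B₂ → ZMod m → k) (L : Enum (B₁ ⊕ B₂))
    (x₁ : Diagram m (A₁ ⊕ B₁)) (x₂ : Diagram m (A₂ ⊕ B₂))
    (y₁ : Diagram m (B₁ ⊕ C₁)) (y₂ : Diagram m (B₂ ⊕ C₂)) :
    gcomp δ L (tens x₁ x₂) (tens y₁ y₂) =
      tens (gcomp (fun b => δ (.inl b)) L.left x₁ y₁) (gcomp (fun b => δ (.inr b)) L.right x₂ y₂) ∧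
    gwt δ L (tens x₁ x₂) (tens y₁ y₂) =
      gwt (fun b => δ (.inl b)) L.left x₁ y₁ * gwt (fun b => δ (.inr b)) L.right x₂ y₂ := by
  have h₁ : Emb midLeft (gjoin k x₂ y₂).wt (gjoin k x₁ y₁) (gjoin k (tens x₁ x₂) (tens y₁ y₂)) := by
    refine ⟨?_, ?_, by simp [gjoin]⟩
    · rintro ((v | v) | (v | v))
      · rcases h : x₁.mate (.inl v) with w | w <;>
          simp [gjoin, midLeft, tens, Diagram.map, Diagram.sum, sumSwap, h]
      · rcases h : x₁.mate (.inr v) with w | w <;>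
          simp [gjoin, midLeft, tens, Diagram.map, Diagram.sum, sumSwap, h]
      · rcases h : y₁.mate (.inl v) with w | w <;>
          simp [gjoin, midLeft, tens, Diagram.map, Diagram.sum, sumSwap, h]
      · rcases h : y₁.mate (.inr v) with w | w <;>
          simp [gjoin, midLeft, tens, Diagram.map, Diagram.sum, sumSwap, h]
    · rintro ((v | v) | (v | v)) <;> rfl
  have h₂ : Emb midRight (gjoin k x₁ y₁).wt (gjoin k x₂ y₂)
      (gjoin k (tens x₁ x₂) (tens y₁ y₂)) := by
    refine ⟨?_, ?_, by simp [gjoin]⟩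
    · rintro ((v | v) | (v | v))
      · rcases h : x₂.mate (.inl v) with w | w <;>
          simp [gjoin, midRight, tens, Diagram.map, Diagram.sum, sumSwap, h]
      · rcases h : x₂.mate (.inr v) with w | w <;>
          simp [gjoin, midRight, tens, Diagram.map, Diagram.sum, sumSwap, h]
      · rcases h : y₂.mate (.inl v) with w | w <;>
          simp [gjoin, midRight, tens, Diagram.map, Diagram.sum, sumSwap, h]
      · rcases h : y₂.mate (.inr v) with w | w <;>
          simp [gjoin, midRight, tens, Diagram.map, Diagram.sum, sumSwap, h]
    · rintro ((v | v) | (v | v)) <;> rfl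
  obtain ⟨g₁, g₂⟩ := gl_tens δ L.1 h₁ h₂
  have f₁ := (gcomp_emb (fun b => δ (.inl b)) L.left x₁ y₁).trans g₁
  have f₂ := (gcomp_emb (fun b => δ (.inr b)) L.right x₂ y₂).trans g₂
  refine gcomp_unique ⟨?_, ?_, ?_⟩
  · rintro ((v | v) | (v | v))
    · refine (f₁.mate (.inl v)).trans ?_
      rcases h : (gcomp (fun b => δ (.inl b)) L.left x₁ y₁).mate (.inl v) with w | w <;>
        simp [Diagram.toState, tens, Diagram.map, Diagram.sum, sumSwap, midLeft, gouter, h]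
    · refine (f₂.mate (.inl v)).trans ?_
      rcases h : (gcomp (fun b => δ (.inr b)) L.right x₂ y₂).mate (.inl v) with w | w <;>
        simp [Diagram.toState, tens, Diagram.map, Diagram.sum, sumSwap, midRight, gouter, h]
    · refine (f₁.mate (.inr v)).trans ?_
      rcases h : (gcomp (fun b => δ (.inl b)) L.left x₁ y₁).mate (.inr v) with w | w <;>
        simp [Diagram.toState, tens, Diagram.map, Diagram.sum, sumSwap, midLeft, gouter, h]
    · refine (f₂.mate (.inr v)).trans ?_
      rcases h : (gcomp (fun b => δ (.inr b)) L.right x₂ y₂).mate (.inr v) with w | w <;>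
        simp [Diagram.toState, tens, Diagram.map, Diagram.sum, sumSwap, midRight, gouter, h]
  · rintro ((v | v) | (v | v))
    · exact f₁.lab (.inl v)
    · exact f₂.lab (.inl v)
    · exact f₁.lab (.inr v)
    · exact f₂.lab (.inr v)
  · rw [g₁.wt]
    simp only [Diagram.toState, mul_one]
    rw [mul_comm]
    rfl

end Tens

/-! ### Composition with a diagram that has a southern arc -/

section SouthArc
variable {k : Type*} [Field k] {m : ℕ} {A B C : Type}
  [DecidableEq A] [DecidableEq B] [DecidableEq C] {Γ : Type*} [InvolutiveNeg Γ]

/-- Some strand joins two southern nodes. -/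
def SouthArc {m : ℕ} {A B : Type} (d : Diagram m (A ⊕ B)) : Prop :=
  ∃ i j, d.mate (.inr i) = .inr j

/-- A strand between outer nodes is unaffected by glueing. -/
theorem gl_outer_strand (δ : B → ZMod m → k) (L : List B) {s : GlueState k m (Mid A B C)}
    {v w : A ⊕ C} (h : s.mate (gouter v) = gouter w) :
    (gl δ L s).mate (gouter v) = gouter w ∧ (gl δ L s).lab (gouter v) = s.lab (gouter v) := by
  induction L with
  | nil => exact ⟨h, rfl⟩
  | cons b L ih =>
    rw [gl_cons]
    simp [glue, ih, (gouter_ne b v).1, (gouter_ne b v).2, (gouter_ne b w).1, (gouter_ne b w).2]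

theorem gcomp_mate_of_gl {δ : B → ZMod m → k} {L : Enum B} {x : Diagram m (A ⊕ B)}
    {y : Diagram m (B ⊕ C)} {v w : A ⊕ C} (h : (gl δ L.1 (gjoin k x y)).mate (gouter v) = gouter w) :
    (gcomp δ L x y).mate v = w := by
  apply gouter_injective (B := B)
  rw [← h]
  exact ((gcomp_emb δ L x y).mate v).symm

/-- A southern arc of the lower diagram survives. -/
theorem SouthArc.gcomp {δ : B → ZMod m → k} {L : Enum B} {x : Diagram m (A ⊕ B)}
    {y : Diagram m (B ⊕ C)} (h : SouthArc y) : SouthArc (gcomp δ L x y) := by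
  obtain ⟨i, j, hij⟩ := h
  refine ⟨i, j, gcomp_mate_of_gl (gl_outer_strand δ L.1 ?_).1⟩
  simp [gjoin, gouter, hij]

/-- The state obtained from `y` and `t`, drawn above each other, by erasing the southern nodes `i`
and `j` of `y`. -/
def cutJoin (i j : B) (y : Diagram 1 (A ⊕ B)) (t : GlueState k 1 (B ⊕ C)) :
    GlueState k 1 (Mid A B C) where
  mate := Sum.elim (fun v => if v = .inr i ∨ v = .inr j then .inl v else .inl (y.mate v))
    fun v => .inr (t.mate v)
  lab _ := 0
  wt := t.wt

theorem glueState_ext {N : Type} {s s' : GlueState k 1 N} (h : s.mate = s'.mate)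
    (h' : s.wt = s'.wt) : s = s' := by
  cases s; cases s'
  simp only [GlueState.mk.injEq]
  exact ⟨h, Subsingleton.elim _ _, h'⟩

/-- Glueing `d` to the ends `i`, `j` of a southern arc amounts to closing `d` at `i` and `j`. -/
theorem gl_pair (δ : B → ZMod 1 → k) {i j : B} (hij : i ≠ j) {y : Diagram 1 (A ⊕ B)}
    (hy : y.mate (.inr i) = .inr j) (d : Diagram 1 (B ⊕ C)) :
    gl δ [i, j] (gjoin k y d) = cutJoin i j y (glue (δ i) (.inl i) (.inl j) (d.toState k)) := by
  have hy' : y.mate (.inr j) = .inr i := by rw [← hy, y.mate_mate]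
  have a1 := d.mate_ne (.inl i)
  have a2 := d.mate_ne (.inl j)
  have a3 := d.mate_mate (.inl i)
  have a4 := d.mate_mate (.inl j)
  have hl : ∀ z z' : ZMod 1, z = z' := fun _ _ => Subsingleton.elim _ _
  apply glueState_ext
  · funext v
    rcases v with v | v
    · have b1 := y.mate_mate v
      simp only [gl, List.foldr, glue, gjoin, cutJoin, Diagram.toState, Sum.map_inl, Sum.map_inr,
        Sum.elim_inl, Sum.inl.injEq, reduceCtorEq, or_false, false_or, if_false]
      grind
    · have b1 := d.mate_mate v
      simp only [gl, List.foldr, glue, gjoin, cutJoin, Diagram.toState, Sum.map_inl, Sum.map_inr,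
        Sum.elim_inr, Sum.inr.injEq, reduceCtorEq, or_false, false_or, if_false]
      grind
  · simp only [gl, List.foldr, glue, gjoin, cutJoin, Diagram.toState, Sum.map_inl, Sum.map_inr,
        Sum.elim_inr, Sum.inr.injEq, reduceCtorEq, or_false, false_or, if_false]
    have e : ∀ z, δ i z = δ i 0 := fun z => by rw [hl z 0]
    simp only [e]
    grind

/-- The diagram with the arcs `i j` at the top and at the bottom and vertical strands otherwise. -/
def arcDiag {B : Type} [DecidableEq B] {i j : B} (hij : i ≠ j) : Diagram 1 (B ⊕ B) where
  mate := Sum.elim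
    (fun v => if v = i then .inl j else if v = j then .inl i else .inr v)
    (fun v => if v = i then .inr j else if v = j then .inr i else .inl v)
  lab _ := 0
  mate_mate v := by rcases v with v | v <;> grind
  mate_ne v := by rcases v with v | v <;> grind
  lab_mate _ := by simp

/-- `d` closed at `i` and `j`, with an arc added there. -/
def capCup {i j : B} (hij : i ≠ j) (d : Diagram 1 (B ⊕ C)) : Diagram 1 (B ⊕ C) where
  mate v := if v = .inl i then .inl j else if v = .inl j then .inl i else
    if d.mate v = .inl i then d.mate (.inl j) else if d.mate v = .inl j then d.mate (.inl i)
    else d.mate v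
  lab _ := 0
  mate_mate v := by
    have a1 := d.mate_ne (.inl i)
    have a2 := d.mate_ne (.inl j)
    have a3 := d.mate_mate (.inl i)
    have a4 := d.mate_mate (.inl j)
    have a5 := d.mate_mate v
    have a6 : (Sum.inl i : B ⊕ C) ≠ .inl j := by simpa using hij
    grind
  mate_ne v := by
    have a1 := d.mate_ne (.inl i)
    have a2 := d.mate_ne (.inl j)
    have a3 := d.mate_mate (.inl i)
    have a4 := d.mate_mate (.inl j)
    have a5 := d.mate_mate v
    have a6 : (Sum.inl i : B ⊕ C) ≠ .inl j := by simpa using hij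
    have a7 := d.mate_ne v
    grind
  lab_mate _ := by simp

theorem gl_scale (δ : B → ZMod m → k) (L : List B) {s s' : GlueState k m (Mid A B C)} {c : k}
    (h : Emb id c s s') : Emb id c (gl δ L s) (gl δ L s') := by
  induction L with
  | nil => exact h
  | cons b L ih => exact ih.glue Function.injective_id _ _ _

theorem Emb.scale {N N' : Type} [DecidableEq N] [DecidableEq N'] {f : N → N'} {u c : k}
    {s : GlueState k m N} {s₁ s₂ : GlueState k m N'} (h : Emb f u s s₁) (h' : Emb id c s₁ s₂) :
    Emb f (c * u) s s₂ := h.trans h'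

theorem gid_compat (γ : A → Γ) : Compat γ γ (gid m A) := by
  rintro (v | v) <;> simp [gid, sign]

theorem arcDiag_compat {γ : B → Γ} {i j : B} (hij : i ≠ j) (hc : γ i = - γ j) :
    Compat γ γ (arcDiag hij) := by
  have hc' : γ j = - γ i := by rw [hc, neg_neg]
  rintro (v | v)
  · by_cases h1 : v = i
    · subst h1; simp [arcDiag, sign, hc']
    · by_cases h2 : v = j
      · subst h2; simp [arcDiag, sign, hc, h1]
      · simp [arcDiag, sign, h1, h2]
  · by_cases h1 : v = i
    · subst h1; simp [arcDiag, sign, hc']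
    · by_cases h2 : v = j
      · subst h2; simp [arcDiag, sign, hc, h1]
      · simp [arcDiag, sign, h1, h2]

theorem exists_enum_pair (L : Enum B) {i j : B} (hij : i ≠ j) :
    ∃ L' : Enum B, ∃ L'' : List B, L'.1 = L'' ++ [i, j] := by
  have hj : j ∈ L.1.erase i := (L.2.1.mem_erase_iff).2 ⟨hij.symm, L.2.2 j⟩
  have hp : (((L.1.erase i).erase j) ++ [i, j]).Perm L.1 := by
    refine List.Perm.trans List.perm_append_comm ?_
    exact ((List.perm_cons_erase hj).symm.cons i).trans (List.perm_cons_erase (L.2.2 i)).symm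
  exact ⟨⟨_, hp.nodup_iff.2 L.2.1, fun b => hp.mem_iff.2 (L.2.2 b)⟩, _, rfl⟩

variable {par : Γ → k} {γ₀ : A → Γ} {γ : B → Γ} {γ' : C → Γ}

/-- Multiplication by `arcDiag` closes a diagram at `i` and `j` and adds an arc there. -/
theorem arcDiag_gcomp (hpar : ∀ c, par (-c) = par c) {i j : B} (hij : i ≠ j) (hc : γ i = - γ j) {d : Diagram 1 (B ⊕ C)}
    (hd : Compat γ γ' d) (L : Enum B) :
    gcomp (colourPar par γ) L (arcDiag hij) d = capCup hij d ∧
      gwt (colourPar par γ) L (arcDiag hij) d =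
        (glue (colourPar par γ i) (.inl i) (.inl j) (d.toState k)).wt := by
  obtain ⟨L', L'', hL⟩ := exists_enum_pair L hij
  rw [(gcomp_perm hpar (arcDiag_compat hij hc) hd L L').1,
    (gcomp_perm hpar (arcDiag_compat hij hc) hd L L').2]
  set w := (glue (colourPar par γ i) (.inl i) (.inl j) (d.toState k)).wt with hw
  have h1 : Emb id w (gl (colourPar par γ) [i, j] (gjoin k (gid 1 B) (capCup hij d)))
      (gl (colourPar par γ) [i, j] (gjoin k (arcDiag hij) d)) := by
    rw [gl_pair _ hij (y := arcDiag hij) (by simp [arcDiag]) d]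
    refine ⟨?_, fun _ => Subsingleton.elim _ _, ?_⟩
    · have a1 := d.mate_ne (.inl i)
      have a2 := d.mate_ne (.inl j)
      have a3 := d.mate_mate (.inl i)
      have a4 := d.mate_mate (.inl j)
      rintro ((v | v) | v)
      · simp only [gl, List.foldr, glue, gjoin, cutJoin, Diagram.toState, Sum.map_inl, Sum.map_inr,
          Sum.elim_inl, Sum.inl.injEq, reduceCtorEq, or_false, false_or, if_false, gid, capCup,
          arcDiag, id, Sum.swap_inl, Sum.swap_inr]
        grind
      · simp only [gl, List.foldr, glue, gjoin, cutJoin, Diagram.toState, Sum.map_inl, Sum.map_inr,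
          Sum.elim_inl, Sum.inl.injEq, reduceCtorEq, or_false, false_or, if_false, gid, capCup,
          arcDiag, id, Sum.swap_inr]
        grind
      · have a5 := d.mate_mate v
        simp only [gl, List.foldr, glue, gjoin, cutJoin, Diagram.toState, Sum.map_inl, Sum.map_inr,
          Sum.elim_inl, Sum.elim_inr, Sum.inl.injEq, reduceCtorEq, or_false, false_or, if_false, gid,
          capCup, arcDiag, id, Sum.swap_inr, Sum.inr.injEq]
        grind
    · have hij' : j ≠ i := hij.symm
      simp [gl, glue, gjoin, cutJoin, gid, capCup, hij, hij', hw, Diagram.toState]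
  have h2 := gl_scale (colourPar par γ) L'' h1
  rw [← gl_append, ← gl_append, ← hL] at h2
  have h3 := (gcomp_emb (colourPar par γ) L' (gid 1 B) (capCup hij d)).scale h2
  rw [(gid_comp _ _ _).1, (gid_comp _ _ _).2, mul_one] at h3
  exact gcomp_unique h3

/-- The product of a diagram having the southern arc `i j` with `d` is determined by that of
`arcDiag` with `d`. -/
theorem gcomp_of_arc (hpar : ∀ c, par (-c) = par c) {i j : B} (hij : i ≠ j) (hc : γ i = - γ j) {y : Diagram 1 (A ⊕ B)}
    (hy : Compat γ₀ γ y) (hyij : y.mate (.inr i) = .inr j) (L : Enum B) :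
    (∀ d d' : Diagram 1 (B ⊕ C), Compat γ γ' d → Compat γ γ' d' →
      gcomp (colourPar par γ) L (arcDiag hij) d = gcomp (colourPar par γ) L (arcDiag hij) d' →
      gcomp (colourPar par γ) L y d = gcomp (colourPar par γ) L y d') ∧
    (∃ g : Diagram 1 (B ⊕ C) → k, ∀ d, Compat γ γ' d → gwt (colourPar par γ) L y d =
      gwt (colourPar par γ) L (arcDiag hij) d * g (gcomp (colourPar par γ) L (arcDiag hij) d)) ∧
    ∀ d, Compat γ γ' d → SouthArc (gcomp (colourPar par γ) L (arcDiag hij) d) →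
      SouthArc (gcomp (colourPar par γ) L y d) := by
  obtain ⟨L', L'', hL⟩ := exists_enum_pair L hij
  let st : Diagram 1 (B ⊕ C) → GlueState k 1 (Mid A B C) := fun d' =>
    gl (colourPar par γ) L'' (cutJoin i j y
      ⟨fun v => if v = .inl i ∨ v = .inl j then v else d'.mate v, fun _ => 0, 1⟩)
  have key : ∀ d, Compat γ γ' d →
      Emb id (gwt (colourPar par γ) L (arcDiag hij) d)
        (st (gcomp (colourPar par γ) L (arcDiag hij) d))
        (gl (colourPar par γ) L'.1 (gjoin k y d)) := by
    intro d hd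
    obtain ⟨e1, e2⟩ := arcDiag_gcomp hpar hij hc hd L
    rw [e1, e2, hL, gl_append, gl_pair _ hij hyij]
    refine gl_scale _ _ ⟨?_, fun _ => Subsingleton.elim _ _, (mul_one _).symm⟩
    rintro (v | v)
    · rfl
    · simp only [cutJoin, id, Sum.elim_inr, glue, capCup, Diagram.toState]
      grind
  have gl_eq : ∀ d, Compat γ γ' d → gl (colourPar par γ) L.1 (gjoin k y d) =
      gl (colourPar par γ) L'.1 (gjoin k y d) := fun d hd =>
    gl_perm hpar (γ := γ) (sg := midSign γ₀ γ γ') (fun _ => rfl) (fun _ => rfl)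
      (L.perm L') (gjoin k y d) (gjoin_signed hy hd) (gjoin_ready y d L.2.1)
  refine ⟨?_, ⟨fun d' => (st d').wt, ?_⟩, ?_⟩
  · intro d d' hd hd' h
    have k1 := key d hd
    have k2 := key d' hd'
    rw [← gl_eq d hd] at k1
    rw [← gl_eq d' hd'] at k2
    rw [← h] at k2
    ext v
    · apply gcomp_mate_of_gl
      have := (gcomp_emb (colourPar par γ) L y d').mate v
      have a1 := k1.mate (gouter v)
      have a2 := k2.mate (gouter v)
      simp only [id] at a1 a2
      rw [a1, ← a2, this]
      rfl
    · exact Subsingleton.elim (α := ZMod 1) _ _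
  · intro d hd
    have k1 := key d hd
    rw [← gl_eq d hd] at k1
    exact k1.wt
  · rintro d hd ⟨b, b', hbb⟩
    refine ⟨b, b', gcomp_mate_of_gl ?_⟩
    rw [gl_eq d hd]
    have k1 := (key d hd).mate (gouter (.inr b))
    simp only [id] at k1
    rw [k1]
    refine (gl_outer_strand _ _ ?_).1
    simp [cutJoin, gouter, hbb]

end SouthArc

/-! ### Coloured diagrams without labels -/

theorem Diagram.finite {m : ℕ} [NeZero m] {N : Type} [Finite N] : Finite (Diagram m N) :=
  Finite.of_injective (fun d : Diagram m N => (d.mate, d.lab)) fun d d' h => by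
    rw [Prod.mk.injEq] at h
    exact Diagram.ext h.1 h.2

/-- The space with basis the unlabelled diagrams with northern nodes `A` and southern nodes `B`. -/
abbrev World (k : Type*) [Field k] (A B : Type) : Type _ := Diagram 1 (A ⊕ B) →₀ k

instance World.finite {k : Type*} [Field k] {A B : Type} [Finite A] [Finite B] :
    FiniteDimensional k (World k A B) :=
  haveI := Diagram.finite (m := 1) (N := A ⊕ B)
  inferInstance

section Coloured
variable {k : Type*} [Field k] {A A' B C : Type} [Fintype A] [Fintype A'] [Fintype B] [Fintype C]
  [DecidableEq A] [DecidableEq A'] [DecidableEq B] [DecidableEq C] {Γ : Type*} [InvolutiveNeg Γ]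

/-- The diagrams respecting the colours in which every southern node is on a through strand. -/
def Good {m : ℕ} {A B : Type} (γ : A → Γ) (γ' : B → Γ) (d : Diagram m (A ⊕ B)) : Prop :=
  Compat γ γ' d ∧ ¬ SouthArc d

variable (k) in
/-- The span of the `Good` diagrams. -/
def goodSpace (γ : A → Γ) (γ' : B → Γ) : Submodule k (World k A B) :=
  Finsupp.supported k k {d | Good γ γ' d}

theorem goodSpace_induction {γ : A → Γ} {γ' : B → Γ} {P : World k A B → Prop} {v : World k A B}
    (hv : v ∈ goodSpace k γ γ') (h0 : P 0) (ha : ∀ v w, P v → P w → P (v + w))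
    (hs : ∀ (c : k) v, P v → P (c • v)) (h : ∀ d, Good γ γ' d → P (Finsupp.single d 1)) : P v := by
  rw [goodSpace, Finsupp.supported_eq_span_single] at hv
  induction hv using Submodule.span_induction with
  | mem x hx => obtain ⟨d, hd, rfl⟩ := hx; exact h d hd
  | zero => exact h0
  | add x y _ _ hx hy => exact ha x y hx hy
  | smul a x _ hx => exact hs a x hx

theorem single_mem_goodSpace {γ : A → Γ} {γ' : B → Γ} {d : Diagram 1 (A ⊕ B)} (h : Good γ γ' d)
    (c : k) : Finsupp.single d c ∈ goodSpace k γ γ' :=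
  Finsupp.single_mem_supported k c h

/-- Two linear maps that agree on the `Good` diagrams agree on their span. -/
theorem goodSpace_ext {γ : A → Γ} {γ' : B → Γ} {E : Type*} [AddCommGroup E] [Module k E]
    {f g : World k A B →ₗ[k] E}
    (h : ∀ d, Good γ γ' d → f (Finsupp.single d 1) = g (Finsupp.single d 1))
    {v : World k A B} (hv : v ∈ goodSpace k γ γ') : f v = g v := by
  refine goodSpace_induction (P := fun v => f v = g v) hv (by simp) ?_ ?_ h
  · intro v w hv hw; rw [map_add, map_add, hv, hw]
  · intro c v hv; rw [map_smul, map_smul, hv]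

theorem goodSpace_map {γ : A → Γ} {γ' : B → Γ} {E : Type*} [AddCommGroup E] [Module k E]
    {f : World k A B →ₗ[k] E} {U : Submodule k E}
    (h : ∀ d, Good γ γ' d → f (Finsupp.single d 1) ∈ U)
    {v : World k A B} (hv : v ∈ goodSpace k γ γ') : f v ∈ U := by
  refine goodSpace_induction (P := fun v => f v ∈ U) hv (by simp) ?_ ?_ h
  · intro v w hv hw; rw [map_add]; exact U.add_mem hv hw
  · intro c v hv; rw [map_smul]; exact U.smul_mem c hv

open Classical in
/-- Concatenation with `y` from above, modulo the diagrams with southern arcs.  A loop at a central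
node is worth the parameter of the colour of this node. -/
noncomputable def leftOp (par : Γ → k) (γ : A → Γ) (y : Diagram 1 (A' ⊕ A)) :
    World k A B →ₗ[k] World k A' B :=
  Finsupp.linearCombination k fun d =>
    if SouthArc (gcomp (colourPar par γ) (Enum.univ A) y d) then 0
    else Finsupp.single (gcomp (colourPar par γ) (Enum.univ A) y d)
      (gwt (colourPar par γ) (Enum.univ A) y d)

open Classical in
theorem leftOp_single (par : Γ → k) (γ : A → Γ) (y : Diagram 1 (A' ⊕ A)) (d : Diagram 1 (A ⊕ B)) :
    leftOp par γ y (Finsupp.single d 1) =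
      if SouthArc (gcomp (colourPar par γ) (Enum.univ A) y d) then 0
      else Finsupp.single (gcomp (colourPar par γ) (Enum.univ A) y d)
        (gwt (colourPar par γ) (Enum.univ A) y d) := by
  simp [leftOp]

theorem leftOp_good {par : Γ → k} {γ₀ : A' → Γ} {γ : A → Γ} {γ' : B → Γ} {y : Diagram 1 (A' ⊕ A)}
    (hy : Compat γ₀ γ y) {v : World k A B} (hv : v ∈ goodSpace k γ γ') :
    leftOp par γ y v ∈ goodSpace k γ₀ γ' := by
  refine goodSpace_map (fun d hd => ?_) hv
  rw [leftOp_single]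
  split_ifs with h
  · exact Submodule.zero_mem _
  · exact single_mem_goodSpace ⟨hy.gcomp hd.1 _ _, h⟩ _

/-! ### Permutations of the northern and of the southern nodes -/

/-- Transport of diagrams as a linear map. -/
noncomputable def mapOp {A B A' B' : Type} (e : A ⊕ B ≃ A' ⊕ B') : World k A B →ₗ[k] World k A' B' :=
  Finsupp.lmapDomain k k (Diagram.map e)

theorem mapOp_single {A B A' B' : Type} (e : A ⊕ B ≃ A' ⊕ B') (d : Diagram 1 (A ⊕ B)) (c : k) :
    mapOp e (Finsupp.single d c) = Finsupp.single (d.map e) c := by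
  simp [mapOp]

theorem Diagram.map_eq_self {m : ℕ} {N : Type} {e : N ≃ N} (h : ∀ v, e v = v) (d : Diagram m N) :
    d.map e = d := by
  have : e = Equiv.refl N := Equiv.ext h
  rw [this, Diagram.map_refl]

theorem mapOp_injective {A B A' B' : Type} (e : A ⊕ B ≃ A' ⊕ B') :
    Function.Injective (mapOp (k := k) e) :=
  Finsupp.mapDomain_injective (Diagram.map_injective e)

theorem mapOp_mapOp {A B A' B' A'' B'' : Type} (e : A ⊕ B ≃ A' ⊕ B') (e' : A' ⊕ B' ≃ A'' ⊕ B'')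
    (v : World k A B) : mapOp e' (mapOp e v) = mapOp (e.trans e') v := by
  induction v using Finsupp.induction_linear with
  | zero => simp
  | add v w hv hw => simp only [map_add, hv, hw]
  | single d c => simp only [mapOp_single, Diagram.map_map]

variable (k A B) in
/-- The representation of the permutations of the northern nodes. -/
noncomputable def repN : Equiv.Perm A →* Module.End k (World k A B) where
  toFun g := mapOp (g.sumCongr (Equiv.refl B))
  map_one' := by
    ext d : 1
    refine LinearMap.ext_ring ?_
    simp only [LinearMap.comp_apply, Finsupp.lsingle_apply, mapOp_single]
    rw [Diagram.map_eq_self (by rintro (v | v) <;> rfl)]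
    rfl
  map_mul' g h := by
    refine LinearMap.ext fun v => ?_
    rw [Module.End.mul_apply, mapOp_mapOp]
    congr 2
    ext v; rcases v with v | v <;> rfl

variable (k A B) in
/-- The representation of the permutations of the southern nodes. -/
noncomputable def repS : Equiv.Perm B →* Module.End k (World k A B) where
  toFun g := mapOp ((Equiv.refl A).sumCongr g)
  map_one' := by
    ext d : 1
    refine LinearMap.ext_ring ?_
    simp only [LinearMap.comp_apply, Finsupp.lsingle_apply, mapOp_single]
    rw [Diagram.map_eq_self (by rintro (v | v) <;> rfl)]
    rfl
  map_mul' g h := by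
    refine LinearMap.ext fun v => ?_
    rw [Module.End.mul_apply, mapOp_mapOp]
    congr 2
    ext v; rcases v with v | v <;> rfl

theorem repN_single (g : Equiv.Perm A) (d : Diagram 1 (A ⊕ B)) (c : k) :
    repN k A B g (Finsupp.single d c) = Finsupp.single (d.map (g.sumCongr (Equiv.refl B))) c :=
  mapOp_single _ d c

theorem repS_single (g : Equiv.Perm B) (d : Diagram 1 (A ⊕ B)) (c : k) :
    repS k A B g (Finsupp.single d c) = Finsupp.single (d.map ((Equiv.refl A).sumCongr g)) c :=
  mapOp_single _ d c

theorem SouthArc.map_iff {m : ℕ} {A B A' B' : Type} (e : A ≃ A') (e' : B ≃ B')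
    (d : Diagram m (A ⊕ B)) : SouthArc (d.map (e.sumCongr e')) ↔ SouthArc d := by
  constructor
  · rintro ⟨i, j, h⟩
    refine ⟨e'.symm i, e'.symm j, ?_⟩
    have h' : (e.sumCongr e') (d.mate (.inr (e'.symm i))) = .inr j := h
    rw [← (e.sumCongr e').eq_symm_apply] at h'
    exact h'
  · rintro ⟨i, j, h⟩
    refine ⟨e' i, e' j, ?_⟩
    change (e.sumCongr e') (d.mate (.inr (e'.symm (e' i)))) = _
    rw [e'.symm_apply_apply, h]; rfl

theorem Compat.map {m : ℕ} {A B A' B' : Type} {γ : A → Γ} {γ' : B → Γ} {δ : A' → Γ} {δ' : B' → Γ}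
    {e : A ≃ A'} {e' : B ≃ B'} (h : ∀ a, δ (e a) = γ a) (h' : ∀ b, δ' (e' b) = γ' b)
    {d : Diagram m (A ⊕ B)} (hd : Compat γ γ' d) : Compat δ δ' (d.map (e.sumCongr e')) := by
  have key : ∀ v, sign δ δ' (e.sumCongr e' v) = sign γ γ' v := by
    rintro (v | v)
    · exact h v
    · exact congrArg Neg.neg (h' v)
  intro v
  obtain ⟨w, rfl⟩ := (e.sumCongr e').surjective v
  change sign δ δ' (e.sumCongr e' (d.mate ((e.sumCongr e').symm (e.sumCongr e' w)))) = _
  rw [Equiv.symm_apply_apply, key, key, hd w]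

theorem repN_good {γ : A → Γ} {γ' : B → Γ} {g : Equiv.Perm A} (hg : g ∈ colourPerms γ)
    {v : World k A B} (hv : v ∈ goodSpace k γ γ') : repN k A B g v ∈ goodSpace k γ γ' := by
  refine goodSpace_map (fun d hd => ?_) hv
  rw [repN_single]
  exact single_mem_goodSpace ⟨hd.1.map hg fun _ => rfl, fun h => hd.2 ((SouthArc.map_iff _ _ _).1 h)⟩ _

theorem repS_good {γ : A → Γ} {γ' : B → Γ} {g : Equiv.Perm B} (hg : g ∈ colourPerms γ')
    {v : World k A B} (hv : v ∈ goodSpace k γ γ') : repS k A B g v ∈ goodSpace k γ γ' := by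
  refine goodSpace_map (fun d hd => ?_) hv
  rw [repS_single]
  exact single_mem_goodSpace ⟨hd.1.map (fun _ => rfl) hg, fun h => hd.2 ((SouthArc.map_iff _ _ _).1 h)⟩ _

theorem repN_comm_repS (g : Equiv.Perm A) (h : Equiv.Perm B) : Commute (repN k A B g) (repS k A B h) := by
  refine LinearMap.ext fun v => ?_
  change mapOp _ (mapOp _ v) = mapOp _ (mapOp _ v)
  rw [mapOp_mapOp, mapOp_mapOp]
  congr 2
  ext v; rcases v with v | v <;> rfl

theorem leftOp_repS (par : Γ → k) (γ : A → Γ) (y : Diagram 1 (A' ⊕ A)) (h : Equiv.Perm B)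
    (v : World k A B) :
    leftOp par γ y (repS k A B h v) = repS k A' B h (leftOp par γ y v) := by
  classical
  have key : leftOp par γ y ∘ₗ repS k A B h = repS k A' B h ∘ₗ leftOp par γ y := by
    ext d : 1
    refine LinearMap.ext_ring ?_
    simp only [LinearMap.comp_apply, Finsupp.lsingle_apply, repS_single, leftOp_single]
    have e := gcomp_map_outer (Equiv.refl A') h (colourPar par γ) (Enum.univ A) y d
    have e0 : y.map ((Equiv.refl A').sumCongr (Equiv.refl A)) = y :=
      Diagram.map_eq_self (by rintro (v | v) <;> rfl) _
    rw [e0] at e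
    rw [e.1, e.2]
    simp only [SouthArc.map_iff]
    split_ifs
    · simp
    · rw [repS_single]
  exact LinearMap.congr_fun key v

/-- The diagram of a permutation. -/
def gperm (m : ℕ) {A : Type} (g : Equiv.Perm A) : Diagram m (A ⊕ A) :=
  (gid m A).map (g.sumCongr (Equiv.refl A))

theorem gperm_mapN {m : ℕ} {A : Type} (g h : Equiv.Perm A) :
    (gperm m g).map (h.sumCongr (Equiv.refl A)) = gperm m (h * g) := by
  ext v <;> rcases v with v | v <;> rfl

theorem gperm_mapS {m : ℕ} {A : Type} (g h : Equiv.Perm A) :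
    (gperm m g).map ((Equiv.refl A).sumCongr h) = gperm m (g * h⁻¹) := by
  ext v <;> rcases v with v | v <;> rfl

theorem gperm_injective {m : ℕ} {A : Type} : Function.Injective (gperm m (A := A)) := by
  intro g h hgh
  ext a
  have := congrFun (congrArg Diagram.mate hgh) (.inr a)
  exact Sum.inl_injective this

theorem gperm_compat {m : ℕ} {γ : A → Γ} {g : Equiv.Perm A} (hg : g ∈ colourPerms γ) :
    Compat γ γ (gperm m g) :=
  (gid_compat γ).map hg fun _ => rfl

theorem gcomp_gperm {m : ℕ} (δ : A → ZMod m → k) (L : Enum A) (g : Equiv.Perm A)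
    (d : Diagram m (A ⊕ B)) :
    gcomp δ L (gperm m g) d = d.map (g.sumCongr (Equiv.refl B)) ∧ gwt δ L (gperm m g) d = 1 := by
  have e := gcomp_map_outer g (Equiv.refl B) δ L (gid m A) d
  have e0 : d.map ((Equiv.refl A).sumCongr (Equiv.refl B)) = d :=
    Diagram.map_eq_self (by rintro (v | v) <;> rfl) _
  rw [e0, (gid_comp δ L d).1, (gid_comp δ L d).2] at e
  exact e

theorem leftOp_gperm (par : Γ → k) {γ : A → Γ} {γ' : B → Γ} (g : Equiv.Perm A) {v : World k A B}
    (hv : v ∈ goodSpace k γ γ') : leftOp par γ (gperm 1 g) v = repN k A B g v := by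
  refine goodSpace_ext (fun d hd => ?_) hv
  rw [leftOp_single, (gcomp_gperm _ _ g d).1, (gcomp_gperm _ _ g d).2, SouthArc.map_iff,
    if_neg hd.2, repN_single]

/-- A diagram on equally many northern and southern nodes without southern arcs is a permutation. -/
theorem Good.eq_gperm {γ : A → Γ} {d : Diagram 1 (A ⊕ A)} (hd : Good γ γ d) :
    ∃ g ∈ colourPerms γ, d = gperm 1 g := by
  have h1 : ∀ i : A, ∃ j, d.mate (.inr i) = .inl j := fun i => by
    rcases h : d.mate (.inr i) with j | j
    · exact ⟨j, rfl⟩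
    · exact absurd ⟨i, j, h⟩ hd.2
  choose g hg using h1
  have hinj : Function.Injective g := fun i j hij => by
    have : d.mate (.inr i) = d.mate (.inr j) := by rw [hg, hg, hij]
    have := congrArg d.mate this
    rw [d.mate_mate, d.mate_mate] at this
    exact Sum.inr_injective this
  let e : Equiv.Perm A := Equiv.ofBijective g (Finite.injective_iff_bijective.1 hinj)
  have he : ∀ i, d.mate (.inr i) = .inl (e i) := hg
  have he' : ∀ i, d.mate (.inl i) = .inr (e.symm i) := fun i => by
    have := he (e.symm i)
    rw [e.apply_symm_apply] at this
    rw [← this, d.mate_mate]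
  refine ⟨e, fun a => ?_, ?_⟩
  · have := hd.1 (.inr a)
    rw [he] at this
    simpa [sign] using this
  · ext v
    · rcases v with v | v
      · rw [he']; rfl
      · rw [he]; rfl
    · exact Subsingleton.elim (α := ZMod 1) _ _

/-! ### Diagrams with a southern arc -/

/-- If the multiplication by `arcDiag` kills a combination of diagrams, then so does every diagram with
the same southern arc. -/
theorem leftOp_eq_zero_of_arc {par : Γ → k} (hpar : ∀ c, par (-c) = par c) {γ₀ : A' → Γ}
    {γ : A → Γ} {γ' : B → Γ} {i j : A} (hij : i ≠ j) (hc : γ i = - γ j) {v : World k A B}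
    (hv : v ∈ goodSpace k γ γ') (h0 : leftOp par γ (arcDiag hij) v = 0) {y : Diagram 1 (A' ⊕ A)}
    (hy : Compat γ₀ γ y) (hyij : y.mate (.inr i) = .inr j) : leftOp par γ y v = 0 := by
  classical
  obtain ⟨f1, ⟨g, f2⟩, f3⟩ := gcomp_of_arc (C := B) (γ' := γ') hpar hij hc hy hyij (Enum.univ A)
  set cA := fun d : Diagram 1 (A ⊕ B) => gcomp (colourPar par γ) (Enum.univ A) (arcDiag hij) d
  let Φ : World k A B →ₗ[k] World k A' B := Finsupp.linearCombination k fun e =>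
    if h : ∃ d, Compat γ γ' d ∧ cA d = e then
      if SouthArc (gcomp (colourPar par γ) (Enum.univ A) y h.choose) then 0
      else Finsupp.single (gcomp (colourPar par γ) (Enum.univ A) y h.choose) (g e)
    else 0
  have key : leftOp par γ y v = (Φ ∘ₗ leftOp par γ (arcDiag hij)) v := by
    refine goodSpace_ext (fun d hd => ?_) hv
    rw [LinearMap.comp_apply, leftOp_single, leftOp_single]
    by_cases hs : SouthArc (cA d)
    · rw [if_pos hs, if_pos (f3 d hd.1 hs), map_zero]
    · have hex : ∃ d', Compat γ γ' d' ∧ cA d' = cA d := ⟨d, hd.1, rfl⟩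
      have e : gcomp (colourPar par γ) (Enum.univ A) y hex.choose =
          gcomp (colourPar par γ) (Enum.univ A) y d :=
        f1 _ _ hex.choose_spec.1 hd.1 hex.choose_spec.2
      rw [if_neg hs]
      simp only [Φ, Finsupp.linearCombination_single]
      rw [dif_pos hex, e, f2 d hd.1]
      split_ifs
      · simp
      · simp
  rw [key, LinearMap.comp_apply, h0, map_zero]

end Coloured

/-! ### The coloured invariants -/

section Invariants
open Module
variable {k : Type*} [Field k] {m : ℕ} {A A' B : Type} [Fintype A] [Fintype A'] [Fintype B]
  [DecidableEq A] [DecidableEq A'] [DecidableEq B]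

variable (k B) in
/-- The group algebra of the northern permutations acting on diagrams. -/
noncomputable def Tab.actN (t : Tab m A) : MonoidAlgebra k t.grp →ₐ[k] Module.End k (World k A B) :=
  MonoidAlgebra.lift k _ _ ((repN k A B).comp t.grp.subtype)

variable (k A) in
/-- The group algebra of the southern permutations acting on diagrams.  This is a left action; the
multiplication by a permutation from below is the action of its inverse. -/
noncomputable def Tab.actS (t' : Tab m B) : MonoidAlgebra k t'.grp →ₐ[k] Module.End k (World k A B) :=
  MonoidAlgebra.lift k _ _ ((repS k A B).comp t'.grp.subtype)

theorem Tab.actN_of (t : Tab m A) (g : t.grp) :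
    t.actN k B (MonoidAlgebra.of k t.grp g) = repN k A B g.1 := MonoidAlgebra.lift_of _ _

theorem Tab.actS_of (t' : Tab m B) (g : t'.grp) :
    t'.actS k A (MonoidAlgebra.of k t'.grp g) = repS k A B g.1 := MonoidAlgebra.lift_of _ _

theorem Tab.actN_good (t : Tab m A) {γ' : B → ZMod m} (x : MonoidAlgebra k t.grp) {v : World k A B}
    (hv : v ∈ goodSpace k t.comp γ') : t.actN k B x v ∈ goodSpace k t.comp γ' := by
  induction x using MonoidAlgebra.induction_on with
  | of g => rw [actN_of]; exact repN_good g.2 hv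
  | add x y hx hy => rw [map_add]; exact Submodule.add_mem _ hx hy
  | smul r x hx => rw [map_smul]; exact Submodule.smul_mem _ _ hx

theorem Tab.actS_good (t' : Tab m B) {γ : A → ZMod m} (x : MonoidAlgebra k t'.grp) {v : World k A B}
    (hv : v ∈ goodSpace k γ t'.comp) : t'.actS k A x v ∈ goodSpace k γ t'.comp := by
  induction x using MonoidAlgebra.induction_on with
  | of g => rw [actS_of]; exact repS_good g.2 hv
  | add x y hx hy => rw [map_add]; exact Submodule.add_mem _ hx hy
  | smul r x hx => rw [map_smul]; exact Submodule.smul_mem _ _ hx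

theorem Tab.actN_comm_actS (t : Tab m A) (t' : Tab m B) (x : MonoidAlgebra k t.grp)
    (y : MonoidAlgebra k t'.grp) : Commute (t.actN k B x) (t'.actS k A y) := by
  induction x using MonoidAlgebra.induction_on with
  | of g =>
    rw [actN_of]
    induction y using MonoidAlgebra.induction_on with
    | of h => rw [actS_of]; exact repN_comm_repS g.1 h.1
    | add x y hx hy => rw [map_add]; exact hx.add_right hy
    | smul r x hx => rw [map_smul]; exact hx.smul_right r
  | add x y hx hy => rw [map_add]; exact hx.add_left hy
  | smul r x hx => rw [map_smul]; exact hx.smul_left r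

theorem Tab.actN_actS (t : Tab m A) (t' : Tab m B) (x : MonoidAlgebra k t.grp)
    (y : MonoidAlgebra k t'.grp) (v : World k A B) :
    t.actN k B x (t'.actS k A y v) = t'.actS k A y (t.actN k B x v) :=
  LinearMap.congr_fun (t.actN_comm_actS t' x y).eq v

theorem Tab.leftOp_actS (t' : Tab m B) {Γ : Type*} [InvolutiveNeg Γ] (par : Γ → k) (γ : A → Γ)
    (y : Diagram 1 (A' ⊕ A)) (x : MonoidAlgebra k t'.grp) (v : World k A B) :
    leftOp par γ y (t'.actS k A x v) = t'.actS k A' x (leftOp par γ y v) := by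
  induction x using MonoidAlgebra.induction_on with
  | of g => rw [actS_of, actS_of, leftOp_repS]
  | add x y hx hy => rw [map_add, map_add, LinearMap.add_apply, map_add, hx, hy]; rfl
  | smul r x hx => rw [map_smul, map_smul, LinearMap.smul_apply, map_smul, hx]; rfl

variable (k A) in
/-- Multiplication by the Young symmetrizer from below. -/
noncomputable def Tab.symmS (t' : Tab m B) : World k A B →ₗ[k] World k A B :=
  t'.actS k A (t'.rho k * t'.kappa k)

variable (k) in
/-- The space `x X x'`, where `X` is spanned by the `Good` diagrams and `x`, `x'` are the Young
symmetrizers of the two tableaux. -/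
noncomputable def cellSpace (t : Tab m A) (t' : Tab m B) : Submodule k (World k A B) :=
  (goodSpace k t.comp t'.comp).map (t.actN k B (t.symm k) ∘ₗ t'.symmS k A)

/-- The operators `x y`, where `y` is a coloured diagram with a southern arc. -/
def cellOps (B : Type) [Fintype B] [DecidableEq B] (par : ZMod m → k) (t : Tab m A) :
    Set (World k A B →ₗ[k] World k A B) :=
  {T | ∃ y, Compat t.comp t.comp y ∧ SouthArc y ∧
    T = t.actN k B (t.symm k) ∘ₗ leftOp par t.comp y}

/-- The number of composition factors of `x X x'` on which all operators `x y` vanish. -/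
noncomputable def cellMult (par : ZMod m → k) (t : Tab m A) (t' : Tab m B) : ℕ :=
  nullLen (cellOps B par t) ⊥ (cellSpace k t t')

/-- The elements of `x X x'` that are killed by all coloured diagrams with a southern arc. -/
noncomputable def arcKernel (par : ZMod m → k) (t : Tab m A) (t' : Tab m B) : Submodule k (World k A B) :=
  cellSpace k t t' ⊓ ⨅ (i : A) (j : A) (hij : i ≠ j) (_ : t.comp i = - t.comp j),
    LinearMap.ker (leftOp par t.comp (arcDiag hij))

theorem mem_arcKernel {par : ZMod m → k} {t : Tab m A} {t' : Tab m B} {v : World k A B} :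
    v ∈ arcKernel par t t' ↔ v ∈ cellSpace k t t' ∧ ∀ i j, ∀ hij : i ≠ j, t.comp i = - t.comp j →
      leftOp par t.comp (arcDiag hij) v = 0 := by
  simp [arcKernel, Submodule.mem_iInf]

theorem cellSpace_le (t : Tab m A) (t' : Tab m B) :
    cellSpace k t t' ≤ goodSpace k t.comp t'.comp := by
  rintro _ ⟨v, hv, rfl⟩
  exact t.actN_good _ (t'.actS_good _ hv)

theorem mem_cellSpace {t : Tab m A} {t' : Tab m B} {v : World k A B} (hv : v ∈ goodSpace k t.comp t'.comp) :
    t.actN k B (t.symm k) (t'.symmS k A v) ∈ cellSpace k t t' := ⟨v, hv, rfl⟩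

/-- The elements of the group algebra act on `x X x'` by scalars, after multiplication by `x`. -/
theorem actN_cellSpace (t : Tab m A) (t' : Tab m B) {y : MonoidAlgebra k t.grp} {ε : k}
    (hy : t.symm k * y * t.symm k = ε • t.symm k) {v : World k A B} (hv : v ∈ cellSpace k t t') :
    t.actN k B (t.symm k * y) v = ε • v := by
  obtain ⟨w, hw, rfl⟩ := hv
  simp only [LinearMap.comp_apply]
  rw [← Module.End.mul_apply, ← map_mul, hy, map_smul, LinearMap.smul_apply]

theorem cellOps_mem {par : ZMod m → k} {t : Tab m A} {t' : Tab m B} {y : Diagram 1 (A ⊕ A)}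
    (hy : Compat t.comp t.comp y) {v : World k A B} (hv : v ∈ cellSpace k t t') :
    t.actN k B (t.symm k) (leftOp par t.comp y v) ∈ cellSpace k t t' := by
  obtain ⟨w, hw, rfl⟩ := hv
  refine ⟨leftOp par t.comp y (t.actN k B (t.symm k) w), leftOp_good hy (t.actN_good _ hw), ?_⟩
  simp only [LinearMap.comp_apply, Tab.symmS]
  rw [← Tab.leftOp_actS, ← Tab.actN_actS]

theorem cellSpace_stab (par : ZMod m → k) (t : Tab m A) (t' : Tab m B) :
    Stab (cellOps B par t) (cellSpace k t t') := by
  rintro _ ⟨y, hy, -, rfl⟩ v hv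
  exact cellOps_mem hy hv

/-- The diagrams `arcDiag` suffice in the definition of `arcKernel`, since every diagram with a southern arc
kills what the corresponding `arcDiag` kills. -/
theorem leftOp_eq_zero {par : ZMod m → k} (hpar : ∀ c, par (-c) = par c) {t : Tab m A}
    {t' : Tab m B} {v : World k A B} (hv : v ∈ arcKernel par t t') {γ₀ : A' → ZMod m}
    {y : Diagram 1 (A' ⊕ A)} (hy : Compat γ₀ t.comp y) (hs : SouthArc y) :
    leftOp par t.comp y v = 0 := by
  obtain ⟨i, j, hij⟩ := hs
  have hne : i ≠ j := by rintro rfl; exact y.mate_ne _ hij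
  have hc : t.comp i = - t.comp j := by
    have := hy (.inr i)
    rw [hij] at this
    simpa [sign, eq_comm] using this
  rw [mem_arcKernel] at hv
  exact leftOp_eq_zero_of_arc hpar hne hc (cellSpace_le t t' hv.1) (hv.2 i j hne hc) hy hij

end Invariants

/-! ### Evaluation of standard modules by the coloured invariants -/

section Evaluation
open Module
variable {k : Type*} [Field k] {m : ℕ} {A B : Type} [Fintype A] [Fintype B]
  [DecidableEq A] [DecidableEq B] {R : Type*} [Ring R] [Algebra k R]
  {N : Type*} [AddCommGroup N] [Module k N] [Module R N] [IsScalarTower k R N]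
  {N₀ : Type*} [AddCommGroup N₀] [Module k N₀] [Module R N₀] [IsScalarTower k R N₀]

/-- The elements `β y` of `R` attached to the coloured diagrams `y` span `e R e`, where `e` is the
idempotent of the identity diagram, and permutations are multiplied as usual. -/
structure Truncates (t : Tab m A) (β : Diagram 1 (A ⊕ A) → R) : Prop where
  mul : ∀ g ∈ t.grp, ∀ h ∈ t.grp, β (gperm 1 g) * β (gperm 1 h) = β (gperm 1 (g * h))
  corner : ∀ b : R, β (gperm 1 1) * b * β (gperm 1 1) ∈
    Submodule.span k (β '' {y | Compat t.comp t.comp y})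

/-- The part `e M` of the module `M` is the image under `E` of the span of the `Good` diagrams,
multiplied by a Young symmetrizer from below. -/
structure Realises (par : ZMod m → k) (t : Tab m A) (t' : Tab m B) (β : Diagram 1 (A ⊕ A) → R)
    (E : World k A B →ₗ[k] N) (M : Submodule R N) : Prop where
  act : ∀ y d, Compat t.comp t.comp y → Good t.comp t'.comp d →
    β y • E (Finsupp.single d 1) = E (leftOp par t.comp y (Finsupp.single d 1))
  inj : ∀ v ∈ goodSpace k t.comp t'.comp, E v = 0 → v = 0
  mem : ∀ v ∈ goodSpace k t.comp t'.comp, E (t'.symmS k A v) ∈ M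
  cut : ∀ n ∈ M, ∃ v ∈ goodSpace k t.comp t'.comp, β (gperm 1 1) • n = E (t'.symmS k A v)

/-- The group algebra mapped to `R`. -/
noncomputable def Truncates.emb {t : Tab m A} {β : Diagram 1 (A ⊕ A) → R}
    (h : Truncates (k := k) t β) : MonoidAlgebra k t.grp →ₙₐ[k] R :=
  MonoidAlgebra.liftMagma k ⟨fun g => β (gperm 1 g.1), fun g h' => (h.mul _ g.2 _ h'.2).symm⟩

theorem Truncates.emb_of {t : Tab m A} {β : Diagram 1 (A ⊕ A) → R}
    (h : Truncates (k := k) t β) (g : t.grp) :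
    h.emb (MonoidAlgebra.of k t.grp g) = β (gperm 1 g.1) := by
  simp [emb]

theorem Truncates.one_emb {t : Tab m A} {β : Diagram 1 (A ⊕ A) → R}
    (h : Truncates (k := k) t β) (x : MonoidAlgebra k t.grp) :
    β (gperm 1 1) * h.emb x = h.emb x ∧ h.emb x * β (gperm 1 1) = h.emb x := by
  have e := h.emb_of 1
  simp only [map_one] at e
  rw [show β (gperm 1 1) = h.emb 1 from e.symm, ← map_mul, ← map_mul, one_mul, mul_one]
  exact ⟨rfl, rfl⟩

variable {par : ZMod m → k} {t : Tab m A} {t' : Tab m B} {β : Diagram 1 (A ⊕ A) → R}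
  {E : World k A B →ₗ[k] N} {M : Submodule R N}

theorem Realises.act_good (h : Realises par t t' β E M) {y : Diagram 1 (A ⊕ A)}
    (hy : Compat t.comp t.comp y) {v : World k A B} (hv : v ∈ goodSpace k t.comp t'.comp) :
    β y • E v = E (leftOp par t.comp y v) :=
  goodSpace_ext (f := Algebra.lsmul k k N (β y) ∘ₗ E) (g := E ∘ₗ leftOp par t.comp y)
    (fun d hd => h.act y d hy hd) hv

theorem Realises.emb_smul (h : Realises par t t' β E M) (hT : Truncates (k := k) t β)
    (x : MonoidAlgebra k t.grp) {v : World k A B} (hv : v ∈ goodSpace k t.comp t'.comp) :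
    hT.emb x • E v = E (t.actN k B x v) := by
  induction x using MonoidAlgebra.induction_on with
  | of g => rw [hT.emb_of, h.act_good (gperm_compat g.2) hv, leftOp_gperm par g.1 hv, t.actN_of]
  | add x y hx hy => rw [map_add, add_smul, hx, hy, map_add, LinearMap.add_apply, map_add]
  | smul r x hx => rw [map_smul, smul_assoc, hx, map_smul, LinearMap.smul_apply, map_smul]

/-- Multiplying the identity diagram by the Young symmetrizer from below or from above is the same. -/
theorem Tab.symmS_one (t : Tab m A) :
    t.symmS k A (Finsupp.single (gperm 1 1) 1) =
      t.actN k A (t.symm k) (Finsupp.single (gperm 1 1) 1) := by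
  classical
  have e : ∀ g : Equiv.Perm A, repS k A A g (Finsupp.single (gperm 1 1) 1) =
      repN k A A g⁻¹ (Finsupp.single (gperm 1 1) 1) := by
    intro g
    rw [repS_single, repN_single]
    rw [gperm_mapN, gperm_mapS, one_mul, mul_one]
  have e1 : t.actS k A (t.kappa k) (Finsupp.single (gperm 1 1) 1) =
      t.actN k A (t.kappa k) (Finsupp.single (gperm 1 1) 1) := by
    simp only [kappa, map_sum, map_zsmul, actN_of, actS_of, LinearMap.sum_apply,
      LinearMap.smul_apply, e]
    refine Finset.sum_bij' (fun g _ => g⁻¹) (fun g _ => g⁻¹) ?_ ?_ (by simp) (by simp) ?_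
    · intro g hg
      simp only [Finset.mem_filter, Finset.mem_univ, true_and] at hg ⊢
      intro a
      have := hg (g.1⁻¹ a)
      rw [perm_apply_inv] at this
      exact ⟨this.1.symm, this.2.symm⟩
    · intro g hg
      simp only [Finset.mem_filter, Finset.mem_univ, true_and] at hg ⊢
      intro a
      have := hg (g.1⁻¹ a)
      rw [perm_apply_inv] at this
      exact ⟨this.1.symm, this.2.symm⟩
    · intro g _
      simp
  have e2 : t.actS k A (t.rho k) (Finsupp.single (gperm 1 1) 1) =
      t.actN k A (t.rho k) (Finsupp.single (gperm 1 1) 1) := by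
    simp only [rho, map_sum, actN_of, actS_of, LinearMap.sum_apply, e]
    refine Finset.sum_bij' (fun g _ => g⁻¹) (fun g _ => g⁻¹) ?_ ?_ (by simp) (by simp) ?_
    · intro g hg
      simp only [Finset.mem_filter, Finset.mem_univ, true_and] at hg ⊢
      intro a
      have := hg (g.1⁻¹ a)
      rw [perm_apply_inv] at this
      exact ⟨this.1.symm, this.2.symm⟩
    · intro g hg
      simp only [Finset.mem_filter, Finset.mem_univ, true_and] at hg ⊢
      intro a
      have := hg (g.1⁻¹ a)
      rw [perm_apply_inv] at this
      exact ⟨this.1.symm, this.2.symm⟩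
    · intro g _
      simp
  rw [symmS, map_mul, Module.End.mul_apply, e1, ← t.actN_actS, e2, ← Module.End.mul_apply, ← map_mul]
  rfl

/-- The permutation diagrams are linearly independent. -/
theorem actN_one_injective (t : Tab m A) {x : MonoidAlgebra k t.grp}
    (hx : t.actN k A x (Finsupp.single (gperm 1 1) 1) = 0) : x = 0 := by
  classical
  have key : ∀ (x : MonoidAlgebra k t.grp) (g : t.grp),
      t.actN k A x (Finsupp.single (gperm 1 1) 1) (gperm 1 g.1) = x.coeff g := by
    intro x g
    induction x using MonoidAlgebra.induction_on with
    | of h =>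
      rw [t.actN_of, repN_single, gperm_mapN, mul_one, MonoidAlgebra.of_apply, MonoidAlgebra.coeff_single,
        Finsupp.single_apply, Finsupp.single_apply]
      simp only [gperm_injective.eq_iff, Subtype.ext_iff]
    | add x y hx hy => simp [hx, hy]
    | smul r x hx => simp [hx]
  apply MonoidAlgebra.coeff_injective
  ext g
  rw [← key, hx]
  simp

end Evaluation

section Evaluation
open Module
variable {k : Type*} [Field k] {m : ℕ} {A B : Type} [Fintype A] [Fintype B]
  [DecidableEq A] [DecidableEq B] {R : Type*} [Ring R] [Algebra k R]
  {N : Type*} [AddCommGroup N] [Module k N] [Module R N] [IsScalarTower k R N]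
  {N₀ : Type*} [AddCommGroup N₀] [Module k N₀] [Module R N₀] [IsScalarTower k R N₀]
  {par : ZMod m → k} {t : Tab m A} {t' : Tab m B} {β : Diagram 1 (A ⊕ A) → R}
  {E : World k A B →ₗ[k] N} {M : Submodule R N} {E₀ : World k A A →ₗ[k] N₀} {D : Submodule R N₀}

theorem Tab.symmS_good (t' : Tab m B) {γ : A → ZMod m} {v : World k A B}
    (hv : v ∈ goodSpace k γ t'.comp) : t'.symmS k A v ∈ goodSpace k γ t'.comp :=
  t'.actS_good _ hv

theorem gperm_one_good (t : Tab m A) : Good t.comp t.comp (gperm 1 (1 : Equiv.Perm A)) :=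
  ⟨gperm_compat (one_mem _), by rintro ⟨i, j, h⟩; simp [gperm, gid, Diagram.map] at h⟩

/-- The vector that generates the standard module. -/
noncomputable def Realises.gen (h : Realises par t t β E₀ D) : D :=
  ⟨E₀ (t.symmS k A (Finsupp.single (gperm 1 1) 1)),
    h.mem _ (single_mem_goodSpace (gperm_one_good t) 1)⟩

/-- The elements `x y x` of `R`, where `x` is the Young symmetrizer and `y` a diagram with southern
arcs. -/
noncomputable def Truncates.arcs (hT : Truncates (k := k) t β) : Set R :=
  {i | ∃ y, Compat t.comp t.comp y ∧ SouthArc y ∧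
    i = hT.emb (t.symm k) * β y * hT.emb (t.symm k)}

/-- The corner `x R x` consists of multiples of `x` and of combinations of the `x y x` in `arcs`: diagrams
without southern arcs are permutations, to which von Neumann's lemma applies. -/
theorem Truncates.corner_symm (hT : Truncates (k := k) t β)
    (hk : ((Fintype.card A).factorial : k) ≠ 0) (b : R) :
    ∃ a : k, hT.emb (t.symm k) * b * hT.emb (t.symm k) - a • hT.emb (t.symm k) ∈
      Submodule.span k hT.arcs := by
  set x := hT.emb (t.symm k) with hx
  have e : x * b * x = x * (β (gperm 1 1) * b * β (gperm 1 1)) * x := by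
    calc x * b * x = (x * β (gperm 1 1)) * b * (β (gperm 1 1) * x) := by
          rw [(hT.one_emb _).1, (hT.one_emb _).2]
      _ = _ := by simp only [mul_assoc]
  rw [e]
  have h0 := hT.corner b
  clear e
  generalize β (gperm 1 1) * b * β (gperm 1 1) = z at h0 ⊢
  induction h0 using Submodule.span_induction with
  | mem y hy =>
    obtain ⟨y, hy, rfl⟩ := hy
    by_cases hs : SouthArc y
    · exact ⟨0, by rw [zero_smul, sub_zero]; exact Submodule.subset_span ⟨y, hy, hs, rfl⟩⟩
    · obtain ⟨g, hg, rfl⟩ := Good.eq_gperm (γ := t.comp) ⟨hy, hs⟩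
      obtain ⟨ε, hε⟩ := t.symm_mul_mul_symm k (Tab.two_ne_zero_of_factorial hk)
        (MonoidAlgebra.of k t.grp ⟨g, hg⟩)
      refine ⟨ε, ?_⟩
      have := congrArg hT.emb hε
      rw [map_mul, map_mul, hT.emb_of, map_smul] at this
      rw [this, sub_self]
      exact Submodule.zero_mem _
  | zero => exact ⟨0, by simp⟩
  | add y z _ _ hy hz =>
    obtain ⟨a, ha⟩ := hy
    obtain ⟨b, hb⟩ := hz
    refine ⟨a + b, ?_⟩
    have := Submodule.add_mem _ ha hb
    convert this using 1
    rw [mul_add, add_mul, add_smul]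
    abel
  | smul r y _ hy =>
    obtain ⟨a, ha⟩ := hy
    refine ⟨r * a, ?_⟩
    have := Submodule.smul_mem _ r ha
    rwa [smul_sub, smul_smul, ← smul_mul_assoc, ← mul_smul_comm] at this

/-- The data that make the standard module `D` accessible: it is generated by `x`, on which diagrams
with southern arcs vanish. -/
structure Standard (h : Realises par t t β E₀ D) : Prop where
  gen : ∀ v : D, ∃ b : R, v = b • h.gen
  kill : ∀ y, Compat t.comp t.comp y → SouthArc y → β y • h.gen = 0

theorem Realises.gen_coe (h : Realises par t t β E₀ D) :
    (h.gen : N₀) = E₀ (t.actN k A (t.symm k) (Finsupp.single (gperm 1 1) 1)) := by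
  rw [← t.symmS_one]; rfl

theorem Realises.emb_gen (h : Realises par t t β E₀ D) (hT : Truncates (k := k) t β) {c : k}
    (hcc : t.symm k * t.symm k = c • t.symm k) : hT.emb (t.symm k) • h.gen = c • h.gen := by
  apply Subtype.ext
  rw [Submodule.coe_smul, Submodule.coe_smul_of_tower, h.gen_coe,
    h.emb_smul hT _ (t.actN_good _ (single_mem_goodSpace (gperm_one_good t) 1)),
    ← Module.End.mul_apply, ← map_mul, hcc, map_smul, LinearMap.smul_apply, map_smul]

/-- The Young symmetrizer, normalized to an idempotent, is the primitive idempotent of the standard module. -/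
theorem Realises.cuts (h : Realises par t t β E₀ D) (hT : Truncates (k := k) t β) (hS : Standard h)
    (hk : ((Fintype.card A).factorial : k) ≠ 0) {c : k} (hc : c ≠ 0)
    (hcc : t.symm k * t.symm k = c • t.symm k) :
    Cuts (k := k) (c⁻¹ • hT.emb (t.symm k)) h.gen hT.arcs := by
  have hg := single_mem_goodSpace (k := k) (gperm_one_good t) 1
  have hxx : hT.emb (t.symm k) * hT.emb (t.symm k) = c • hT.emb (t.symm k) := by
    rw [← map_mul, hcc, map_smul]
  refine ⟨?_, ?_, ?_, hS.gen, ?_, ?_, ?_, ?_, ?_⟩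
  · rw [smul_mul_smul_comm, hxx, smul_smul, mul_assoc, inv_mul_cancel₀ hc, mul_one]
  · rw [smul_assoc, h.emb_gen hT hcc, smul_smul, inv_mul_cancel₀ hc, one_smul]
  · intro h0
    have h1 : (h.gen : N₀) = 0 := by rw [h0]; rfl
    rw [h.gen_coe] at h1
    have h2 := actN_one_injective t (h.inj _ (t.actN_good _ hg) h1)
    exact t.symm_sq_ne_zero k hk (by rw [h2, zero_mul])
  · intro v
    obtain ⟨w, hw, hwv⟩ := h.cut v v.2
    -- the `Good` diagrams are permutations, so that `x v` is `x y x` for some `y` in the group algebra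
    have h1 : ∃ a : k, t.actN k A (t.symm k) (t.symmS k A w) =
        a • t.actN k A (t.symm k) (Finsupp.single (gperm 1 1) 1) := by
      refine goodSpace_induction (P := fun w => ∃ a : k, t.actN k A (t.symm k) (t.symmS k A w) =
        a • t.actN k A (t.symm k) (Finsupp.single (gperm 1 1) 1)) hw ⟨0, by simp⟩ ?_ ?_ ?_
      · rintro v w ⟨a, ha⟩ ⟨b, hb⟩
        exact ⟨a + b, by rw [map_add, map_add, ha, hb, add_smul]⟩
      · rintro r v ⟨a, ha⟩
        exact ⟨r * a, by rw [map_smul, map_smul, ha, smul_smul]⟩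
      · intro d hd
        obtain ⟨g, hg, rfl⟩ := hd.eq_gperm
        obtain ⟨ε, hε⟩ := t.symm_mul_mul_symm k (Tab.two_ne_zero_of_factorial hk)
          (MonoidAlgebra.of k t.grp ⟨g, hg⟩)
        refine ⟨ε, ?_⟩
        have e : (Finsupp.single (gperm 1 g) 1 : World k A A) =
            t.actN k A (MonoidAlgebra.of k t.grp ⟨g, hg⟩) (Finsupp.single (gperm 1 1) 1) := by
          rw [t.actN_of, repN_single, gperm_mapN, mul_one]
        rw [e, Tab.symmS, ← t.actN_actS, ← Tab.symmS, t.symmS_one, ← Module.End.mul_apply,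
          ← Module.End.mul_apply, ← map_mul, ← map_mul, hε, map_smul, LinearMap.smul_apply]
    obtain ⟨a, ha⟩ := h1
    refine ⟨c⁻¹ * a, ?_⟩
    apply Subtype.ext
    rw [Submodule.coe_smul, Submodule.coe_smul_of_tower, h.gen_coe, smul_assoc, ← (hT.one_emb _).2,
      mul_smul, hwv, h.emb_smul hT _ (t.symmS_good hw), ha, map_smul, smul_smul]
  · intro b
    obtain ⟨a, ha⟩ := hT.corner_symm hk b
    refine ⟨c⁻¹ * a, ?_⟩
    have := Submodule.smul_mem _ (c⁻¹ * c⁻¹) ha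
    convert this using 1
    rw [smul_sub, smul_mul_assoc, smul_mul_smul_comm, smul_smul, smul_smul]
    congr 2
    ring
  · rintro _ ⟨y, hy, hs, rfl⟩
    rw [mul_assoc, mul_smul, mul_smul, h.emb_gen hT hcc, smul_comm (β y) c, hS.kill y hy hs,
      smul_zero, smul_zero]
  · rintro _ ⟨y, hy, hs, rfl⟩
    rw [smul_mul_assoc, mul_assoc, ← mul_assoc _ _ (β y * _), hxx, smul_mul_assoc, smul_smul,
      inv_mul_cancel₀ hc, one_smul]
  · rintro _ ⟨y, hy, hs, rfl⟩
    rw [mul_smul_comm, mul_assoc, hxx, mul_smul_comm, smul_smul, inv_mul_cancel₀ hc, one_smul]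

/-- The embedding of `x X x'` into the module. -/
noncomputable def Realises.incl (h : Realises par t t' β E M) : cellSpace k t t' →ₗ[k] M :=
  LinearMap.codRestrict (M.restrictScalars k) (E ∘ₗ (cellSpace k t t').subtype) (by
    rintro ⟨_, v, hv, rfl⟩
    simp only [LinearMap.comp_apply, Submodule.subtype_apply, Submodule.restrictScalars_mem]
    rw [Tab.symmS, Tab.actN_actS]
    exact h.mem _ (t.actN_good _ hv))

theorem Realises.incl_coe (h : Realises par t t' β E M) (v : cellSpace k t t') :
    (h.incl v : N) = E v := rfl

theorem Realises.incl_injective (h : Realises par t t' β E M) : Function.Injective h.incl := by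
  intro v w hvw
  apply Subtype.ext
  rw [← sub_eq_zero]
  refine h.inj _ (Submodule.sub_mem _ (cellSpace_le t t' v.2) (cellSpace_le t t' w.2)) ?_
  rw [map_sub, ← h.incl_coe, ← h.incl_coe, hvw, sub_self]

theorem Realises.emb_incl (h : Realises par t t' β E M) (hT : Truncates (k := k) t β) {c : k}
    (hcc : t.symm k * t.symm k = c • t.symm k) (v : cellSpace k t t') :
    hT.emb (t.symm k) • h.incl v = c • h.incl v := by
  apply Subtype.ext
  rw [Submodule.coe_smul, Submodule.coe_smul_of_tower, h.incl_coe,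
    h.emb_smul hT _ (cellSpace_le t t' v.2)]
  have := actN_cellSpace (k := k) t t' (y := 1) (ε := c) (by rw [mul_one, hcc]) v.2
  rw [mul_one] at this
  rw [this, map_smul]

/-- The part of `M` cut out by the Young symmetrizer is `x X x'`. -/
theorem Realises.range_incl (h : Realises par t t' β E M) (hT : Truncates (k := k) t β) {c : k}
    (hc : c ≠ 0) (hcc : t.symm k * t.symm k = c • t.symm k) :
    LinearMap.range h.incl =
      LinearMap.range (Algebra.lsmul k k M (c⁻¹ • hT.emb (t.symm k))) := by
  apply le_antisymm
  · rintro _ ⟨v, rfl⟩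
    refine ⟨h.incl v, ?_⟩
    change (c⁻¹ • hT.emb (t.symm k)) • h.incl v = _
    rw [smul_assoc, h.emb_incl hT hcc, smul_smul, inv_mul_cancel₀ hc, one_smul]
  · rintro _ ⟨n, rfl⟩
    obtain ⟨w, hw, hwn⟩ := h.cut n n.2
    refine ⟨c⁻¹ • ⟨_, mem_cellSpace hw⟩, ?_⟩
    apply Subtype.ext
    change _ = (c⁻¹ • hT.emb (t.symm k)) • (n : N)
    rw [map_smul, Submodule.coe_smul_of_tower, h.incl_coe, smul_assoc, ← (hT.one_emb _).2, mul_smul,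
      hwn, h.emb_smul hT _ (t'.symmS_good hw)]

theorem Realises.arc_incl (h : Realises par t t' β E M) (hT : Truncates (k := k) t β) {c : k}
    (hcc : t.symm k * t.symm k = c • t.symm k) {y : Diagram 1 (A ⊕ A)} (hy : Compat t.comp t.comp y)
    (v : cellSpace k t t') :
    (hT.emb (t.symm k) * β y * hT.emb (t.symm k)) • h.incl v =
      c • h.incl ⟨_, cellOps_mem (par := par) hy v.2⟩ := by
  rw [mul_smul, h.emb_incl hT hcc, smul_comm]
  congr 1
  apply Subtype.ext
  rw [Submodule.coe_smul, h.incl_coe, h.incl_coe, mul_smul, h.act_good hy (cellSpace_le t t' v.2),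
    h.emb_smul hT _ (leftOp_good hy (cellSpace_le t t' v.2))]

theorem Realises.ops_incl (h : Realises par t t' β E M) (hT : Truncates (k := k) t β) {c : k}
    (hcc : t.symm k * t.symm k = c • t.symm k) :
    ∀ s ∈ opsOf k M hT.arcs, ∃ u, Dom (subOps (cellSpace_stab par t t')) u ∧
      s ∘ₗ h.incl = h.incl ∘ₗ u := by
  intro s hs
  obtain ⟨i, hi, rfl⟩ := hs
  obtain ⟨y, hy, hs, rfl⟩ := hi
  let T : cellOps (k := k) B par t := ⟨t.actN k B (t.symm k) ∘ₗ leftOp par t.comp y, y, hy, hs, rfl⟩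
  refine ⟨c • T.1.restrict (cellSpace_stab par t t' T.1 T.2),
    Dom.smul (Dom.of_mem (Set.mem_range_self T)) c, LinearMap.ext fun v => ?_⟩
  exact (h.arc_incl hT hcc hy v).trans (map_smul h.incl c _).symm

theorem Realises.incl_ops (h : Realises par t t' β E M) (hT : Truncates (k := k) t β) {c : k}
    (hc : c ≠ 0) (hcc : t.symm k * t.symm k = c • t.symm k) :
    ∀ s ∈ subOps (cellSpace_stab par t t'), ∃ u, Dom (opsOf k M hT.arcs) u ∧
      h.incl ∘ₗ s = u ∘ₗ h.incl := by
  intro s hs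
  obtain ⟨⟨_, y, hy, hs, rfl⟩, rfl⟩ := hs
  have hi : hT.emb (t.symm k) * β y * hT.emb (t.symm k) ∈ hT.arcs := ⟨y, hy, hs, rfl⟩
  refine ⟨c⁻¹ • Algebra.lsmul k k M (hT.emb (t.symm k) * β y * hT.emb (t.symm k)),
    Dom.smul (Dom.of_mem (Set.mem_image_of_mem _ hi)) _, LinearMap.ext fun v => ?_⟩
  change _ = c⁻¹ • ((hT.emb (t.symm k) * β y * hT.emb (t.symm k)) • h.incl v)
  rw [h.arc_incl hT hcc hy v, smul_smul, inv_mul_cancel₀ hc, one_smul]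
  rfl

/-- The multiplicity of the head of `D` in `M` is the coloured multiplicity. -/
theorem Realises.multiplicity_eq [FiniteDimensional k N] (h : Realises par t t' β E M)
    (h₀ : Realises par t t β E₀ D) (hT : Truncates (k := k) t β) (hS : Standard h₀)
    (hk : ((Fintype.card A).factorial : k) ≠ 0) :
    multiplicity R M (head R D) = cellMult par t t' := by
  obtain ⟨c, hc, hcc⟩ := t.symm_sq k hk
  have : FiniteDimensional k M :=
    FiniteDimensional.of_injective (M.restrictScalars k).subtype (Submodule.injective_subtype _)
  have h1 := (h₀.cuts hT hS hk hc hcc).multiplicity_eq (M := M)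
  have h2 := nullLen_map (S := subOps (cellSpace_stab par t t')) (S' := opsOf k M hT.arcs)
    h.incl h.incl_injective (h.ops_incl hT hcc) (h.incl_ops hT hc hcc)
    (stab_bot _) (stab_top _) bot_le
  rw [Submodule.map_bot, Submodule.map_top, h.range_incl hT hc hcc] at h2
  rw [h1, h2, nullLen_sub]
  rfl

/-- The homomorphisms `D → M` correspond to the vectors of `arcKernel`.  They send the generator to a vector
of `x X x'` which is killed by diagrams with southern arcs since the generator is; conversely, by `hann`
such vectors are killed by the whole annihilator of the generator. -/
theorem Realises.finrank_hom (h : Realises par t t' β E M)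
    (h₀ : Realises par t t β E₀ D) (hT : Truncates (k := k) t β) (hS : Standard h₀)
    (hk : ((Fintype.card A).factorial : k) ≠ 0)
    (hann : ∀ b : R, b • h₀.gen = 0 → ∀ v ∈ arcKernel par t t', b • E v = 0) :
    finrank k (D →ₗ[R] M) = finrank k (arcKernel par t t') := by
  obtain ⟨c, hc, hcc⟩ := t.symm_sq k hk
  have hcut := h₀.cuts hT hS hk hc hcc
  obtain ⟨e⟩ := hcut.hom_equiv (M := M)
  rw [e.finrank_eq]
  have key : Cuts.homVecs k (B := R) M h₀.gen =
      ((arcKernel par t t').comap (cellSpace k t t').subtype).map h.incl := by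
    apply le_antisymm
    · intro w hw
      have h1 : w = (c⁻¹ • hT.emb (t.symm k)) • w := by
        have := hw (1 - c⁻¹ • hT.emb (t.symm k)) (by rw [sub_smul, hcut.fix, one_smul, sub_self])
        rw [sub_smul, one_smul, sub_eq_zero] at this
        exact this
      have h2 : w ∈ LinearMap.range h.incl := by
        rw [h.range_incl hT hc hcc]
        exact ⟨w, h1.symm⟩
      obtain ⟨v, rfl⟩ := h2
      refine ⟨v, ?_, rfl⟩
      simp only [SetLike.mem_coe, Submodule.mem_comap, Submodule.subtype_apply, mem_arcKernel]
      refine ⟨v.2, fun i j hij hij' => ?_⟩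
      have hy := arcDiag_compat hij hij'
      refine h.inj _ (leftOp_good hy (cellSpace_le t t' v.2)) ?_
      rw [← h.act_good hy (cellSpace_le t t' v.2)]
      have := hw (β (arcDiag hij)) (hS.kill _ hy ⟨i, j, by simp [arcDiag]⟩)
      exact congrArg Subtype.val this
    · intro w hw b hb
      obtain ⟨v, hv, rfl⟩ := hw
      apply Subtype.ext
      exact hann b hb _ hv
  rw [key, ← (Submodule.equivMapOfInjective h.incl h.incl_injective _).finrank_eq]
  have := Submodule.finrank_map_subtype_eq _ ((arcKernel par t t').comap (cellSpace k t t').subtype)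
  rw [← this, Submodule.map_comap_subtype, inf_eq_right.2]
  exact fun v hv => (mem_arcKernel.1 hv).1

end Evaluation

/-! ### Dependence of the coloured invariants on the colours -/

section Transport
open Module
variable {k : Type*} [Field k] {m m' : ℕ} {A B A' B' : Type} [Fintype A] [Fintype B]
  [DecidableEq A] [DecidableEq B] [Fintype A'] [Fintype B'] [DecidableEq A'] [DecidableEq B']

open Classical in
theorem Tab.actN_kappa (t : Tab m A) (v : World k A B) :
    t.actN k B (t.kappa k) v =
      ∑ g : Equiv.Perm A with t.ColPres g, (Equiv.Perm.sign g : ℤ) • repN k A B g v := by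
  simp only [kappa, map_sum, map_zsmul, actN_of, LinearMap.sum_apply, LinearMap.smul_apply]
  refine Finset.sum_bij (fun g _ => g.1) ?_ (fun _ _ _ _ h => Subtype.ext h) ?_ (fun _ _ => rfl)
  · intro g hg; simpa using hg
  · intro g hg
    simp only [Finset.mem_filter, Finset.mem_univ, true_and] at hg
    exact ⟨⟨g, fun a => (hg a).1⟩, by simpa using hg, rfl⟩

open Classical in
theorem Tab.actN_rho (t : Tab m A) (v : World k A B) :
    t.actN k B (t.rho k) v = ∑ g : Equiv.Perm A with t.RowPres g, repN k A B g v := by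
  simp only [rho, map_sum, actN_of, LinearMap.sum_apply]
  refine Finset.sum_bij (fun g _ => g.1) ?_ (fun _ _ _ _ h => Subtype.ext h) ?_ (fun _ _ => rfl)
  · intro g hg; simpa using hg
  · intro g hg
    simp only [Finset.mem_filter, Finset.mem_univ, true_and] at hg
    exact ⟨⟨g, fun a => (hg a).1⟩, by simpa using hg, rfl⟩

open Classical in
theorem Tab.actS_kappa (t : Tab m B) (v : World k A B) :
    t.actS k A (t.kappa k) v =
      ∑ g : Equiv.Perm B with t.ColPres g, (Equiv.Perm.sign g : ℤ) • repS k A B g v := by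
  simp only [kappa, map_sum, map_zsmul, actS_of, LinearMap.sum_apply, LinearMap.smul_apply]
  refine Finset.sum_bij (fun g _ => g.1) ?_ (fun _ _ _ _ h => Subtype.ext h) ?_ (fun _ _ => rfl)
  · intro g hg; simpa using hg
  · intro g hg
    simp only [Finset.mem_filter, Finset.mem_univ, true_and] at hg
    exact ⟨⟨g, fun a => (hg a).1⟩, by simpa using hg, rfl⟩

open Classical in
theorem Tab.actS_rho (t : Tab m B) (v : World k A B) :
    t.actS k A (t.rho k) v = ∑ g : Equiv.Perm B with t.RowPres g, repS k A B g v := by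
  simp only [rho, map_sum, actS_of, LinearMap.sum_apply]
  refine Finset.sum_bij (fun g _ => g.1) ?_ (fun _ _ _ _ h => Subtype.ext h) ?_ (fun _ _ => rfl)
  · intro g hg; simpa using hg
  · intro g hg
    simp only [Finset.mem_filter, Finset.mem_univ, true_and] at hg
    exact ⟨⟨g, fun a => (hg a).1⟩, by simpa using hg, rfl⟩

/-- A diagram without southern arcs respects the colours if its northern arcs join opposite colours and its
through strands join equal colours. -/
theorem Compat.id_iff {Γ : Type*} [InvolutiveNeg Γ] {A B : Type} {γ : A → Γ} {γ' : B → Γ}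
    {m : ℕ} {d : Diagram m (A ⊕ B)} (hd : ¬ SouthArc d) :
    Compat γ γ' d ↔ (∀ i j, d.mate (.inl i) = .inl j → γ i = - γ j) ∧
      ∀ i j, d.mate (.inl i) = .inr j → γ i = γ' j := by
  constructor
  · intro h
    refine ⟨fun i j hij => ?_, fun i j hij => ?_⟩
    · have := h (.inl i)
      rw [hij] at this
      simp only [sign, Sum.elim_inl] at this
      rw [this, neg_neg]
    · have := h (.inl i)
      rw [hij] at this
      simp only [sign, Sum.elim_inl, Sum.elim_inr] at this
      exact (neg_injective this).symm
  · rintro ⟨h1, h2⟩ (v | v)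
    · rcases h : d.mate (.inl v) with w | w
      · simp only [sign, Sum.elim_inl]
        rw [h1 v w h, neg_neg]
      · simp only [sign, Sum.elim_inl, Sum.elim_inr]
        rw [h2 v w h]
    · rcases h : d.mate (.inr v) with w | w
      · have h' : d.mate (.inl w) = .inr v := by rw [← h, d.mate_mate]
        simp only [sign, Sum.elim_inl, Sum.elim_inr, neg_neg]
        exact h2 w v h'
      · exact absurd ⟨v, w, h⟩ hd

/-- A bijection of the entries of two tableaux that preserves rows and columns, equality of colours,
and the relation of having opposite colours. -/
structure Tab.Matches (t : Tab m A) (t₁ : Tab m' A') (e : A ≃ A') : Prop where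
  eq : ∀ a b, t₁.comp (e a) = t₁.comp (e b) ↔ t.comp a = t.comp b
  neg : ∀ a b, t₁.comp (e a) = - t₁.comp (e b) ↔ t.comp a = - t.comp b
  row : ∀ a, t₁.row (e a) = t.row a
  col : ∀ a, t₁.col (e a) = t.col a

variable {t : Tab m A} {t₁ : Tab m' A'} {e : A ≃ A'} {t' : Tab m B} {t₁' : Tab m' B'} {e' : B ≃ B'}

theorem Tab.Matches.colPres (h : t.Matches t₁ e) (g : Equiv.Perm A) :
    t₁.ColPres (e.permCongr g) ↔ t.ColPres g := by
  constructor
  · intro hg a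
    have := hg (e a)
    rwa [Equiv.permCongr_apply, e.symm_apply_apply, h.eq, h.col, h.col] at this
  · intro hg a
    obtain ⟨a, rfl⟩ := e.surjective a
    rw [Equiv.permCongr_apply, e.symm_apply_apply, h.eq, h.col, h.col]
    exact hg a

theorem Tab.Matches.rowPres (h : t.Matches t₁ e) (g : Equiv.Perm A) :
    t₁.RowPres (e.permCongr g) ↔ t.RowPres g := by
  constructor
  · intro hg a
    have := hg (e a)
    rwa [Equiv.permCongr_apply, e.symm_apply_apply, h.eq, h.row, h.row] at this
  · intro hg a
    obtain ⟨a, rfl⟩ := e.surjective a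
    rw [Equiv.permCongr_apply, e.symm_apply_apply, h.eq, h.row, h.row]
    exact hg a

theorem mapOp_repN (e : A ≃ A') (e' : B ≃ B') (g : Equiv.Perm A) (v : World k A B) :
    mapOp (e.sumCongr e') (repN k A B g v) =
      repN k A' B' (e.permCongr g) (mapOp (e.sumCongr e') v) := by
  change mapOp _ (mapOp _ v) = mapOp _ (mapOp _ v)
  rw [mapOp_mapOp, mapOp_mapOp]
  congr 2
  ext v; rcases v with v | v <;> simp

theorem mapOp_repS (e : A ≃ A') (e' : B ≃ B') (g : Equiv.Perm B) (v : World k A B) :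
    mapOp (e.sumCongr e') (repS k A B g v) =
      repS k A' B' (e'.permCongr g) (mapOp (e.sumCongr e') v) := by
  change mapOp _ (mapOp _ v) = mapOp _ (mapOp _ v)
  rw [mapOp_mapOp, mapOp_mapOp]
  congr 2
  ext v; rcases v with v | v <;> simp

theorem mapOp_symm (h : t.Matches t₁ e) (e' : B ≃ B') (v : World k A B) :
    mapOp (e.sumCongr e') (t.actN k B (t.symm k) v) =
      t₁.actN k B' (t₁.symm k) (mapOp (e.sumCongr e') v) := by
  classical
  have h1 : ∀ v : World k A B, mapOp (e.sumCongr e') (t.actN k B (t.kappa k) v) =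
      t₁.actN k B' (t₁.kappa k) (mapOp (e.sumCongr e') v) := by
    intro v
    rw [Tab.actN_kappa, Tab.actN_kappa, map_sum]
    refine Finset.sum_equiv e.permCongr (by simp [h.colPres]) fun g _ => ?_
    rw [map_zsmul, mapOp_repN, Equiv.Perm.sign_permCongr]
  have h2 : ∀ v : World k A B, mapOp (e.sumCongr e') (t.actN k B (t.rho k) v) =
      t₁.actN k B' (t₁.rho k) (mapOp (e.sumCongr e') v) := by
    intro v
    rw [Tab.actN_rho, Tab.actN_rho, map_sum]
    refine Finset.sum_equiv e.permCongr (by simp [h.rowPres]) fun g _ => ?_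
    rw [mapOp_repN]
  simp only [Tab.symm, map_mul, Module.End.mul_apply, h1, h2]

theorem mapOp_symmS (e : A ≃ A') (h : t'.Matches t₁' e') (v : World k A B) :
    mapOp (e.sumCongr e') (t'.symmS k A v) = t₁'.symmS k A' (mapOp (e.sumCongr e') v) := by
  classical
  have h1 : ∀ v : World k A B, mapOp (e.sumCongr e') (t'.actS k A (t'.kappa k) v) =
      t₁'.actS k A' (t₁'.kappa k) (mapOp (e.sumCongr e') v) := by
    intro v
    rw [Tab.actS_kappa, Tab.actS_kappa, map_sum]
    refine Finset.sum_equiv e'.permCongr (by simp [h.colPres]) fun g _ => ?_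
    rw [map_zsmul, mapOp_repS, Equiv.Perm.sign_permCongr]
  have h2 : ∀ v : World k A B, mapOp (e.sumCongr e') (t'.actS k A (t'.rho k) v) =
      t₁'.actS k A' (t₁'.rho k) (mapOp (e.sumCongr e') v) := by
    intro v
    rw [Tab.actS_rho, Tab.actS_rho, map_sum]
    refine Finset.sum_equiv e'.permCongr (by simp [h.rowPres]) fun g _ => ?_
    rw [mapOp_repS]
  simp only [Tab.symmS, map_mul, Module.End.mul_apply, h1, h2]

theorem Tab.Matches.compat (h : t.Matches t₁ e) {y : Diagram 1 (A ⊕ A)} :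
    Compat t₁.comp t₁.comp (y.map (e.sumCongr e)) ↔ Compat t.comp t.comp y := by
  have key : ∀ v w : A ⊕ A, sign t₁.comp t₁.comp (e.sumCongr e v) =
      - sign t₁.comp t₁.comp (e.sumCongr e w) ↔ sign t.comp t.comp v = - sign t.comp t.comp w := by
    rintro (v | v) (w | w)
    · exact h.neg v w
    · simpa [sign] using h.eq v w
    · simpa [sign] using h.eq v w
    · simpa [sign, neg_eq_iff_eq_neg] using h.neg v w
  constructor
  · intro hy v
    have := hy (e.sumCongr e v)
    simp only [Diagram.map, Equiv.symm_apply_apply] at this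
    exact (key _ _).1 this
  · intro hy v
    obtain ⟨v, rfl⟩ := (e.sumCongr e).surjective v
    simp only [Diagram.map, Equiv.symm_apply_apply]
    exact (key _ _).2 (hy v)

theorem Tab.Matches.good (h : t.Matches t₁ e)
    (hx : ∀ a b, t₁.comp (e a) = t₁'.comp (e' b) ↔ t.comp a = t'.comp b) {d : Diagram 1 (A ⊕ B)} :
    Good t₁.comp t₁'.comp (d.map (e.sumCongr e')) ↔ Good t.comp t'.comp d := by
  rw [Good, Good, SouthArc.map_iff]
  refine and_congr_left fun hs => ?_
  rw [Compat.id_iff hs, Compat.id_iff (by rwa [SouthArc.map_iff])]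
  constructor
  · rintro ⟨h1, h2⟩
    refine ⟨fun i j hij => ?_, fun i j hij => ?_⟩
    · exact (h.neg i j).1 (h1 (e i) (e j) (by simp [Diagram.map, hij]))
    · exact (hx i j).1 (h2 (e i) (e' j) (by simp [Diagram.map, hij]))
  · rintro ⟨h1, h2⟩
    refine ⟨fun i j hij => ?_, fun i j hij => ?_⟩
    · obtain ⟨i, rfl⟩ := e.surjective i
      obtain ⟨j, rfl⟩ := e.surjective j
      refine (h.neg i j).2 (h1 i j ?_)
      apply (e.sumCongr e').injective
      simpa [Diagram.map] using hij
    · obtain ⟨i, rfl⟩ := e.surjective i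
      obtain ⟨j, rfl⟩ := e'.surjective j
      refine (hx i j).2 (h2 i j ?_)
      apply (e.sumCongr e').injective
      simpa [Diagram.map] using hij

theorem map_goodSpace (h : t.Matches t₁ e)
    (hx : ∀ a b, t₁.comp (e a) = t₁'.comp (e' b) ↔ t.comp a = t'.comp b) :
    (goodSpace k t.comp t'.comp).map (mapOp (e.sumCongr e')) = goodSpace k t₁.comp t₁'.comp := by
  apply le_antisymm
  · rintro _ ⟨v, hv, rfl⟩
    refine goodSpace_map (fun d hd => ?_) hv
    rw [mapOp_single]
    exact single_mem_goodSpace ((h.good hx).2 hd) _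
  · intro v hv
    refine goodSpace_map (f := LinearMap.id) (fun d hd => ?_) hv
    have e1 : (d.map (e.sumCongr e').symm).map (e.sumCongr e') = d := by
      rw [Diagram.map_map]
      exact Diagram.map_eq_self (fun v => by simp) d
    refine ⟨Finsupp.single (d.map (e.sumCongr e').symm) 1,
      single_mem_goodSpace ((h.good hx).1 (by rwa [e1])) _, ?_⟩
    rw [mapOp_single, e1]; rfl

theorem map_cellSpace (h : t.Matches t₁ e) (h' : t'.Matches t₁' e')
    (hx : ∀ a b, t₁.comp (e a) = t₁'.comp (e' b) ↔ t.comp a = t'.comp b) :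
    (cellSpace k t t').map (mapOp (e.sumCongr e')) = cellSpace k t₁ t₁' := by
  rw [cellSpace, cellSpace, ← map_goodSpace h hx, ← Submodule.map_comp, ← Submodule.map_comp]
  congr 1
  refine LinearMap.ext fun v => ?_
  simp only [LinearMap.comp_apply, mapOp_symm h, mapOp_symmS e h']

/-- The operators `leftOp` depend only on the combinatorics of the colours and on the parameters of the
colours that occur. -/
theorem mapOp_leftOp {par : ZMod m → k} {par₁ : ZMod m' → k} (hpar : ∀ c, par₁ (-c) = par₁ c)
    (h : t.Matches t₁ e) (hp : ∀ a, par₁ (t₁.comp (e a)) = par (t.comp a))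
    (hx : ∀ a b, t₁.comp (e a) = t₁'.comp (e' b) ↔ t.comp a = t'.comp b)
    {y : Diagram 1 (A ⊕ A)} (hy : Compat t.comp t.comp y) {v : World k A B}
    (hv : v ∈ goodSpace k t.comp t'.comp) :
    mapOp (e.sumCongr e') (leftOp par t.comp y v) =
      leftOp par₁ t₁.comp (y.map (e.sumCongr e)) (mapOp (e.sumCongr e') v) := by
  classical
  refine goodSpace_ext (f := mapOp (e.sumCongr e') ∘ₗ leftOp par t.comp y)
    (g := leftOp par₁ t₁.comp (y.map (e.sumCongr e)) ∘ₗ mapOp (e.sumCongr e')) (fun d hd => ?_) hv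
  simp only [LinearMap.comp_apply, mapOp_single, leftOp_single]
  obtain ⟨e1, e2⟩ := gcomp_perm hpar (h.compat.2 hy) ((h.good hx).2 hd).1
    (Enum.univ A') ((Enum.univ A).map e)
  obtain ⟨f1, f2⟩ := gcomp_map e e e' (δ := colourPar par t.comp)
    (δ' := colourPar par₁ t₁.comp) (fun a => funext fun _ => hp a) (Enum.univ A) y d
  rw [e1, e2, f1, f2, SouthArc.map_iff]
  split_ifs
  · simp
  · rw [mapOp_single]

theorem mem_arcKernel_iff {par : ZMod m → k} (hpar : ∀ c, par (-c) = par c) {v : World k A B} :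
    v ∈ arcKernel par t t' ↔ v ∈ cellSpace k t t' ∧ ∀ y : Diagram 1 (A ⊕ A),
      Compat t.comp t.comp y → SouthArc y → leftOp par t.comp y v = 0 := by
  constructor
  · intro hv
    exact ⟨(mem_arcKernel.1 hv).1, fun y hy hs => leftOp_eq_zero hpar hv hy hs⟩
  · rintro ⟨h1, h2⟩
    exact mem_arcKernel.2 ⟨h1, fun i j hij hc =>
      h2 _ (arcDiag_compat hij hc) ⟨i, j, by simp [arcDiag]⟩⟩

/-- The dimension of `arcKernel` depends only on the rows and columns, on the coincidences among the colours and
their opposites, and on the parameters of the colours that occur. -/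
theorem arcKernel_congr {par : ZMod m → k} {par₁ : ZMod m' → k} (hpar : ∀ c, par (-c) = par c)
    (hpar₁ : ∀ c, par₁ (-c) = par₁ c)
    (h : t.Matches t₁ e) (h' : t'.Matches t₁' e') (hp : ∀ a, par₁ (t₁.comp (e a)) = par (t.comp a))
    (hx : ∀ a b, t₁.comp (e a) = t₁'.comp (e' b) ↔ t.comp a = t'.comp b) :
    finrank k (arcKernel par t t') = finrank k (arcKernel par₁ t₁ t₁') := by
  have inj := mapOp_injective (k := k) (e.sumCongr e')
  have key : (arcKernel par t t').map (mapOp (e.sumCongr e')) = arcKernel par₁ t₁ t₁' := by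
    ext w
    rw [mem_arcKernel_iff hpar₁, ← map_cellSpace h h' hx]
    constructor
    · rintro ⟨v, hv, rfl⟩
      rw [SetLike.mem_coe, mem_arcKernel_iff hpar] at hv
      refine ⟨⟨v, hv.1, rfl⟩, fun y hy hs => ?_⟩
      obtain ⟨y, rfl⟩ : ∃ y₀ : Diagram 1 (A ⊕ A), y = y₀.map (e.sumCongr e) :=
        ⟨y.map (e.sumCongr e).symm, by
          rw [Diagram.map_map]; exact (Diagram.map_eq_self (fun v => by simp) y).symm⟩
      rw [h.compat] at hy
      rw [← mapOp_leftOp hpar₁ h hp hx hy (cellSpace_le t t' hv.1),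
        hv.2 y hy ((SouthArc.map_iff _ _ _).1 hs), map_zero]
    · rintro ⟨⟨v, hv, rfl⟩, hw⟩
      refine ⟨v, ?_, rfl⟩
      rw [SetLike.mem_coe, mem_arcKernel_iff hpar]
      refine ⟨hv, fun y hy hs => inj ?_⟩
      rw [mapOp_leftOp hpar₁ h hp hx hy (cellSpace_le t t' hv), map_zero]
      exact hw _ (h.compat.2 hy) ((SouthArc.map_iff _ _ _).2 hs)
  rw [← key]
  exact (Submodule.equivMapOfInjective _ inj _).finrank_eq

/-- The multiplicity `cellMult` depends only on the data listed for `arcKernel_congr`. -/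
theorem cellMult_congr {par : ZMod m → k} {par₁ : ZMod m' → k}
    (hpar₁ : ∀ c, par₁ (-c) = par₁ c)
    (h : t.Matches t₁ e) (h' : t'.Matches t₁' e') (hp : ∀ a, par₁ (t₁.comp (e a)) = par (t.comp a))
    (hx : ∀ a b, t₁.comp (e a) = t₁'.comp (e' b) ↔ t.comp a = t'.comp b) :
    cellMult par t t' = cellMult par₁ t₁ t₁' := by
  have inj := mapOp_injective (k := k) (e.sumCongr e')
  have key : ∀ {y : Diagram 1 (A ⊕ A)} (hy : Compat t.comp t.comp y) {v : World k A B}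
      (hv : v ∈ cellSpace k t t'),
      t₁.actN k B' (t₁.symm k) (leftOp par₁ t₁.comp (y.map (e.sumCongr e)) (mapOp (e.sumCongr e') v)) =
        mapOp (e.sumCongr e') (t.actN k B (t.symm k) (leftOp par t.comp y v)) := by
    intro y hy v hv
    rw [← mapOp_leftOp hpar₁ h hp hx hy (cellSpace_le t t' hv), mapOp_symm h]
  rw [cellMult, cellMult, ← nullLen_sub (cellSpace_stab par t t')]
  have hm := nullLen_map (S := subOps (cellSpace_stab par t t')) (S' := cellOps B' par₁ t₁)
    (mapOp (e.sumCongr e') ∘ₗ (cellSpace k t t').subtype)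
    (inj.comp (Submodule.injective_subtype _)) ?_ ?_ (stab_bot _) (stab_top _) bot_le
  · rw [Submodule.map_bot, Submodule.map_top, LinearMap.range_comp, Submodule.range_subtype,
      map_cellSpace h h' hx] at hm
    exact hm.symm
  · rintro _ ⟨y, hy, hs, rfl⟩
    obtain ⟨y, rfl⟩ : ∃ y₀ : Diagram 1 (A ⊕ A), y = y₀.map (e.sumCongr e) :=
      ⟨y.map (e.sumCongr e).symm, by
        rw [Diagram.map_map]; exact (Diagram.map_eq_self (fun v => by simp) y).symm⟩
    rw [h.compat] at hy
    rw [SouthArc.map_iff] at hs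
    let T : cellOps (k := k) B par t := ⟨t.actN k B (t.symm k) ∘ₗ leftOp par t.comp y, y, hy, hs, rfl⟩
    refine ⟨T.1.restrict (cellSpace_stab par t t' T.1 T.2), Dom.of_mem (Set.mem_range_self T),
      LinearMap.ext fun v => ?_⟩
    exact key hy v.2
  · rintro _ ⟨⟨_, y, hy, hs, rfl⟩, rfl⟩
    refine ⟨_, Dom.of_mem ⟨y.map (e.sumCongr e), h.compat.2 hy, (SouthArc.map_iff _ _ _).2 hs, rfl⟩,
      LinearMap.ext fun v => ?_⟩
    exact (key hy v.2).symm

end Transport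

/-! ### Multiplicativity over disjoint sets of colours -/

section Product
open Module TensorProduct
variable {k : Type*} [Field k] {m : ℕ} {A₁ A₂ B₁ B₂ : Type} [Fintype A₁] [Fintype A₂] [Fintype B₁]
  [Fintype B₂] [DecidableEq A₁] [DecidableEq A₂] [DecidableEq B₁] [DecidableEq B₂]

theorem tens_injective {m : ℕ} {A₁ A₂ B₁ B₂ : Type} {x x' : Diagram m (A₁ ⊕ B₁)}
    {y y' : Diagram m (A₂ ⊕ B₂)} (h : tens x y = tens x' y') : x = x' ∧ y = y' := by
  have h1 := Diagram.map_injective _ h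
  constructor
  · ext v
    · have := congrFun (congrArg Diagram.mate h1) (.inl v)
      exact Sum.inl_injective this
    · exact congrFun (congrArg Diagram.lab h1) (.inl v)
  · ext v
    · have := congrFun (congrArg Diagram.mate h1) (.inr v)
      exact Sum.inr_injective this
    · exact congrFun (congrArg Diagram.lab h1) (.inr v)

/-- A diagram whose strands stay within the two summands is a disjoint union. -/
theorem Diagram.exists_sum {m : ℕ} {N N' : Type} (d : Diagram m (N ⊕ N'))
    (h : ∀ v, (d.mate v).isLeft = v.isLeft) : ∃ x y, d = Diagram.sum x y := by
  have h1 : ∀ v, ∃ w, d.mate (.inl v) = .inl w := fun v => by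
    have := h (.inl v)
    rcases hw : d.mate (.inl v) with w | w
    · exact ⟨w, rfl⟩
    · simp [hw] at this
  have h2 : ∀ v, ∃ w, d.mate (.inr v) = .inr w := fun v => by
    have := h (.inr v)
    rcases hw : d.mate (.inr v) with w | w
    · simp [hw] at this
    · exact ⟨w, rfl⟩
  choose f hf using h1
  choose g hg using h2
  refine ⟨⟨f, fun v => d.lab (.inl v), fun v => ?_, fun v hv => ?_, fun v => ?_⟩,
    ⟨g, fun v => d.lab (.inr v), fun v => ?_, fun v hv => ?_, fun v => ?_⟩, ?_⟩
  · apply Sum.inl_injective (β := N')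
    rw [← hf, ← hf, d.mate_mate]
  · exact d.mate_ne (.inl v) (by rw [hf, hv])
  · rw [← hf, d.lab_mate]
  · apply Sum.inr_injective (α := N)
    rw [← hg, ← hg, d.mate_mate]
  · exact d.mate_ne (.inr v) (by rw [hg, hv])
  · rw [← hg, d.lab_mate]
  · ext v <;> rcases v with v | v <;> simp [Diagram.sum, hf, hg]

/-- A southern arc of a disjoint union lies in one of the two parts. -/
theorem tens_southArc {m : ℕ} {A₁ A₂ B₁ B₂ : Type} {x : Diagram m (A₁ ⊕ B₁)}
    {y : Diagram m (A₂ ⊕ B₂)} : SouthArc (tens x y) ↔ SouthArc x ∨ SouthArc y := by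
  constructor
  · rintro ⟨i | i, j, h⟩
    · left
      rcases hw : x.mate (.inr i) with w | w
      · simp [tens, Diagram.map, Diagram.sum, sumSwap, hw] at h
      · exact ⟨i, w, hw⟩
    · right
      rcases hw : y.mate (.inr i) with w | w
      · simp [tens, Diagram.map, Diagram.sum, sumSwap, hw] at h
      · exact ⟨i, w, hw⟩
  · rintro (⟨i, j, h⟩ | ⟨i, j, h⟩)
    · exact ⟨.inl i, .inl j, by simp [tens, Diagram.map, Diagram.sum, sumSwap, h]⟩
    · exact ⟨.inr i, .inr j, by simp [tens, Diagram.map, Diagram.sum, sumSwap, h]⟩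

theorem tens_compat {m : ℕ} {Γ : Type*} [InvolutiveNeg Γ] {A₁ A₂ B₁ B₂ : Type} {γ₁ : A₁ → Γ}
    {γ₂ : A₂ → Γ} {γ₁' : B₁ → Γ} {γ₂' : B₂ → Γ} {x : Diagram m (A₁ ⊕ B₁)} {y : Diagram m (A₂ ⊕ B₂)} :
    Compat (Sum.elim γ₁ γ₂) (Sum.elim γ₁' γ₂') (tens x y) ↔ Compat γ₁ γ₁' x ∧ Compat γ₂ γ₂' y := by
  have key : ∀ v : (A₁ ⊕ B₁) ⊕ (A₂ ⊕ B₂), sign (Sum.elim γ₁ γ₂) (Sum.elim γ₁' γ₂')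
      (sumSwap A₁ B₁ A₂ B₂ v) = Sum.elim (sign γ₁ γ₁') (sign γ₂ γ₂') v := by
    rintro ((v | v) | (v | v)) <;> rfl
  constructor
  · intro h
    refine ⟨fun v => ?_, fun v => ?_⟩
    · have := h (sumSwap A₁ B₁ A₂ B₂ (.inl v))
      simp only [tens, Diagram.map, Equiv.symm_apply_apply, key, Diagram.sum, Sum.map_inl,
        Sum.elim_inl] at this
      exact this
    · have := h (sumSwap A₁ B₁ A₂ B₂ (.inr v))
      simp only [tens, Diagram.map, Equiv.symm_apply_apply, key, Diagram.sum, Sum.map_inr,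
        Sum.elim_inr] at this
      exact this
  · rintro ⟨h1, h2⟩ v
    obtain ⟨v, rfl⟩ := (sumSwap A₁ B₁ A₂ B₂).surjective v
    simp only [tens, Diagram.map, Equiv.symm_apply_apply, key]
    rcases v with v | v
    · exact h1 v
    · exact h2 v

/-- A diagram in which the colours of the two parts cannot be joined is a disjoint union. -/
theorem Compat.exists_tens {m : ℕ} {Γ : Type*} [InvolutiveNeg Γ] {A₁ A₂ B₁ B₂ : Type} {γ₁ : A₁ → Γ}
    {γ₂ : A₂ → Γ} {γ₁' : B₁ → Γ} {γ₂' : B₂ → Γ} {T : Set Γ} (hT : ∀ c, -c ∈ T ↔ c ∈ T)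
    (h1 : ∀ a, γ₁ a ∈ T) (h2 : ∀ a, γ₂ a ∉ T) (h1' : ∀ a, γ₁' a ∈ T) (h2' : ∀ a, γ₂' a ∉ T)
    {d : Diagram m ((A₁ ⊕ A₂) ⊕ (B₁ ⊕ B₂))}
    (hd : Compat (Sum.elim γ₁ γ₂) (Sum.elim γ₁' γ₂') d) :
    ∃ x y, d = tens x y ∧ Compat γ₁ γ₁' x ∧ Compat γ₂ γ₂' y := by
  have key : ∀ v : (A₁ ⊕ B₁) ⊕ (A₂ ⊕ B₂), sign (Sum.elim γ₁ γ₂) (Sum.elim γ₁' γ₂')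
      (sumSwap A₁ B₁ A₂ B₂ v) ∈ T ↔ v.isLeft := by
    rintro ((v | v) | (v | v)) <;> simp [sumSwap, sign, h1, h2, h1', h2', hT]
  obtain ⟨x, y, hxy⟩ := (d.map (sumSwap A₁ B₁ A₂ B₂).symm).exists_sum (by
    intro v
    have h3 := key ((sumSwap A₁ B₁ A₂ B₂).symm (d.mate (sumSwap A₁ B₁ A₂ B₂ v)))
    rw [Equiv.apply_symm_apply, hd, hT, key] at h3
    exact Bool.eq_iff_iff.2 h3.symm)
  have e : d = tens x y := by
    rw [tens, ← hxy, Diagram.map_map]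
    exact (Diagram.map_eq_self (fun v => by simp) d).symm
  subst e
  exact ⟨x, y, rfl, tens_compat.1 hd⟩

theorem tens_map {m : ℕ} {A₁ A₂ B₁ B₂ A₁' A₂' B₁' B₂' : Type} (e₁ : A₁ ≃ A₁') (e₂ : A₂ ≃ A₂')
    (f₁ : B₁ ≃ B₁') (f₂ : B₂ ≃ B₂') (x : Diagram m (A₁ ⊕ B₁)) (y : Diagram m (A₂ ⊕ B₂)) :
    (tens x y).map ((e₁.sumCongr e₂).sumCongr (f₁.sumCongr f₂)) =
      tens (x.map (e₁.sumCongr f₁)) (y.map (e₂.sumCongr f₂)) := by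
  ext v
  · rcases v with (v | v) | (v | v)
    · rcases h : x.mate (.inl (e₁.symm v)) with w | w <;>
        simp [tens, Diagram.map, Diagram.sum, sumSwap, h]
    · rcases h : y.mate (.inl (e₂.symm v)) with w | w <;>
        simp [tens, Diagram.map, Diagram.sum, sumSwap, h]
    · rcases h : x.mate (.inr (f₁.symm v)) with w | w <;>
        simp [tens, Diagram.map, Diagram.sum, sumSwap, h]
    · rcases h : y.mate (.inr (f₂.symm v)) with w | w <;>
        simp [tens, Diagram.map, Diagram.sum, sumSwap, h]
  · rcases v with (v | v) | (v | v) <;> rfl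

/-- Placing diagrams side by side, as a bilinear map. -/
noncomputable def tensOp : World k A₁ B₁ →ₗ[k] World k A₂ B₂ →ₗ[k] World k (A₁ ⊕ A₂) (B₁ ⊕ B₂) :=
  Finsupp.linearCombination k fun x => Finsupp.lmapDomain k k (tens x)

theorem tensOp_single {A₁ A₂ B₁ B₂ : Type} (x : Diagram 1 (A₁ ⊕ B₁)) (y : Diagram 1 (A₂ ⊕ B₂)) (c c' : k) :
    tensOp (Finsupp.single x c) (Finsupp.single y c') = Finsupp.single (tens x y) (c * c') := by
  simp [tensOp]

theorem tensOp_injective : Function.Injective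
    (TensorProduct.lift (tensOp (k := k) (A₁ := A₁) (B₁ := B₁) (A₂ := A₂) (B₂ := B₂))) := by
  have e : TensorProduct.lift (tensOp (k := k) (A₁ := A₁) (B₁ := B₁) (A₂ := A₂) (B₂ := B₂)) =
      Finsupp.lmapDomain k k (fun p => tens p.1 p.2) ∘ₗ
        (finsuppTensorFinsupp' k (Diagram 1 (A₁ ⊕ B₁)) (Diagram 1 (A₂ ⊕ B₂))).toLinearMap := by
    ext x y : 5
    simp [tensOp]
  rw [e]
  rw [LinearMap.coe_comp]
  refine Function.Injective.comp (Finsupp.mapDomain_injective ?_) (LinearEquiv.injective _)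
  rintro ⟨x, y⟩ ⟨x', y'⟩ h
  exact Prod.ext_iff.2 (tens_injective h)

/-- To check an identity of bilinear maps on two spans of `Good` diagrams. -/
theorem goodSpace_ext₂ {Γ : Type*} [InvolutiveNeg Γ] {γ₁ : A₁ → Γ} {γ₂ : A₂ → Γ} {γ₁' : B₁ → Γ}
    {γ₂' : B₂ → Γ} {E : Type*} [AddCommGroup E] [Module k E]
    {f g : World k A₁ B₁ →ₗ[k] World k A₂ B₂ →ₗ[k] E}
    (h : ∀ x y, Good γ₁ γ₁' x → Good γ₂ γ₂' y → f (Finsupp.single x 1) (Finsupp.single y 1) =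
      g (Finsupp.single x 1) (Finsupp.single y 1))
    {v : World k A₁ B₁} (hv : v ∈ goodSpace k γ₁ γ₁') {w : World k A₂ B₂}
    (hw : w ∈ goodSpace k γ₂ γ₂') : f v w = g v w := by
  refine goodSpace_ext (f := f.flip w) (g := g.flip w) (fun x hx => ?_) hv
  exact goodSpace_ext (f := f _) (g := g _) (fun y hy => h x y hx hy) hw

theorem tensOp_mapOp {A₁' A₂' B₁' B₂' : Type} (e₁ : A₁ ≃ A₁') (e₂ : A₂ ≃ A₂') (f₁ : B₁ ≃ B₁')
    (f₂ : B₂ ≃ B₂') (v : World k A₁ B₁) (w : World k A₂ B₂) :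
    mapOp ((e₁.sumCongr e₂).sumCongr (f₁.sumCongr f₂)) (tensOp v w) =
      tensOp (mapOp (e₁.sumCongr f₁) v) (mapOp (e₂.sumCongr f₂) w) := by
  have e : tensOp.compr₂ (mapOp (k := k) ((e₁.sumCongr e₂).sumCongr (f₁.sumCongr f₂))) =
      tensOp.compl₁₂ (mapOp (e₁.sumCongr f₁)) (mapOp (e₂.sumCongr f₂)) := by
    ext x y : 4
    simp only [LinearMap.comp_apply, LinearMap.compr₂_apply, LinearMap.compl₁₂_apply,
      Finsupp.lsingle_apply, tensOp_single, mapOp_single, tens_map]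
  exact LinearMap.congr_fun₂ e v w

theorem tensOp_repN (g : Equiv.Perm A₁) (h : Equiv.Perm A₂) (v : World k A₁ B₁)
    (w : World k A₂ B₂) : repN k (A₁ ⊕ A₂) (B₁ ⊕ B₂) (g.sumCongr h) (tensOp v w) =
      tensOp (repN k A₁ B₁ g v) (repN k A₂ B₂ h w) := by
  refine Eq.trans ?_ (tensOp_mapOp g h (Equiv.refl B₁) (Equiv.refl B₂) v w)
  rw [Equiv.sumCongr_refl]
  rfl

theorem tensOp_repS (g : Equiv.Perm B₁) (h : Equiv.Perm B₂) (v : World k A₁ B₁)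
    (w : World k A₂ B₂) : repS k (A₁ ⊕ A₂) (B₁ ⊕ B₂) (g.sumCongr h) (tensOp v w) =
      tensOp (repS k A₁ B₁ g v) (repS k A₂ B₂ h w) := by
  refine Eq.trans ?_ (tensOp_mapOp (Equiv.refl A₁) (Equiv.refl A₂) g h v w)
  rw [Equiv.sumCongr_refl]
  rfl

end Product

section Product
open Module TensorProduct
variable {k : Type*} [Field k] {m : ℕ} {A₁ A₂ B₁ B₂ : Type} [Fintype A₁] [Fintype A₂] [Fintype B₁]
  [Fintype B₂] [DecidableEq A₁] [DecidableEq A₂] [DecidableEq B₁] [DecidableEq B₂]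

/-- The union of two tableaux whose entries are placed in different components. -/
def Tab.sum (t₁ : Tab m A₁) (t₂ : Tab m A₂) (h : ∀ a b, t₁.comp a ≠ t₂.comp b) : Tab m (A₁ ⊕ A₂) where
  comp := Sum.elim t₁.comp t₂.comp
  row := Sum.elim t₁.row t₂.row
  col := Sum.elim t₁.col t₂.col
  inj := by
    rintro (a | a) (b | b) h1 h2 h3
    · exact congrArg _ (t₁.inj a b h1 h2 h3)
    · exact (h a b h1).elim
    · exact (h b a h1.symm).elim
    · exact congrArg _ (t₂.inj a b h1 h2 h3)
  lower := by
    rintro (a | a) i j h1 h2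
    · obtain ⟨b, hb⟩ := t₁.lower a i j h1 h2
      exact ⟨.inl b, hb⟩
    · obtain ⟨b, hb⟩ := t₂.lower a i j h1 h2
      exact ⟨.inr b, hb⟩

open Classical in
/-- A sum over permutations that preserve the two summands. -/
theorem sum_sumCongr {E : Type*} [AddCommMonoid E] {P : Equiv.Perm (A₁ ⊕ A₂) → Prop}
    {P₁ : Equiv.Perm A₁ → Prop} {P₂ : Equiv.Perm A₂ → Prop}
    (h : ∀ g, P g → ∀ a, (g (.inl a)).isLeft)
    (h' : ∀ g₁ g₂, P (Equiv.sumCongr g₁ g₂) ↔ P₁ g₁ ∧ P₂ g₂) (f : Equiv.Perm (A₁ ⊕ A₂) → E) :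
    ∑ g : Equiv.Perm (A₁ ⊕ A₂) with P g, f g = ∑ g₁ : Equiv.Perm A₁ with P₁ g₁,
      ∑ g₂ : Equiv.Perm A₂ with P₂ g₂, f (Equiv.sumCongr g₁ g₂) := by
  rw [← Finset.sum_product']
  symm
  refine Finset.sum_bij (fun g _ => Equiv.sumCongr g.1 g.2) ?_ ?_ ?_ (fun _ _ => rfl)
  · intro g hg
    simp only [Finset.mem_product, Finset.mem_filter, Finset.mem_univ, true_and] at hg ⊢
    exact (h' _ _).2 hg
  · intro g _ g' _ hgg
    exact Equiv.Perm.sumCongrHom_injective hgg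
  · intro g hg
    simp only [Finset.mem_filter, Finset.mem_univ, true_and] at hg
    obtain ⟨⟨g₁, g₂⟩, rfl⟩ := Equiv.Perm.mem_sumCongrHom_range_of_perm_mapsTo_inl (σ := g) (by
      rintro _ ⟨a, rfl⟩
      have := h g hg a
      rcases hw : g (.inl a) with w | w
      · exact ⟨w, rfl⟩
      · simp [hw] at this)
    refine ⟨(g₁, g₂), ?_, rfl⟩
    simp only [Finset.mem_product, Finset.mem_filter, Finset.mem_univ, true_and]
    exact (h' _ _).1 hg

section TabSum
variable {t₁ : Tab m A₁} {t₂ : Tab m A₂} (h : ∀ a b, t₁.comp a ≠ t₂.comp b)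

theorem Tab.sum_isLeft {g : Equiv.Perm (A₁ ⊕ A₂)} (hg : g ∈ (t₁.sum t₂ h).grp) (a : A₁) :
    (g (.inl a)).isLeft := by
  have := hg (.inl a)
  rcases hw : g (.inl a) with w | w
  · rfl
  · rw [hw] at this
    exact (h a w this.symm).elim

theorem Tab.sum_colPres (g₁ : Equiv.Perm A₁) (g₂ : Equiv.Perm A₂) :
    (t₁.sum t₂ h).ColPres (Equiv.sumCongr g₁ g₂) ↔ t₁.ColPres g₁ ∧ t₂.ColPres g₂ := by
  simp [ColPres, Sum.forall, Tab.sum]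

theorem Tab.sum_rowPres (g₁ : Equiv.Perm A₁) (g₂ : Equiv.Perm A₂) :
    (t₁.sum t₂ h).RowPres (Equiv.sumCongr g₁ g₂) ↔ t₁.RowPres g₁ ∧ t₂.RowPres g₂ := by
  simp [RowPres, Sum.forall, Tab.sum]

/-- The Young symmetrizer of a union of tableaux is the product of the two Young symmetrizers. -/
theorem tensOp_symm (v : World k A₁ B₁) (w : World k A₂ B₂) :
    (t₁.sum t₂ h).actN k (B₁ ⊕ B₂) ((t₁.sum t₂ h).symm k) (tensOp v w) =
      tensOp (t₁.actN k B₁ (t₁.symm k) v) (t₂.actN k B₂ (t₂.symm k) w) := by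
  classical
  have h1 : ∀ (v : World k A₁ B₁) (w : World k A₂ B₂),
      (t₁.sum t₂ h).actN k (B₁ ⊕ B₂) ((t₁.sum t₂ h).kappa k) (tensOp v w) =
        tensOp (t₁.actN k B₁ (t₁.kappa k) v) (t₂.actN k B₂ (t₂.kappa k) w) := by
    intro v w
    rw [Tab.actN_kappa, Tab.actN_kappa, Tab.actN_kappa, sum_sumCongr
      (fun g hg => Tab.sum_isLeft h (fun a => (hg a).1)) (Tab.sum_colPres h)]
    simp only [map_sum, LinearMap.sum_apply, Equiv.Perm.sign_sumCongr, tensOp_repN, map_zsmul,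
      LinearMap.smul_apply, mul_smul, Units.val_mul]
    rw [Finset.sum_comm]
    refine Finset.sum_congr rfl fun y _ => ?_
    rw [Finset.smul_sum]
    exact Finset.sum_congr rfl fun x _ => smul_comm _ _ _
  have h2 : ∀ (v : World k A₁ B₁) (w : World k A₂ B₂),
      (t₁.sum t₂ h).actN k (B₁ ⊕ B₂) ((t₁.sum t₂ h).rho k) (tensOp v w) =
        tensOp (t₁.actN k B₁ (t₁.rho k) v) (t₂.actN k B₂ (t₂.rho k) w) := by
    intro v w
    rw [Tab.actN_rho, Tab.actN_rho, Tab.actN_rho, sum_sumCongr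
      (fun g hg => Tab.sum_isLeft h (fun a => (hg a).1)) (Tab.sum_rowPres h)]
    simp only [map_sum, LinearMap.sum_apply, tensOp_repN]
    rw [Finset.sum_comm]
  simp only [Tab.symm, map_mul, Module.End.mul_apply, h1, h2]

/-- The analogue of `tensOp_symm` for the southern nodes. -/
theorem tensOp_symmS {t₁ : Tab m B₁} {t₂ : Tab m B₂} (h : ∀ a b, t₁.comp a ≠ t₂.comp b)
    (v : World k A₁ B₁) (w : World k A₂ B₂) :
    (t₁.sum t₂ h).symmS k (A₁ ⊕ A₂) (tensOp v w) =
      tensOp (t₁.symmS k A₁ v) (t₂.symmS k A₂ w) := by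
  classical
  have h1 : ∀ (v : World k A₁ B₁) (w : World k A₂ B₂),
      (t₁.sum t₂ h).actS k (A₁ ⊕ A₂) ((t₁.sum t₂ h).kappa k) (tensOp v w) =
        tensOp (t₁.actS k A₁ (t₁.kappa k) v) (t₂.actS k A₂ (t₂.kappa k) w) := by
    intro v w
    rw [Tab.actS_kappa, Tab.actS_kappa, Tab.actS_kappa, sum_sumCongr
      (fun g hg => Tab.sum_isLeft h (fun a => (hg a).1)) (Tab.sum_colPres h)]
    simp only [map_sum, LinearMap.sum_apply, Equiv.Perm.sign_sumCongr, tensOp_repS, map_zsmul,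
      LinearMap.smul_apply, mul_smul, Units.val_mul]
    rw [Finset.sum_comm]
    refine Finset.sum_congr rfl fun y _ => ?_
    rw [Finset.smul_sum]
    exact Finset.sum_congr rfl fun x _ => smul_comm _ _ _
  have h2 : ∀ (v : World k A₁ B₁) (w : World k A₂ B₂),
      (t₁.sum t₂ h).actS k (A₁ ⊕ A₂) ((t₁.sum t₂ h).rho k) (tensOp v w) =
        tensOp (t₁.actS k A₁ (t₁.rho k) v) (t₂.actS k A₂ (t₂.rho k) w) := by
    intro v w
    rw [Tab.actS_rho, Tab.actS_rho, Tab.actS_rho, sum_sumCongr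
      (fun g hg => Tab.sum_isLeft h (fun a => (hg a).1)) (Tab.sum_rowPres h)]
    simp only [map_sum, LinearMap.sum_apply, tensOp_repS]
    rw [Finset.sum_comm]
  simp only [Tab.symmS, map_mul, Module.End.mul_apply, h1, h2]

end TabSum

/-- Concatenation is compatible with disjoint unions. -/
theorem leftOp_tens {Γ : Type*} [InvolutiveNeg Γ] {par : Γ → k} (hpar : ∀ c, par (-c) = par c)
    {A₁' A₂' : Type} [Fintype A₁'] [Fintype A₂'] [DecidableEq A₁'] [DecidableEq A₂']
    {γ₁ : A₁ → Γ} {γ₂ : A₂ → Γ} {γ₁' : B₁ → Γ} {γ₂' : B₂ → Γ} {ε₁ : A₁' → Γ} {ε₂ : A₂' → Γ}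
    {y₁ : Diagram 1 (A₁' ⊕ A₁)} {y₂ : Diagram 1 (A₂' ⊕ A₂)} (hy₁ : Compat ε₁ γ₁ y₁)
    (hy₂ : Compat ε₂ γ₂ y₂) {v : World k A₁ B₁} (hv : v ∈ goodSpace k γ₁ γ₁') {w : World k A₂ B₂}
    (hw : w ∈ goodSpace k γ₂ γ₂') :
    leftOp par (Sum.elim γ₁ γ₂) (tens y₁ y₂) (tensOp v w) =
      tensOp (leftOp par γ₁ y₁ v) (leftOp par γ₂ y₂ w) := by
  classical
  refine goodSpace_ext₂ (f := tensOp.compr₂ (leftOp par (Sum.elim γ₁ γ₂) (tens y₁ y₂)))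
    (g := tensOp.compl₁₂ (leftOp par γ₁ y₁) (leftOp par γ₂ y₂)) (fun x y hx hy => ?_) hv hw
  simp only [LinearMap.compr₂_apply, LinearMap.compl₁₂_apply, tensOp_single, mul_one, leftOp_single]
  obtain ⟨e1, e2⟩ := gcomp_tens (colourPar par (Sum.elim γ₁ γ₂)) (Enum.univ (A₁ ⊕ A₂)) y₁ y₂ x y
  obtain ⟨f1, f2⟩ := gcomp_perm hpar hy₁ hx.1 (Enum.univ (A₁ ⊕ A₂)).left (Enum.univ A₁)
  obtain ⟨g1, g2⟩ := gcomp_perm hpar hy₂ hy.1 (Enum.univ (A₁ ⊕ A₂)).right (Enum.univ A₂)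
  have e1' : gcomp (colourPar par (Sum.elim γ₁ γ₂)) (Enum.univ (A₁ ⊕ A₂)) (tens y₁ y₂) (tens x y) =
      tens (gcomp (colourPar par γ₁) (Enum.univ A₁) y₁ x)
        (gcomp (colourPar par γ₂) (Enum.univ A₂) y₂ y) := by
    rw [← f1, ← g1]; exact e1
  have e2' : gwt (colourPar par (Sum.elim γ₁ γ₂)) (Enum.univ (A₁ ⊕ A₂)) (tens y₁ y₂) (tens x y) =
      gwt (colourPar par γ₁) (Enum.univ A₁) y₁ x * gwt (colourPar par γ₂) (Enum.univ A₂) y₂ y := by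
    rw [← f2, ← g2]; exact e2
  rw [e1', e2', tens_southArc]
  by_cases h1 : SouthArc (gcomp (colourPar par γ₁) (Enum.univ A₁) y₁ x)
  · simp [h1]
  · by_cases h2 : SouthArc (gcomp (colourPar par γ₂) (Enum.univ A₂) y₂ y)
    · simp [h2]
    · simp [h1, h2, tensOp_single]

section Spaces
variable {t₁ : Tab m A₁} {t₂ : Tab m A₂} {t₁' : Tab m B₁} {t₂' : Tab m B₂} {T : Set (ZMod m)}

/-- The tableau `t₁` uses only components in the set `T`, which is closed under negation, and `t₂` uses only
components outside `T`. -/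
structure Separates (T : Set (ZMod m)) (t₁ : Tab m A₁) (t₂ : Tab m A₂) : Prop where
  neg : ∀ c, -c ∈ T ↔ c ∈ T
  left : ∀ a, t₁.comp a ∈ T
  right : ∀ a, t₂.comp a ∉ T

theorem Separates.ne (h : Separates T t₁ t₂) (a : A₁) (b : A₂) : t₁.comp a ≠ t₂.comp b :=
  fun e => h.right b (e ▸ h.left a)

/-- If the colours of the two parts cannot be joined, the space of diagrams is a tensor product. -/
theorem goodSpace_sum (h : Separates T t₁ t₂) (h' : Separates T t₁' t₂') :
    goodSpace k (t₁.sum t₂ h.ne).comp (t₁'.sum t₂' h'.ne).comp =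
      Submodule.map₂ tensOp (goodSpace k t₁.comp t₁'.comp) (goodSpace k t₂.comp t₂'.comp) := by
  apply le_antisymm
  · intro v hv
    refine goodSpace_map (f := LinearMap.id) (fun d hd => ?_) hv
    obtain ⟨x, y, rfl, hx, hy⟩ := Compat.exists_tens h.neg h.left h.right h'.left h'.right hd.1
    have hs := hd.2
    rw [tens_southArc, not_or] at hs
    have := Submodule.apply_mem_map₂ (tensOp (k := k)) (single_mem_goodSpace ⟨hx, hs.1⟩ 1)
      (single_mem_goodSpace ⟨hy, hs.2⟩ 1)
    rwa [tensOp_single, mul_one] at this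
  · refine Submodule.map₂_le.2 fun v hv w hw => ?_
    refine goodSpace_map (f := tensOp v) (fun y hy => ?_) hw
    refine goodSpace_map (f := tensOp.flip (Finsupp.single y 1)) (fun x hx => ?_) hv
    rw [LinearMap.flip_apply, tensOp_single]
    exact single_mem_goodSpace ⟨tens_compat.2 ⟨hx.1, hy.1⟩, fun hs => (tens_southArc.1 hs).elim hx.2 hy.2⟩ _

theorem cellSpace_sum (h : Separates T t₁ t₂) (h' : Separates T t₁' t₂') :
    cellSpace k (t₁.sum t₂ h.ne) (t₁'.sum t₂' h'.ne) =
      Submodule.map₂ tensOp (cellSpace k t₁ t₁') (cellSpace k t₂ t₂') := by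
  rw [cellSpace, cellSpace, cellSpace, goodSpace_sum h h', Submodule.map_map₂, Submodule.map₂_map_map]
  congr 1
  refine LinearMap.ext₂ fun v w => ?_
  simp only [LinearMap.compr₂_apply, LinearMap.compl₁₂_apply, LinearMap.comp_apply, tensOp_symm,
    tensOp_symmS]

end Spaces

end Product

section Kernels
open Module TensorProduct
variable {k : Type*} [Field k] {E F : Type*} [AddCommGroup E] [Module k E] [AddCommGroup F]
  [Module k F]

/-- An element of `P ⊗ Q` that is killed by the `L i ⊗ 1` lies in `P' ⊗ Q`, where `P'` is the
intersection of `P` with the kernels of the `L i`. -/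
theorem mem_map₂_of_rTensor {ι : Type*} {E' : ι → Type*} [∀ i, AddCommGroup (E' i)]
    [∀ i, Module k (E' i)] {P : Submodule k E} {Q : Submodule k F} (L : ∀ i, E →ₗ[k] E' i)
    {z : E ⊗[k] F} (hz : z ∈ Submodule.map₂ (TensorProduct.mk k E F) P Q)
    (h : ∀ i, (L i).rTensor F z = 0) :
    z ∈ Submodule.map₂ (TensorProduct.mk k E F) (P ⊓ ⨅ i, LinearMap.ker (L i)) Q := by
  rw [TensorProduct.map₂_eq_range_lift_comp_mapIncl] at hz
  obtain ⟨z, rfl⟩ := hz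
  let c := Basis.ofVectorSpace k Q
  obtain ⟨b, rfl⟩ := TensorProduct.eq_repr_basis_right c z
  have hb : ∀ j i, L i (b j) = 0 := by
    intro j i
    have h1 : (L i ∘ₗ P.subtype).rTensor Q (b.sum fun j m => m ⊗ₜ[k] c j) = 0 := by
      apply Module.Flat.lTensor_preserves_injective_linearMap (M := E' i) Q.subtype
        Q.injective_subtype
      rw [map_zero, ← h i]
      simp [Finsupp.sum, TensorProduct.mapIncl]
    have h2 : (b.mapRange (L i ∘ₗ P.subtype) (map_zero _)).sum (fun j m => m ⊗ₜ[k] c j) = 0 := by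
      rw [Finsupp.sum_mapRange_index (by simp), ← h1]
      simp [Finsupp.sum]
    have := TensorProduct.sum_tmul_basis_right_eq_zero c _ h2
    simpa using DFunLike.congr_fun this j
  simp only [Finsupp.sum, map_sum]
  refine Submodule.sum_mem _ fun j _ => ?_
  exact Submodule.apply_mem_map₂ (TensorProduct.mk k E F)
    ⟨(b j).2, Submodule.mem_iInf _ |>.2 fun i => hb j i⟩ (c j).2

/-- The mirror image of `mem_map₂_of_rTensor`. -/
theorem mem_map₂_of_lTensor {ι : Type*} {F' : ι → Type*} [∀ i, AddCommGroup (F' i)]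
    [∀ i, Module k (F' i)] {P : Submodule k E} {Q : Submodule k F} (L : ∀ i, F →ₗ[k] F' i)
    {z : E ⊗[k] F} (hz : z ∈ Submodule.map₂ (TensorProduct.mk k E F) P Q)
    (h : ∀ i, (L i).lTensor E z = 0) :
    z ∈ Submodule.map₂ (TensorProduct.mk k E F) P (Q ⊓ ⨅ i, LinearMap.ker (L i)) := by
  have key : ∀ (P : Submodule k E) (Q : Submodule k F),
      (Submodule.map₂ (TensorProduct.mk k E F) P Q).map (TensorProduct.comm k E F).toLinearMap =
        Submodule.map₂ (TensorProduct.mk k F E) Q P := by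
    intro P Q
    rw [Submodule.map_map₂, ← Submodule.map₂_flip]
    rfl
  have h1 := mem_map₂_of_rTensor L (key P Q ▸ Submodule.mem_map_of_mem hz) (fun i => by
    have e : (L i).rTensor E ∘ₗ (TensorProduct.comm k E F).toLinearMap =
        (TensorProduct.comm k E (F' i)).toLinearMap ∘ₗ (L i).lTensor E := by ext; rfl
    refine (LinearMap.congr_fun e z).trans ?_
    rw [LinearMap.comp_apply, h i, map_zero])
  rw [← key] at h1
  obtain ⟨w, hw, hwz⟩ := h1
  rwa [← (TensorProduct.comm k E F).injective hwz]

theorem finrank_map₂ {G : Type*} [AddCommGroup G] [Module k G] {f : E →ₗ[k] F →ₗ[k] G}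
    (hf : Function.Injective (TensorProduct.lift f)) (P : Submodule k E) (Q : Submodule k F) :
    finrank k (Submodule.map₂ f P Q) = finrank k P * finrank k Q := by
  have inj : Function.Injective (TensorProduct.lift f ∘ₗ TensorProduct.mapIncl P Q) := by
    rw [LinearMap.coe_comp]
    exact hf.comp (Module.Flat.tensorProduct_mapIncl_injective_of_right P Q)
  rw [TensorProduct.map₂_eq_range_lift_comp_mapIncl, LinearMap.finrank_range_of_inj inj,
    finrank_tensorProduct]

end Kernels

section Product
open Module TensorProduct
variable {k : Type*} [Field k] {m : ℕ} {A A₁ A₂ B B₁ B₂ : Type} [Fintype A₁] [Fintype A₂] [Fintype B₁]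
  [Fintype B₂] [DecidableEq A₁] [DecidableEq A₂] [DecidableEq B₁] [DecidableEq B₂]
  [Fintype A] [Fintype B] [DecidableEq A] [DecidableEq B]

/-- The diagrams without southern arcs act on `x X x'` by scalars, after multiplication by `x`. -/
theorem exists_scalar (hk : ((Fintype.card A).factorial : k) ≠ 0) (par : ZMod m → k) (t : Tab m A)
    (t' : Tab m B) {y : Diagram 1 (A ⊕ A)} (hy : Good t.comp t.comp y) :
    ∃ ε : k, ∀ v ∈ cellSpace k t t', t.actN k B (t.symm k) (leftOp par t.comp y v) = ε • v := by
  obtain ⟨g, hg, rfl⟩ := hy.eq_gperm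
  obtain ⟨ε, hε⟩ := t.symm_mul_mul_symm k (Tab.two_ne_zero_of_factorial hk)
    (MonoidAlgebra.of k t.grp ⟨g, hg⟩)
  refine ⟨ε, fun v hv => ?_⟩
  rw [leftOp_gperm par g (cellSpace_le t t' hv), ← actN_cellSpace t t' hε hv, map_mul,
    Module.End.mul_apply, t.actN_of]

theorem exists_scalar_one (hk : ((Fintype.card A).factorial : k) ≠ 0) (par : ZMod m → k)
    (t : Tab m A) (t' : Tab m B) :
    ∃ ε : k, ε ≠ 0 ∧ ∀ v ∈ cellSpace k t t',
      t.actN k B (t.symm k) (leftOp par t.comp (gperm 1 1) v) = ε • v := by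
  obtain ⟨ε, h0, hε⟩ := t.symm_sq k hk
  refine ⟨ε, h0, fun v hv => ?_⟩
  rw [leftOp_gperm par 1 (cellSpace_le t t' hv), map_one, Module.End.one_apply,
    ← actN_cellSpace t t' (y := 1) (by rw [mul_one, hε]) hv, mul_one]

variable {t₁ : Tab m A₁} {t₂ : Tab m A₂} {t₁' : Tab m B₁} {t₂' : Tab m B₂} {T : Set (ZMod m)}
  {par : ZMod m → k}

theorem mem_cellSpace_sum (h : Separates T t₁ t₂) (h' : Separates T t₁' t₂')
    {v : World k (A₁ ⊕ A₂) (B₁ ⊕ B₂)} :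
    v ∈ cellSpace k (t₁.sum t₂ h.ne) (t₁'.sum t₂' h'.ne) ↔
      ∃ z ∈ Submodule.map₂ (TensorProduct.mk k _ _) (cellSpace k t₁ t₁') (cellSpace k t₂ t₂'),
        TensorProduct.lift tensOp z = v := by
  rw [cellSpace_sum h h']
  change _ ↔ v ∈ Submodule.map _ _
  rw [Submodule.map_map₂]
  rfl

/-- The compatibility of `leftOp` with disjoint unions on sums of pure tensors. -/
theorem leftOp_lift (hpar : ∀ c, par (-c) = par c) {y₁ : Diagram 1 (A₁ ⊕ A₁)}
    {y₂ : Diagram 1 (A₂ ⊕ A₂)} (hy₁ : Compat t₁.comp t₁.comp y₁) (hy₂ : Compat t₂.comp t₂.comp y₂)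
    {z : World k A₁ B₁ ⊗[k] World k A₂ B₂}
    (hz : z ∈ Submodule.map₂ (TensorProduct.mk k _ _) (cellSpace k t₁ t₁') (cellSpace k t₂ t₂')) :
    leftOp par (Sum.elim t₁.comp t₂.comp) (tens y₁ y₂) (TensorProduct.lift tensOp z) =
      TensorProduct.lift tensOp
        (TensorProduct.map (leftOp par t₁.comp y₁) (leftOp par t₂.comp y₂) z) := by
  have key : Submodule.map₂ (TensorProduct.mk k _ _) (cellSpace k t₁ t₁') (cellSpace k t₂ t₂') ≤
      LinearMap.eqLocus
        (leftOp par (Sum.elim t₁.comp t₂.comp) (tens y₁ y₂) ∘ₗ TensorProduct.lift tensOp)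
        (TensorProduct.lift tensOp ∘ₗ
          TensorProduct.map (leftOp par t₁.comp y₁) (leftOp par t₂.comp y₂)) := by
    refine Submodule.map₂_le.2 fun v hv w hw => ?_
    simp only [LinearMap.mem_eqLocus, LinearMap.comp_apply, TensorProduct.mk_apply,
      TensorProduct.lift.tmul, TensorProduct.map_tmul]
    exact leftOp_tens hpar hy₁ hy₂ (cellSpace_le _ _ hv) (cellSpace_le _ _ hw)
  exact key hz

theorem map_leftOp_one_right (f : World k A₁ B₁ →ₗ[k] World k A₁ B₁)
    {z : World k A₁ B₁ ⊗[k] World k A₂ B₂}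
    (hz : z ∈ Submodule.map₂ (TensorProduct.mk k _ _) (cellSpace k t₁ t₁') (cellSpace k t₂ t₂')) :
    TensorProduct.map f (leftOp par t₂.comp (gperm 1 1)) z = f.rTensor _ z := by
  have key : Submodule.map₂ (TensorProduct.mk k _ _) (cellSpace k t₁ t₁') (cellSpace k t₂ t₂') ≤
      LinearMap.eqLocus (TensorProduct.map f (leftOp par t₂.comp (gperm 1 1))) (f.rTensor _) := by
    refine Submodule.map₂_le.2 fun v hv w hw => ?_
    simp [leftOp_gperm par 1 (cellSpace_le _ _ hw)]
  exact key hz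

theorem map_leftOp_one_left (f : World k A₂ B₂ →ₗ[k] World k A₂ B₂)
    {z : World k A₁ B₁ ⊗[k] World k A₂ B₂}
    (hz : z ∈ Submodule.map₂ (TensorProduct.mk k _ _) (cellSpace k t₁ t₁') (cellSpace k t₂ t₂')) :
    TensorProduct.map (leftOp par t₁.comp (gperm 1 1)) f z = f.lTensor _ z := by
  have key : Submodule.map₂ (TensorProduct.mk k _ _) (cellSpace k t₁ t₁') (cellSpace k t₂ t₂') ≤
      LinearMap.eqLocus (TensorProduct.map (leftOp par t₁.comp (gperm 1 1)) f) (f.lTensor _) := by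
    refine Submodule.map₂_le.2 fun v hv w hw => ?_
    simp [leftOp_gperm par 1 (cellSpace_le _ _ hv)]
  exact key hz

theorem gperm_one_compat (t : Tab m A) : Compat t.comp t.comp (gperm 1 1) :=
  gperm_compat t.grp.one_mem

/-- A vector of the tensor product is killed by all diagrams with southern arcs exactly if it is killed by those
whose arcs lie in one of the parts and which are the identity on the other one. -/
theorem arcKernel_sum (hpar : ∀ c, par (-c) = par c) (h : Separates T t₁ t₂)
    (h' : Separates T t₁' t₂') :
    arcKernel par (t₁.sum t₂ h.ne) (t₁'.sum t₂' h'.ne) =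
      Submodule.map₂ tensOp (arcKernel par t₁ t₁') (arcKernel par t₂ t₂') := by
  have e : ∀ {A B : Type} [Fintype A] [Fintype B] [DecidableEq A] [DecidableEq B] (t : Tab m A)
      (t' : Tab m B), cellSpace k t t' ⊓ ⨅ y : {y // Compat t.comp t.comp y ∧ SouthArc y},
        LinearMap.ker (leftOp par t.comp y.1) ≤ arcKernel par t t' := by
    intro A B _ _ _ _ t t' v hv
    rw [Submodule.mem_inf, Submodule.mem_iInf] at hv
    exact (mem_arcKernel_iff hpar).2 ⟨hv.1, fun y hy hs => hv.2 ⟨y, hy, hs⟩⟩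
  apply le_antisymm
  · intro v hv
    rw [mem_arcKernel_iff hpar, mem_cellSpace_sum h h'] at hv
    obtain ⟨⟨z, hz, rfl⟩, hv⟩ := hv
    have h1 : ∀ y : {y // Compat t₁.comp t₁.comp y ∧ SouthArc y},
        (leftOp par t₁.comp y.1).rTensor _ z = 0 := by
      rintro ⟨y, hy, hs⟩
      apply tensOp_injective
      rw [← map_leftOp_one_right (par := par) _ hz, ← leftOp_lift hpar hy (gperm_one_compat t₂) hz,
        map_zero]
      exact hv _ (tens_compat.2 ⟨hy, gperm_one_compat t₂⟩) (tens_southArc.2 (.inl hs))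
    have h2 : ∀ y : {y // Compat t₂.comp t₂.comp y ∧ SouthArc y},
        (leftOp par t₂.comp y.1).lTensor _ z = 0 := by
      rintro ⟨y, hy, hs⟩
      apply tensOp_injective
      rw [← map_leftOp_one_left (par := par) _ hz, ← leftOp_lift hpar (gperm_one_compat t₁) hy hz,
        map_zero]
      exact hv _ (tens_compat.2 ⟨gperm_one_compat t₁, hy⟩) (tens_southArc.2 (.inr hs))
    have h3 := mem_map₂_of_lTensor _ (mem_map₂_of_rTensor _ hz h1) h2
    have h4 := Submodule.mem_map_of_mem (f := TensorProduct.lift tensOp) h3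
    rw [Submodule.map_map₂] at h4
    exact Submodule.map₂_le_map₂ (e t₁ t₁') (e t₂ t₂') h4
  · refine Submodule.map₂_le.2 fun v hv w hw => ?_
    have hv' := (mem_arcKernel_iff hpar).1 hv
    have hw' := (mem_arcKernel_iff hpar).1 hw
    rw [mem_arcKernel_iff hpar, cellSpace_sum h h']
    refine ⟨Submodule.apply_mem_map₂ _ hv'.1 hw'.1, fun y hy hs => ?_⟩
    obtain ⟨y₁, y₂, rfl, hy₁, hy₂⟩ := Compat.exists_tens h.neg h.left h.right h.left h.right hy
    refine (leftOp_tens hpar hy₁ hy₂ (cellSpace_le _ _ hv'.1) (cellSpace_le _ _ hw'.1)).trans ?_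
    rcases tens_southArc.1 hs with hs | hs
    · rw [hv'.2 _ hy₁ hs, map_zero, LinearMap.zero_apply]
    · rw [hw'.2 _ hy₂ hs, map_zero]

theorem finrank_arcKernel_sum (hpar : ∀ c, par (-c) = par c) (h : Separates T t₁ t₂)
    (h' : Separates T t₁' t₂') :
    finrank k (arcKernel par (t₁.sum t₂ h.ne) (t₁'.sum t₂' h'.ne)) =
      finrank k (arcKernel par t₁ t₁') * finrank k (arcKernel par t₂ t₂') := by
  rw [arcKernel_sum hpar h h', finrank_map₂ tensOp_injective]

/-- The operator `x y` on `x X x'`. -/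
noncomputable def cellOp (par : ZMod m → k) (t : Tab m A) (t' : Tab m B) {y : Diagram 1 (A ⊕ A)}
    (hy : Compat t.comp t.comp y) : cellSpace k t t' →ₗ[k] cellSpace k t t' :=
  (t.actN k B (t.symm k) ∘ₗ leftOp par t.comp y).restrict fun _ hv => cellOps_mem hy hv

theorem cellOp_mem {t : Tab m A} {t' : Tab m B} {y : Diagram 1 (A ⊕ A)}
    (hy : Compat t.comp t.comp y) (hs : SouthArc y) :
    cellOp par t t' hy ∈ subOps (cellSpace_stab par t t') :=
  ⟨⟨_, y, hy, hs, rfl⟩, rfl⟩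

/-- An operator `x y` belongs to the given ones or is a scalar. -/
theorem cellOp_cases (hk : ((Fintype.card A).factorial : k) ≠ 0) {t : Tab m A} {t' : Tab m B}
    {y : Diagram 1 (A ⊕ A)} (hy : Compat t.comp t.comp y) :
    SouthArc y ∨ ∃ ε : k, cellOp par t t' hy = ε • LinearMap.id := by
  by_cases hs : SouthArc y
  · exact .inl hs
  · obtain ⟨ε, hε⟩ := exists_scalar hk par t t' ⟨hy, hs⟩
    exact .inr ⟨ε, LinearMap.ext fun v => Subtype.ext (hε v v.2)⟩

set_option maxSynthPendingDepth 3 in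
/-- On the tensor product the operators of diagrams with southern arcs generate the same stable subspaces as the
operators of the two factors, since all other diagrams act by scalars. -/
theorem cellMult_sum (hpar : ∀ c, par (-c) = par c) (h : Separates T t₁ t₂)
    (h' : Separates T t₁' t₂') (hk₁ : ((Fintype.card A₁).factorial : k) ≠ 0)
    (hk₂ : ((Fintype.card A₂).factorial : k) ≠ 0) :
    cellMult par (t₁.sum t₂ h.ne) (t₁'.sum t₂' h'.ne) = cellMult par t₁ t₁' * cellMult par t₂ t₂' := by
  set φ := TensorProduct.lift (tensOp (k := k) (A₁ := A₁) (B₁ := B₁) (A₂ := A₂) (B₂ := B₂)) ∘ₗ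
    TensorProduct.mapIncl (cellSpace k t₁ t₁') (cellSpace k t₂ t₂') with hφ
  have inj : Function.Injective φ := by
    rw [hφ, LinearMap.coe_comp]
    exact tensOp_injective.comp (Module.Flat.tensorProduct_mapIncl_injective_of_right _ _)
  have key : ∀ {y₁ : Diagram 1 (A₁ ⊕ A₁)} {y₂ : Diagram 1 (A₂ ⊕ A₂)} (hy₁ : Compat t₁.comp t₁.comp y₁)
      (hy₂ : Compat t₂.comp t₂.comp y₂),
      ((t₁.sum t₂ h.ne).actN k (B₁ ⊕ B₂) ((t₁.sum t₂ h.ne).symm k) ∘ₗ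
        leftOp par (t₁.sum t₂ h.ne).comp (tens y₁ y₂)) ∘ₗ φ =
      φ ∘ₗ TensorProduct.map (cellOp par t₁ t₁' hy₁) (cellOp par t₂ t₂' hy₂) := by
    intro y₁ y₂ hy₁ hy₂
    refine TensorProduct.ext' fun v w => ?_
    simp only [hφ, LinearMap.comp_apply, TensorProduct.mapIncl, TensorProduct.map_tmul,
      TensorProduct.lift.tmul, Submodule.subtype_apply]
    refine (congrArg _ (leftOp_tens hpar hy₁ hy₂ (cellSpace_le _ _ v.2) (cellSpace_le _ _ w.2))).trans ?_
    exact tensOp_symm h.ne _ _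
  have hmap : (⊤ : Submodule k (cellSpace k t₁ t₁' ⊗[k] cellSpace k t₂ t₂')).map φ =
      cellSpace k (t₁.sum t₂ h.ne) (t₁'.sum t₂' h'.ne) := by
    rw [cellSpace_sum h h', TensorProduct.map₂_eq_range_lift_comp_mapIncl, Submodule.map_top]
  have main := nullLen_map (S := tensorOps (subOps (cellSpace_stab par t₁ t₁'))
      (subOps (cellSpace_stab par t₂ t₂')))
    (S' := cellOps (B₁ ⊕ B₂) par (t₁.sum t₂ h.ne)) φ inj (U := ⊥) (W := ⊤) ?_ ?_
    (stab_bot _) (stab_top _) bot_le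
  · rw [Submodule.map_bot, hmap, nullLen_tensor, nullLen_sub, nullLen_sub] at main
    exact main
  · rintro _ ⟨y, hy, hs, rfl⟩
    obtain ⟨y₁, y₂, rfl, hy₁, hy₂⟩ := Compat.exists_tens h.neg h.left h.right h.left h.right hy
    refine ⟨_, ?_, key hy₁ hy₂⟩
    have e : TensorProduct.map (cellOp par t₁ t₁' hy₁) (cellOp par t₂ t₂' hy₂) =
        (cellOp par t₁ t₁' hy₁).rTensor _ ∘ₗ (cellOp par t₂ t₂' hy₂).lTensor _ := by
      ext; rfl
    rw [e]
    have m₁ : SouthArc y₁ → Dom (tensorOps (subOps (cellSpace_stab par t₁ t₁'))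
        (subOps (cellSpace_stab par t₂ t₂'))) ((cellOp par t₁ t₁' hy₁).rTensor (cellSpace k t₂ t₂')) :=
      fun hs => Dom.of_mem (.inl ⟨_, cellOp_mem hy₁ hs, rfl⟩)
    have m₂ : SouthArc y₂ → Dom (tensorOps (subOps (cellSpace_stab par t₁ t₁'))
        (subOps (cellSpace_stab par t₂ t₂'))) ((cellOp par t₂ t₂' hy₂).lTensor (cellSpace k t₁ t₁')) :=
      fun hs => Dom.of_mem (.inr ⟨_, cellOp_mem hy₂ hs, rfl⟩)
    rcases tens_southArc.1 hs with hs | hs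
    · rcases cellOp_cases (par := par) (t' := t₂') hk₂ hy₂ with hs₂ | ⟨ε, hε⟩
      · exact (m₁ hs).comp (m₂ hs₂)
      · rw [hε, LinearMap.lTensor_smul, LinearMap.lTensor_id, LinearMap.comp_smul, LinearMap.comp_id]
        exact (m₁ hs).smul ε
    · rcases cellOp_cases (par := par) (t' := t₁') hk₁ hy₁ with hs₁ | ⟨ε, hε⟩
      · exact (m₁ hs₁).comp (m₂ hs)
      · rw [hε, LinearMap.rTensor_smul, LinearMap.rTensor_id, LinearMap.smul_comp, LinearMap.id_comp]
        exact (m₂ hs).smul ε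
  · rintro _ (⟨_, ⟨⟨_, y, hy, hs, rfl⟩, rfl⟩, rfl⟩ | ⟨_, ⟨⟨_, y, hy, hs, rfl⟩, rfl⟩, rfl⟩)
    · obtain ⟨ε, h0, hε⟩ := exists_scalar_one hk₂ par t₂ t₂'
      have e : cellOp par t₂ t₂' (gperm_one_compat t₂) = ε • LinearMap.id :=
        LinearMap.ext fun v => Subtype.ext (hε v v.2)
      refine ⟨_, (Dom.of_mem (S := cellOps (B₁ ⊕ B₂) par (t₁.sum t₂ h.ne))
        ⟨_, tens_compat.2 ⟨hy, gperm_one_compat t₂⟩,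
        tens_southArc.2 (.inl hs), rfl⟩).smul ε⁻¹, ?_⟩
      rw [LinearMap.smul_comp, key hy (gperm_one_compat t₂), e, TensorProduct.map_smul_right,
        LinearMap.comp_smul, smul_smul, inv_mul_cancel₀ h0, one_smul]
      rfl
    · obtain ⟨ε, h0, hε⟩ := exists_scalar_one hk₁ par t₁ t₁'
      have e : cellOp par t₁ t₁' (gperm_one_compat t₁) = ε • LinearMap.id :=
        LinearMap.ext fun v => Subtype.ext (hε v v.2)
      refine ⟨_, (Dom.of_mem (S := cellOps (B₁ ⊕ B₂) par (t₁.sum t₂ h.ne))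
        ⟨_, tens_compat.2 ⟨gperm_one_compat t₁, hy⟩,
        tens_southArc.2 (.inr hs), rfl⟩).smul ε⁻¹, ?_⟩
      rw [LinearMap.smul_comp, key (gperm_one_compat t₁) hy, e, TensorProduct.map_smul_left,
        LinearMap.comp_smul, smul_smul, inv_mul_cancel₀ h0, one_smul]
      rfl

end Product

/-! ### Gauge transformations and the Fourier transform of the labels -/

/-- The gauge transformation by `G`: the label of every strand changes by the difference of the values
of `G` at its two ends. -/
def Diagram.shift {m : ℕ} {N : Type} (G : N → ZMod m) (y : Diagram m N) : Diagram m N where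
  mate := y.mate
  lab v := y.lab v + G v - G (y.mate v)
  mate_mate := y.mate_mate
  mate_ne := y.mate_ne
  lab_mate v := by rw [y.mate_mate, y.lab_mate]; ring

theorem Diagram.shift_shift {m : ℕ} {N : Type} (G G' : N → ZMod m) (y : Diagram m N) :
    (y.shift G').shift G = y.shift (G + G') := by
  ext v
  · rfl
  · simp [shift]; ring

/-- The diagram with all labels `0`. -/
def Diagram.lift (m : ℕ) {N : Type} (d : Diagram 1 N) : Diagram m N where
  mate := d.mate
  lab _ := 0
  mate_mate := d.mate_mate
  mate_ne := d.mate_ne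
  lab_mate _ := by simp

/-- The diagram without its labels. -/
def Diagram.forget {m : ℕ} {N : Type} (y : Diagram m N) : Diagram 1 N where
  mate := y.mate
  lab _ := 0
  mate_mate := y.mate_mate
  mate_ne := y.mate_ne
  lab_mate _ := by simp

theorem Diagram.forget_shift_lift {m : ℕ} {N : Type} (G : N → ZMod m) (d : Diagram 1 N) :
    ((d.lift m).shift G).forget = d := by
  ext v
  · rfl
  · exact Subsingleton.elim (α := ZMod 1) _ _

/-- All labellings are gauge equivalent: a gauge is obtained by putting the label of each strand at one
of its ends. -/
theorem Diagram.exists_shift {m : ℕ} {N : Type} [Finite N] (y : Diagram m N) :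
    ∃ G, y = (y.forget.lift m).shift G := by
  obtain ⟨n, ⟨e⟩⟩ := Finite.exists_equiv_fin N
  refine ⟨fun v => if e v < e (y.mate v) then y.lab v else 0, ?_⟩
  ext v
  · rfl
  · have h : e v ≠ e (y.mate v) := fun h => y.mate_ne v (e.injective h.symm)
    change y.lab v = 0 + (if e v < e (y.mate v) then y.lab v else 0) -
      if e (y.mate v) < e (y.mate (y.mate v)) then y.lab (y.mate v) else 0
    rw [y.mate_mate, y.lab_mate]
    rcases lt_or_gt_of_ne h with h | h
    · simp [h, not_lt_of_gt h]
    · simp [h, not_lt_of_gt h]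

/-- The gauge transformation by a function that has equal values at the two ends of each strand is the
identity on `y`. -/
theorem Diagram.shift_eq_self {m : ℕ} {N : Type} {G : N → ZMod m} {y : Diagram m N}
    (h : ∀ v, G (y.mate v) = G v) : y.shift G = y := by
  ext v
  · rfl
  · simp [shift, h]

section Fourier
open Matrix
variable {k : Type*} [Field k] {m : ℕ} [NeZero m] {N : Type} [Fintype N] [DecidableEq N]

variable (k) in
/-- A gauge transformation as a linear map. -/
noncomputable def shiftOp (G : N → ZMod m) : (Diagram m N →₀ k) →ₗ[k] (Diagram m N →₀ k) :=
  Finsupp.lmapDomain k k (Diagram.shift G)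

theorem shiftOp_single (G : N → ZMod m) (y : Diagram m N) (c : k) :
    shiftOp k G (Finsupp.single y c) = Finsupp.single (y.shift G) c := by
  simp [shiftOp]

theorem shiftOp_shiftOp (G G' : N → ZMod m) (v : Diagram m N →₀ k) :
    shiftOp k G (shiftOp k G' v) = shiftOp k (G + G') v := by
  induction v using Finsupp.induction_linear with
  | zero => simp
  | add v w hv hw => simp only [map_add, hv, hw]
  | single y c => simp only [shiftOp_single, Diagram.shift_shift]

theorem shiftOp_zero (v : Diagram m N →₀ k) : shiftOp k 0 v = v := by
  induction v using Finsupp.induction_linear with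
  | zero => simp
  | add v w hv hw => simp only [map_add, hv, hw]
  | single y c =>
    rw [shiftOp_single, Diagram.shift_eq_self fun _ => rfl]

/-- The projection to the vectors on which the gauge transformations act by the character `s`. -/
noncomputable def proj (ψ : AddChar (ZMod m) k) (s : N → ZMod m) :
    (Diagram m N →₀ k) →ₗ[k] (Diagram m N →₀ k) :=
  ((m : k) ^ Fintype.card N)⁻¹ • ∑ G : N → ZMod m, ψ (-(s ⬝ᵥ G)) • shiftOp k G

theorem proj_apply (ψ : AddChar (ZMod m) k) (s : N → ZMod m) (v : Diagram m N →₀ k) :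
    proj ψ s v = ((m : k) ^ Fintype.card N)⁻¹ •
      ∑ G : N → ZMod m, ψ (-(s ⬝ᵥ G)) • shiftOp k G v := by
  simp [proj, LinearMap.sum_apply]

theorem AddChar.apply_neg_mul {m : ℕ} (ψ : AddChar (ZMod m) k) (c : ZMod m) : ψ (-c) * ψ c = 1 := by
  rw [← AddChar.map_add_eq_mul, neg_add_cancel, AddChar.map_zero_eq_one]

theorem proj_shiftOp (ψ : AddChar (ZMod m) k) (s G : N → ZMod m) (v : Diagram m N →₀ k) :
    proj ψ s (shiftOp k G v) = ψ (s ⬝ᵥ G) • proj ψ s v := by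
  have e : ∀ G', ψ (-(s ⬝ᵥ G')) • shiftOp k G' (shiftOp k G v) =
      ψ (s ⬝ᵥ G) • (ψ (-(s ⬝ᵥ (G' + G))) • shiftOp k (G' + G) v) := fun G' => by
    rw [shiftOp_shiftOp, smul_smul, dotProduct_add, neg_add, AddChar.map_add_eq_mul, mul_left_comm,
      mul_comm (ψ (s ⬝ᵥ G)), AddChar.apply_neg_mul, mul_one]
  rw [proj_apply, proj_apply]
  simp only [e, ← Finset.smul_sum]
  rw [smul_comm]
  congr 2
  exact Equiv.sum_comp (Equiv.addRight G) fun G' => ψ (-(s ⬝ᵥ G')) • shiftOp k G' v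

theorem shiftOp_proj (ψ : AddChar (ZMod m) k) (s G : N → ZMod m) (v : Diagram m N →₀ k) :
    shiftOp k G (proj ψ s v) = ψ (s ⬝ᵥ G) • proj ψ s v := by
  rw [← proj_shiftOp, proj_apply, proj_apply, map_smul, map_sum]
  simp only [map_smul, shiftOp_shiftOp, add_comm]

/-- A vector on which the gauge transformations act by `s` is fixed by the projection. -/
theorem proj_eq_self (hm : (m : k) ≠ 0) {ψ : AddChar (ZMod m) k} {s : N → ZMod m}
    {v : Diagram m N →₀ k} (h : ∀ G, shiftOp k G v = ψ (s ⬝ᵥ G) • v) : proj ψ s v = v := by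
  rw [proj_apply]
  simp only [h, smul_smul, AddChar.apply_neg_mul, one_smul, Finset.sum_const, Finset.card_univ,
    Fintype.card_pi, ZMod.card, Finset.prod_const]
  rw [← Nat.cast_smul_eq_nsmul k, smul_smul, Nat.cast_pow, inv_mul_cancel₀ (pow_ne_zero _ hm),
    one_smul]

theorem proj_single_eq_zero {ψ : AddChar (ZMod m) k} (hψ : ∀ c, ψ c = 1 → c = 0) {s : N → ZMod m}
    {y : Diagram m N} (h : ¬ ∀ v, s (y.mate v) = - s v) (c : k) :
    proj ψ s (Finsupp.single y c) = 0 := by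
  push Not at h
  obtain ⟨v, hv⟩ := h
  have h1 : y.shift (Pi.single v 1 + Pi.single (y.mate v) 1) = y := by
    refine Diagram.shift_eq_self fun w => ?_
    have e : y.mate w = v ↔ w = y.mate v :=
      ⟨fun h => by rw [← h, y.mate_mate], fun h => by rw [h, y.mate_mate]⟩
    have e' : y.mate w = y.mate v ↔ w = v :=
      ⟨fun h => by rw [← y.mate_mate w, h, y.mate_mate], fun h => by rw [h]⟩
    simp only [Pi.add_apply, Pi.single_apply, e, e', add_comm]
  have h2 := proj_shiftOp ψ s (Pi.single v 1 + Pi.single (y.mate v) 1) (Finsupp.single y c)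
  rw [shiftOp_single, h1, dotProduct_add, dotProduct_single, dotProduct_single, mul_one, mul_one] at h2
  by_contra h0
  have h3 : (1 - ψ (s v + s (y.mate v))) • proj ψ s (Finsupp.single y c) = 0 := by
    rw [sub_smul, one_smul, ← h2, sub_self]
  rcases smul_eq_zero.1 h3 with h3 | h3
  · exact hv (eq_neg_of_add_eq_zero_right (hψ _ (sub_eq_zero.1 h3).symm))
  · exact h0 h3

/-- A function with opposite signs at the ends of the strands is orthogonal to one with equal values
there. -/
theorem dotProduct_eq_zero_of_mate {s G : N → ZMod m} {f : N → N} (hf : ∀ v, f (f v) = v)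
    (hne : ∀ v, f v ≠ v) (hs : ∀ v, s (f v) = - s v) (hG : ∀ v, G (f v) = G v) : s ⬝ᵥ G = 0 := by
  refine Finset.sum_involution (fun v _ => f v) ?_ ?_ ?_ ?_
  · intro v _; rw [hs, hG]; ring
  · intro v _ _; exact hne v
  · intro v _; exact Finset.mem_univ _
  · intro v _; exact hf v

/-- The unlabelled diagrams, mapped to the vectors on which gauge transformations act by `s`. -/
noncomputable def spread (ψ : AddChar (ZMod m) k) (s : N → ZMod m) :
    (Diagram 1 N →₀ k) →ₗ[k] (Diagram m N →₀ k) :=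
  proj ψ s ∘ₗ Finsupp.lmapDomain k k (Diagram.lift m)

theorem spread_single (ψ : AddChar (ZMod m) k) (s : N → ZMod m) (d : Diagram 1 N) (c : k) :
    spread ψ s (Finsupp.single d c) = proj ψ s (Finsupp.single (d.lift m) c) := by
  simp [spread]

theorem shiftOp_spread (ψ : AddChar (ZMod m) k) (s G : N → ZMod m) (v : Diagram 1 N →₀ k) :
    shiftOp k G (spread ψ s v) = ψ (s ⬝ᵥ G) • spread ψ s v := shiftOp_proj _ _ _ _

theorem proj_shift_lift (ψ : AddChar (ZMod m) k) (s G : N → ZMod m) (d : Diagram 1 N) (c : k) :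
    proj ψ s (Finsupp.single ((d.lift m).shift G) c) =
      ψ (s ⬝ᵥ G) • spread ψ s (Finsupp.single d c) := by
  rw [← shiftOp_single, proj_shiftOp, spread_single]

theorem proj_single (ψ : AddChar (ZMod m) k) (s : N → ZMod m) (y : Diagram m N) :
    ∃ a : k, ∀ c, proj ψ s (Finsupp.single y c) = a • spread ψ s (Finsupp.single y.forget c) := by
  obtain ⟨G, hG⟩ := y.exists_shift
  exact ⟨ψ (s ⬝ᵥ G), fun c => by conv_lhs => rw [hG, proj_shift_lift]⟩

/-- A left inverse of `spread` on the span of the diagrams compatible with `s`. -/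
noncomputable def unspread (ψ : AddChar (ZMod m) k) (s : N → ZMod m) :
    (Diagram m N →₀ k) →ₗ[k] (Diagram 1 N →₀ k) :=
  Finsupp.linearCombination k fun y =>
    Finsupp.single y.forget (ψ (s ⬝ᵥ y.exists_shift.choose))

/-- The map `spread` is injective on compatible diagrams. -/
theorem unspread_spread (hm : (m : k) ≠ 0) (ψ : AddChar (ZMod m) k) {s : N → ZMod m}
    {d : Diagram 1 N} (hd : ∀ v, s (d.mate v) = - s v) (c : k) :
    unspread ψ s (spread ψ s (Finsupp.single d c)) = Finsupp.single d c := by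
  have key : ∀ G, unspread ψ s (shiftOp k G (Finsupp.single (d.lift m) c)) =
      ψ (s ⬝ᵥ G) • Finsupp.single d c := by
    intro G
    rw [shiftOp_single, unspread, Finsupp.linearCombination_single]
    have h := ((d.lift m).shift G).exists_shift.choose_spec
    set H := ((d.lift m).shift G).exists_shift.choose
    clear_value H
    rw [Diagram.forget_shift_lift] at h ⊢
    rw [Finsupp.smul_single, Finsupp.smul_single, smul_eq_mul, smul_eq_mul, mul_comm]
    congr 3
    rw [← sub_eq_zero, ← dotProduct_sub]
    refine dotProduct_eq_zero_of_mate d.mate_mate d.mate_ne hd fun v => ?_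
    have h' := congrFun (congrArg Diagram.lab h) v
    simp only [Diagram.shift, Diagram.lift, zero_add] at h'
    simp only [Pi.sub_apply]
    linear_combination h'
  rw [spread_single, proj_apply, map_smul, map_sum]
  simp only [map_smul, key, smul_smul, AddChar.apply_neg_mul, one_smul, Finset.sum_const,
    Finset.card_univ, Fintype.card_pi, ZMod.card, Finset.prod_const]
  rw [← Nat.cast_smul_eq_nsmul k, smul_smul, Nat.cast_pow, inv_mul_cancel₀ (pow_ne_zero _ hm),
    one_smul]

end Fourier

/-! ### Concatenation and the Fourier transform -/

section GaugeGlue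
open Matrix
variable {k : Type*} [Field k] {m : ℕ} {N : Type} [DecidableEq N] {A B C : Type} [DecidableEq A]
  [DecidableEq B] [DecidableEq C]

/-- The gauge transformation of an intermediate stage of a concatenation. -/
def GlueState.shift (K : N → ZMod m) (s : GlueState k m N) : GlueState k m N :=
  ⟨s.mate, fun v => s.lab v + K v - K (s.mate v), s.wt⟩

/-- Glueing commutes with gauge transformations that are trivial at the glued nodes. -/
theorem glue_shift (δ : ZMod m → k) {p q : N} {K : N → ZMod m} (hp : K p = 0) (hq : K q = 0)
    (s : GlueState k m N) : glue δ p q (s.shift K) = (glue δ p q s).shift K := by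
  simp only [glue, GlueState.shift, GlueState.mk.injEq]
  refine ⟨rfl, ?_, ?_⟩
  · funext v
    by_cases h1 : v = p ∨ v = q
    · simp [h1]
    · by_cases h2 : s.mate v = p
      · simp only [h1, h2, if_true, if_false, hp, hq]; ring
      · by_cases h3 : s.mate v = q
        · by_cases h4 : q = p
          · subst h4; exact (h2 h3).elim
          · simp only [h1, h3, h4, if_true, if_false, hp, hq]; ring
        · simp only [h1, h2, h3, if_false]
  · by_cases h : s.mate q = p
    · simp [h, hp, hq]
    · simp [h]

theorem gl_shift (δ : B → ZMod m → k) (L : List B) {K : Mid A B C → ZMod m}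
    (hK : ∀ b ∈ L, K (.inl (.inr b)) = 0 ∧ K (.inr (.inl b)) = 0) (s : GlueState k m (Mid A B C)) :
    gl δ L (s.shift K) = (gl δ L s).shift K := by
  induction L with
  | nil => rfl
  | cons b L ih =>
    rw [gl_cons, ih fun c hc => hK c (List.mem_cons_of_mem _ hc),
      glue_shift _ (hK b (by simp)).1 (hK b (by simp)).2, gl_cons]

/-- Gauge transformations at the outer nodes commute with concatenation. -/
theorem gcomp_shift (δ : B → ZMod m → k) (L : Enum B) (g : A → ZMod m) (h : C → ZMod m)
    (x : Diagram m (A ⊕ B)) (y : Diagram m (B ⊕ C)) :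
    gcomp δ L (x.shift (Sum.elim g 0)) (y.shift (Sum.elim 0 h)) =
      (gcomp δ L x y).shift (Sum.elim g h) ∧
    gwt δ L (x.shift (Sum.elim g 0)) (y.shift (Sum.elim 0 h)) = gwt δ L x y := by
  set K : Mid A B C → ZMod m := Sum.elim (Sum.elim g 0) (Sum.elim 0 h)
  have e : gjoin k (x.shift (Sum.elim g 0)) (y.shift (Sum.elim 0 h)) = (gjoin k x y).shift K := by
    simp only [gjoin, GlueState.shift, GlueState.mk.injEq, Diagram.shift, true_and, and_true]
    funext v
    rcases v with v | v <;> simp [K]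
  have f := gcomp_emb δ L x y
  have hK : ∀ v, K (gouter v) = Sum.elim g h v := by rintro (v | v) <;> rfl
  refine gcomp_unique ?_
  rw [e, gl_shift _ _ (fun b _ => by simp [K])]
  refine ⟨f.mate, fun v => ?_, f.wt⟩
  have f1 := f.mate v
  have f2 := f.lab v
  simp only [Diagram.toState] at f1 f2
  simp only [GlueState.shift, Diagram.toState, Diagram.shift, f1, f2, hK]

/-- The gauge of a concatenation.  If the labels are the differences of the values of `K` before gluing
the nodes in `L`, then afterwards they are those of `gaugeAfter mate L K`; here `mate` gives the
strands after each step. -/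
def gaugeAfter (mate : List B → Mid A B C → Mid A B C) : List B → (Mid A B C → ZMod m) →
    (Mid A B C → ZMod m)
  | [], K => K
  | b :: L, K =>
    let K' := gaugeAfter mate L K
    K' - Pi.single (.inl (.inr b)) (K' (.inl (.inr b))) - Pi.single (.inr (.inl b)) (K' (.inr (.inl b)))
      + if mate L (.inr (.inl b)) = .inl (.inr b) then 0 else
        Pi.single (mate L (.inr (.inl b))) (K' (.inl (.inr b)) - K' (.inr (.inl b)))

variable {mt : List B → Mid A B C → Mid A B C}

/-- The gauge after glueing determines the labels. -/
theorem gl_gaugeAfter (δ : B → ZMod m → k) (L : List B) {s : GlueState k m (Mid A B C)}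
    (hs : GReady L s) (K : Mid A B C → ZMod m) (hlab : ∀ v, s.lab v = K v - K (s.mate v)) :
    (∀ v, (gl δ L s).lab v = gaugeAfter (fun L => (gl δ L s).mate) L K v -
      gaugeAfter (fun L => (gl δ L s).mate) L K ((gl δ L s).mate v)) ∧
    (∀ b ∈ L, gaugeAfter (fun L => (gl δ L s).mate) L K (.inl (.inr b)) = 0 ∧
      gaugeAfter (fun L => (gl δ L s).mate) L K (.inr (.inl b)) = 0) := by
  induction L with
  | nil => exact ⟨hlab, by simp⟩
  | cons b L ih =>
    obtain ⟨i1, i2⟩ := ih hs.tail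
    obtain ⟨g1, g2, g3⟩ := gl_spec δ L s hs.tail
    have hb := (List.nodup_cons.1 hs.nodup).1
    have hal := hs.alive b (by simp)
    have hne : ∀ c ∈ L, b ≠ c := by rintro c hc rfl; exact hb hc
    have q1 := g2 (.inl (.inr b)) hal.1 (fun c hc => by simp [hne c hc])
    have q2 := g2 (.inr (.inl b)) hal.2 (fun c hc => by simp [hne c hc])
    set K' := gaugeAfter (fun L => (gl δ L s).mate) L K with hK'
    set t := gl δ L s with ht
    have m1 := g1.mate_mate
    have hK : gaugeAfter (fun L => (gl δ L s).mate) (b :: L) K =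
      K' - Pi.single (.inl (.inr b)) (K' (.inl (.inr b))) -
        Pi.single (.inr (.inl b)) (K' (.inr (.inl b)))
      + if t.mate (.inr (.inl b)) = .inl (.inr b) then 0 else
        Pi.single (t.mate (.inr (.inl b))) (K' (.inl (.inr b)) - K' (.inr (.inl b))) := rfl
    have z1 : ∀ c ∈ L, t.mate (.inr (.inl b)) ≠ .inl (.inr c) ∧ t.mate (.inr (.inl b)) ≠ .inr (.inl c) := by
      intro c hc
      have e1 := (g3 c hc).1
      have e2 := (g3 c hc).2
      refine ⟨fun h => ?_, fun h => ?_⟩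
      · have := m1 (.inr (.inl b)); rw [h, e1] at this; simp at this
      · have := m1 (.inr (.inl b)); rw [h, e2] at this; simp [(hne c hc).symm] at this
    have z2 : ∀ c ∈ b :: L, gaugeAfter (fun L => (gl δ L s).mate) (b :: L) K (.inl (.inr c)) = 0 ∧
        gaugeAfter (fun L => (gl δ L s).mate) (b :: L) K (.inr (.inl c)) = 0 := by
      intro c hc
      rw [hK]
      by_cases hl : t.mate (.inr (.inl b)) = .inl (.inr b)
      · rw [if_pos hl]
        rcases List.mem_cons.1 hc with rfl | hc
        · simp
        · simp [(hne c hc).symm, (i2 c hc).1, (i2 c hc).2]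
      · rw [if_neg hl]
        rcases List.mem_cons.1 hc with rfl | hc
        · simp [Ne.symm hl, q2.symm]
        · simp [(hne c hc).symm, (i2 c hc).1, (i2 c hc).2, (z1 c hc).1.symm,
            (z1 c hc).2.symm]
    refine ⟨?_, z2⟩
    clear z1 z2 i2 g3 hal
    rw [gl_cons, ← ht, hK]
    generalize hp : (Sum.inl (Sum.inr b) : Mid A B C) = p at *
    generalize hq : (Sum.inr (Sum.inl b) : Mid A B C) = q at *
    have hpq : p ≠ q := by rw [← hp, ← hq]; simp
    intro v
    · have b1 := m1 v
      have b2 := m1 p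
      have b3 := m1 q
      have c1 := i1 v
      have c2 := i1 p
      have c3 := i1 q
      by_cases hl : t.mate q = p
      · rw [if_pos hl]
        simp only [glue, Pi.add_apply, Pi.sub_apply, Pi.single_apply, Pi.zero_apply]
        grind
      · rw [if_neg hl]
        simp only [glue, Pi.add_apply, Pi.sub_apply, Pi.single_apply]
        grind

/-- Gauge transformations at a node that has not been glued carry over. -/
theorem gaugeAfter_add_single (mt : List B → Mid A B C → Mid A B C) {L : List B} {b : B} (hb : b ∉ L)
    (K : Mid A B C → ZMod m) (i : ZMod m) :
    gaugeAfter mt L (K + Pi.single (.inr (.inl b)) i) =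
      gaugeAfter mt L K + Pi.single (.inr (.inl b)) i := by
  induction L with
  | nil => rfl
  | cons c L ih =>
    have h1 : c ≠ b := fun h => hb (by simp [h])
    simp only [gaugeAfter, ih fun h => hb (List.mem_cons_of_mem _ h), Pi.add_apply]
    have e1 : (Pi.single (.inr (.inl b)) i : Mid A B C → ZMod m) (.inl (.inr c)) = 0 := by simp
    have e2 : (Pi.single (.inr (.inl b)) i : Mid A B C → ZMod m) (.inr (.inl c)) = 0 := by
      simp [h1]
    rw [e1, e2, add_zero, add_zero]
    abel

theorem gaugeAfter_cons_dotProduct [Fintype A] [Fintype B] [Fintype C]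
    (mt : List B → Mid A B C → Mid A B C) (L : List B) (b : B)
    {sg : Mid A B C → ZMod m} (h : sg (.inl (.inr b)) = - sg (.inr (.inl b)))
    (h' : mt L (.inr (.inl b)) ≠ .inr (.inl b) →
      sg (mt L (.inr (.inl b))) = - sg (.inr (.inl b)))
    (hne : mt L (.inr (.inl b)) ≠ .inr (.inl b)) (K : Mid A B C → ZMod m) :
    sg ⬝ᵥ gaugeAfter mt (b :: L) K = sg ⬝ᵥ gaugeAfter mt L K -
      if mt L (.inr (.inl b)) = .inl (.inr b) then
        sg (.inr (.inl b)) * (gaugeAfter mt L K (.inr (.inl b)) - gaugeAfter mt L K (.inl (.inr b)))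
      else 0 := by
  simp only [gaugeAfter, dotProduct_add, dotProduct_sub, dotProduct_single, h]
  by_cases hl : mt L (.inr (.inl b)) = .inl (.inr b)
  · rw [if_pos hl, if_pos hl, dotProduct_zero]; ring
  · rw [if_neg hl, if_neg hl, dotProduct_single, h' hne]; ring

theorem gl_mate_eq {m' : ℕ} (δ : B → ZMod m → k) (δ' : B → ZMod m' → k) (L : List B)
    {s : GlueState k m (Mid A B C)} {s' : GlueState k m' (Mid A B C)} (h : s.mate = s'.mate) :
    (gl δ L s).mate = (gl δ' L s').mate := by
  induction L with
  | nil => exact h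
  | cons b L ih => simp only [gl_cons, glue, ih]

/-- The Fourier transform of the parameters. -/
noncomputable def parBar [NeZero m] (ψ : AddChar (ZMod m) k) (δ : ZMod m → k) (c : ZMod m) : k :=
  (m : k)⁻¹ * ∑ i, ψ (c * i) * δ i

theorem parBar_neg [NeZero m] (ψ : AddChar (ZMod m) k) {δ : ZMod m → k} (hδ : ∀ i, δ (-i) = δ i)
    (c : ZMod m) : parBar ψ δ (-c) = parBar ψ δ c := by
  rw [parBar, parBar]
  congr 1
  refine Fintype.sum_equiv (Equiv.neg _) _ _ fun i => ?_
  rw [Equiv.neg_apply, hδ, mul_neg, neg_mul]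

/-- The average over all labellings, with the weights of the characters, of the product of the
parameters of the loops.  The labels of a loop are averaged by the gauge transformations at one of its
nodes. -/
theorem sum_gl_wt [NeZero m] [Fintype A] [Fintype B] [Fintype C] (hm : (m : k) ≠ 0)
    (ψ : AddChar (ZMod m) k) {δ : ZMod m → k}
    (hδ : ∀ i, δ (-i) = δ i) {γ₀ : A → ZMod m} {γ : B → ZMod m} {γ' : C → ZMod m}
    {x : Diagram 1 (A ⊕ B)} {y : Diagram 1 (B ⊕ C)} (hx : Compat γ₀ γ x) (hy : Compat γ γ' y)
    (L : List B) (hL : L.Nodup) :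
    ∑ K : Mid A B C → ZMod m,
      ψ (midSign γ₀ γ γ' ⬝ᵥ gaugeAfter (fun L => (gl (fun _ => δ) L (gjoin k (x.lift m) (y.lift m))).mate) L K
        - midSign γ₀ γ γ' ⬝ᵥ K) *
      (gl (fun _ => δ) L ((gjoin k (x.lift m) (y.lift m)).shift K)).wt =
    (m : k) ^ Fintype.card (Mid A B C) *
      (gl (colourPar (parBar ψ δ) γ) L (gjoin k x y)).wt := by
  set s₀ := gjoin k (x.lift m) (y.lift m) with hs₀
  set mt : List B → Mid A B C → Mid A B C := fun L => (gl (fun _ => δ) L s₀).mate with hmt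
  have e0 : ∀ (K : Mid A B C → ZMod m) (L : List B),
      (gl (fun _ => δ) L (s₀.shift K)).mate = mt L := fun K L => gl_mate_eq _ _ L rfl
  have e1 : ∀ L, (gl (colourPar (parBar ψ δ) γ) L (gjoin k x y)).mate = mt L :=
    fun L => gl_mate_eq _ _ L rfl
  have hsg : ∀ b, midSign γ₀ γ γ' (.inl (.inr b)) = - midSign γ₀ γ γ' (.inr (.inl b)) := fun _ => rfl
  induction L with
  | nil =>
    simp [gaugeAfter, gl, GlueState.shift, hs₀, gjoin, Finset.card_univ, Fintype.card_pi]
  | cons b L ih =>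
    obtain ⟨hb, hL'⟩ := List.nodup_cons.1 hL
    have ih := ih hL'
    have hr : GReady L s₀ := gjoin_ready (k := k) (x.lift m) (y.lift m) hL'
    have hr₁ := gjoin_ready (k := k) x y hL'
    have hne : ∀ c ∈ L, b ≠ c := by rintro c hc rfl; exact hb hc
    have halive : mt L (.inr (.inl b)) ≠ .inr (.inl b) :=
      (gl_spec (fun _ => δ) L s₀ hr).2.1 _ (gjoin_alive _ _ _) (fun c hc => by simp [hne c hc])
    have hsigned : mt L (.inr (.inl b)) ≠ .inr (.inl b) →
        midSign γ₀ γ γ' (mt L (.inr (.inl b))) = - midSign γ₀ γ γ' (.inr (.inl b)) := by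
      have := (gjoin_signed (k := k) hx hy).gl (colourPar (parBar ψ δ) γ) hsg L hr₁ (.inr (.inl b))
      rwa [e1] at this
    have hpair := gaugeAfter_cons_dotProduct mt L b (hsg b) hsigned halive
    have hlab : ∀ K, (gl (fun _ => δ) L (s₀.shift K)).lab (.inr (.inl b)) =
        gaugeAfter mt L K (.inr (.inl b)) - gaugeAfter mt L K (mt L (.inr (.inl b))) := by
      intro K
      have hrK : GReady L (s₀.shift K) := by
        refine ⟨⟨hr.good.mate_mate, fun v => ?_⟩, hL', hr.alive⟩
        have h1 := hr.good.mate_mate v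
        have h2 := hr.good.lab_mate v
        simp only [GlueState.shift, h1, h2]; ring
      have h := (gl_gaugeAfter (fun _ => δ) L hrK K (fun v => by
        rcases v with v | v <;> simp [GlueState.shift, hs₀, gjoin, Diagram.lift])).1 (.inr (.inl b))
      have e : (fun L => (gl (fun _ => δ) L (s₀.shift K)).mate) = mt := funext fun L => e0 K L
      rw [e, e0] at h
      exact h
    by_cases hl : mt L (.inr (.inl b)) = .inl (.inr b)
    · simp only [gl_cons, glue, e0, e1, hl, if_true, hpair, hlab]
      set f : (Mid A B C → ZMod m) → k := fun K =>
        ψ (midSign γ₀ γ γ' ⬝ᵥ gaugeAfter mt L K - midSign γ₀ γ γ' ⬝ᵥ K) *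
          (gl (fun _ => δ) L (s₀.shift K)).wt with hf
      set z : (Mid A B C → ZMod m) → ZMod m := fun K =>
        gaugeAfter mt L K (.inr (.inl b)) - gaugeAfter mt L K (.inl (.inr b)) with hz
      set g : ZMod m → k := fun i => ψ (-(γ b) * i) * δ i with hg
      have hfi : ∀ K i, f (K + Pi.single (.inr (.inl b)) i) = f K := by
        intro K i
        have h1 : s₀.shift (K + Pi.single (.inr (.inl b)) i) =
            (s₀.shift K).shift (Pi.single (.inr (.inl b)) i) := by
          simp only [GlueState.shift, GlueState.mk.injEq, Pi.add_apply, true_and, and_true]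
          funext v; ring
        simp only [hf]
        rw [h1, gl_shift _ _ (fun c hc => by simp [(hne c hc).symm]),
          gaugeAfter_add_single mt hb, dotProduct_add, dotProduct_add, add_sub_add_right_eq_sub]
        rfl
      have hzi : ∀ K i, z (K + Pi.single (.inr (.inl b)) i) = z K + i := by
        intro K i
        simp only [hz]
        rw [gaugeAfter_add_single mt hb]
        simp
        ring
      have hsum : ∀ i, ∑ K, f K * g (z K) = ∑ K, f K * g (z K + i) := by
        intro i
        rw [← Equiv.sum_comp (Equiv.addRight (Pi.single (.inr (.inl b)) i))]
        simp only [Equiv.coe_addRight, hfi, hzi]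
      have hG : ∀ w, ∑ i, g (w + i) = (m : k) * parBar ψ δ (γ b) := by
        intro w
        rw [← parBar_neg ψ hδ, parBar, mul_inv_cancel_left₀ hm]
        exact Equiv.sum_comp (Equiv.addLeft w) g
      have hmain : (m : k) * ∑ K, f K * g (z K) = (m : k) * (parBar ψ δ (γ b) * ∑ K, f K) := by
        calc (m : k) * ∑ K, f K * g (z K) = ∑ i : ZMod m, ∑ K, f K * g (z K) := by
              simp [Finset.card_univ, ZMod.card]
          _ = ∑ i : ZMod m, ∑ K, f K * g (z K + i) := Finset.sum_congr rfl fun i _ => hsum i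
          _ = ∑ K, f K * ∑ i, g (z K + i) := by
              rw [Finset.sum_comm]; simp only [Finset.mul_sum]
          _ = _ := by
              simp only [hG, ← Finset.sum_mul]; ring
      have hmain := mul_left_cancel₀ hm hmain
      rw [ih] at hmain
      refine Eq.trans ?_ (show parBar ψ δ (γ b) * ((m : k) ^ Fintype.card (Mid A B C) *
        (gl (colourPar (parBar ψ δ) γ) L (gjoin k x y)).wt) = (m : k) ^ Fintype.card (Mid A B C) *
        ((gl (colourPar (parBar ψ δ) γ) L (gjoin k x y)).wt * parBar ψ δ (γ b)) by ring)
      rw [← hmain]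
      refine Finset.sum_congr rfl fun K _ => ?_
      simp only [hf, hg]
      have hq : midSign γ₀ γ γ' (.inr (.inl b)) = γ b := rfl
      rw [hq, show midSign γ₀ γ γ' ⬝ᵥ gaugeAfter mt L K - γ b * z K - midSign γ₀ γ γ' ⬝ᵥ K =
        (midSign γ₀ γ γ' ⬝ᵥ gaugeAfter mt L K - midSign γ₀ γ γ' ⬝ᵥ K) + -γ b * z K by ring,
        AddChar.map_add_eq_mul]
      ring
    · simp only [gl_cons, glue, e0, e1, hl, if_false, hpair, sub_zero]
      exact ih

/-- The concatenation of gauge transforms of unlabelled diagrams. -/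
theorem gcomp_shift_lift [NeZero m] (δ : ZMod m → k) (L : Enum B) (δ' : B → ZMod 1 → k)
    (x : Diagram 1 (A ⊕ B)) (y : Diagram 1 (B ⊕ C)) (K : Mid A B C → ZMod m) :
    gcomp (fun _ => δ) L ((x.lift m).shift (K ∘ .inl)) ((y.lift m).shift (K ∘ .inr)) =
      ((gcomp δ' L x y).lift m).shift
        (gaugeAfter (fun L => (gl (fun _ => δ) L (gjoin k (x.lift m) (y.lift m))).mate) L.1 K ∘ gouter) ∧
    gwt (fun _ => δ) L ((x.lift m).shift (K ∘ .inl)) ((y.lift m).shift (K ∘ .inr)) =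
      (gl (fun _ => δ) L.1 ((gjoin k (x.lift m) (y.lift m)).shift K)).wt ∧
    ∀ b, gaugeAfter (fun L => (gl (fun _ => δ) L (gjoin k (x.lift m) (y.lift m))).mate) L.1 K
        (.inl (.inr b)) = 0 ∧
      gaugeAfter (fun L => (gl (fun _ => δ) L (gjoin k (x.lift m) (y.lift m))).mate) L.1 K
        (.inr (.inl b)) = 0 := by
  have e : gjoin k ((x.lift m).shift (K ∘ .inl)) ((y.lift m).shift (K ∘ .inr)) =
      (gjoin k (x.lift m) (y.lift m)).shift K := by
    simp only [gjoin, GlueState.shift, GlueState.mk.injEq, Diagram.shift, true_and, and_true]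
    funext v
    rcases v with v | v <;> simp [Diagram.lift]
  have e0 : (fun L => (gl (fun _ => δ) L ((gjoin k (x.lift m) (y.lift m)).shift K)).mate) =
      fun L => (gl (fun _ => δ) L (gjoin k (x.lift m) (y.lift m))).mate :=
    funext fun L => gl_mate_eq _ _ L rfl
  have e1 : (gl (fun _ => δ) L.1 ((gjoin k (x.lift m) (y.lift m)).shift K)).mate =
      (gl δ' L.1 (gjoin k x y)).mate := gl_mate_eq _ _ L.1 rfl
  have hr := gjoin_ready (k := k) ((x.lift m).shift (K ∘ .inl)) ((y.lift m).shift (K ∘ .inr)) L.2.1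
  rw [e] at hr
  have h := (gl_gaugeAfter (fun _ => δ) L.1 hr K (fun v => by
    rcases v with v | v <;> simp [GlueState.shift, gjoin, Diagram.lift]))
  rw [e0] at h
  obtain ⟨h, h0⟩ := h
  rw [← and_assoc]
  refine ⟨?_, fun b => h0 b (L.2.2 b)⟩
  refine gcomp_unique ?_
  rw [e]
  have f := gcomp_emb δ' L x y
  refine ⟨fun v => ?_, fun v => ?_, (mul_one _).symm⟩
  · rw [e1]; exact f.mate v
  · rw [h, e1, f.mate v]
    simp [Diagram.toState, Diagram.shift, Diagram.lift]

section Spread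
variable [NeZero m] {a b c : ℕ}

theorem compLin_shiftOp (δ : ZMod m → k) (g : Fin a → ZMod m) (h : Fin c → ZMod m)
    (X : Diag m a b →₀ k) (Y : Diag m b c →₀ k) :
    compLin δ a b c (shiftOp k (Sum.elim g 0) X) (shiftOp k (Sum.elim 0 h) Y) =
      shiftOp k (Sum.elim g h) (compLin δ a b c X Y) := by
  have e : (compLin δ a b c).compl₁₂ (shiftOp k (Sum.elim g 0)) (shiftOp k (Sum.elim 0 h)) =
      (compLin δ a b c).compr₂ (shiftOp k (Sum.elim g h)) := by
    ext x y : 4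
    simp only [LinearMap.comp_apply, LinearMap.compr₂_apply, LinearMap.compl₁₂_apply,
      Finsupp.lsingle_apply, shiftOp_single, compLin_single, (comp_eq_gcomp _ _ _).1,
      (comp_eq_gcomp _ _ _).2, (gcomp_shift _ _ _ _ _ _).1, (gcomp_shift _ _ _ _ _ _).2]
  exact LinearMap.congr_fun₂ e X Y

/-- Concatenation of the Fourier transforms of coloured diagrams.  The parameter of a loop becomes the
Fourier coefficient at the colour of the loop. -/
theorem compLin_spread (hm : (m : k) ≠ 0) (ψ : AddChar (ZMod m) k) {δ : ZMod m → k}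
    (hδ : ∀ i, δ (-i) = δ i) {γ₀ : Fin a → ZMod m} {γ : Fin b → ZMod m} {γ' : Fin c → ZMod m}
    {x : Diag 1 a b} {y : Diag 1 b c} (hx : Compat γ₀ γ x) (hy : Compat γ γ' y) :
    compLin δ a b c (spread ψ (sign γ₀ γ) (Finsupp.single x 1))
      (spread ψ (sign γ γ') (Finsupp.single y 1)) =
    gwt (colourPar (parBar ψ δ) γ) (Enum.fin b) x y •
      spread ψ (sign γ₀ γ')
        (Finsupp.single (gcomp (colourPar (parBar ψ δ) γ) (Enum.fin b) x y) 1) := by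
  set Z := compLin δ a b c (spread ψ (sign γ₀ γ) (Finsupp.single x 1))
      (spread ψ (sign γ γ') (Finsupp.single y 1)) with hZ
  have h1 : proj ψ (sign γ₀ γ') Z = Z := by
    refine proj_eq_self hm fun G => ?_
    obtain ⟨g, h, rfl⟩ : ∃ g h, G = Sum.elim g h := ⟨_, _, (Sum.elim_comp_inl_inr G).symm⟩
    rw [hZ, ← compLin_shiftOp, shiftOp_spread, shiftOp_spread, map_smul, map_smul,
      LinearMap.smul_apply, smul_smul, ← AddChar.map_add_eq_mul]
    congr 2
    simp [sign, add_comm]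
  set mt : List (Fin b) → Mid (Fin a) (Fin b) (Fin c) → Mid (Fin a) (Fin b) (Fin c) :=
    fun L => (gl (fun _ => δ) L (gjoin k (x.lift m) (y.lift m))).mate with hmt
  set D := gcomp (colourPar (parBar ψ δ) γ) (Enum.fin b) x y with hD
  have h2 : Z = (((m : k) ^ Fintype.card (Fin a ⊕ Fin b))⁻¹ * ((m : k) ^ Fintype.card (Fin b ⊕ Fin c))⁻¹) •
      ∑ K : Mid (Fin a) (Fin b) (Fin c) → ZMod m, ψ (-(midSign γ₀ γ γ' ⬝ᵥ K)) •
        Finsupp.single ((D.lift m).shift (gaugeAfter mt (Enum.fin b).1 K ∘ gouter))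
          (gl (fun _ => δ) (Enum.fin b).1 ((gjoin k (x.lift m) (y.lift m)).shift K)).wt := by
    rw [hZ, spread_single, spread_single, proj_apply, proj_apply, map_smul, map_smul,
      LinearMap.smul_apply, smul_smul, mul_comm]
    congr 1
    refine Eq.trans ?_ (Equiv.sum_comp
      (Equiv.sumArrowEquivProdArrow (Fin a ⊕ Fin b) (Fin b ⊕ Fin c) (ZMod m)).symm _)
    rw [Fintype.sum_prod_type]
    simp only [map_sum, LinearMap.sum_apply]
    rw [Finset.sum_comm]
    refine Finset.sum_congr rfl fun G _ => ?_
    refine Finset.sum_congr rfl fun H _ => ?_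
    rw [map_smul, map_smul, LinearMap.smul_apply, smul_smul, ← AddChar.map_add_eq_mul, shiftOp_single,
      shiftOp_single, compLin_single, (comp_eq_gcomp _ _ _).1, (comp_eq_gcomp _ _ _).2]
    obtain ⟨k1, k2, -⟩ := gcomp_shift_lift δ (Enum.fin b) (colourPar (parBar ψ δ) γ) x y (Sum.elim G H)
    rw [Sum.elim_comp_inl, Sum.elim_comp_inr] at k1 k2
    rw [k1, k2]
    congr 2
    · change _ = -(Sum.elim (sign γ₀ γ) (sign γ γ') ⬝ᵥ Sum.elim G H)
      rw [sumElim_dotProduct_sumElim]; ring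
    · rw [mul_one, one_mul]; rfl
  have h3 : ∀ K : Mid (Fin a) (Fin b) (Fin c) → ZMod m,
      sign γ₀ γ' ⬝ᵥ (gaugeAfter mt (Enum.fin b).1 K ∘ gouter) =
        midSign γ₀ γ γ' ⬝ᵥ gaugeAfter mt (Enum.fin b).1 K := by
    intro K
    have h := (gcomp_shift_lift δ (Enum.fin b) (colourPar (parBar ψ δ) γ) x y K).2.2
    rw [← hmt] at h
    simp only [dotProduct, Fintype.sum_sum_type, h, mul_zero, Finset.sum_const_zero, add_zero, zero_add]
    rfl
  have h4 := sum_gl_wt hm ψ hδ hx hy (Enum.fin b).1 (Enum.fin b).2.1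
  rw [← hmt] at h4
  have h5 : ∀ w : k, spread ψ (sign γ₀ γ') (Finsupp.single D w) =
      w • spread ψ (sign γ₀ γ') (Finsupp.single D 1) := fun w => by
    rw [← map_smul, Finsupp.smul_single, smul_eq_mul, mul_one]
  have h6 : ∀ K : Mid (Fin a) (Fin b) (Fin c) → ZMod m,
      ψ (-(midSign γ₀ γ γ' ⬝ᵥ K)) * (ψ (midSign γ₀ γ γ' ⬝ᵥ gaugeAfter mt (Enum.fin b).1 K) *
        (gl (fun _ => δ) (Enum.fin b).1 ((gjoin k (x.lift m) (y.lift m)).shift K)).wt) =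
      ψ (midSign γ₀ γ γ' ⬝ᵥ gaugeAfter mt (Enum.fin b).1 K - midSign γ₀ γ γ' ⬝ᵥ K) *
        (gl (fun _ => δ) (Enum.fin b).1 ((gjoin k (x.lift m) (y.lift m)).shift K)).wt := fun K => by
    rw [sub_eq_add_neg, AddChar.map_add_eq_mul]; ring
  have h7 : ∀ K : Mid (Fin a) (Fin b) (Fin c) → ZMod m,
      proj ψ (sign γ₀ γ') (ψ (-(midSign γ₀ γ γ' ⬝ᵥ K)) •
        Finsupp.single ((D.lift m).shift (gaugeAfter mt (Enum.fin b).1 K ∘ gouter))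
          (gl (fun _ => δ) (Enum.fin b).1 ((gjoin k (x.lift m) (y.lift m)).shift K)).wt) =
      (ψ (midSign γ₀ γ γ' ⬝ᵥ gaugeAfter mt (Enum.fin b).1 K - midSign γ₀ γ γ' ⬝ᵥ K) *
        (gl (fun _ => δ) (Enum.fin b).1 ((gjoin k (x.lift m) (y.lift m)).shift K)).wt) •
        spread ψ (sign γ₀ γ') (Finsupp.single D 1) := fun K => by
    rw [map_smul, proj_shift_lift, h3, h5, smul_smul, smul_smul, ← h6, mul_assoc]
  rw [← h1, h2, map_smul, map_sum, Finset.sum_congr rfl fun K _ => h7 K, ← Finset.sum_smul, smul_smul]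
  congr 1
  rw [h4, Fintype.card_sum (α := Fin a ⊕ Fin b), pow_add]
  have z1 := pow_ne_zero (Fintype.card (Fin a ⊕ Fin b)) hm
  have z2 := pow_ne_zero (Fintype.card (Fin b ⊕ Fin c)) hm
  field_simp
  rfl

end Spread
end GaugeGlue

/-! ### Permutations and labels as factors -/

section Factors
open Matrix
variable {k : Type*} [Field k] {m : ℕ} [NeZero m] {a b c : ℕ}

/-- Transport of labelled diagrams as a linear map. -/
noncomputable def mapLin (k : Type*) [Field k] {m : ℕ} {N N' : Type} (e : N ≃ N') :
    (Diagram m N →₀ k) →ₗ[k] (Diagram m N' →₀ k) :=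
  Finsupp.lmapDomain k k (Diagram.map e)

theorem mapLin_single {m : ℕ} {N N' : Type} (e : N ≃ N') (y : Diagram m N) (c : k) :
    mapLin k e (Finsupp.single y c) = Finsupp.single (y.map e) c := by
  simp [mapLin]

theorem permDiag_eq (m : ℕ) (g : Equiv.Perm (Fin a)) : permDiag m g = gperm m g := by
  ext v <;> rcases v with v | v <;> rfl

theorem perm_compLin (δ : ZMod m → k) (g : Equiv.Perm (Fin a)) (Y : Diag m a b →₀ k) :
    compLin δ a a b (Finsupp.single (permDiag m g) 1) Y =
      mapLin k (g.sumCongr (Equiv.refl _)) Y := by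
  induction Y using Finsupp.induction_linear with
  | zero => simp
  | add v w hv hw => simp only [map_add, hv, hw]
  | single y c =>
    rw [compLin_single, (comp_eq_gcomp _ _ _).1, (comp_eq_gcomp _ _ _).2, permDiag_eq,
      (gcomp_gperm _ _ g y).1, (gcomp_gperm _ _ g y).2, mapLin_single, mul_one, one_mul]

theorem compLin_perm (δ : ZMod m → k) (g : Equiv.Perm (Fin b)) (Y : Diag m a b →₀ k) :
    compLin δ a b b Y (Finsupp.single (permDiag m g) 1) =
      mapLin k ((Equiv.refl _).sumCongr g⁻¹) Y := by
  induction Y using Finsupp.induction_linear with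
  | zero => simp
  | add v w hv hw => simp only [map_add, LinearMap.add_apply, hv, hw]
  | single y c =>
    have e := gcomp_map_outer (Equiv.refl _) g⁻¹ (fun _ => δ) (Enum.fin b) y (gid m (Fin b))
    have e0 : y.map ((Equiv.refl _).sumCongr (Equiv.refl _)) = y :=
      Diagram.map_eq_self (by rintro (v | v) <;> rfl) _
    have e1 : (gid m (Fin b)).map ((Equiv.refl _).sumCongr g⁻¹) = permDiag m g := by
      rw [permDiag_eq]
      ext v <;> rcases v with v | v <;> rfl
    have e2 := comp_id δ y
    rw [(comp_eq_gcomp _ _ _).1, (comp_eq_gcomp _ _ _).2] at e2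
    have e3 : idDiag m b = gid m (Fin b) := rfl
    rw [e0, e1, ← e3, e2.1, e2.2] at e
    rw [compLin_single, (comp_eq_gcomp _ _ _).1, (comp_eq_gcomp _ _ _).2, e.1, e.2, mapLin_single,
      mul_one, mul_one]

theorem shiftOp_mapLin {N N' : Type} [Fintype N] [Fintype N'] [DecidableEq N] [DecidableEq N']
    (e : N ≃ N') (G : N' → ZMod m) (v : Diagram m N →₀ k) :
    shiftOp k G (mapLin k e v) = mapLin k e (shiftOp k (G ∘ e) v) := by
  induction v using Finsupp.induction_linear with
  | zero => simp
  | add v w hv hw => simp only [map_add, hv, hw]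
  | single y c =>
    simp only [shiftOp_single, mapLin_single]
    congr 1
    ext v
    · rfl
    · simp [Diagram.shift, Diagram.map]

theorem proj_mapLin {N N' : Type} [Fintype N] [Fintype N'] [DecidableEq N] [DecidableEq N'] (e : N ≃ N')
    (ψ : AddChar (ZMod m) k) (s : N' → ZMod m)
    (v : Diagram m N →₀ k) : proj ψ s (mapLin k e v) = mapLin k e (proj ψ (s ∘ e) v) := by
  rw [proj_apply, proj_apply, map_smul, map_sum, Fintype.card_congr e]
  congr 1
  refine Fintype.sum_equiv (e.symm.arrowCongr (Equiv.refl _)) _ _ fun G => ?_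
  rw [shiftOp_mapLin, map_smul]
  have h : (e.symm.arrowCongr (Equiv.refl (ZMod m))) G = G ∘ e := rfl
  rw [h, ← dotProduct_comp_equiv_symm]
  congr 3
  congr 2
  funext v
  simp

theorem spread_mapOp {A B A' B' : Type} [Fintype A] [Fintype B] [Fintype A'] [Fintype B']
    [DecidableEq A] [DecidableEq B] [DecidableEq A'] [DecidableEq B'] (e : A ⊕ B ≃ A' ⊕ B')
    (ψ : AddChar (ZMod m) k) (s : A' ⊕ B' → ZMod m) (v : World k A B) :
    spread ψ s (mapOp e v) = mapLin k e (spread ψ (s ∘ e) v) := by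
  have h : spread ψ s ∘ₗ mapOp e = mapLin k e ∘ₗ spread ψ (s ∘ e) := by
    ext d : 1
    refine LinearMap.ext_ring ?_
    simp only [LinearMap.comp_apply, Finsupp.lsingle_apply, mapOp_single, spread_single,
      ← proj_mapLin, mapLin_single]
    rfl
  exact LinearMap.congr_fun h v

variable (ψ : AddChar (ZMod m) k) (δ : ZMod m → k)

theorem perm_spread {γ : Fin a → ZMod m} (γ' : Fin b → ZMod m) {g : Equiv.Perm (Fin a)}
    (hg : g ∈ colourPerms γ) (v : World k (Fin a) (Fin b)) :
    compLin δ a a b (Finsupp.single (permDiag m g) 1) (spread ψ (sign γ γ') v) =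
      spread ψ (sign γ γ') (repN k _ _ g v) := by
  have e : sign γ γ' ∘ (g.sumCongr (Equiv.refl (Fin b))) = sign γ γ' := by
    funext v; rcases v with v | v
    · exact hg v
    · rfl
  rw [perm_compLin]
  conv_lhs => rw [← e]
  exact (spread_mapOp _ ψ _ v).symm

theorem spread_perm (γ : Fin a → ZMod m) {γ' : Fin b → ZMod m} {g : Equiv.Perm (Fin b)}
    (hg : g ∈ colourPerms γ') (v : World k (Fin a) (Fin b)) :
    compLin δ a b b (spread ψ (sign γ γ') v) (Finsupp.single (permDiag m g) 1) =
      spread ψ (sign γ γ') (repS k _ _ g⁻¹ v) := by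
  have e : sign γ γ' ∘ ((Equiv.refl (Fin a)).sumCongr g⁻¹) = sign γ γ' := by
    funext v; rcases v with v | v
    · rfl
    · exact congrArg Neg.neg ((colourPerms γ').inv_mem hg v)
  rw [compLin_perm]
  conv_lhs => rw [← e]
  exact (spread_mapOp _ ψ _ v).symm

/-- The average over the labels of the northern ends, weighted by a character. -/
noncomputable def avgN (γ : Fin a → ZMod m) : (Diag m a b →₀ k) →ₗ[k] (Diag m a b →₀ k) :=
  ((m : k) ^ a)⁻¹ • ∑ z : Fin a → ZMod m, ψ (-(γ ⬝ᵥ z)) • shiftOp k (Sum.elim z 0)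

/-- The average over the labels of the southern ends, weighted by a character. -/
noncomputable def avgS (γ' : Fin b → ZMod m) : (Diag m a b →₀ k) →ₗ[k] (Diag m a b →₀ k) :=
  ((m : k) ^ b)⁻¹ • ∑ z : Fin b → ZMod m, ψ (γ' ⬝ᵥ z) • shiftOp k (Sum.elim 0 z)

theorem avgN_apply (γ : Fin a → ZMod m) (Y : Diag m a b →₀ k) : avgN ψ γ Y =
    ((m : k) ^ a)⁻¹ • ∑ z : Fin a → ZMod m, ψ (-(γ ⬝ᵥ z)) • shiftOp k (Sum.elim z 0) Y := by
  simp [avgN, LinearMap.sum_apply]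

theorem avgS_apply (γ' : Fin b → ZMod m) (Y : Diag m a b →₀ k) : avgS ψ γ' Y =
    ((m : k) ^ b)⁻¹ • ∑ z : Fin b → ZMod m, ψ (γ' ⬝ᵥ z) • shiftOp k (Sum.elim 0 z) Y := by
  simp [avgS, LinearMap.sum_apply]

/-- The projection splits into the averages over the northern and over the southern ends. -/
theorem proj_eq_avg (γ : Fin a → ZMod m) (γ' : Fin b → ZMod m) (Y : Diag m a b →₀ k) :
    proj ψ (sign γ γ') Y = avgN ψ γ (avgS ψ γ' Y) := by
  rw [proj_apply, avgN_apply, avgS_apply]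
  simp only [map_smul, map_sum, Finset.smul_sum]
  refine (Equiv.sum_comp (Equiv.sumArrowEquivProdArrow (Fin a) (Fin b) (ZMod m)).symm _).symm.trans ?_
  rw [Fintype.sum_prod_type]
  refine Finset.sum_congr rfl fun z _ => ?_
  refine Finset.sum_congr rfl fun w _ => ?_
  have h : (Equiv.sumArrowEquivProdArrow (Fin a) (Fin b) (ZMod m)).symm (z, w) = Sum.elim z w := rfl
  have h2 : -(sign γ γ' ⬝ᵥ Sum.elim z w) = -(γ ⬝ᵥ z) + γ' ⬝ᵥ w := by
    have : sign γ γ' = Sum.elim γ (-γ') := rfl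
    rw [this, sumElim_dotProduct_sumElim, neg_dotProduct]; ring
  rw [h, h2, shiftOp_shiftOp, AddChar.map_add_eq_mul, ← Sum.elim_add_add, add_zero, zero_add,
    Fintype.card_sum, Fintype.card_fin, Fintype.card_fin, pow_add, mul_inv]
  simp only [smul_smul]
  congr 1
  ring

theorem compLin_avgN (γ : Fin a → ZMod m) (X : Diag m a b →₀ k) (Y : Diag m b c →₀ k) :
    compLin δ a b c (avgN ψ γ X) Y = avgN ψ γ (compLin δ a b c X Y) := by
  have e : ∀ z, compLin δ a b c (shiftOp k (Sum.elim z 0) X) Y =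
      shiftOp k (Sum.elim z 0) (compLin δ a b c X Y) := fun z => by
    rw [← compLin_shiftOp]
    congr 1
    have : (Sum.elim 0 0 : Fin b ⊕ Fin c → ZMod m) = 0 := by funext v; rcases v with v | v <;> rfl
    rw [this, shiftOp_zero]
  simp only [avgN_apply, map_smul, map_sum, LinearMap.smul_apply, LinearMap.sum_apply, e]

theorem compLin_avgS (γ' : Fin c → ZMod m) (X : Diag m a b →₀ k) (Y : Diag m b c →₀ k) :
    compLin δ a b c X (avgS ψ γ' Y) = avgS ψ γ' (compLin δ a b c X Y) := by
  have e : ∀ z, compLin δ a b c X (shiftOp k (Sum.elim 0 z) Y) =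
      shiftOp k (Sum.elim 0 z) (compLin δ a b c X Y) := fun z => by
    rw [← compLin_shiftOp]
    congr 2
    have : (Sum.elim 0 0 : Fin a ⊕ Fin b → ZMod m) = 0 := by funext v; rcases v with v | v <;> rfl
    rw [this, shiftOp_zero]
  simp only [avgS_apply, map_smul, map_sum, e]

theorem shift_idDiag (z w : Fin a → ZMod m) : (idDiag m a).shift (Sum.elim z w) = labelDiag (z - w) := by
  ext v
  · rfl
  · rcases v with v | v <;> simp [Diagram.shift, idDiag, labelDiag]

/-- The idempotent belonging to a character of the labels. -/
noncomputable def charIdem (γ : Fin a → ZMod m) : Diag m a a →₀ k := avgN ψ γ (Finsupp.single (idDiag m a) 1)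

theorem charIdem_eq_avgS (γ : Fin a → ZMod m) :
    charIdem ψ γ = avgS ψ γ (Finsupp.single (idDiag m a) 1) := by
  rw [charIdem, avgN_apply, avgS_apply]
  congr 1
  refine Fintype.sum_equiv (Equiv.neg _) _ _ fun z => ?_
  simp only [shiftOp_single, shift_idDiag, Equiv.neg_apply, dotProduct_neg, sub_zero, zero_sub, neg_neg]

theorem charIdem_compLin (γ : Fin a → ZMod m) (Y : Diag m a b →₀ k) :
    compLin δ a a b (charIdem ψ γ) Y = avgN ψ γ Y := by
  rw [charIdem, compLin_avgN, one_compLin]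

theorem compLin_charIdem (γ' : Fin b → ZMod m) (Y : Diag m a b →₀ k) :
    compLin δ a b b Y (charIdem ψ γ') = avgS ψ γ' Y := by
  rw [charIdem_eq_avgS, compLin_avgS, compLin_one]

/-- The average is a projection. -/
theorem avgN_avgN (hm : (m : k) ≠ 0) (γ : Fin a → ZMod m) (Y : Diag m a b →₀ k) :
    avgN ψ γ (avgN ψ γ Y) = avgN ψ γ Y := by
  have e : ∀ w : Fin a → ZMod m, avgN ψ γ (shiftOp k (Sum.elim w 0) Y) = ψ (γ ⬝ᵥ w) • avgN ψ γ Y := by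
    intro w
    have e : ∀ z : Fin a → ZMod m, ψ (-(γ ⬝ᵥ z)) • shiftOp k (Sum.elim z 0) (shiftOp k (Sum.elim w 0) Y) =
        ψ (γ ⬝ᵥ w) • (ψ (-(γ ⬝ᵥ (z + w))) • shiftOp k (Sum.elim (z + w) 0) Y) := fun z => by
      rw [shiftOp_shiftOp, ← Sum.elim_add_add, add_zero, smul_smul, dotProduct_add, neg_add,
        AddChar.map_add_eq_mul, mul_left_comm, mul_comm (ψ (γ ⬝ᵥ w)), AddChar.apply_neg_mul, mul_one]
    rw [avgN_apply, avgN_apply]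
    simp only [e, ← Finset.smul_sum]
    rw [smul_comm]
    congr 2
    exact Equiv.sum_comp (Equiv.addRight w)
      fun z => ψ (-(γ ⬝ᵥ z)) • shiftOp k (Sum.elim z 0) Y
  conv_lhs => rw [avgN_apply ψ γ Y]
  rw [map_smul, map_sum]
  simp only [map_smul, e, smul_smul, AddChar.apply_neg_mul, one_smul, Finset.sum_const,
    Finset.card_univ, Fintype.card_pi, ZMod.card, Finset.prod_const]
  rw [← Nat.cast_smul_eq_nsmul k, smul_smul, Nat.cast_pow, Fintype.card_fin,
    inv_mul_cancel₀ (pow_ne_zero _ hm), one_smul]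

/-- The identity is the sum of the idempotents of all characters. -/
theorem sum_avgN (hm : (m : k) ≠ 0) {ψ : AddChar (ZMod m) k} (hψ : ∀ c, ψ c = 1 → c = 0)
    (Y : Diag m a b →₀ k) : ∑ γ : Fin a → ZMod m, avgN ψ γ Y = Y := by
  have e : ∀ z : Fin a → ZMod m, ∑ γ : Fin a → ZMod m, ψ (-(γ ⬝ᵥ z)) = if z = 0 then (m : k) ^ a else 0 := by
    intro z
    split_ifs with h
    · subst h; simp [Finset.card_univ, Fintype.card_pi]
    · obtain ⟨i, hi⟩ := Function.ne_iff.1 h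
      have h1 := Equiv.sum_comp (Equiv.addRight (Pi.single i (1 : ZMod m)))
        (fun γ : Fin a → ZMod m => ψ (-(γ ⬝ᵥ z)))
      simp only [Equiv.coe_addRight, add_dotProduct, single_dotProduct, one_mul, neg_add,
        AddChar.map_add_eq_mul, ← Finset.sum_mul] at h1
      by_contra h0
      have h2 := mul_left_cancel₀ h0 (h1.trans (mul_one _).symm)
      exact hi (neg_eq_zero.1 (hψ _ h2))
  simp only [avgN_apply, ← Finset.smul_sum]
  rw [Finset.sum_comm]
  simp only [← Finset.sum_smul, e, ite_smul, zero_smul]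
  rw [Finset.sum_ite_eq' Finset.univ (0 : Fin a → ZMod m), if_pos (Finset.mem_univ _), smul_smul,
    inv_mul_cancel₀ (pow_ne_zero _ hm), one_smul]
  have : (Sum.elim 0 0 : Fin a ⊕ Fin b → ZMod m) = 0 := by funext v; rcases v with v | v <;> rfl
  rw [this, shiftOp_zero]

theorem charIdem_spread (hm : (m : k) ≠ 0) (γ : Fin a → ZMod m) (γ' : Fin b → ZMod m)
    (v : World k (Fin a) (Fin b)) :
    compLin δ a a b (charIdem ψ γ) (spread ψ (sign γ γ') v) = spread ψ (sign γ γ') v := by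
  rw [charIdem_compLin, spread, LinearMap.comp_apply, proj_eq_avg, avgN_avgN ψ hm]

theorem charIdem_mul_self (hm : (m : k) ≠ 0) (γ : Fin a → ZMod m) :
    compLin δ a a a (charIdem ψ γ) (charIdem ψ γ) = charIdem ψ γ := by
  rw [charIdem_compLin, charIdem, avgN_avgN ψ hm]

theorem spread_one (hm : (m : k) ≠ 0) (γ : Fin a → ZMod m) :
    spread ψ (sign γ γ) (Finsupp.single (gperm 1 1) 1) = charIdem ψ γ := by
  have e : (gperm 1 (1 : Equiv.Perm (Fin a))).lift m = idDiag m a := by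
    ext v <;> rcases v with v | v <;> rfl
  rw [spread_single, proj_eq_avg, e, ← charIdem_eq_avgS, charIdem, avgN_avgN ψ hm]

/-- The analogue of `charIdem_spread` for the southern nodes.  Loops do not occur in products with
`charIdem`, so that the parameters may be taken to be `0`. -/
theorem spread_charIdem (hm : (m : k) ≠ 0) (γ : Fin a → ZMod m) (γ' : Fin b → ZMod m)
    (v : World k (Fin a) (Fin b)) :
    compLin δ a b b (spread ψ (sign γ γ') v) (charIdem ψ γ') = spread ψ (sign γ γ') v := by
  have e : ∀ X : Diag m a b →₀ k, avgS ψ γ' X = compLin δ a b b X (charIdem ψ γ') := fun X =>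
    (compLin_charIdem ψ δ γ' X).symm
  have e2 : ∀ X : Diag m a b →₀ k, avgN ψ γ (avgS ψ γ' X) = compLin δ a b b (avgN ψ γ X) (charIdem ψ γ') := by
    intro X
    rw [e, compLin_avgN]
  rw [spread, LinearMap.comp_apply, proj_eq_avg, compLin_charIdem, e2, compLin_charIdem, ← compLin_charIdem ψ 0,
    ← compLin_charIdem ψ 0]
  have h : ∀ X : Diag m a b →₀ k, compLin (0 : ZMod m → k) a b b (compLin 0 a b b X (charIdem ψ γ'))
      (charIdem ψ γ') = compLin 0 a b b X (charIdem ψ γ') := fun X =>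
    (compLin_assoc (⟨0, fun _ => rfl⟩ : LoopParams k m) X (charIdem ψ γ') (charIdem ψ γ')).trans
      (by rw [charIdem_mul_self ψ 0 hm])
  exact h _

end Factors

/-! ### Young symmetrizers as factors -/

/-- The boxes of the components with index in `T`. -/
def Boxes {m : ℕ} (lam : ZMod m → YoungDiagram) (T : Set (ZMod m)) : Type :=
  {x : Σ r, (lam r).cells // x.1 ∈ T}

open Classical in
noncomputable instance {m : ℕ} [NeZero m] (lam : ZMod m → YoungDiagram) (T : Set (ZMod m)) :
    Fintype (Boxes lam T) := Subtype.fintype _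

noncomputable instance {m : ℕ} (lam : ZMod m → YoungDiagram) (T : Set (ZMod m)) :
    DecidableEq (Boxes lam T) := fun a b => Classical.propDecidable (a = b)

/-- The tableau on the boxes of the components with index in `T`. -/
def boxTab {m : ℕ} (lam : ZMod m → YoungDiagram) (T : Set (ZMod m)) :
    Tab m (Boxes lam T) where
  comp x := x.1.1
  row x := x.1.2.1.1
  col x := x.1.2.1.2
  inj := by
    rintro ⟨⟨r, c, hc⟩, hr⟩ ⟨⟨r', c', hc'⟩, hr'⟩ h1 h2 h3
    dsimp only at h1 h2 h3
    subst h1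
    obtain rfl : c = c' := Prod.ext h2 h3
    rfl
  lower := by
    rintro ⟨⟨r, c, hc⟩, hr⟩ i j hi hj
    exact ⟨⟨⟨r, (i, j), (lam r).isLowerSet (show (i, j) ≤ c from ⟨hi, hj⟩) hc⟩, hr⟩, rfl, rfl, rfl⟩

/-- The tableau with other names of the entries. -/
def Tab.pull {m : ℕ} {A A' : Type} (t : Tab m A) (e : A' ≃ A) : Tab m A' where
  comp := t.comp ∘ e
  row := t.row ∘ e
  col := t.col ∘ e
  inj a b h1 h2 h3 := e.injective (t.inj _ _ h1 h2 h3)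
  lower a i j hi hj := by
    obtain ⟨b, h⟩ := t.lower (e a) i j hi hj
    exact ⟨e.symm b, by simpa using h⟩

theorem Tab.pull_matches {m : ℕ} {A A' : Type} (t : Tab m A) (e : A' ≃ A) : (t.pull e).Matches t e :=
  ⟨fun _ _ => Iff.rfl, fun _ _ => Iff.rfl, fun _ => rfl, fun _ => rfl⟩

/-- The tableau whose entries are the numbers given by `tableau`. -/
noncomputable def finTab {m : ℕ} [NeZero m] (lam : ZMod m → YoungDiagram) : Tab m (Fin (size lam)) :=
  (boxTab lam Set.univ).pull ((tableau lam).trans (Equiv.Set.univ _).symm)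

/-- The coefficients of an element of the algebra. -/
def CycAlg.coeffs {k : Type*} [Field k] {m n : ℕ} {δ : LoopParams k m} (x : CycAlg δ n) :
    Diag m n n →₀ k := x

section Symmetrizers
open Matrix
variable {k : Type*} [Field k] {m m' : ℕ} [NeZero m] [NeZero m'] {a b c : ℕ} {R : Type} [DecidableEq R]

theorem Tab.colPres_inv {A : Type} [Fintype A] [DecidableEq A] {t : Tab m A} {g : Equiv.Perm A}
    (hg : t.ColPres g) : t.ColPres g⁻¹ := fun a => by
  have := hg (g⁻¹ a)
  rw [perm_apply_inv] at this
  exact ⟨this.1.symm, this.2.symm⟩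

theorem Tab.rowPres_inv {A : Type} [Fintype A] [DecidableEq A] {t : Tab m A} {g : Equiv.Perm A}
    (hg : t.RowPres g) : t.RowPres g⁻¹ := fun a => by
  have := hg (g⁻¹ a)
  rw [perm_apply_inv] at this
  exact ⟨this.1.symm, this.2.symm⟩

variable {t : Tab m' (Fin a)} {t' : Tab m' (Fin b)}
  {F : World k (Fin a) (Fin b) →ₗ[k] (Diag m a b →₀ k)} (δ : LoopParams k m)

/-- If the map `F` turns the multiplication by permutations of one colour into the action on unlabelled
diagrams, then it does so with `colSum`. -/
theorem compLin_colSum (hF : ∀ g ∈ t'.grp, ∀ v,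
      compLin δ.toFun a b b (F v) (Finsupp.single (permDiag m g) 1) = F (repS k _ _ g⁻¹ v))
    {col : Fin b → R} (hcol : ∀ g : Equiv.Perm (Fin b), (∀ i, col (g i) = col i) ↔ t'.ColPres g)
    (v : World k (Fin a) (Fin b)) :
    compLin δ.toFun a b b (F v) (colSum δ col).coeffs = F (t'.actS k _ (t'.kappa k) v) := by
  classical
  have h0 : compLin δ.toFun a b b (F v) (colSum δ col).coeffs =
      ∑ g : Equiv.Perm (Fin b) with ∀ i, col (g i) = col i, (Equiv.Perm.sign g : ℤ) •
        compLin δ.toFun a b b (F v) (Finsupp.single (permDiag m g) 1) := by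
    refine (map_sum (compLin δ.toFun a b b (F v)) _ _).trans (Finset.sum_congr rfl fun g _ => ?_)
    exact map_zsmul (compLin δ.toFun a b b (F v)) _ _
  rw [h0, Tab.actS_kappa, map_sum]
  refine Finset.sum_bij' (fun g _ => g⁻¹) (fun g _ => g⁻¹) ?_ ?_ (by simp) (by simp) ?_
  · intro g hg
    simp only [Finset.mem_filter, Finset.mem_univ, true_and] at hg ⊢
    exact Tab.colPres_inv ((hcol g).1 hg)
  · intro g hg
    simp only [Finset.mem_filter, Finset.mem_univ, true_and] at hg ⊢
    exact (hcol _).2 (Tab.colPres_inv hg)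
  · intro g hg
    simp only [Finset.mem_filter, Finset.mem_univ, true_and] at hg
    rw [hF g (fun i => ((hcol g).1 hg i).1), map_zsmul, Equiv.Perm.sign_inv]

theorem compLin_rowSum (hF : ∀ g ∈ t'.grp, ∀ v,
      compLin δ.toFun a b b (F v) (Finsupp.single (permDiag m g) 1) = F (repS k _ _ g⁻¹ v))
    {row : Fin b → R} (hrow : ∀ g : Equiv.Perm (Fin b), (∀ i, row (g i) = row i) ↔ t'.RowPres g)
    (v : World k (Fin a) (Fin b)) :
    compLin δ.toFun a b b (F v) (rowSum δ row).coeffs = F (t'.actS k _ (t'.rho k) v) := by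
  classical
  have h0 : compLin δ.toFun a b b (F v) (rowSum δ row).coeffs =
      ∑ g : Equiv.Perm (Fin b) with ∀ i, row (g i) = row i,
        compLin δ.toFun a b b (F v) (Finsupp.single (permDiag m g) 1) :=
    map_sum (compLin δ.toFun a b b (F v)) _ _
  rw [h0, Tab.actS_rho, map_sum]
  refine Finset.sum_bij' (fun g _ => g⁻¹) (fun g _ => g⁻¹) ?_ ?_ (by simp) (by simp) ?_
  · intro g hg
    simp only [Finset.mem_filter, Finset.mem_univ, true_and] at hg ⊢
    exact Tab.rowPres_inv ((hrow g).1 hg)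
  · intro g hg
    simp only [Finset.mem_filter, Finset.mem_univ, true_and] at hg ⊢
    exact (hrow _).2 (Tab.rowPres_inv hg)
  · intro g hg
    simp only [Finset.mem_filter, Finset.mem_univ, true_and] at hg
    rw [hF g (fun i => ((hrow g).1 hg i).1)]

theorem colSum_compLin (hF : ∀ g ∈ t.grp, ∀ v,
      compLin δ.toFun a a b (Finsupp.single (permDiag m g) 1) (F v) = F (repN k _ _ g v))
    {col : Fin a → R} (hcol : ∀ g : Equiv.Perm (Fin a), (∀ i, col (g i) = col i) ↔ t.ColPres g)
    (v : World k (Fin a) (Fin b)) :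
    compLin δ.toFun a a b (colSum δ col).coeffs (F v) = F (t.actN k _ (t.kappa k) v) := by
  classical
  have h0 : compLin δ.toFun a a b (colSum δ col).coeffs (F v) =
      ∑ g : Equiv.Perm (Fin a) with ∀ i, col (g i) = col i, (Equiv.Perm.sign g : ℤ) •
        compLin δ.toFun a a b (Finsupp.single (permDiag m g) 1) (F v) := by
    refine (map_sum ((compLin δ.toFun a a b).flip (F v)) _ _).trans (Finset.sum_congr rfl fun g _ => ?_)
    exact map_zsmul ((compLin δ.toFun a a b).flip (F v)) _ _
  rw [h0, Tab.actN_kappa, map_sum]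
  refine Finset.sum_congr (Finset.filter_congr fun g _ => hcol g) fun g hg => ?_
  simp only [Finset.mem_filter, Finset.mem_univ, true_and] at hg
  rw [hF g (fun i => (hg i).1), map_zsmul]

theorem rowSum_compLin (hF : ∀ g ∈ t.grp, ∀ v,
      compLin δ.toFun a a b (Finsupp.single (permDiag m g) 1) (F v) = F (repN k _ _ g v))
    {row : Fin a → R} (hrow : ∀ g : Equiv.Perm (Fin a), (∀ i, row (g i) = row i) ↔ t.RowPres g)
    (v : World k (Fin a) (Fin b)) :
    compLin δ.toFun a a b (rowSum δ row).coeffs (F v) = F (t.actN k _ (t.rho k) v) := by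
  classical
  have h0 : compLin δ.toFun a a b (rowSum δ row).coeffs (F v) =
      ∑ g : Equiv.Perm (Fin a) with ∀ i, row (g i) = row i,
        compLin δ.toFun a a b (Finsupp.single (permDiag m g) 1) (F v) :=
    map_sum ((compLin δ.toFun a a b).flip (F v)) _ _
  rw [h0, Tab.actN_rho, map_sum]
  refine Finset.sum_congr (Finset.filter_congr fun g _ => hrow g) fun g hg => ?_
  simp only [Finset.mem_filter, Finset.mem_univ, true_and] at hg
  rw [hF g (fun i => (hg i).1)]

/-- Multiplication by `κ ρ` from below. -/
theorem compLin_colSum_rowSum (hF : ∀ g ∈ t'.grp, ∀ v,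
      compLin δ.toFun a b b (F v) (Finsupp.single (permDiag m g) 1) = F (repS k _ _ g⁻¹ v))
    {R' : Type} [DecidableEq R'] {col : Fin b → R} {row : Fin b → R'}
    (hcol : ∀ g : Equiv.Perm (Fin b), (∀ i, col (g i) = col i) ↔ t'.ColPres g)
    (hrow : ∀ g : Equiv.Perm (Fin b), (∀ i, row (g i) = row i) ↔ t'.RowPres g)
    (v : World k (Fin a) (Fin b)) :
    compLin δ.toFun a b b (F v) (compLin δ.toFun b b b (colSum δ col).coeffs (rowSum δ row).coeffs) =
      F (t'.symmS k _ v) := by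
  rw [← compLin_assoc δ, compLin_colSum δ hF hcol, compLin_rowSum δ hF hrow, Tab.symmS, map_mul]
  rfl

/-- Multiplication by `κ ρ` from above. -/
theorem colSum_rowSum_compLin (hF : ∀ g ∈ t.grp, ∀ v,
      compLin δ.toFun a a b (Finsupp.single (permDiag m g) 1) (F v) = F (repN k _ _ g v))
    {R' : Type} [DecidableEq R'] {col : Fin a → R} {row : Fin a → R'}
    (hcol : ∀ g : Equiv.Perm (Fin a), (∀ i, col (g i) = col i) ↔ t.ColPres g)
    (hrow : ∀ g : Equiv.Perm (Fin a), (∀ i, row (g i) = row i) ↔ t.RowPres g)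
    (v : World k (Fin a) (Fin b)) :
    compLin δ.toFun a a b (compLin δ.toFun a a a (colSum δ col).coeffs (rowSum δ row).coeffs) (F v) =
      F (t.actN k _ (t.symm k) v) := by
  rw [compLin_assoc δ, rowSum_compLin δ hF hrow, colSum_compLin δ hF hcol, Tab.symm, map_mul]
  rfl

variable {ξ : k} (hξ : IsPrimitiveRoot ξ m)

/-- The character `i ↦ ξ ^ i` of `ℤ/m`. -/
noncomputable def rootChar : AddChar (ZMod m) k := AddChar.zmodChar m hξ.pow_eq_one

theorem rootChar_apply (i : ZMod m) : rootChar hξ i = ξ ^ i.val := AddChar.zmodChar_apply _ i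

theorem rootChar_faithful (c : ZMod m) (h : rootChar hξ c = 1) : c = 0 := by
  rw [rootChar_apply, hξ.pow_eq_one_iff_dvd] at h
  exact (ZMod.val_eq_zero c).1 (Nat.eq_zero_of_dvd_of_lt h (ZMod.val_lt c))

theorem rootChar_mul (c i : ZMod m) : rootChar hξ (c * i) = ξ ^ (i.val * c.val) := by
  rw [rootChar_apply, ZMod.val_mul, mul_comm i.val]
  exact (pow_eq_pow_mod _ hξ.pow_eq_one).symm

theorem labelIdem_eq (c : Fin a → ZMod m) : (labelIdem δ ξ c).coeffs = charIdem (rootChar hξ) c := by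
  have h : ∀ z : Fin a → ZMod m, (∏ i, ξ ^ ((z i).val * (c i).val))⁻¹ = rootChar hξ (-(c ⬝ᵥ z)) := by
    intro z
    rw [AddChar.map_neg_eq_inv, dotProduct]
    congr 1
    refine Eq.trans ?_ (map_prod (rootChar hξ).toMonoidHom
      (fun i => Multiplicative.ofAdd (c i * z i)) Finset.univ).symm
    exact Finset.prod_congr rfl fun i _ => (rootChar_mul hξ _ _).symm
  rw [charIdem, avgN_apply]
  simp only [shiftOp_single, shift_idDiag, sub_zero, ← h]
  rfl

theorem deltaBar_eq (r : ℕ) : deltaBar δ ξ r = parBar (rootChar hξ) δ.toFun (r : ZMod m) := by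
  rw [deltaBar, parBar]
  congr 1
  refine Finset.sum_congr rfl fun i _ => ?_
  rw [rootChar_mul, ZMod.val_natCast, pow_mul, pow_mul,
    ← pow_eq_pow_mod r (by rw [← pow_mul, mul_comm, pow_mul, hξ.pow_eq_one, one_pow])]

theorem finTab_colPres (lam : ZMod m → YoungDiagram) (g : Equiv.Perm (Fin (size lam))) :
    (∀ i, ((tableau lam (g i)).1, (tableau lam (g i)).2.1.2) =
      ((tableau lam i).1, (tableau lam i).2.1.2)) ↔ (finTab lam).ColPres g :=
  forall_congr' fun _ => Prod.mk_inj

theorem finTab_rowPres (lam : ZMod m → YoungDiagram) (g : Equiv.Perm (Fin (size lam))) :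
    (∀ i, ((tableau lam (g i)).1, (tableau lam (g i)).2.1.1) =
      ((tableau lam i).1, (tableau lam i).2.1.1)) ↔ (finTab lam).RowPres g :=
  forall_congr' fun _ => Prod.mk_inj

theorem spechtGen_eq (lam : ZMod m → YoungDiagram) : (spechtGen δ ξ lam).coeffs =
    compLin δ.toFun _ _ _ (charIdem (rootChar hξ) (finTab lam).comp) (compLin δ.toFun _ _ _
      (colSum δ fun i => ((tableau lam i).1, (tableau lam i).2.1.2)).coeffs
      (rowSum δ fun i => ((tableau lam i).1, (tableau lam i).2.1.1)).coeffs) := by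
  rw [← compLin_assoc δ, ← labelIdem_eq δ hξ]
  rfl

theorem compLin_spechtGen (hm : (m : k) ≠ 0) (γ : Fin a → ZMod m) (lam : ZMod m → YoungDiagram)
    (v : World k (Fin a) (Fin (size lam))) :
    compLin δ.toFun _ _ _ (spread (rootChar hξ) (sign γ (finTab lam).comp) v) (spechtGen δ ξ lam).coeffs =
      spread (rootChar hξ) (sign γ (finTab lam).comp) ((finTab lam).symmS k _ v) := by
  rw [spechtGen_eq δ hξ, ← compLin_assoc δ, spread_charIdem _ _ hm]
  exact compLin_colSum_rowSum δ (fun g hg v => spread_perm _ _ _ hg v) (finTab_colPres lam)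
    (finTab_rowPres lam) v

theorem spechtGen_compLin (hm : (m : k) ≠ 0) (γ' : Fin b → ZMod m) (lam : ZMod m → YoungDiagram)
    (v : World k (Fin (size lam)) (Fin b)) :
    compLin δ.toFun _ _ _ (spechtGen δ ξ lam).coeffs (spread (rootChar hξ) (sign (finTab lam).comp γ') v) =
      spread (rootChar hξ) (sign (finTab lam).comp γ') ((finTab lam).actN k _ ((finTab lam).symm k) v) := by
  rw [spechtGen_eq δ hξ, compLin_assoc δ]
  rw [colSum_rowSum_compLin (F := spread (rootChar hξ) (sign (finTab lam).comp γ')) δ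
    (fun g hg v => perm_spread _ _ _ hg v) (finTab_colPres lam) (finTab_rowPres lam) v,
    charIdem_spread _ _ hm]

theorem charIdem_spechtGen (hm : (m : k) ≠ 0) (lam : ZMod m → YoungDiagram) :
    compLin δ.toFun _ _ _ (charIdem (rootChar hξ) (finTab lam).comp) (spechtGen δ ξ lam).coeffs =
      (spechtGen δ ξ lam).coeffs := by
  rw [spechtGen_eq δ hξ, ← compLin_assoc δ, charIdem_mul_self _ _ hm]

end Symmetrizers

/-! ### Evaluation of the standard modules of the cyclotomic Brauer algebra -/

section Arcs
variable {k : Type*} [Field k] {m : ℕ} {n a b c : ℕ}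

variable (k m) in
/-- The combinations of diagrams with southern arcs. -/
def arcSpan (A B : Type) : Submodule k (Diagram m (A ⊕ B) →₀ k) :=
  Finsupp.supported k k {d | SouthArc d}

theorem single_mem_arcSpan {A B : Type} {d : Diagram m (A ⊕ B)} (hd : SouthArc d) (r : k) :
    Finsupp.single d r ∈ arcSpan k m A B :=
  Finsupp.single_mem_supported k r hd

theorem arcSpan_map {A B : Type} {E : Type*} [AddCommGroup E] [Module k E]
    {f : (Diagram m (A ⊕ B) →₀ k) →ₗ[k] E} {U : Submodule k E}
    (h : ∀ d, SouthArc d → f (Finsupp.single d 1) ∈ U) {v : Diagram m (A ⊕ B) →₀ k}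
    (hv : v ∈ arcSpan k m A B) : f v ∈ U := by
  rw [arcSpan, Finsupp.supported_eq_span_single] at hv
  induction hv using Submodule.span_induction with
  | mem x hx => obtain ⟨d, hd, rfl⟩ := hx; exact h d hd
  | zero => rw [map_zero]; exact U.zero_mem
  | add x y _ _ hx hy => rw [map_add]; exact U.add_mem hx hy
  | smul r x _ hx => rw [map_smul]; exact U.smul_mem r hx

theorem compLin_arcSpan (δ : ZMod m → k) (X : Diag m n a →₀ k) {Y : Diag m a b →₀ k}
    (hY : Y ∈ arcSpan k m (Fin a) (Fin b)) :
    compLin δ n a b X Y ∈ arcSpan k m (Fin n) (Fin b) := by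
  refine arcSpan_map (f := compLin δ n a b X) (fun d hd => ?_) hY
  induction X using Finsupp.induction_linear with
  | zero => rw [map_zero]; exact Submodule.zero_mem _
  | add v w hv hw => rw [map_add]; exact Submodule.add_mem _ hv hw
  | single x r =>
    rw [compLin_single, (comp_eq_gcomp _ _ _).1]
    exact single_mem_arcSpan hd.gcomp _

/-- The submodule `southArcs` is the span of the diagrams with southern arcs. -/
theorem mem_southArcs (δ : LoopParams k m) (X : Diag m n a →₀ k) :
    (show DiagSpace δ n a from X) ∈ southArcs δ n a ↔ X ∈ arcSpan k m (Fin n) (Fin a) := by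
  constructor
  · intro h
    refine Submodule.span_induction (R := CycAlg δ n) (p := fun (x : DiagSpace δ n a) _ =>
      (x : Diag m n a →₀ k) ∈ arcSpan k m (Fin n) (Fin a)) ?_ ?_ ?_ ?_ h
    · rintro _ ⟨d, hd, rfl⟩
      exact single_mem_arcSpan hd 1
    · exact Submodule.zero_mem _
    · intro x y _ _ hx hy
      exact Submodule.add_mem _ hx hy
    · intro r x _ hx
      exact compLin_arcSpan δ.toFun _ hx
  · intro h
    let f : (Diag m n a →₀ k) →ₗ[k] DiagSpace δ n a := LinearMap.id
    refine arcSpan_map (f := f) (U := (southArcs δ n a).restrictScalars k) (fun d hd => ?_) h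
    exact Submodule.subset_span ⟨d, hd, rfl⟩

/-- The class of a combination of diagrams modulo those with southern arcs. -/
noncomputable def toThrough (δ : LoopParams k m) (n a : ℕ) :
    (Diag m n a →₀ k) →ₗ[k] ThroughSpace δ n a :=
  (Submodule.mkQ (southArcs δ n a)).restrictScalars k

theorem toThrough_eq_zero (δ : LoopParams k m) (X : Diag m n a →₀ k) :
    toThrough δ n a X = 0 ↔ X ∈ arcSpan k m (Fin n) (Fin a) :=
  (Submodule.Quotient.mk_eq_zero _).trans (mem_southArcs δ X)

theorem toThrough_surjective (δ : LoopParams k m) : Function.Surjective (toThrough δ n a) := fun v => by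
  obtain ⟨x, rfl⟩ := Submodule.Quotient.mk_surjective _ v
  exact ⟨x, rfl⟩

theorem smul_toThrough (δ : LoopParams k m) (b : CycAlg δ n) (X : Diag m n a →₀ k) :
    b • toThrough δ n a X = toThrough δ n a (compLin δ.toFun n n a b.coeffs X) := rfl

instance (δ : LoopParams k m) [NeZero m] : FiniteDimensional k (ThroughSpace δ n a) := by
  have := Diagram.finite (m := m) (N := Fin n ⊕ Fin a)
  exact Module.Finite.of_surjective (toThrough δ n a) (toThrough_surjective δ)

theorem SouthArc.shift {m : ℕ} {A B : Type} {d : Diagram m (A ⊕ B)} (h : SouthArc d)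
    (G : A ⊕ B → ZMod m) : SouthArc (d.shift G) := h

variable [NeZero m]

theorem proj_arcSpan {A B : Type} [Fintype A] [Fintype B] [DecidableEq A] [DecidableEq B]
    (ψ : AddChar (ZMod m) k) (s : A ⊕ B → ZMod m) {v : Diagram m (A ⊕ B) →₀ k}
    (hv : v ∈ arcSpan k m A B) : proj ψ s v ∈ arcSpan k m A B := by
  refine arcSpan_map (f := proj ψ s) (fun d hd => ?_) hv
  rw [proj_apply]
  refine Submodule.smul_mem _ _ (Submodule.sum_mem _ fun G _ => Submodule.smul_mem _ _ ?_)
  rw [shiftOp_single]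
  exact single_mem_arcSpan (hd.shift G) 1

theorem spread_arcSpan {A B : Type} [Fintype A] [Fintype B] [DecidableEq A] [DecidableEq B]
    (ψ : AddChar (ZMod m) k) (s : A ⊕ B → ZMod m) {v : World k A B}
    (hv : v ∈ arcSpan k 1 A B) : spread ψ s v ∈ arcSpan k m A B := by
  refine arcSpan_map (f := spread ψ s) (fun d hd => ?_) hv
  rw [spread_single]
  exact proj_arcSpan ψ s (single_mem_arcSpan (show SouthArc (d.lift m) from hd) 1)

theorem unspread_arcSpan {A B : Type} [Fintype A] [Fintype B] [DecidableEq A] [DecidableEq B]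
    (ψ : AddChar (ZMod m) k) (s : A ⊕ B → ZMod m) {v : Diagram m (A ⊕ B) →₀ k}
    (hv : v ∈ arcSpan k m A B) : unspread ψ s v ∈ arcSpan k 1 A B := by
  refine arcSpan_map (f := unspread ψ s) (fun d hd => ?_) hv
  rw [unspread, Finsupp.linearCombination_single, one_smul]
  exact single_mem_arcSpan (show SouthArc d.forget from hd) _

theorem Tab.symmS_arcSpan {m : ℕ} {A B : Type} [Fintype A] [Fintype B] [DecidableEq A] [DecidableEq B]
    (t' : Tab m B) {v : World k A B} (hv : v ∈ arcSpan k 1 A B) : t'.symmS k A v ∈ arcSpan k 1 A B := by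
  have key : ∀ (x : MonoidAlgebra k t'.grp), t'.actS k A x v ∈ arcSpan k 1 A B := by
    intro x
    induction x using MonoidAlgebra.induction_on with
    | of g =>
      rw [actS_of]
      refine arcSpan_map (f := repS k A B g.1) (fun d hd => ?_) hv
      rw [repS_single]
      exact single_mem_arcSpan ((SouthArc.map_iff _ _ _).2 hd) 1
    | add x y hx hy => rw [map_add]; exact Submodule.add_mem _ hx hy
    | smul r x hx => rw [map_smul]; exact Submodule.smul_mem _ _ hx
  exact key _

theorem goodSpace_disjoint {Γ : Type*} [InvolutiveNeg Γ] {A B : Type} {γ : A → Γ} {γ' : B → Γ}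
    {v : World k A B} (h : v ∈ goodSpace k γ γ') (h' : v ∈ arcSpan k 1 A B) : v = 0 := by
  rw [goodSpace, Finsupp.mem_supported] at h
  rw [arcSpan, Finsupp.mem_supported] at h'
  rw [← Finsupp.support_eq_empty, Finset.eq_empty_iff_forall_notMem]
  exact fun d hd => (h hd).2 (h' hd)

/-- Modulo diagrams with southern arcs, the products of the images of coloured diagrams are described
by `leftOp`. -/
theorem compLin_spread_leftOp (hm : (m : k) ≠ 0) (ψ : AddChar (ZMod m) k) {δ : ZMod m → k}
    (hδ : ∀ i, δ (-i) = δ i) {γ₀ : Fin n → ZMod m} {γ : Fin a → ZMod m} {γ' : Fin b → ZMod m}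
    {y : Diag 1 n a} (hy : Compat γ₀ γ y) {v : World k (Fin a) (Fin b)} (hv : v ∈ goodSpace k γ γ') :
    compLin δ n a b (spread ψ (sign γ₀ γ) (Finsupp.single y 1)) (spread ψ (sign γ γ') v) -
      spread ψ (sign γ₀ γ') (leftOp (parBar ψ δ) γ y v) ∈ arcSpan k m (Fin n) (Fin b) := by
  classical
  refine goodSpace_map (f := compLin δ n a b (spread ψ (sign γ₀ γ) (Finsupp.single y 1)) ∘ₗ
    spread ψ (sign γ γ') - spread ψ (sign γ₀ γ') ∘ₗ leftOp (parBar ψ δ) γ y) (fun d hd => ?_) hv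
  obtain ⟨e1, e2⟩ := gcomp_perm (parBar_neg ψ hδ) hy hd.1 (Enum.fin a) (Enum.univ (Fin a))
  rw [LinearMap.sub_apply, LinearMap.comp_apply, LinearMap.comp_apply, compLin_spread hm ψ hδ hy hd.1,
    e1, e2, leftOp_single]
  split_ifs with h
  · rw [map_zero, sub_zero]
    exact Submodule.smul_mem _ _ (spread_arcSpan _ _ (single_mem_arcSpan h 1))
  · rw [← map_smul, Finsupp.smul_single_one, sub_self]
    exact Submodule.zero_mem _

/-- The projection of a combination of labelled diagrams to the part belonging to the colours. -/
theorem exists_spread_eq {ψ : AddChar (ZMod m) k} (hψ : ∀ c, ψ c = 1 → c = 0) (γ : Fin a → ZMod m)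
    (γ' : Fin b → ZMod m) (Z : Diag m a b →₀ k) :
    ∃ v ∈ goodSpace k γ γ', ∃ w ∈ arcSpan k 1 (Fin a) (Fin b),
      proj ψ (sign γ γ') Z = spread ψ (sign γ γ') (v + w) := by
  induction Z using Finsupp.induction_linear with
  | zero => exact ⟨0, Submodule.zero_mem _, 0, Submodule.zero_mem _, by simp⟩
  | add Z Z' h h' =>
    obtain ⟨v, hv, w, hw, e⟩ := h
    obtain ⟨v', hv', w', hw', e'⟩ := h'
    refine ⟨v + v', Submodule.add_mem _ hv hv', w + w', Submodule.add_mem _ hw hw', ?_⟩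
    rw [map_add, e, e', ← map_add]
    congr 1
    abel
  | single y r =>
    by_cases hy : ∀ v, sign γ γ' (y.mate v) = - sign γ γ' v
    · obtain ⟨c, hc⟩ := proj_single ψ (sign γ γ') y
      by_cases hs : SouthArc y
      · exact ⟨0, Submodule.zero_mem _, c • Finsupp.single y.forget r,
          Submodule.smul_mem _ _ (single_mem_arcSpan (show SouthArc y.forget from hs) r), by rw [hc, zero_add, map_smul]⟩
      · exact ⟨c • Finsupp.single y.forget r,
          Submodule.smul_mem _ _ (single_mem_goodSpace (show Good γ γ' y.forget from ⟨hy, hs⟩) r), 0, Submodule.zero_mem _,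
          by rw [hc, add_zero, map_smul]⟩
    · exact ⟨0, Submodule.zero_mem _, 0, Submodule.zero_mem _, by
        rw [proj_single_eq_zero hψ hy]; simp⟩

end Arcs

section CycEvaluation
open Module
variable {k : Type*} [Field k] {m n : ℕ} [NeZero m] (δ : LoopParams k m) {ξ : k}

/-- The elements of the standard module are the classes of multiples of `spechtGen`. -/
theorem mem_cell (ξ : k) (lam : ZMod m → YoungDiagram) (v : ThroughSpace δ n (size lam)) :
    v ∈ cell δ ξ n lam ↔ ∃ X : Diag m n (size lam) →₀ k,
      v = toThrough δ n _ (compLin δ.toFun _ _ _ X (spechtGen δ ξ lam).coeffs) := by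
  constructor
  · intro h
    refine Submodule.span_induction (R := CycAlg δ n) (p := fun v _ =>
      ∃ X : Diag m n (size lam) →₀ k,
        v = toThrough δ n _ (compLin δ.toFun _ _ _ X (spechtGen δ ξ lam).coeffs)) ?_ ?_ ?_ ?_ h
    · rintro _ ⟨d, x, hx, rfl⟩
      have h1 : ∃ Y : Diag m (size lam) (size lam) →₀ k, x.coeffs =
          compLin δ.toFun _ _ _ Y (spechtGen δ ξ lam).coeffs := by
        refine Submodule.span_induction (R := k) (p := fun x _ =>
          ∃ Y : Diag m (size lam) (size lam) →₀ k, x.coeffs =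
            compLin δ.toFun _ _ _ Y (spechtGen δ ξ lam).coeffs) ?_ ?_ ?_ ?_ hx
        · rintro _ ⟨u, -, rfl⟩
          exact ⟨Finsupp.single u 1, rfl⟩
        · exact ⟨0, (LinearMap.map_zero₂ _ _).symm⟩
        · rintro x y _ _ ⟨X, hX⟩ ⟨Y, hY⟩
          refine ⟨X + Y, ?_⟩
          rw [map_add, LinearMap.add_apply, ← hX, ← hY]; rfl
        · rintro r x _ ⟨X, hX⟩
          refine ⟨r • X, ?_⟩
          rw [map_smul, LinearMap.smul_apply, ← hX]; rfl
      obtain ⟨Y, hY⟩ := h1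
      refine ⟨compLin δ.toFun _ _ _ (Finsupp.single d 1) Y, ?_⟩
      rw [compLin_assoc δ, ← hY]
      rfl
    · exact ⟨0, by rw [map_zero, LinearMap.zero_apply, map_zero]⟩
    · rintro x y _ _ ⟨X, rfl⟩ ⟨Y, rfl⟩
      exact ⟨X + Y, by rw [map_add, LinearMap.add_apply, map_add]⟩
    · rintro r x _ ⟨X, rfl⟩
      exact ⟨compLin δ.toFun _ _ _ r.coeffs X, by rw [smul_toThrough, compLin_assoc δ]⟩
  · rintro ⟨X, rfl⟩
    have hs : spechtGen δ ξ lam ∈ specht δ ξ lam :=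
      Submodule.subset_span ⟨idDiag m _, by rintro ⟨i, j, h⟩; simp [idDiag] at h, (one_mul _).symm⟩
    induction X using Finsupp.induction_linear with
    | zero => rw [map_zero, LinearMap.zero_apply, map_zero]; exact Submodule.zero_mem _
    | add X Y hX hY =>
      rw [map_add, LinearMap.add_apply, map_add]; exact Submodule.add_mem _ hX hY
    | single d r =>
      have : Finsupp.single d r = r • (Finsupp.single d 1 : Diag m n (size lam) →₀ k) := by simp
      rw [this, map_smul, LinearMap.smul_apply, map_smul]
      exact Submodule.smul_of_tower_mem _ r (Submodule.subset_span ⟨d, _, hs, rfl⟩)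

variable (hξ : IsPrimitiveRoot ξ m) {lam mu : ZMod m → YoungDiagram}
  (u : Diag m n (size lam) →₀ k) (w : Diag m (size lam) n →₀ k)

/-- The element `u y w` of the algebra, with the labels of `y` averaged. -/
noncomputable def cycElem (y : Diag 1 (size lam) (size lam)) : CycAlg δ n :=
  compLin δ.toFun _ _ _ (compLin δ.toFun _ _ _ u
    (spread (rootChar hξ) (sign (finTab lam).comp (finTab lam).comp) (Finsupp.single y 1))) w

theorem cycElem_coeffs (y : Diag 1 (size lam) (size lam)) : (cycElem δ hξ u w y).coeffs =
  compLin δ.toFun _ _ _ (compLin δ.toFun _ _ _ u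
    (spread (rootChar hξ) (sign (finTab lam).comp (finTab lam).comp) (Finsupp.single y 1))) w := rfl

/-- The vector `u v`, with the labels of `v` averaged. -/
noncomputable def cycVec (mu : ZMod m → YoungDiagram) :
    World k (Fin (size lam)) (Fin (size mu)) →ₗ[k] ThroughSpace δ n (size mu) :=
  toThrough δ n _ ∘ₗ compLin δ.toFun _ _ _ u ∘ₗ
    spread (rootChar hξ) (sign (finTab lam).comp (finTab mu).comp)

theorem cycVec_apply (v : World k (Fin (size lam)) (Fin (size mu))) : cycVec δ hξ u mu v =
    toThrough δ n _ (compLin δ.toFun _ _ _ u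
      (spread (rootChar hξ) (sign (finTab lam).comp (finTab mu).comp) v)) := rfl

variable {u w}

theorem cyc_cancel (huw : compLin δ.toFun _ _ _ w u = Finsupp.single (idDiag m _) 1) {b c : ℕ}
    (X : Diag m b (size lam) →₀ k) (Y : Diag m (size lam) c →₀ k) :
    compLin δ.toFun _ _ _ (compLin δ.toFun _ _ _ X w) (compLin δ.toFun _ _ _ u Y) =
      compLin δ.toFun _ _ _ X Y := by
  rw [compLin_assoc δ, ← compLin_assoc δ w, huw, one_compLin]

/-- The averages of diagrams with southern arcs vanish in the module. -/
theorem cycVec_arcSpan {v : World k (Fin (size lam)) (Fin (size mu))}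
    (hv : v ∈ arcSpan k 1 (Fin (size lam)) (Fin (size mu))) : cycVec δ hξ u mu v = 0 := by
  rw [cycVec_apply, toThrough_eq_zero]
  exact compLin_arcSpan _ _ (spread_arcSpan _ _ hv)

/-- The elements `u y w` span a corner of the algebra: the projection to characters turns labelled diagrams
into multiples of the averages of coloured unlabelled diagrams. -/
theorem cyc_truncates (hm : (m : k) ≠ 0)
    (huw : compLin δ.toFun _ _ _ w u = Finsupp.single (idDiag m _) 1) :
    Truncates (k := k) (finTab lam) (cycElem δ hξ u w) := by
  constructor
  · intro g hg h hh
    change (compLin δ.toFun _ _ _ (cycElem δ hξ u w _).coeffs (cycElem δ hξ u w _).coeffs : Diag m n n →₀ k) =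
      (cycElem δ hξ u w _).coeffs
    simp only [cycElem_coeffs]
    rw [compLin_assoc δ u (spread (rootChar hξ) (sign (finTab lam).comp (finTab lam).comp)
      (Finsupp.single (gperm 1 h) 1)) w, cyc_cancel δ huw, ← compLin_assoc δ, compLin_assoc δ u,
      compLin_spread hm _ δ.symm (gperm_compat hg) (gperm_compat hh), (gcomp_gperm _ _ _ _).1,
      (gcomp_gperm _ _ _ _).2, one_smul, gperm_mapN]
  · intro b
    let f : (Diag m (size lam) (size lam) →₀ k) →ₗ[k] CycAlg δ n :=
      (compLin δ.toFun n (size lam) n).flip w ∘ₗ compLin δ.toFun n (size lam) (size lam) u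
    have key : ∀ Z, f (proj (rootChar hξ) (sign (finTab lam).comp (finTab lam).comp) Z) ∈
        Submodule.span k (cycElem δ hξ u w '' {y | Compat (finTab lam).comp (finTab lam).comp y}) := by
      intro Z
      induction Z using Finsupp.induction_linear with
      | zero => rw [map_zero, map_zero]; exact Submodule.zero_mem _
      | add v v' hv hv' => rw [map_add, map_add]; exact Submodule.add_mem _ hv hv'
      | single y r =>
        by_cases hy : ∀ v, sign (finTab lam).comp (finTab lam).comp (y.mate v) =
            - sign (finTab lam).comp (finTab lam).comp v
        · obtain ⟨c, hc⟩ := proj_single (rootChar hξ) (sign (finTab lam).comp (finTab lam).comp) y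
          have e : Finsupp.single y.forget r = r • (Finsupp.single y.forget 1 :
            World k (Fin (size lam)) (Fin (size lam))) := by simp
          rw [hc, e, map_smul, map_smul, map_smul]
          exact Submodule.smul_mem _ _ (Submodule.smul_mem _ _
            (Submodule.subset_span ⟨y.forget, hy, rfl⟩))
        · rw [proj_single_eq_zero (rootChar_faithful hξ) hy, map_zero]
          exact Submodule.zero_mem _
    have e : cycElem δ hξ u w (gperm 1 1) * b * cycElem δ hξ u w (gperm 1 1) =
        f (proj (rootChar hξ) (sign (finTab lam).comp (finTab lam).comp)
          (compLin δ.toFun _ _ _ w (compLin δ.toFun _ _ _ b.coeffs u))) := by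
      change compLin δ.toFun n n n (compLin δ.toFun n n n (cycElem δ hξ u w _).coeffs b.coeffs)
        (cycElem δ hξ u w _).coeffs = compLin δ.toFun _ _ _ (compLin δ.toFun _ _ _ u _) w
      rw [cycElem_coeffs, spread_one _ hm, proj_eq_avg, ← compLin_charIdem _ δ.toFun,
        ← charIdem_compLin _ δ.toFun]
      simp only [compLin_assoc δ]
    rw [e]
    exact key _

/-- The corner of the standard module is described by coloured diagrams, with the Fourier transform of the
parameters. -/
theorem cyc_realises (hm : (m : k) ≠ 0)
    (huw : compLin δ.toFun _ _ _ w u = Finsupp.single (idDiag m _) 1) :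
    Realises (parBar (rootChar hξ) δ.toFun) (finTab lam) (finTab mu) (cycElem δ hξ u w)
      (cycVec δ hξ u mu) (cell δ ξ n mu) := by
  have cancel : ∀ y v, cycElem δ hξ u w y • cycVec δ hξ u mu v =
      toThrough δ n _ (compLin δ.toFun _ _ _ u (compLin δ.toFun _ _ _
        (spread (rootChar hξ) (sign (finTab lam).comp (finTab lam).comp) (Finsupp.single y 1))
        (spread (rootChar hξ) (sign (finTab lam).comp (finTab mu).comp) v))) := by
    intro y v
    rw [cycVec_apply, smul_toThrough, cycElem_coeffs, cyc_cancel δ huw, compLin_assoc δ]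
  constructor
  · intro y d hy hd
    rw [cancel, cycVec_apply, ← sub_eq_zero, ← map_sub, ← map_sub, toThrough_eq_zero]
    exact compLin_arcSpan _ _ (compLin_spread_leftOp hm _ δ.symm hy (single_mem_goodSpace hd 1))
  · intro v hv h0
    rw [cycVec_apply, toThrough_eq_zero] at h0
    have h1 := compLin_arcSpan δ.toFun w h0
    rw [← compLin_assoc δ, huw, one_compLin] at h1
    have h2 := unspread_arcSpan (rootChar hξ) (sign (finTab lam).comp (finTab mu).comp) h1
    have h3 : unspread (rootChar hξ) (sign (finTab lam).comp (finTab mu).comp)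
        (spread (rootChar hξ) (sign (finTab lam).comp (finTab mu).comp) v) = v :=
      goodSpace_ext (f := unspread (rootChar hξ) (sign (finTab lam).comp (finTab mu).comp) ∘ₗ
        spread (rootChar hξ) (sign (finTab lam).comp (finTab mu).comp)) (g := LinearMap.id)
        (fun d hd => unspread_spread hm _ hd.1 1) hv
    rw [h3] at h2
    exact goodSpace_disjoint hv h2
  · intro v hv
    rw [mem_cell]
    exact ⟨compLin δ.toFun _ _ _ u (spread (rootChar hξ) (sign (finTab lam).comp (finTab mu).comp) v), by
      rw [compLin_assoc δ, compLin_spechtGen δ hξ hm, cycVec_apply]⟩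
  · intro v hv
    rw [mem_cell] at hv
    obtain ⟨X, rfl⟩ := hv
    obtain ⟨v, hv, v', hv', e⟩ := exists_spread_eq (rootChar_faithful hξ) (finTab lam).comp
      (finTab mu).comp (compLin δ.toFun _ _ _ w X)
    refine ⟨v, hv, ?_⟩
    have h1 : cycElem δ hξ u w (gperm 1 1) • toThrough δ n _ (compLin δ.toFun _ _ _ X (spechtGen δ ξ mu).coeffs) =
        cycVec δ hξ u mu ((finTab mu).symmS k _ (v + v')) := by
      rw [smul_toThrough, cycElem_coeffs, spread_one _ hm, cycVec_apply, ← compLin_spechtGen δ hξ hm,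
        ← e, proj_eq_avg, ← compLin_charIdem _ δ.toFun, ← charIdem_compLin _ δ.toFun]
      simp only [compLin_assoc δ]
      rw [charIdem_spechtGen δ hξ hm]
    rw [h1, map_add, map_add, cycVec_arcSpan δ hξ ((finTab mu).symmS_arcSpan hv'), add_zero]

theorem cyc_gen (hm : (m : k) ≠ 0)
    (huw : compLin δ.toFun _ _ _ w u = Finsupp.single (idDiag m _) 1) :
    ((cyc_realises δ hξ hm huw (mu := lam)).gen : ThroughSpace δ n (size lam)) =
      toThrough δ n _ (compLin δ.toFun _ _ _ u (spechtGen δ ξ lam).coeffs) := by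
  change cycVec δ hξ u lam _ = _
  rw [cycVec_apply, ← compLin_spechtGen δ hξ hm, spread_one _ hm, charIdem_spechtGen δ hξ hm]

/-- The standard module is generated by `u` times the generator of the Specht module. -/
theorem cyc_standard (hm : (m : k) ≠ 0)
    (huw : compLin δ.toFun _ _ _ w u = Finsupp.single (idDiag m _) 1) :
    Standard (cyc_realises δ hξ hm huw (mu := lam)) := by
  constructor
  · rintro ⟨v, hv⟩
    obtain ⟨X, rfl⟩ := (mem_cell δ ξ lam v).1 hv
    obtain ⟨b, hb⟩ : ∃ b : CycAlg δ n, b.coeffs = compLin δ.toFun _ _ _ X w := ⟨_, rfl⟩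
    refine ⟨b, Subtype.ext ?_⟩
    rw [Submodule.coe_smul, cyc_gen δ hξ hm huw, smul_toThrough, hb, cyc_cancel δ huw]
  · intro y _ hs
    apply Subtype.ext
    rw [Submodule.coe_smul, cyc_gen δ hξ hm huw, smul_toThrough, cycElem_coeffs, cyc_cancel δ huw, compLin_assoc δ,
      compLin_spechtGen δ hξ hm, ← cycVec_apply]
    exact cycVec_arcSpan δ hξ ((finTab lam).symmS_arcSpan (single_mem_arcSpan hs 1))

/-- Diagrams with southern arcs annihilate the vectors in `arcKernel`. -/
theorem compLin_arcKernel (hm : (m : k) ≠ 0) {X : Diag m n (size lam) →₀ k}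
    (hX : X ∈ arcSpan k m (Fin n) (Fin (size lam))) {v : World k (Fin (size lam)) (Fin (size mu))}
    (hv : v ∈ arcKernel (parBar (rootChar hξ) δ.toFun) (finTab lam) (finTab mu)) :
    compLin δ.toFun _ _ _ X (spread (rootChar hξ) (sign (finTab lam).comp (finTab mu).comp) v) ∈
      arcSpan k m (Fin n) (Fin (size mu)) := by
  refine arcSpan_map (f := (compLin δ.toFun _ _ _).flip
    (spread (rootChar hξ) (sign (finTab lam).comp (finTab mu).comp) v)) (fun y hy => ?_) hX
  rw [LinearMap.flip_apply, ← charIdem_spread _ δ.toFun hm, ← compLin_assoc δ, compLin_charIdem,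
    ← sum_avgN hm (rootChar_faithful hξ) (avgS _ _ _), map_sum, LinearMap.sum_apply]
  refine Submodule.sum_mem _ fun γ₀ _ => ?_
  rw [← proj_eq_avg]
  by_cases hc : ∀ v, sign γ₀ (finTab lam).comp (y.mate v) = - sign γ₀ (finTab lam).comp v
  · obtain ⟨c, hc'⟩ := proj_single (rootChar hξ) (sign γ₀ (finTab lam).comp) y
    rw [hc', map_smul, LinearMap.smul_apply]
    refine Submodule.smul_mem _ _ ?_
    have h1 := compLin_spread_leftOp hm (rootChar hξ) δ.symm (show Compat γ₀ (finTab lam).comp y.forget from hc)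
      (cellSpace_le _ _ (mem_arcKernel.1 hv).1)
    rwa [leftOp_eq_zero (parBar_neg _ δ.symm) hv (show Compat γ₀ (finTab lam).comp y.forget from hc)
      (show SouthArc y.forget from hy), map_zero, sub_zero] at h1
  · rw [proj_single_eq_zero (rootChar_faithful hξ) hc, map_zero, LinearMap.zero_apply]
    exact Submodule.zero_mem _

/-- The multiplicities of the cyclotomic Brauer algebra are coloured multiplicities. -/
theorem cycDecomp_eq (hm : (m : k) ≠ 0)
    (huw : compLin δ.toFun _ _ _ w u = Finsupp.single (idDiag m (size lam)) 1)
    (hk : ((size lam).factorial : k) ≠ 0) :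
    cycDecomp δ ξ n mu lam =
      cellMult (parBar (rootChar hξ) δ.toFun) (finTab lam) (finTab mu) :=
  (cyc_realises δ hξ hm huw).multiplicity_eq _ (cyc_truncates δ hξ hm huw)
    (cyc_standard δ hξ hm huw) (by rwa [Fintype.card_fin])

/-- The homomorphisms of standard modules of the cyclotomic Brauer algebra. -/
theorem finrank_cycHom (hm : (m : k) ≠ 0)
    (huw : compLin δ.toFun _ _ _ w u = Finsupp.single (idDiag m (size lam)) 1)
    (hk : ((size lam).factorial : k) ≠ 0) :
    finrank k (cycHom δ ξ n lam mu) =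
      finrank k (arcKernel (parBar (rootChar hξ) δ.toFun) (finTab lam) (finTab mu)) := by
  refine (cyc_realises δ hξ hm huw).finrank_hom _ (cyc_truncates δ hξ hm huw)
    (cyc_standard δ hξ hm huw) (by rwa [Fintype.card_fin]) fun b hb v hv => ?_
  obtain ⟨c, hc, hcc⟩ := (finTab lam).symm_sq k (by rwa [Fintype.card_fin])
  have h1 : v = c⁻¹ • (finTab lam).actN k _ ((finTab lam).symm k) v := by
    have := actN_cellSpace (k := k) (finTab lam) (finTab mu) (y := 1) (ε := c) (by rw [mul_one, hcc])
      (mem_arcKernel.1 hv).1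
    rw [mul_one] at this
    rw [this, smul_smul, inv_mul_cancel₀ hc, one_smul]
  have h2 := congrArg Subtype.val hb
  rw [Submodule.coe_smul, cyc_gen δ hξ hm huw, smul_toThrough] at h2
  have h3 := (toThrough_eq_zero δ _).1 h2
  rw [h1, map_smul, smul_comm, cycVec_apply, smul_toThrough, ← spechtGen_compLin δ hξ hm,
    ← compLin_assoc δ, ← compLin_assoc δ, compLin_assoc δ b.coeffs,
    (toThrough_eq_zero δ _).2 (compLin_arcKernel δ hξ hm h3 hv), smul_zero]

end CycEvaluation

/-! ### Inserting arcs -/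

section Insert
variable {k : Type*} [Field k] {m : ℕ}

/-- Independence of the order for labelled diagrams whose central nodes have equal parameters. -/
theorem gl_perm_const {A B C : Type} [DecidableEq A] [DecidableEq B] [DecidableEq C] (δ : LoopParams k m)
    (L L' : Enum B) (x : Diagram m (A ⊕ B)) (y : Diagram m (B ⊕ C)) :
    gl (fun _ => δ.toFun) L.1 (gjoin k x y) = gl (fun _ => δ.toFun) L'.1 (gjoin k x y) := by
  let f : B → Mid A B C × Mid A B C := fun b => (.inl (.inr b), .inr (.inl b))
  have e : ∀ L : List B, gl (fun _ => δ.toFun) L (gjoin k x y) =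
      glueAll δ.toFun (L.map f) (gjoin k x y) := fun L => by
    simp only [gl, glueAll, List.foldr_map, f]
  rw [e, e]
  refine glueAll_perm _ δ.symm ((L.perm L').map f) _ ⟨gjoin_good x y, ?_, ?_⟩
  · intro p hp
    obtain ⟨b, -, rfl⟩ := List.mem_map.1 hp
    exact ⟨by simp [f], gjoin_alive x y _, gjoin_alive x y _⟩
  · rw [List.pairwise_map]
    refine L.2.1.imp fun {i j} hij => ?_
    simp [Apart, hij, f]

/-- The concatenation does not depend on the order in which the central nodes are glued. -/
theorem gcomp_perm_const {A B C : Type} [DecidableEq A] [DecidableEq B] [DecidableEq C] (δ : LoopParams k m)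
    (L L' : Enum B) (x : Diagram m (A ⊕ B)) (y : Diagram m (B ⊕ C)) :
    gcomp (fun _ => δ.toFun) L x y = gcomp (fun _ => δ.toFun) L' x y ∧
      gwt (fun _ => δ.toFun) L x y = gwt (fun _ => δ.toFun) L' x y := by
  have e := gcomp_emb (k := k) (fun _ => δ.toFun) L' x y
  rw [gl_perm_const δ L' L] at e
  exact gcomp_unique e

/-- A strand that passes three southern nodes. -/
def zig (m : ℕ) : Diagram m (Fin 1 ⊕ Fin 3) where
  mate := Sum.elim (fun _ => .inr 2) ![.inr 1, .inr 0, .inl 0]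
  lab _ := 0
  mate_mate := by decide
  mate_ne := by decide
  lab_mate _ := by simp

/-- A strand that passes three northern nodes. -/
def zag (m : ℕ) : Diagram m (Fin 3 ⊕ Fin 1) where
  mate := Sum.elim ![.inr 0, .inl 2, .inl 1] (fun _ => .inl 0)
  lab _ := 0
  mate_mate := by decide
  mate_ne := by decide
  lab_mate _ := by simp

/-- The two zigzags straighten to a strand without closing a loop. -/
theorem zig_zag (δ : LoopParams k m) (L : Enum (Fin 3)) :
    gcomp (fun _ => δ.toFun) L (zig m) (zag m) = gid m (Fin 1) ∧
      gwt (fun _ => δ.toFun) L (zig m) (zag m) = 1 := by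
  obtain ⟨e1, e2⟩ := gcomp_perm_const δ L ⟨[0, 1, 2], by decide, by decide⟩ (zig m) (zag m)
  rw [e1, e2]
  refine gcomp_unique ⟨?_, ?_, ?_⟩
  · rintro (v | v)
    · fin_cases v; rfl
    · fin_cases v; rfl
  · rintro (v | v)
    · fin_cases v
      simp [gl, glue, gjoin, zig, zag, gouter, gid, Diagram.toState]
    · fin_cases v
      simp [gl, glue, gjoin, zig, zag, gouter, gid, Diagram.toState]
  · simp [gl, glue, gjoin, zig, zag, gid, Diagram.toState]

theorem gid_map (m : ℕ) {A A' : Type} (e : A ≃ A') : (gid m A).map (e.sumCongr e) = gid m A' := by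
  ext v <;> rcases v with v | v <;> simp [gid, Diagram.map]

theorem tens_gid (m : ℕ) (A B : Type) : tens (gid m A) (gid m B) = gid m (A ⊕ B) := by
  ext v <;> rcases v with (v | v) | (v | v) <;> rfl

/-- Two strands can be inserted and removed without closing a loop if there is a strand already. -/
theorem exists_insert_two (δ : LoopParams k m) (n : ℕ) : ∃ (u : Diag m (n + 3) (n + 1) →₀ k)
    (w : Diag m (n + 1) (n + 3) →₀ k),
      compLin δ.toFun _ _ _ w u = Finsupp.single (idDiag m (n + 1)) 1 := by
  let e : Fin n ⊕ Fin 1 ≃ Fin (n + 1) := finSumFinEquiv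
  let e' : Fin n ⊕ Fin 3 ≃ Fin (n + 3) := finSumFinEquiv
  refine ⟨Finsupp.single ((tens (gid m (Fin n)) (zag m)).map (e'.sumCongr e)) 1,
    Finsupp.single ((tens (gid m (Fin n)) (zig m)).map (e.sumCongr e')) 1, ?_⟩
  rw [compLin_single, (comp_eq_gcomp _ _ _).1, (comp_eq_gcomp _ _ _).2]
  obtain ⟨h1, h2⟩ := gcomp_perm_const δ (Enum.fin (n + 3)) ((Enum.univ _).map e')
    ((tens (gid m (Fin n)) (zig m)).map (e.sumCongr e')) ((tens (gid m (Fin n)) (zag m)).map (e'.sumCongr e))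
  obtain ⟨h3, h4⟩ := gcomp_map e e' e (δ := fun _ => δ.toFun) (δ' := fun _ => δ.toFun) (fun _ => rfl)
    (Enum.univ _) (tens (gid m (Fin n)) (zig m)) (tens (gid m (Fin n)) (zag m))
  obtain ⟨h5, h6⟩ := gcomp_tens (fun _ => δ.toFun) (Enum.univ (Fin n ⊕ Fin 3))
    (gid m (Fin n)) (zig m) (gid m (Fin n)) (zag m)
  rw [h1, h2, h3, h4, h5, h6, (zig_zag δ _).1, (zig_zag δ _).2, (gid_comp _ _ _).1, (gid_comp _ _ _).2,
    tens_gid, gid_map]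
  simp
  rfl

/-- The diagram of a southern arc with label `i`. -/
def cup (m : ℕ) (i : ZMod m) : Diag m 0 2 where
  mate := Sum.elim Fin.elim0 ![.inr 1, .inr 0]
  lab := Sum.elim Fin.elim0 ![i, -i]
  mate_mate := by decide
  mate_ne := by decide
  lab_mate v := by
    rcases v with v | v
    · exact v.elim0
    · fin_cases v <;> simp

/-- The diagram of a northern arc with label `0`. -/
def cap (m : ℕ) : Diag m 2 0 where
  mate := Sum.elim ![.inl 1, .inl 0] Fin.elim0
  lab _ := 0
  mate_mate := by decide
  mate_ne := by decide
  lab_mate _ := by simp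

theorem loopFactor_cup_cap (δ : LoopParams k m) (i : ZMod m) :
    loopFactor δ.toFun (cup m i) (cap m) = δ.toFun i := by
  rw [(comp_eq_gcomp _ _ _).2, (gcomp_perm_const δ _ ⟨[0, 1], by decide, by decide⟩ _ _).2]
  simp [gwt, gl, glue, gjoin, cup, cap, δ.symm]

/-- Diagrams on `a` nodes are a factor of diagrams on `a + 2 l` nodes. -/
theorem exists_insert (δ : LoopParams k m) (a l : ℕ) (h : l = 0 ∨ a ≠ 0 ∨ δ.toFun ≠ 0) :
    ∃ (u : Diag m (a + 2 * l) a →₀ k) (w : Diag m a (a + 2 * l) →₀ k),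
      compLin δ.toFun _ _ _ w u = Finsupp.single (idDiag m a) 1 := by
  induction l with
  | zero => exact ⟨Finsupp.single (idDiag m a) 1, Finsupp.single (idDiag m a) 1, one_compLin _ _⟩
  | succ l ih =>
    have h' : a ≠ 0 ∨ δ.toFun ≠ 0 := h.resolve_left (Nat.succ_ne_zero l)
    obtain ⟨u, w, huw⟩ := ih (Or.inr h')
    have key : ∃ (u' : Diag m (a + 2 * l + 2) (a + 2 * l) →₀ k)
        (w' : Diag m (a + 2 * l) (a + 2 * l + 2) →₀ k),
        compLin δ.toFun _ _ _ w' u' = Finsupp.single (idDiag m (a + 2 * l)) 1 := by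
      rcases hn : a + 2 * l with _ | n
      · obtain ⟨i, hi⟩ := Function.ne_iff.1 (h'.resolve_left (by omega))
        refine ⟨Finsupp.single (cap m) 1, Finsupp.single (cup m i) (δ.toFun i)⁻¹, ?_⟩
        rw [compLin_single, loopFactor_cup_cap, mul_one, inv_mul_cancel₀ hi]
        congr 1
        ext v <;> rcases v with v | v <;> exact v.elim0
      · exact exists_insert_two δ n
    obtain ⟨u', w', huw'⟩ := key
    refine ⟨compLin δ.toFun _ _ _ u' u, compLin δ.toFun _ _ _ w w', ?_⟩
    rw [compLin_assoc δ]
    have e := compLin_assoc δ w' u' u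
    rw [huw', one_compLin] at e
    exact (congrArg (compLin δ.toFun _ _ _ w) e.symm).trans huw

end Insert

section CycBrauerEvaluation
open Module
variable {k : Type*} [Field k] {m n : ℕ} [NeZero m] (δ : LoopParams k m) {ξ : k}
  (hξ : IsPrimitiveRoot ξ m) {lam mu : ZMod m → YoungDiagram}

theorem exists_insert_of_isLabel (hδ : Even n → δ.toFun ≠ 0) (hlam : IsLabel m n lam) :
    ∃ (u : Diag m n (size lam) →₀ k) (w : Diag m (size lam) n →₀ k),
      compLin δ.toFun _ _ _ w u = Finsupp.single (idDiag m (size lam)) 1 := by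
  obtain ⟨l, rfl⟩ := hlam
  refine exists_insert δ _ l (Or.inr ?_)
  by_cases h : size lam = 0
  · exact Or.inr (hδ (by rw [h, zero_add]; exact even_two_mul l))
  · exact Or.inl h

theorem factorial_ne_zero_of_le {p : ℕ} [CharP k p] (hp : p = 0 ∨ n < p) {a : ℕ} (ha : a ≤ n) :
    (a.factorial : k) ≠ 0 := by
  rw [Ne, CharP.cast_eq_zero_iff k p]
  rcases hp with rfl | hp
  · rw [zero_dvd_iff]; exact Nat.factorial_ne_zero a
  · have hp' : p.Prime := (CharP.char_is_prime_or_zero k p).resolve_right (by omega)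
    rw [hp'.dvd_factorial]
    omega

theorem parBar_constParams (x : k) (hξ : IsPrimitiveRoot (1 : k) 1) :
    parBar (rootChar hξ) (constParams x).toFun = fun _ => x := by
  funext r
  simp [parBar, constParams, rootChar_apply]

theorem size_one (lam : YoungDiagram) : size (m := 1) (fun _ => lam) = lam.card := by simp [size]

theorem exists_insert_one (x : k) (lam : YoungDiagram) :
    ∃ (u : Diag 1 lam.card (size (m := 1) fun _ => lam) →₀ k)
      (w : Diag 1 (size (m := 1) fun _ => lam) lam.card →₀ k),
      compLin (constParams x).toFun _ _ _ w u = Finsupp.single (idDiag 1 _) 1 := by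
  rw [size_one]
  exact ⟨_, _, one_compLin _ _⟩

/-- The multiplicities of the Brauer algebra are coloured multiplicities. -/
theorem brauerDecomp_eq (x : k) {lam mu : YoungDiagram} (hk : (lam.card.factorial : k) ≠ 0) :
    brauerDecomp x lam.card mu lam =
      cellMult (fun _ => x) (finTab (m := 1) fun _ => lam) (finTab (m := 1) fun _ => mu) := by
  obtain ⟨u, w, huw⟩ := exists_insert_one x lam
  rw [← parBar_constParams x IsPrimitiveRoot.one]
  exact cycDecomp_eq (constParams x) IsPrimitiveRoot.one (by simp) huw (by rwa [size_one])

theorem finrank_brauerHom (x : k) {lam mu : YoungDiagram} (hk : (lam.card.factorial : k) ≠ 0) :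
    finrank k (brauerHom x lam.card lam mu) =
      finrank k (arcKernel (fun _ => x) (finTab (m := 1) fun _ => lam)
        (finTab (m := 1) fun _ => mu)) := by
  obtain ⟨u, w, huw⟩ := exists_insert_one x lam
  rw [← parBar_constParams x IsPrimitiveRoot.one]
  exact finrank_cycHom (constParams x) IsPrimitiveRoot.one (by simp) huw (by rwa [size_one])

end CycBrauerEvaluation

/-! ### Evaluation of the standard modules of the walled Brauer algebra -/

/-- The tableau of a pair of Young diagrams, with the opposite colours `1` and `-1` in `ℤ/3` for the two
components. -/
def pairTab (lam mu : YoungDiagram) : Tab 3 (lam.cells ⊕ mu.cells) where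
  comp := Sum.elim (fun _ => 1) (fun _ => -1)
  row := Sum.elim (fun c => c.1.1) (fun c => c.1.1)
  col := Sum.elim (fun c => c.1.2) (fun c => c.1.2)
  inj := by
    have h : (1 : ZMod 3) ≠ -1 := by decide
    rintro (a | a) (b | b) h1 h2 h3
    · exact congrArg _ (Subtype.ext (Prod.ext h2 h3))
    · exact absurd h1 h
    · exact absurd h1 h.symm
    · exact congrArg _ (Subtype.ext (Prod.ext h2 h3))
  lower := by
    rintro (⟨c, hc⟩ | ⟨c, hc⟩) i j hi hj
    · exact ⟨.inl ⟨(i, j), lam.isLowerSet (show (i, j) ≤ c from ⟨hi, hj⟩) hc⟩, rfl, rfl, rfl⟩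
    · exact ⟨.inr ⟨(i, j), mu.isLowerSet (show (i, j) ≤ c from ⟨hi, hj⟩) hc⟩, rfl, rfl, rfl⟩

/-- The tableau whose entries are the numbers given by `biTableau`. -/
noncomputable def wallTab (lam mu : YoungDiagram) : Tab 3 (Fin (lam.card + mu.card)) :=
  (pairTab lam mu).pull (biTableau lam mu)

theorem wallTab_comp (lam mu : YoungDiagram) (i : Fin (lam.card + mu.card)) :
    (wallTab lam mu).comp i = if i.val < lam.card then 1 else -1 := by
  change Sum.elim _ _ (biTableau lam mu i) = _
  obtain ⟨j, rfl⟩ := finSumFinEquiv.surjective i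
  have h : biTableau lam mu (finSumFinEquiv j) =
      lam.cells.equivFin.symm.sumCongr mu.cells.equivFin.symm j := by
    simp only [biTableau, Equiv.trans_apply, Equiv.symm_apply_apply]
  rw [h]
  rcases j with j | j
  · exact (if_pos j.2).symm
  · exact (if_neg (by simp)).symm

theorem wallTab_colPres (lam mu : YoungDiagram) (g : Equiv.Perm (Fin (lam.card + mu.card))) :
    (∀ i, Sum.map (fun c : lam.cells => c.1.2) (fun c : mu.cells => c.1.2) (biTableau lam mu (g i)) =
      Sum.map (fun c : lam.cells => c.1.2) (fun c : mu.cells => c.1.2) (biTableau lam mu i)) ↔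
      (wallTab lam mu).ColPres g := by
  have h : (1 : ZMod 3) ≠ -1 := by decide
  refine forall_congr' fun i => ?_
  change _ ↔ Sum.elim _ _ (biTableau lam mu (g i)) = Sum.elim _ _ (biTableau lam mu i) ∧
    Sum.elim _ _ (biTableau lam mu (g i)) = Sum.elim _ _ (biTableau lam mu i)
  rcases biTableau lam mu (g i) with a | a <;> rcases biTableau lam mu i with b | b <;>
    simp [h, h.symm]

theorem wallTab_rowPres (lam mu : YoungDiagram) (g : Equiv.Perm (Fin (lam.card + mu.card))) :
    (∀ i, Sum.map (fun c : lam.cells => c.1.1) (fun c : mu.cells => c.1.1) (biTableau lam mu (g i)) =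
      Sum.map (fun c : lam.cells => c.1.1) (fun c : mu.cells => c.1.1) (biTableau lam mu i)) ↔
      (wallTab lam mu).RowPres g := by
  have h : (1 : ZMod 3) ≠ -1 := by decide
  refine forall_congr' fun i => ?_
  change _ ↔ Sum.elim _ _ (biTableau lam mu (g i)) = Sum.elim _ _ (biTableau lam mu i) ∧
    Sum.elim _ _ (biTableau lam mu (g i)) = Sum.elim _ _ (biTableau lam mu i)
  rcases biTableau lam mu (g i) with a | a <;> rcases biTableau lam mu i with b | b <;>
    simp [h, h.symm]

section Walled
open Module
variable {k : Type*} [Field k]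

/-- The walled diagrams are the diagrams that respect the colours. -/
theorem isWalled_iff {lam lam' mu mu' : YoungDiagram}
    {d : Diag 1 (lam.card + lam'.card) (mu.card + mu'.card)} :
    IsWalled lam.card lam'.card mu.card mu'.card d ↔
      Compat (wallTab lam lam').comp (wallTab mu mu').comp d := by
  classical
  have h : (1 : ZMod 3) ≠ -1 := by decide
  have h' : (-1 : ZMod 3) ≠ 1 := by decide
  have e : ∀ v, sign (wallTab lam lam').comp (wallTab mu mu').comp v =
      if (leftOfWall lam.card lam'.card mu.card mu'.card v ↔ v.isLeft) then 1 else -1 := by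
    rintro (v | v)
    · simp [sign, wallTab_comp, leftOfWall]
    · simp only [sign, wallTab_comp, leftOfWall, Sum.elim_inr, Sum.isLeft_inr, Bool.false_eq_true,
        iff_false]
      split_ifs <;> simp
  refine forall_congr' fun v => ?_
  rw [e, e]
  generalize d.mate v = w
  by_cases h1 : leftOfWall lam.card lam'.card mu.card mu'.card v <;>
    by_cases h2 : leftOfWall lam.card lam'.card mu.card mu'.card w <;>
    cases v.isLeft <;> cases w.isLeft <;> simp [h1, h2, h, h']

variable (k) in
/-- The span of the diagrams that respect the colours. -/
def compatSpan {A B : Type} {Γ : Type*} [InvolutiveNeg Γ] (γ : A → Γ) (γ' : B → Γ) :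
    Submodule k (World k A B) :=
  Finsupp.supported k k {d | Compat γ γ' d}

section Compat
variable {A B : Type} {Γ : Type*} [InvolutiveNeg Γ] {γ : A → Γ} {γ' : B → Γ}

theorem single_mem_compatSpan {d : Diagram 1 (A ⊕ B)} (hd : Compat γ γ' d) (c : k) :
    Finsupp.single d c ∈ compatSpan k γ γ' := Finsupp.single_mem_supported k c hd

theorem compatSpan_map {E : Type*} [AddCommGroup E] [Module k E]
    {f : World k A B →ₗ[k] E} {U : Submodule k E}
    (h : ∀ d, Compat γ γ' d → f (Finsupp.single d 1) ∈ U) {v : World k A B}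
    (hv : v ∈ compatSpan k γ γ') : f v ∈ U := by
  rw [compatSpan, Finsupp.supported_eq_span_single] at hv
  induction hv using Submodule.span_induction with
  | mem x hx => obtain ⟨d, hd, rfl⟩ := hx; exact h d hd
  | zero => rw [map_zero]; exact U.zero_mem
  | add x y _ _ hx hy => rw [map_add]; exact U.add_mem hx hy
  | smul r x _ hx => rw [map_smul]; exact U.smul_mem r hx

theorem compatSpan_ext {E : Type*} [AddCommGroup E] [Module k E] {f g : World k A B →ₗ[k] E}
    (h : ∀ d, Compat γ γ' d → f (Finsupp.single d 1) = g (Finsupp.single d 1)) {v : World k A B}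
    (hv : v ∈ compatSpan k γ γ') : f v = g v := by
  have h0 := compatSpan_map (f := f - g) (U := ⊥)
    (fun d hd => by rw [Submodule.mem_bot, LinearMap.sub_apply, h d hd, sub_self]) hv
  rwa [Submodule.mem_bot, LinearMap.sub_apply, sub_eq_zero] at h0

theorem goodSpace_le_compatSpan : goodSpace k γ γ' ≤ compatSpan k γ γ' :=
  Finsupp.supported_mono fun _ hd => hd.1

theorem exists_add_of_compatSpan {v : World k A B} (hv : v ∈ compatSpan k γ γ') :
    ∃ w ∈ goodSpace k γ γ', ∃ w' ∈ arcSpan k 1 A B, w + w' = v := by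
  have h : ({d | Compat γ γ' d} : Set (Diagram 1 (A ⊕ B))) ⊆ {d | Good γ γ' d} ∪ {d | SouthArc d} :=
    fun d hd => (em (SouthArc d)).symm.imp (fun h => ⟨hd, h⟩) id
  have h1 := Finsupp.supported_mono (M := k) (R := k) h hv
  rw [Finsupp.supported_union] at h1
  exact Submodule.mem_sup.1 h1

end Compat

theorem compLin_compatSpan {a b c : ℕ} {Γ : Type*} [InvolutiveNeg Γ] {γ₀ : Fin a → Γ} {γ : Fin b → Γ}
    {γ' : Fin c → Γ} (δ : ZMod 1 → k) {v : World k (Fin a) (Fin b)} {w : World k (Fin b) (Fin c)}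
    (hv : v ∈ compatSpan k γ₀ γ) (hw : w ∈ compatSpan k γ γ') :
    compLin δ a b c v w ∈ compatSpan k γ₀ γ' := by
  refine compatSpan_map (f := (compLin δ a b c).flip w) (fun d hd => ?_) hv
  rw [LinearMap.flip_apply]
  refine compatSpan_map (f := compLin δ a b c (Finsupp.single d 1)) (fun e he => ?_) hw
  rw [compLin_single, (comp_eq_gcomp _ _ _).1]
  exact single_mem_compatSpan (hd.gcomp he _ _) _

variable (x : k) (lam lam' mu mu' : YoungDiagram)

/-- The span of the walled diagrams is closed under multiplication. -/
theorem coeffs_mem_compatSpan {b : BrauerAlg x (lam.card + lam'.card)}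
    (hb : b ∈ walledAlg x lam.card lam'.card) :
    b.coeffs ∈ compatSpan k (wallTab lam lam').comp (wallTab lam lam').comp := by
  have h1 : ((1 : BrauerAlg x (lam.card + lam'.card)).coeffs : World k _ _) ∈
      compatSpan k (wallTab lam lam').comp (wallTab lam lam').comp :=
    single_mem_compatSpan (gid_compat _) 1
  refine Algebra.adjoin_induction (p := fun b _ =>
    CycAlg.coeffs b ∈ compatSpan k (wallTab lam lam').comp (wallTab lam lam').comp) ?_ ?_ ?_ ?_ hb
  · rintro _ ⟨d, hd, rfl⟩
    exact single_mem_compatSpan (isWalled_iff.1 hd) 1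
  · intro r
    rw [Algebra.algebraMap_eq_smul_one]
    exact Submodule.smul_mem _ r h1
  · intro b c _ _ hb hc
    exact Submodule.add_mem _ hb hc
  · intro b c _ _ hb hc
    exact compLin_compatSpan _ hb hc

open Classical in
/-- The elements of the walled Brauer algebra given by the diagrams that respect the colours. -/
noncomputable def wallElem (y : Diag 1 (lam.card + lam'.card) (lam.card + lam'.card)) :
    walledAlg x lam.card lam'.card :=
  if h : Compat (wallTab lam lam').comp (wallTab lam lam').comp y then
    ⟨CycAlg.of _ y, Algebra.subset_adjoin ⟨y, isWalled_iff.2 h, rfl⟩⟩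
  else 0

theorem wallElem_coe {y : Diag 1 (lam.card + lam'.card) (lam.card + lam'.card)}
    (h : Compat (wallTab lam lam').comp (wallTab lam lam').comp y) :
    (wallElem x lam lam' y : BrauerAlg x (lam.card + lam'.card)) = CycAlg.of _ y := by
  rw [wallElem, dif_pos h]

/-- The combinations of the elements `wallElem`. -/
noncomputable def wallMap :
    World k (Fin (lam.card + lam'.card)) (Fin (lam.card + lam'.card)) →ₗ[k]
      walledAlg x lam.card lam'.card :=
  Finsupp.linearCombination k (wallElem x lam lam')

theorem wallMap_coeffs {v : World k (Fin (lam.card + lam'.card)) (Fin (lam.card + lam'.card))}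
    (hv : v ∈ compatSpan k (wallTab lam lam').comp (wallTab lam lam').comp) :
    (wallMap x lam lam' v : BrauerAlg x (lam.card + lam'.card)).coeffs = v := by
  refine compatSpan_ext (f := (walledAlg x lam.card lam'.card).val.toLinearMap ∘ₗ wallMap x lam lam')
    (g := LinearMap.id (M := World k (Fin (lam.card + lam'.card)) (Fin (lam.card + lam'.card))))
    (fun d hd => ?_) hv
  have h1 : wallMap x lam lam' (Finsupp.single d 1) = wallElem x lam lam' d := by
    rw [wallMap, Finsupp.linearCombination_single, one_smul]
  exact (congrArg Subtype.val h1).trans (wallElem_coe x lam lam' hd)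

theorem exists_wallMap (b : walledAlg x lam.card lam'.card) :
    ∃ v ∈ compatSpan k (wallTab lam lam').comp (wallTab lam lam').comp, b = wallMap x lam lam' v :=
  ⟨CycAlg.coeffs b.1, coeffs_mem_compatSpan x lam lam' b.2,
    Subtype.ext (wallMap_coeffs x lam lam' (coeffs_mem_compatSpan x lam lam' b.2)).symm⟩

theorem compLin_walledSpechtGen {a : ℕ} (v : World k (Fin a) (Fin (mu.card + mu'.card))) :
    compLin (constParams x).toFun _ _ _ v (walledSpechtGen x mu mu').coeffs =
      (wallTab mu mu').symmS k _ v :=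
  compLin_colSum_rowSum (F := LinearMap.id) (constParams x)
    (fun g _ v => compLin_perm _ g v) (wallTab_colPres mu mu') (wallTab_rowPres mu mu') v

theorem walledSpechtGen_compLin {b : ℕ} (v : World k (Fin (lam.card + lam'.card)) (Fin b)) :
    compLin (constParams x).toFun _ _ _ (walledSpechtGen x lam lam').coeffs v =
      (wallTab lam lam').actN k _ ((wallTab lam lam').symm k) v :=
  colSum_rowSum_compLin (F := LinearMap.id) (constParams x)
    (fun g _ v => perm_compLin _ g v) (wallTab_colPres lam lam') (wallTab_rowPres lam lam') v

theorem smul_toThrough_wall (b : walledAlg x lam.card lam'.card)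
    (X : World k (Fin (lam.card + lam'.card)) (Fin (mu.card + mu'.card))) :
    b • toThrough (constParams x) _ _ X =
      toThrough (constParams x) _ _ (compLin (constParams x).toFun _ _ _ (CycAlg.coeffs b.1) X) := rfl

/-- The elements of the standard module. -/
theorem mem_walledCell
    (v : ThroughSpace (constParams x) (lam.card + lam'.card) (mu.card + mu'.card)) :
    v ∈ walledCell x lam.card lam'.card mu mu' ↔
      ∃ X ∈ goodSpace k (wallTab lam lam').comp (wallTab mu mu').comp,
        v = toThrough (constParams x) _ _ ((wallTab mu mu').symmS k _ X) := by
  have good : ∀ X ∈ compatSpan k (wallTab lam lam').comp (wallTab mu mu').comp,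
      ∃ Y ∈ goodSpace k (wallTab lam lam').comp (wallTab mu mu').comp,
        toThrough (constParams x) _ _ ((wallTab mu mu').symmS k _ X) =
          toThrough (constParams x) _ _ ((wallTab mu mu').symmS k _ Y) := by
    intro X hX
    obtain ⟨Y, hY, Z, hZ, rfl⟩ := exists_add_of_compatSpan hX
    refine ⟨Y, hY, ?_⟩
    rw [map_add, map_add, (toThrough_eq_zero _ _).2 ((wallTab mu mu').symmS_arcSpan hZ), add_zero]
  constructor
  · intro h
    refine Submodule.span_induction (R := walledAlg x lam.card lam'.card) (p := fun v _ =>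
      ∃ X ∈ goodSpace k (wallTab lam lam').comp (wallTab mu mu').comp,
        v = toThrough (constParams x) _ _ ((wallTab mu mu').symmS k _ X)) ?_ ?_ ?_ ?_ h
    · rintro _ ⟨d, y, hd, hy, rfl⟩
      have h1 : ∃ Y ∈ compatSpan k (wallTab mu mu').comp (wallTab mu mu').comp, y.coeffs =
          compLin (constParams x).toFun _ _ _ Y (walledSpechtGen x mu mu').coeffs := by
        refine Submodule.span_induction (R := k) (p := fun y _ =>
          ∃ Y ∈ compatSpan k (wallTab mu mu').comp (wallTab mu mu').comp, y.coeffs =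
          compLin (constParams x).toFun _ _ _ Y (walledSpechtGen x mu mu').coeffs) ?_ ?_ ?_ ?_ hy
        · rintro _ ⟨u, hu, -, rfl⟩
          exact ⟨Finsupp.single u 1, single_mem_compatSpan (isWalled_iff.1 hu) 1, rfl⟩
        · exact ⟨0, Submodule.zero_mem _, (LinearMap.map_zero₂ _ _).symm⟩
        · rintro x y _ _ ⟨X, hX', hX⟩ ⟨Y, hY', hY⟩
          refine ⟨X + Y, Submodule.add_mem _ hX' hY', ?_⟩
          rw [map_add, LinearMap.add_apply, ← hX, ← hY]; rfl
        · rintro r x _ ⟨X, hX', hX⟩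
          refine ⟨r • X, Submodule.smul_mem _ _ hX', ?_⟩
          rw [map_smul, LinearMap.smul_apply, ← hX]; rfl
      obtain ⟨Y, hY', hY⟩ := h1
      obtain ⟨Z, hZ, e⟩ := good _ (compLin_compatSpan (constParams x).toFun
        (single_mem_compatSpan (isWalled_iff.1 hd) 1) hY')
      refine ⟨Z, hZ, ?_⟩
      rw [← e, ← compLin_walledSpechtGen x, compLin_assoc (constParams x), ← hY]
      rfl
    · exact ⟨0, Submodule.zero_mem _, by simp⟩
    · rintro _ _ _ _ ⟨X, hX, rfl⟩ ⟨Y, hY, rfl⟩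
      exact ⟨X + Y, Submodule.add_mem _ hX hY, by simp only [map_add]⟩
    · rintro r _ _ ⟨X, hX, rfl⟩
      obtain ⟨Z, hZ, e⟩ := good _ (compLin_compatSpan (constParams x).toFun
        (coeffs_mem_compatSpan x lam lam' r.2) (goodSpace_le_compatSpan hX))
      refine ⟨Z, hZ, ?_⟩
      rw [smul_toThrough_wall, ← e, ← compLin_walledSpechtGen x, ← compLin_walledSpechtGen x,
        compLin_assoc (constParams x)]
  · rintro ⟨X, hX, rfl⟩
    have hs : walledSpechtGen x mu mu' ∈ walledSpecht x mu mu' :=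
      Submodule.subset_span ⟨idDiag 1 _, isWalled_iff.2 (gid_compat _),
        by rintro ⟨i, j, h⟩; simp [idDiag] at h, (one_mul _).symm⟩
    refine goodSpace_map (f := toThrough (constParams x) _ _ ∘ₗ (wallTab mu mu').symmS k _)
      (U := (walledCell x lam.card lam'.card mu mu').restrictScalars k) (fun d hd => ?_) hX
    rw [LinearMap.comp_apply, ← compLin_walledSpechtGen x]
    exact Submodule.subset_span ⟨d, _, isWalled_iff.2 hd.1, hs, rfl⟩

/-- Modulo diagrams with southern arcs, products are described by `leftOp`. -/
theorem wall_compLin {n a b : ℕ} {γ₀ : Fin n → ZMod 3} {γ : Fin a → ZMod 3} {γ' : Fin b → ZMod 3}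
    {y : Diag 1 n a} (hy : Compat γ₀ γ y) {v : World k (Fin a) (Fin b)} (hv : v ∈ goodSpace k γ γ') :
    toThrough (constParams x) _ _ (compLin (constParams x).toFun n a b (Finsupp.single y 1) v) =
      toThrough (constParams x) _ _ (leftOp (fun _ => x) γ y v) := by
  classical
  refine goodSpace_ext (f := toThrough (constParams x) _ _ ∘ₗ
    compLin (constParams x).toFun n a b (Finsupp.single y 1))
    (g := toThrough (constParams x) _ _ ∘ₗ leftOp (fun _ => x) γ y) (fun d hd => ?_) hv
  obtain ⟨e1, e2⟩ := gcomp_perm (par := fun _ => x) (fun _ => rfl) hy hd.1 (Enum.fin a) (Enum.univ (Fin a))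
  have e3 : (fun _ => (constParams x).toFun : Fin a → ZMod 1 → k) = colourPar (fun _ => x) γ := rfl
  rw [LinearMap.comp_apply, LinearMap.comp_apply, compLin_single, (comp_eq_gcomp _ _ _).1,
    (comp_eq_gcomp _ _ _).2, e3, e1, e2, leftOp_single, one_mul, one_mul]
  split_ifs with h
  · rw [map_zero, toThrough_eq_zero]
    exact single_mem_arcSpan h _
  · rfl

theorem gperm_one (n : ℕ) : gperm 1 (1 : Equiv.Perm (Fin n)) = idDiag 1 n := by
  ext v <;> rcases v with v | v <;> rfl

theorem wallElem_one : wallElem x lam lam' (gperm 1 1) = 1 := by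
  apply Subtype.ext
  rw [wallElem_coe x lam lam' (gperm_compat (one_mem _)), gperm_one]
  rfl

/-- Here the corner is the whole walled Brauer algebra. -/
theorem wall_truncates : Truncates (k := k) (wallTab lam lam') (wallElem x lam lam') := by
  constructor
  · intro g hg h hh
    apply Subtype.ext
    rw [MulMemClass.coe_mul, wallElem_coe x lam lam' (gperm_compat hg),
      wallElem_coe x lam lam' (gperm_compat hh), wallElem_coe x lam lam' (gperm_compat (mul_mem hg hh))]
    have e := compLin_single (constParams x).toFun (gperm 1 g) (gperm 1 h) 1 1
    rw [(comp_eq_gcomp _ _ _).1, (comp_eq_gcomp _ _ _).2, (gcomp_gperm _ _ _ _).1,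
      (gcomp_gperm _ _ _ _).2, mul_one, mul_one, gperm_mapN] at e
    exact e
  · intro b
    rw [wallElem_one, one_mul, mul_one]
    obtain ⟨v, hv, rfl⟩ := exists_wallMap x lam lam' b
    refine compatSpan_map (f := wallMap x lam lam') (fun d hd => ?_) hv
    rw [wallMap, Finsupp.linearCombination_single, one_smul]
    exact Submodule.subset_span ⟨d, hd, rfl⟩

theorem wallElem_smul {y : Diag 1 (lam.card + lam'.card) (lam.card + lam'.card)}
    (hy : Compat (wallTab lam lam').comp (wallTab lam lam').comp y)
    (X : World k (Fin (lam.card + lam'.card)) (Fin (mu.card + mu'.card))) :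
    wallElem x lam lam' y • toThrough (constParams x) _ _ X =
      toThrough (constParams x) _ _ (compLin (constParams x).toFun _ _ _ (Finsupp.single y 1) X) := by
  rw [smul_toThrough_wall, wallElem_coe x lam lam' hy]
  rfl

theorem wall_realises : Realises (fun _ => x) (wallTab lam lam') (wallTab mu mu')
    (wallElem x lam lam') (toThrough (constParams x) _ _) (walledCell x lam.card lam'.card mu mu') := by
  constructor
  · intro y d hy hd
    rw [wallElem_smul x _ _ _ _ hy, wall_compLin x hy (single_mem_goodSpace hd 1)]
  · intro v hv h0
    exact goodSpace_disjoint hv ((toThrough_eq_zero _ _).1 h0)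
  · intro v hv
    exact (mem_walledCell x lam lam' mu mu' _).2 ⟨v, hv, rfl⟩
  · intro v hv
    obtain ⟨X, hX, rfl⟩ := (mem_walledCell x lam lam' mu mu' _).1 hv
    exact ⟨X, hX, by rw [wallElem_one, one_smul]⟩

theorem wall_gen : ((wall_realises x lam lam' lam lam').gen :
      ThroughSpace (constParams x) (lam.card + lam'.card) (lam.card + lam'.card)) =
    toThrough (constParams x) _ _ (walledSpechtGen x lam lam').coeffs := by
  change toThrough (constParams x) _ _ ((wallTab lam lam').symmS k _ _) = _
  rw [← compLin_walledSpechtGen x, gperm_one, one_compLin]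

theorem wall_standard : Standard (wall_realises x lam lam' lam lam') := by
  constructor
  · rintro ⟨v, hv⟩
    obtain ⟨X, hX, rfl⟩ := (mem_walledCell x lam lam' lam lam' v).1 hv
    refine ⟨wallMap x lam lam' X, Subtype.ext ?_⟩
    rw [Submodule.coe_smul, wall_gen, smul_toThrough_wall,
      wallMap_coeffs x lam lam' (goodSpace_le_compatSpan hX), compLin_walledSpechtGen]
  · intro y hy hs
    apply Subtype.ext
    rw [Submodule.coe_smul, wall_gen, wallElem_smul x _ _ _ _ hy, compLin_walledSpechtGen,
      (toThrough_eq_zero _ _).2 ((wallTab lam lam').symmS_arcSpan (single_mem_arcSpan hs 1))]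
    rfl

/-- The multiplicities of the walled Brauer algebra are coloured multiplicities. -/
theorem walledDecomp_eq (hk : ((lam.card + lam'.card).factorial : k) ≠ 0) :
    walledDecomp x lam.card lam'.card mu mu' lam lam' =
      cellMult (fun _ => x) (wallTab lam lam') (wallTab mu mu') :=
  (wall_realises x lam lam' mu mu').multiplicity_eq _ (wall_truncates x lam lam')
    (wall_standard x lam lam') (by rwa [Fintype.card_fin])

/-- The homomorphisms of standard modules of the walled Brauer algebra. -/
theorem finrank_walledHom (hk : ((lam.card + lam'.card).factorial : k) ≠ 0) :
    finrank k (walledHom x lam.card lam'.card lam lam' mu mu') =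
      finrank k (arcKernel (fun _ => x) (wallTab lam lam') (wallTab mu mu')) := by
  refine (wall_realises x lam lam' mu mu').finrank_hom _ (wall_truncates x lam lam')
    (wall_standard x lam lam') (by rwa [Fintype.card_fin]) fun b hb v hv => ?_
  obtain ⟨c, hc, hcc⟩ := (wallTab lam lam').symm_sq k (by rwa [Fintype.card_fin])
  have h1 : v = c⁻¹ • (wallTab lam lam').actN k _ ((wallTab lam lam').symm k) v := by
    have := actN_cellSpace (k := k) (wallTab lam lam') (wallTab mu mu') (y := 1) (ε := c)
      (by rw [mul_one, hcc]) (mem_arcKernel.1 hv).1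
    rw [mul_one] at this
    rw [this, smul_smul, inv_mul_cancel₀ hc, one_smul]
  have h6 : ∀ Z ∈ Finsupp.supported k k ({d | SouthArc d} ∩
      {d | Compat (wallTab lam lam').comp (wallTab lam lam').comp d}),
      toThrough (constParams x) _ _ (compLin (constParams x).toFun _ _ _ Z v) = 0 := by
    intro Z h5
    rw [Finsupp.supported_eq_span_single] at h5
    induction h5 using Submodule.span_induction with
    | mem z hz =>
      obtain ⟨d, hd, rfl⟩ := hz
      rw [wall_compLin x hd.2 (cellSpace_le _ _ (mem_arcKernel.1 hv).1),
        leftOp_eq_zero (fun _ => rfl) hv hd.2 hd.1, map_zero]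
    | zero => rw [map_zero, LinearMap.zero_apply, map_zero]
    | add y z _ _ hy hz => rw [map_add, LinearMap.add_apply, map_add, hy, hz, add_zero]
    | smul r y _ hy => rw [map_smul, LinearMap.smul_apply, map_smul, hy, smul_zero]
  obtain ⟨X, hX, rfl⟩ := exists_wallMap x lam lam' b
  have h2 := congrArg Subtype.val hb
  rw [Submodule.coe_smul, wall_gen, smul_toThrough_wall, wallMap_coeffs x lam lam' hX,
    compLin_walledSpechtGen] at h2
  have h3 := (toThrough_eq_zero _ _).1 h2
  obtain ⟨Y, hY, Z, hZ, rfl⟩ := exists_add_of_compatSpan hX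
  -- only the part with southern arcs contributes
  have h4 : (wallTab lam lam').symmS k _ Y = 0 := by
    refine goodSpace_disjoint ((wallTab lam lam').symmS_good hY) ?_
    have := Submodule.sub_mem _ h3 ((wallTab lam lam').symmS_arcSpan hZ)
    rwa [map_add, add_sub_cancel_right] at this
  have h5 : Z ∈ Finsupp.supported k k ({d | SouthArc d} ∩
      {d | Compat (wallTab lam lam').comp (wallTab lam lam').comp d}) := by
    rw [Finsupp.supported_inter]
    refine ⟨hZ, ?_⟩
    have := Submodule.sub_mem _ hX (goodSpace_le_compatSpan hY)
    rwa [add_sub_cancel_left] at this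
  have h7 : c • v = (wallTab lam lam').actN k _ ((wallTab lam lam').symm k) v := by
    conv_lhs => rw [h1, smul_smul, mul_inv_cancel₀ hc, one_smul]
  rw [h1, map_smul, smul_comm, smul_toThrough_wall, wallMap_coeffs x lam lam' hX,
    ← walledSpechtGen_compLin, ← compLin_assoc (constParams x), compLin_walledSpechtGen, map_add, h4,
    zero_add, ← compLin_walledSpechtGen x, compLin_assoc (constParams x), walledSpechtGen_compLin, ← h7,
    map_smul, map_smul, h6 Z h5, smul_zero, smul_zero]

end Walled

/-! ### Factorization over the pairs of opposite colours -/

section Invariants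
open Module
variable {k : Type*} [Field k] {m m' : ℕ} {A A₁ A₂ A' B B₁ B₂ B' : Type} [Fintype A] [Fintype A₁]
  [Fintype A₂] [Fintype A'] [Fintype B] [Fintype B₁] [Fintype B₂] [Fintype B'] [DecidableEq A]
  [DecidableEq A₁] [DecidableEq A₂] [DecidableEq A'] [DecidableEq B] [DecidableEq B₁] [DecidableEq B₂]
  [DecidableEq B'] {par : ZMod m → k} {par₁ : ZMod m' → k}

/-- The dimension of the space of homomorphisms and the decomposition number that belong to two
coloured tableaux. -/
noncomputable def invariants (par : ZMod m → k) (t : Tab m A) (t' : Tab m B) : ℕ × ℕ :=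
  (finrank k (arcKernel par t t'), cellMult par t t')

theorem invariants_congr (hpar : ∀ c, par (-c) = par c) (hpar₁ : ∀ c, par₁ (-c) = par₁ c)
    {t : Tab m A} {t₁ : Tab m' A'} {e : A ≃ A'} {t' : Tab m B} {t₁' : Tab m' B'} {e' : B ≃ B'}
    (h : t.Matches t₁ e) (h' : t'.Matches t₁' e') (hp : ∀ a, par₁ (t₁.comp (e a)) = par (t.comp a))
    (hx : ∀ a b, t₁.comp (e a) = t₁'.comp (e' b) ↔ t.comp a = t'.comp b) :
    invariants par t t' = invariants par₁ t₁ t₁' :=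
  Prod.ext (arcKernel_congr hpar hpar₁ h h' hp hx) (cellMult_congr hpar₁ h h' hp hx)

theorem invariants_pull (hpar : ∀ c, par (-c) = par c) (t : Tab m A) (e : A' ≃ A) (t' : Tab m B)
    (e' : B' ≃ B) : invariants par (t.pull e) (t'.pull e') = invariants par t t' :=
  invariants_congr hpar hpar (t.pull_matches e) (t'.pull_matches e') (fun _ => rfl)
    fun _ _ => Iff.rfl

theorem invariants_sum (hpar : ∀ c, par (-c) = par c) {T : Set (ZMod m)} {t₁ : Tab m A₁}
    {t₂ : Tab m A₂} {t₁' : Tab m B₁} {t₂' : Tab m B₂} (h : Separates T t₁ t₂)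
    (h' : Separates T t₁' t₂') (hk₁ : ((Fintype.card A₁).factorial : k) ≠ 0)
    (hk₂ : ((Fintype.card A₂).factorial : k) ≠ 0) :
    invariants par (t₁.sum t₂ h.ne) (t₁'.sum t₂' h'.ne) =
      invariants par t₁ t₁' * invariants par t₂ t₂' :=
  Prod.ext (finrank_arcKernel_sum hpar h h') (cellMult_sum hpar h h' hk₁ hk₂)

end Invariants

section Boxes
variable {k : Type*} [Field k] {m : ℕ} [NeZero m] {par : ZMod m → k} (lam mu : ZMod m → YoungDiagram)

/-- The boxes of the components in the union of two disjoint sets. -/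
noncomputable def boxUnion {T₁ T₂ : Set (ZMod m)} (hd : Disjoint T₁ T₂) :
    Boxes lam T₁ ⊕ Boxes lam T₂ ≃
      Boxes lam (T₁ ∪ T₂) :=
  Equiv.ofBijective (Sum.elim (fun x => ⟨x.1, .inl x.2⟩) (fun x => ⟨x.1, .inr x.2⟩)) (by
    constructor
    · rintro (⟨x, hx⟩ | ⟨x, hx⟩) (⟨y, hy⟩ | ⟨y, hy⟩) h <;> obtain rfl : x = y := congrArg Subtype.val h
      · rfl
      · exact (Set.disjoint_left.1 hd hx hy).elim
      · exact (Set.disjoint_left.1 hd hy hx).elim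
      · rfl
    · rintro ⟨x, hx | hx⟩
      · exact ⟨.inl ⟨x, hx⟩, rfl⟩
      · exact ⟨.inr ⟨x, hx⟩, rfl⟩)

theorem boxTab_separates {T₁ T₂ : Set (ZMod m)} (hd : Disjoint T₁ T₂) (hT : ∀ c, -c ∈ T₁ ↔ c ∈ T₁) :
    Separates T₁ (boxTab lam T₁) (boxTab lam T₂) :=
  ⟨hT, fun a => a.2, fun a ha => Set.disjoint_left.1 hd ha a.2⟩

theorem boxUnion_matches {T₁ T₂ : Set (ZMod m)} (hd : Disjoint T₁ T₂) (hT : ∀ c, -c ∈ T₁ ↔ c ∈ T₁) :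
    ((boxTab lam T₁).sum (boxTab lam T₂) (boxTab_separates lam hd hT).ne).Matches
      (boxTab lam (T₁ ∪ T₂)) (boxUnion lam hd) := by
  refine ⟨?_, ?_, ?_, ?_⟩
  · rintro (a | a) (b | b) <;> exact Iff.rfl
  · rintro (a | a) (b | b) <;> exact Iff.rfl
  · rintro (a | a) <;> rfl
  · rintro (a | a) <;> rfl

/-- The invariants of the parts of two multipartitions in the components with index in `T`. -/
noncomputable def boxInv (par : ZMod m → k) (T : Set (ZMod m)) : ℕ × ℕ :=
  invariants par (boxTab lam T) (boxTab mu T)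

theorem card_boxes_le (T : Set (ZMod m)) : Fintype.card (Boxes lam T) ≤ size lam := by
  classical
  refine (Fintype.card_subtype_le _).trans_eq ?_
  simp [size, Fintype.card_sigma]

variable {lam} in
theorem factorial_ne_zero_of_le_size (hk : ((size lam).factorial : k) ≠ 0) {a : ℕ}
    (ha : a ≤ size lam) : (a.factorial : k) ≠ 0 := fun h => hk (by
  obtain ⟨c, hc⟩ := Nat.factorial_dvd_factorial ha
  rw [hc, Nat.cast_mul, h, zero_mul])

theorem invariants_finTab (hpar : ∀ c, par (-c) = par c) :
    invariants par (finTab lam) (finTab mu) = boxInv lam mu par Set.univ :=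
  invariants_pull hpar _ _ _ _

variable {lam} in
/-- The invariants are multiplicative over disjoint sets of colours that are closed under negation. -/
theorem boxInv_union (hpar : ∀ c, par (-c) = par c) (hk : ((size lam).factorial : k) ≠ 0)
    {T₁ T₂ : Set (ZMod m)} (hd : Disjoint T₁ T₂) (hT : ∀ c, -c ∈ T₁ ↔ c ∈ T₁) :
    boxInv lam mu par (T₁ ∪ T₂) = boxInv lam mu par T₁ * boxInv lam mu par T₂ := by
  refine Eq.trans ?_ (invariants_sum hpar (boxTab_separates lam hd hT) (boxTab_separates mu hd hT)
    (factorial_ne_zero_of_le_size hk (card_boxes_le lam _))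
    (factorial_ne_zero_of_le_size hk (card_boxes_le lam _)))
  refine (invariants_congr hpar hpar (boxUnion_matches lam hd hT) (boxUnion_matches mu hd hT)
    ?_ ?_).symm
  · rintro (a | a) <;> rfl
  · rintro (a | a) (b | b) <;> exact Iff.rfl

/-- The boxes of a single component. -/
noncomputable def boxSingle (lam : ZMod m → YoungDiagram) (c : ZMod m) :
    Boxes (m := 1) (fun _ => lam c) Set.univ ≃ Boxes lam {c} :=
  Equiv.ofBijective (fun x => ⟨⟨c, x.1.2⟩, rfl⟩) (by
    constructor
    · rintro ⟨⟨r, b⟩, h⟩ ⟨⟨r', b'⟩, h'⟩ e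
      obtain rfl : b = b' := eq_of_heq (Sigma.mk.inj (congrArg Subtype.val e)).2
      obtain rfl : r = r' := Subsingleton.elim (α := ZMod 1) _ _
      rfl
    · rintro ⟨⟨r, b⟩, rfl⟩
      exact ⟨⟨⟨0, b⟩, trivial⟩, rfl⟩)

theorem boxSingle_matches {c : ZMod m} (hc : c = -c) :
    (boxTab (m := 1) (fun _ => lam c) Set.univ).Matches (boxTab lam {c}) (boxSingle lam c) :=
  ⟨fun _ _ => iff_of_true rfl (Subsingleton.elim (α := ZMod 1) _ _),
    fun _ _ => iff_of_true hc (Subsingleton.elim (α := ZMod 1) _ _), fun _ => rfl, fun _ => rfl⟩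

/-- A colour that is its own opposite contributes the invariants of a Brauer algebra. -/
theorem boxInv_single (hpar : ∀ c, par (-c) = par c) {c : ZMod m} (hc : c = -c) :
    boxInv lam mu par {c} = invariants (fun _ => par c) (finTab (m := 1) fun _ => lam c)
      (finTab (m := 1) fun _ => mu c) := by
  refine ((invariants_finTab _ _ fun _ => rfl).trans ?_).symm
  exact invariants_congr (fun _ => rfl) hpar (boxSingle_matches lam hc) (boxSingle_matches mu hc)
    (fun _ => rfl) fun _ _ => iff_of_true rfl (Subsingleton.elim (α := ZMod 1) _ _)

/-- The boxes of a pair of components with opposite indices. -/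
noncomputable def boxPair (lam : ZMod m → YoungDiagram) {c : ZMod m} (hc : c ≠ -c) :
    (lam c).cells ⊕ (lam (-c)).cells ≃ Boxes lam {c, -c} :=
  Equiv.ofBijective (Sum.elim (fun b => ⟨⟨c, b⟩, .inl rfl⟩) (fun b => ⟨⟨-c, b⟩, .inr rfl⟩)) (by
    constructor
    · rintro (b | b) (b' | b') e
      · exact congrArg _ (eq_of_heq (Sigma.mk.inj (congrArg Subtype.val e)).2)
      · exact (hc (congrArg (fun x => x.1.1) e)).elim
      · exact (hc (congrArg (fun x => x.1.1) e).symm).elim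
      · exact congrArg _ (eq_of_heq (Sigma.mk.inj (congrArg Subtype.val e)).2)
    · rintro ⟨⟨r, b⟩, h⟩
      obtain rfl | h := h
      · exact ⟨.inl b, rfl⟩
      · obtain rfl : r = -c := h
        exact ⟨.inr b, rfl⟩)

/-- Different opposite colours are as good as the colours `1` and `-1` in `ℤ/3`. -/
theorem boxPair_matches {c : ZMod m} (hc : c ≠ -c) :
    (pairTab (lam c) (lam (-c))).Matches (boxTab lam {c, -c}) (boxPair lam hc) := by
  have h : (1 : ZMod 3) ≠ -1 := by decide
  refine ⟨?_, ?_, ?_, ?_⟩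
  · rintro (a | a) (b | b)
    · exact iff_of_true rfl rfl
    · exact iff_of_false hc h
    · exact iff_of_false hc.symm h.symm
    · exact iff_of_true rfl rfl
  · rintro (a | a) (b | b)
    · exact iff_of_false hc h
    · exact iff_of_true (neg_neg c).symm (neg_neg (1 : ZMod 3)).symm
    · exact iff_of_true rfl rfl
    · exact iff_of_false (fun e => hc (e.trans (neg_neg c)).symm)
        fun e => h (e.trans (neg_neg _)).symm
  · rintro (a | a) <;> rfl
  · rintro (a | a) <;> rfl

/-- A pair of different opposite colours contributes the invariants of a walled Brauer algebra. -/
theorem boxInv_pair (hpar : ∀ c, par (-c) = par c) {c : ZMod m} (hc : c ≠ -c) :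
    boxInv lam mu par {c, -c} = invariants (fun _ => par c) (wallTab (lam c) (lam (-c)))
      (wallTab (mu c) (mu (-c))) := by
  have h : (1 : ZMod 3) ≠ -1 := by decide
  refine ((invariants_pull (fun _ => rfl) _ _ _ _).trans ?_).symm
  refine invariants_congr (fun _ => rfl) hpar (boxPair_matches lam hc) (boxPair_matches mu hc) ?_ ?_
  · rintro (a | a)
    · rfl
    · exact hpar c
  · rintro (a | a) (b | b)
    · exact iff_of_true rfl rfl
    · exact iff_of_false hc h
    · exact iff_of_false hc.symm h.symm
    · exact iff_of_true rfl rfl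

/-- The colour `0` and the colours `± r` with `r` in `s`. -/
def coloursOf (m : ℕ) (s : Finset ℕ) : Set (ZMod m) := {c | c = 0 ∨ ∃ r ∈ s, c = (r : ZMod m) ∨ c = -(r : ZMod m)}

theorem mem_middle {r : ℕ} : r ∈ middle m ↔ 0 < r ∧ 2 * r < m := by
  simp only [middle, Finset.mem_filter, Finset.mem_range]
  omega

theorem natCast_ne_neg {r s : ℕ} (h : 0 < r + s) (h' : r + s < m) : (r : ZMod m) ≠ -(s : ZMod m) := by
  rw [Ne, eq_neg_iff_add_eq_zero, ← Nat.cast_add, ZMod.natCast_eq_zero_iff]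
  exact Nat.not_dvd_of_pos_of_lt h h'

theorem natCast_inj_of_lt {r s : ℕ} (h : r < m) (h' : s < m) (e : (r : ZMod m) = s) : r = s := by
  rwa [ZMod.natCast_eq_natCast_iff', Nat.mod_eq_of_lt h, Nat.mod_eq_of_lt h'] at e

theorem coloursOf_neg (s : Finset ℕ) (c : ZMod m) : -c ∈ coloursOf m s ↔ c ∈ coloursOf m s := by
  simp only [coloursOf, Set.mem_ofPred_eq, neg_eq_iff_eq_neg, neg_zero, neg_neg]
  exact or_congr_right (exists_congr fun r => and_congr_right fun _ => or_comm)

variable {lam} in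
/-- The sets `{r, -r}` with `0 < r < m/2` are disjoint and closed under negation. -/
theorem boxInv_coloursOf (hpar : ∀ c, par (-c) = par c) (hk : ((size lam).factorial : k) ≠ 0)
    {s : Finset ℕ} (hs : s ⊆ middle m) :
    boxInv lam mu par (coloursOf m s) =
      boxInv lam mu par {0} * ∏ r ∈ s, boxInv lam mu par {(r : ZMod m), -(r : ZMod m)} := by
  induction s using Finset.induction_on with
  | empty => rw [Finset.prod_empty, mul_one]; congr 1; ext c; simp [coloursOf]
  | insert r s hr ih =>
    have hrm := mem_middle.1 (hs (Finset.mem_insert_self r s))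
    have hsm : s ⊆ middle m := (Finset.subset_insert r s).trans hs
    have hu : coloursOf m (insert r s) = coloursOf m s ∪ {(r : ZMod m), -(r : ZMod m)} := by
      ext c
      simp only [coloursOf, Set.mem_ofPred_eq, Finset.exists_mem_insert, Set.mem_union,
        Set.mem_insert_iff, Set.mem_singleton_iff]
      rw [or_comm (a := c = r ∨ _), or_assoc]
    have hr' : (r : ZMod m) ∉ coloursOf m s := by
      rintro (h | ⟨t, ht, h | h⟩)
      · exact natCast_ne_neg (m := m) (r := r) (s := 0) (by omega) (by omega) (by simpa using h)
      · have htm := mem_middle.1 (hsm ht)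
        obtain rfl := natCast_inj_of_lt (by omega) (by omega) h
        exact hr ht
      · have htm := mem_middle.1 (hsm ht)
        exact natCast_ne_neg (by omega) (by omega) h
    have hd : Disjoint (coloursOf m s) {(r : ZMod m), -(r : ZMod m)} := by
      rw [Set.disjoint_right]
      rintro c (rfl | rfl)
      · exact hr'
      · rwa [coloursOf_neg]
    rw [hu, boxInv_union mu hpar hk hd (coloursOf_neg s), ih hsm, Finset.prod_insert hr]
    ac_rfl

theorem mem_coloursOf_middle {c : ZMod m} (h : 2 * c.val ≠ m) : c ∈ coloursOf m (middle m) := by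
  have hc := c.val_lt
  have e : ((c.val : ℕ) : ZMod m) = c := ZMod.natCast_zmod_val c
  by_cases h0 : c.val = 0
  · exact .inl ((ZMod.val_eq_zero c).1 h0)
  by_cases h1 : 2 * c.val < m
  · exact .inr ⟨c.val, mem_middle.2 ⟨by omega, h1⟩, .inl e.symm⟩
  · refine .inr ⟨m - c.val, mem_middle.2 ⟨by omega, by omega⟩, .inr ?_⟩
    rw [Nat.cast_sub hc.le, ZMod.natCast_self, e, zero_sub, neg_neg]

variable {lam} in
theorem boxInv_univ_odd (hpar : ∀ c, par (-c) = par c) (hk : ((size lam).factorial : k) ≠ 0)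
    (ho : Odd m) : boxInv lam mu par Set.univ =
      boxInv lam mu par {0} * ∏ r ∈ middle m, boxInv lam mu par {(r : ZMod m), -(r : ZMod m)} := by
  rw [← boxInv_coloursOf mu hpar hk subset_rfl]
  congr 1
  refine (Set.eq_univ_of_forall fun c => mem_coloursOf_middle fun h => ?_).symm
  exact Nat.not_even_iff_odd.2 ho (h ▸ even_two_mul _)

theorem half_eq_neg (he : Even m) : ((m / 2 : ℕ) : ZMod m) = -((m / 2 : ℕ) : ZMod m) := by
  rw [eq_neg_iff_add_eq_zero, ← Nat.cast_add, ← two_mul, Nat.two_mul_div_two_of_even he,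
    ZMod.natCast_self]

variable {lam} in
theorem boxInv_univ_even (hpar : ∀ c, par (-c) = par c) (hk : ((size lam).factorial : k) ≠ 0)
    (he : Even m) : boxInv lam mu par Set.univ =
      boxInv lam mu par {0} * (∏ r ∈ middle m, boxInv lam mu par {(r : ZMod m), -(r : ZMod m)}) *
        boxInv lam mu par {((m / 2 : ℕ) : ZMod m)} := by
  have hm2 := Nat.two_mul_div_two_of_even he
  have hm0 := NeZero.ne m
  rw [← boxInv_coloursOf mu hpar hk subset_rfl, ← boxInv_union mu hpar hk _ (coloursOf_neg _)]
  · congr 1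
    refine (Set.eq_univ_of_forall fun c => ?_).symm
    by_cases h : 2 * c.val = m
    · refine .inr ?_
      rw [Set.mem_singleton_iff, ← ZMod.natCast_zmod_val c, show c.val = m / 2 by omega]
    · exact .inl (mem_coloursOf_middle h)
  · rw [Set.disjoint_singleton_right]
    rintro (h | ⟨t, ht, h | h⟩)
    · have := natCast_inj_of_lt (m := m) (r := m / 2) (s := 0) (by omega) (by omega) (by simpa using h)
      omega
    · have htm := mem_middle.1 ht
      have := natCast_inj_of_lt (m := m) (by omega) (by omega) h
      omega
    · have htm := mem_middle.1 ht
      exact natCast_ne_neg (by omega) (by omega) h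

end Boxes

/-! ### Dimensions of spaces of homomorphisms -/

section Homs
open Module TensorProduct
variable {k : Type*} [Field k]

instance {m : ℕ} [NeZero m] (δ : LoopParams k m) (ξ : k) (n : ℕ) (lam mu : ZMod m → YoungDiagram) :
    FiniteDimensional k (cycHom δ ξ n lam mu) :=
  haveI (nu : ZMod m → YoungDiagram) : FiniteDimensional k (cell δ ξ n nu) :=
    Module.Finite.of_injective ((cell δ ξ n nu).subtype.restrictScalars k) Subtype.val_injective
  Module.Finite.of_injective (LinearMap.restrictScalarsₗ k (CycAlg δ n) _ _ k)
    (LinearMap.restrictScalars_injective k)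

instance (x : k) (r s : ℕ) (lam lam' mu mu' : YoungDiagram) :
    FiniteDimensional k (walledHom x r s lam lam' mu mu') :=
  haveI (nu nu' : YoungDiagram) : FiniteDimensional k (walledCell x r s nu nu') :=
    Module.Finite.of_injective ((walledCell x r s nu nu').subtype.restrictScalars k)
      Subtype.val_injective
  Module.Finite.of_injective (LinearMap.restrictScalarsₗ k (walledAlg x r s) _ _ k)
    (LinearMap.restrictScalars_injective k)

variable {ι : Type*} [Fintype ι] {M : ι → Type*} [∀ i, AddCommMonoid (M i)] [∀ i, Module k (M i)]
  [∀ i, Module.Finite k (M i)] {E V W : Type*} [AddCommMonoid E] [Module k E] [Module.Finite k E]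
  [AddCommMonoid V] [Module k V] [Module.Finite k V] [AddCommMonoid W] [Module k W] [Module.Finite k W]

/-- Spaces of equal dimension are isomorphic.  Here and below the spaces are additive monoids, since their
additive structure has to unify with the one of a space of linear maps. -/
theorem nonempty_linearEquiv_of_finrank_eq (h : finrank k E = finrank k V) :
    Nonempty (E ≃ₗ[k] V) :=
  letI := Module.addCommMonoidToAddCommGroup k (M := E)
  letI := Module.addCommMonoidToAddCommGroup k (M := V)
  FiniteDimensional.nonempty_linearEquiv_of_finrank_eq h

theorem finite_and_finrank_piTensorProduct :
    Module.Finite k (⨂[k] i, M i) ∧ finrank k (⨂[k] i, M i) = ∏ i, finrank k (M i) := by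
  classical
  let _ := fun i => Module.addCommMonoidToAddCommGroup k (M := M i)
  let b := Basis.piTensorProduct fun i => Module.finBasis k (M i)
  refine ⟨Module.Finite.of_basis b, ?_⟩
  rw [finrank_eq_card_basis b, Fintype.card_pi]
  exact Finset.prod_congr rfl fun i _ => Fintype.card_fin _

theorem finrank_tmul : finrank k (V ⊗[k] W) = finrank k V * finrank k W :=
  letI := Module.addCommMonoidToAddCommGroup k (M := V)
  letI := Module.addCommMonoidToAddCommGroup k (M := W)
  finrank_tensorProduct

theorem nonempty_equiv_tensor (h : finrank k E = finrank k V * ∏ i, finrank k (M i)) :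
    Nonempty (E ≃ₗ[k] V ⊗[k] (⨂[k] i, M i)) :=
  haveI := (finite_and_finrank_piTensorProduct (k := k) (M := M)).1
  nonempty_linearEquiv_of_finrank_eq (by rw [finrank_tmul, finite_and_finrank_piTensorProduct.2, h])

theorem nonempty_equiv_tensor_tensor
    (h : finrank k E = finrank k V * (∏ i, finrank k (M i)) * finrank k W) :
    Nonempty (E ≃ₗ[k] V ⊗[k] (⨂[k] i, M i) ⊗[k] W) :=
  haveI := (finite_and_finrank_piTensorProduct (k := k) (M := M)).1
  nonempty_linearEquiv_of_finrank_eq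
    (by rw [finrank_tmul, finrank_tmul, finite_and_finrank_piTensorProduct.2, h])

end Homs

theorem IsLabel.size_le {m n : ℕ} [NeZero m] {lam : ZMod m → YoungDiagram} (h : IsLabel m n lam) :
    size lam ≤ n := by
  obtain ⟨l, hl⟩ := h
  omega

section Evaluation
open Module
variable {k : Type*} [Field k] {m n : ℕ} [NeZero m] (δ : LoopParams k m) {ξ : k}
  (hξ : IsPrimitiveRoot ξ m) {lam mu : ZMod m → YoungDiagram}

theorem boxInv_self_opposite (hk : ((size lam).factorial : k) ≠ 0) {r : ℕ}
    (hr : (r : ZMod m) = -(r : ZMod m)) :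
    boxInv lam mu (parBar (rootChar hξ) δ.toFun) {(r : ZMod m)} =
      (finrank k (brauerHom (deltaBar δ ξ r) (lam r).card (lam r) (mu r)),
        brauerDecomp (deltaBar δ ξ r) (lam r).card (mu r) (lam r)) := by
  have hk₁ : ((lam r).card.factorial : k) ≠ 0 := factorial_ne_zero_of_le_size hk
    (Finset.single_le_sum (f := fun r => (lam r).card) (fun _ _ => Nat.zero_le _) (Finset.mem_univ _))
  rw [boxInv_single lam mu (parBar_neg (rootChar hξ) δ.symm) hr, ← deltaBar_eq δ hξ,
    finrank_brauerHom _ hk₁, brauerDecomp_eq _ hk₁, invariants]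

theorem boxInv_opposite (hk : ((size lam).factorial : k) ≠ 0) {r : ℕ} (hr : r ∈ middle m) :
    boxInv lam mu (parBar (rootChar hξ) δ.toFun) {(r : ZMod m), -(r : ZMod m)} =
      (finrank k (walledHom (deltaBar δ ξ r) (lam r).card (lam (-r)).card
          (lam r) (lam (-r)) (mu r) (mu (-r))),
        walledDecomp (deltaBar δ ξ r) (lam r).card (lam (-r)).card
          (mu r) (mu (-r)) (lam r) (lam (-r))) := by
  have hr' := mem_middle.1 hr
  have hne : (r : ZMod m) ≠ -(r : ZMod m) := natCast_ne_neg (by omega) (by omega)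
  have hk₂ : (((lam r).card + (lam (-r)).card).factorial : k) ≠ 0 := by
    refine factorial_ne_zero_of_le_size hk ?_
    rw [← Finset.sum_pair (f := fun r => (lam r).card) hne]
    exact Finset.sum_le_sum_of_subset (Finset.subset_univ _)
  rw [boxInv_pair lam mu (parBar_neg (rootChar hξ) δ.symm) hne, ← deltaBar_eq δ hξ,
    finrank_walledHom _ _ _ _ _ hk₂, walledDecomp_eq _ _ _ _ _ hk₂, invariants]

theorem boxInv_univ (hm : (m : k) ≠ 0) (hk : ((size lam).factorial : k) ≠ 0)
    (hδ : Even n → δ.toFun ≠ 0) (hlam : IsLabel m n lam) :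
    boxInv lam mu (parBar (rootChar hξ) δ.toFun) Set.univ =
      (finrank k (cycHom δ ξ n lam mu), cycDecomp δ ξ n mu lam) := by
  obtain ⟨u, w, huw⟩ := exists_insert_of_isLabel δ hδ hlam
  rw [← invariants_finTab lam mu (parBar_neg (rootChar hξ) δ.symm), finrank_cycHom δ hξ hm huw hk,
    cycDecomp_eq δ hξ hm huw hk, invariants]

end Evaluation

end CycBrauer

theorem mainTheorem1 {k : Type*} [Field k] [IsAlgClosed k] (p : ℕ) [CharP k p]
    (m n : ℕ) [NeZero m] (hm : (m : k) ≠ 0) (hp : p = 0 ∨ n < p)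
    (ξ : k) (hξ : IsPrimitiveRoot ξ m)
    (δ : LoopParams k m) (hδ : Even n → δ.toFun ≠ 0)
    (lam mu : ZMod m → YoungDiagram) (hlam : IsLabel m n lam) (hmu : IsLabel m n mu) :
    (Odd m →
      Nonempty (cycHom δ ξ n lam mu ≃ₗ[k]
        brauerHom (deltaBar δ ξ 0) (lam 0).card (lam 0) (mu 0) ⊗[k]
        (⨂[k] r : middle m,
          walledHom (deltaBar δ ξ r) (lam (r : ℕ)).card (lam (-(r : ℕ))).card
            (lam (r : ℕ)) (lam (-(r : ℕ))) (mu (r : ℕ)) (mu (-(r : ℕ))))) ∧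
      cycDecomp δ ξ n mu lam =
        brauerDecomp (deltaBar δ ξ 0) (lam 0).card (mu 0) (lam 0) *
        ∏ r ∈ middle m,
          walledDecomp (deltaBar δ ξ r) (lam r).card (lam (-r)).card
            (mu r) (mu (-r)) (lam r) (lam (-r))) ∧
    (Even m →
      Nonempty (cycHom δ ξ n lam mu ≃ₗ[k]
        brauerHom (deltaBar δ ξ 0) (lam 0).card (lam 0) (mu 0) ⊗[k]
        (⨂[k] r : middle m,
          walledHom (deltaBar δ ξ r) (lam (r : ℕ)).card (lam (-(r : ℕ))).card
            (lam (r : ℕ)) (lam (-(r : ℕ))) (mu (r : ℕ)) (mu (-(r : ℕ)))) ⊗[k]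
        brauerHom (deltaBar δ ξ (m / 2)) (lam (m / 2 : ℕ)).card
          (lam (m / 2 : ℕ)) (mu (m / 2 : ℕ))) ∧
      cycDecomp δ ξ n mu lam =
        brauerDecomp (deltaBar δ ξ 0) (lam 0).card (mu 0) (lam 0) *
        (∏ r ∈ middle m,
          walledDecomp (deltaBar δ ξ r) (lam r).card (lam (-r)).card
            (mu r) (mu (-r)) (lam r) (lam (-r))) *
        brauerDecomp (deltaBar δ ξ (m / 2)) (lam (m / 2 : ℕ)).card
          (mu (m / 2 : ℕ)) (lam (m / 2 : ℕ))) := by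
  have hk : ((size lam).factorial : k) ≠ 0 :=
    factorial_ne_zero_of_le hp hlam.size_le
  have hpar := parBar_neg (rootChar hξ) δ.symm
  have zero := boxInv_self_opposite δ hξ (mu := mu) hk (r := 0) (by simp)
  rw [Nat.cast_zero] at zero
  refine ⟨fun ho => ?_, fun he => ?_⟩
  · have h := boxInv_univ_odd mu hpar hk ho
    rw [Finset.prod_congr rfl fun r hr => boxInv_opposite δ hξ hk hr, boxInv_univ δ hξ hm hk hδ hlam,
      zero] at h
    have h1 := congrArg Prod.fst h
    have h2 := congrArg Prod.snd h
    rw [Prod.fst_mul, Prod.fst_prod, ← Finset.prod_coe_sort] at h1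
    rw [Prod.snd_mul, Prod.snd_prod] at h2
    exact ⟨nonempty_equiv_tensor h1, h2⟩
  · have h := boxInv_univ_even mu hpar hk he
    rw [Finset.prod_congr rfl fun r hr => boxInv_opposite δ hξ hk hr, boxInv_univ δ hξ hm hk hδ hlam,
      zero, boxInv_self_opposite δ hξ hk (half_eq_neg he)] at h
    have h1 := congrArg Prod.fst h
    have h2 := congrArg Prod.snd h
    rw [Prod.fst_mul, Prod.fst_mul, Prod.fst_prod, ← Finset.prod_coe_sort] at h1
    rw [Prod.snd_mul, Prod.snd_mul, Prod.snd_prod] at h2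
    exact ⟨nonempty_equiv_tensor_tensor h1, h2⟩
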